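/- **Setting.** Let $m\ge 0$, $n\ge 1$ and $e_0,\dots,e_m\ge 1$ be integers with $e_0+\dots+e_m=n$. Let $\Omega$ be the stratum of meromorphic differentials on the Riemann sphere with $m+1\ge1$ labelled zeros of orders $e_0,\dots,e_m$ and $n+2$ labelled poles, all simple. Normalising the zero $x_0$ to $0$ and two of the poles to $y_0=1$ and $\infty$, it is the Zariski open set of all $(\lambda,x_1,\dots,x_m,y_1,\dots,y_n)\in\mathbb C^{m+n+1}$ with $\lambda\ne0$ and $x_0,\dots,x_m,y_0,\dots,y_n$ pairwise distinct; the differential is $\omega=\lambda\prod_i(z-x_i)^{e_i}\prod_j(z-y_j)^{-1}dz$. Let $R_j$ be its residue at $y_j$. A *period vector* of $\omega$ is $$v=\Big(\int_{x_0}^{x_1}\omega,\dots,\int_{x_0}^{x_m}\omega,\;2\pi iR_0,\dots,2\pi iR_n\Big)\in\mathbb C^{m+n+1}$$ for some choice of paths avoiding the poles. A *period chart* is a connected open set $U\subseteq\Omega$ with an injective holomorphic map $\phi_U:U\to\mathbb C^{m+n+1}$ with open image such that $\phi_U(s)$ is a period vector of $s$ for all $s\in U$. A Zariski closed $S\subseteq\Omega$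 is *bi-algebraic* if around each of its points there is a period chart in which it is given by polynomial equations in the periods. It is *$K$-linear of dimension $d$*, for a field $K\subseteq\mathbb C$, if around each of its points there is a period chart in which it is a finite union of $d$-dimensional complex linear subspaces defined over $K$. A *(meromorphic) Teichmüller curve* is an irreducible bi-algebraic subvariety that is $\mathbb R$-linear of dimension $2$. A *residue variety* is the locus where $(R_0,\dots,R_n)$ satisfies given polynomial equations. A *covering construction* is the set of all $\omega\in\Omega$ with $\omega=f^*\eta$, where $f$ is a branched covering of the sphere by the sphere with fixed degree and ramification profile, $\eta$ is a differential with prescribed orders at the marked points of the target, all branch points of $f$ and all zeros and poles of $\eta$ are marked, and the preimages of marked points are marked. A subvariety is *obvious* if it is an irreducible component of the Zariski closure of the intersection of a covering construction with a residue variety. For $k\ge0$, $A\in\mathbb Q^{k\times m}$, $B\in\mathbb C^{k\times(n+1)}$ and $q\in(\mathbb Q\setminus\{0\})^n$ such that $$M=\begin{pmatrix}A&B\\0&C\end{pmatrix},\qquad C=(I_n\mid q),$$ is in reduced row echelon form, let $S_M\subseteq\Omega$ be the set of all differentials that have, for some choice of paths, a period vector $v$ with $Mv=0$. **Theorem.**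 1. For every such $M$, the locus $S_M$ is obtained by gluing the local loci $\{M\phi_U=0\}$: for every period chart $(U,\phi_U)$ and every $s\in U$ with $M\phi_U(s)=0$, the sets $S_M$ and $\{M\phi_U=0\}$ agree in a neighbourhood of $s$, and around every point of $S_M$ there is a period chart $(U,\phi_U)$ with $S_M\cap U=\{M\phi_U=0\}$. Moreover $S_M$ is a Zariski closed bi-algebraic subvariety of $\Omega$ and is $\mathbb C$-linear of the expected codimension $k+n$, that is, of dimension $d$ with $d+(k+n)=m+n+1$. If the entries of $B$ lie in a field $K\subseteq\mathbb C$, then $S_M$ is $K$-linear of this dimension. 2. For every $k$ and every $A\in\mathbb Q^{k\times m}$ in reduced row echelon form without zero rows, there are infinitely many distinct non-empty loci $S_M$ with upper left block $A$. 3. If the differentials in $\Omega$ have at least three zeros ($m\ge2$), then infinitely many Teichmüller curves in $\Omega$ are irreducible components of loci $S_M$ and are not obvious. -/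

import Mathlib

open scoped Topology

noncomputable section

namespace SimplePoleStratum

variable {m n : ℕ}

/-! ### The stratum and its algebraic coordinates

A differential in genus zero with `m + 1` labelled zeros of orders `e 0, …, e m` and `n + 2` labelled
simple poles is normalised so that the zero `x₀` is `0` and two of the poles are `y₀ = 1` and `∞`:
`ω = l ∏ (z - xᵢ) ^ eᵢ / ∏ (z - yⱼ) dz`. The global coordinates are `l, x₁, …, xₘ, y₁, …, yₙ`.
If `∑ eᵢ = n`, then `ω` has a simple pole at `∞`. -/

/-- Indices of the algebraic coordinates `l`, `x₁, …, xₘ`, `y₁, …, yₙ`. -/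
abbrev CoordIdx (m n : ℕ) : Type := Unit ⊕ (Fin m ⊕ Fin n)

/-- The affine space of the algebraic coordinates. -/
abbrev Coord (m n : ℕ) : Type := CoordIdx m n → ℂ

/-- The leading coefficient `l`. -/
def scale (s : Coord m n) : ℂ := s (Sum.inl ())

/-- The zeros `x₀ = 0, x₁, …, xₘ`. -/
def zeroPt (s : Coord m n) : Fin (m + 1) → ℂ :=
  Fin.cons 0 fun i => s (Sum.inr (Sum.inl i))

/-- The finite poles `y₀ = 1, y₁, …, yₙ`. -/
def polePt (s : Coord m n) : Fin (n + 1) → ℂ :=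
  Fin.cons 1 fun j => s (Sum.inr (Sum.inr j))

/-- The stratum: `l ≠ 0`, and all zeros and finite poles are pairwise distinct. It is a Zariski open
subset of the affine space of coordinates, and does not depend on `e`. -/
def stratum (m n : ℕ) : Set (Coord m n) :=
  {s | scale s ≠ 0 ∧ Function.Injective (Sum.elim (zeroPt s) (polePt s))}

/-- The coefficient `g` of the differential `ω = g(z) dz`. -/
def omega (e : Fin (m + 1) → ℕ) (s : Coord m n) (z : ℂ) : ℂ :=
  scale s * (∏ i, (z - zeroPt s i) ^ e i) / ∏ j, (z - polePt s j)

/-- The residue of `ω` at the simple pole `y_j`, that is `lim (z - y_j) g(z)` for `z → y_j`. -/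
def res (e : Fin (m + 1) → ℕ) (s : Coord m n) (j : Fin (n + 1)) : ℂ :=
  scale s * (∏ i, (polePt s j - zeroPt s i) ^ e i) /
    ∏ l ∈ Finset.univ.erase j, (polePt s j - polePt s l)

/-! ### Algebraic subvarieties of the stratum -/

/-- Zariski closed subsets of the stratum. -/
def IsSubvariety (S : Set (Coord m n)) : Prop :=
  ∃ I : Ideal (MvPolynomial (CoordIdx m n) ℂ), S = stratum m n ∩ MvPolynomial.zeroLocus ℂ I

/-- Irreducible Zariski closed subsets of the stratum. -/
def IsIrredSubvariety (S : Set (Coord m n)) : Prop :=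
  IsSubvariety S ∧ S.Nonempty ∧
    ∀ A B : Set (Coord m n), IsSubvariety A → IsSubvariety B → S ⊆ A ∪ B → S ⊆ A ∨ S ⊆ B

/-- `C` is an irreducible component of the Zariski closed set `S`. -/
def IsIrredComponent (C S : Set (Coord m n)) : Prop :=
  IsIrredSubvariety C ∧ C ⊆ S ∧ ∀ D, IsIrredSubvariety D → C ⊆ D → D ⊆ S → D = C

/-- The Zariski closure, in the stratum, of a subset of the stratum. -/
def zariskiClosure (S : Set (Coord m n)) : Set (Coord m n) :=
  stratum m n ∩ MvPolynomial.zeroLocus ℂ (MvPolynomial.vanishingIdeal ℂ S)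

/-! ### Periods -/

/-- Indices of the period coordinates: the `m` relative periods from `x₀` to `x₁, …, xₘ`, and the
`n + 1` absolute periods `2πi R₀, …, 2πi Rₙ`. -/
abbrev PeriodIdx (m n : ℕ) : Type := Fin m ⊕ Fin (n + 1)

/-- The space of periods. -/
abbrev PeriodSpace (m n : ℕ) : Type := PeriodIdx m n → ℂ

/-- `c` is the integral of `ω` along some path from `x₀` to `x_{i+1}` that avoids the poles. -/
def IsRelPeriod (e : Fin (m + 1) → ℕ) (s : Coord m n) (i : Fin m) (c : ℂ) : Prop :=
  ∃ γ : ℝ → ℂ, ContDiff ℝ 1 γ ∧ γ 0 = zeroPt s 0 ∧ γ 1 = zeroPt s i.succ ∧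
    (∀ t ∈ Set.Icc (0 : ℝ) 1, ∀ j, γ t ≠ polePt s j) ∧
    c = ∫ t in (0 : ℝ)..1, omega e s (γ t) * deriv γ t

/-- `v` is the vector of periods of `ω`, for some choice of the paths from `x₀` to `x₁, …, xₘ`. -/
def IsPeriodVector (e : Fin (m + 1) → ℕ) (s : Coord m n) (v : PeriodSpace m n) : Prop :=
  (∀ i, IsRelPeriod e s i (v (Sum.inl i))) ∧
    ∀ j, v (Sum.inr j) = 2 * Real.pi * Complex.I * res e s j

/-- `(U, φ)` is a period chart: `U` is a connected open subset of the stratum and `φ` is a holomorphic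
choice of the period vector on `U` that is injective with open image. (On a connected set, a
holomorphic choice of periods is the same as a continuous choice of the classes of the paths.) -/
structure IsPeriodChart (e : Fin (m + 1) → ℕ) (U : Set (Coord m n))
    (φ : Coord m n → PeriodSpace m n) : Prop where
  isOpen : IsOpen U
  isConnected : IsConnected U
  subset_stratum : U ⊆ stratum m n
  holomorphic : DifferentiableOn ℂ φ U
  injOn : Set.InjOn φ U
  isOpen_image : IsOpen (φ '' U)
  isPeriodVector : ∀ s ∈ U, IsPeriodVector e s (φ s)

/-- A bi-algebraic subvariety: an algebraic subvariety of the stratum that agrees, locally in period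
coordinates, with an algebraic subvariety of the space of periods. -/
def IsBiAlgebraic (e : Fin (m + 1) → ℕ) (S : Set (Coord m n)) : Prop :=
  IsSubvariety S ∧ ∀ s ∈ S, ∃ U φ, IsPeriodChart e U φ ∧ s ∈ U ∧
    ∃ J : Ideal (MvPolynomial (PeriodIdx m n) ℂ),
      ∀ u ∈ U, u ∈ S ↔ φ u ∈ MvPolynomial.zeroLocus ℂ J

/-- A complex subspace of the space of periods is defined over the field `K`. -/
def DefinedOver (K : Subfield ℂ) (T : Submodule ℂ (PeriodSpace m n)) : Prop :=
  ∃ W : Set (PeriodSpace m n), (∀ w ∈ W, ∀ i, w i ∈ K) ∧ T = Submodule.span ℂ W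

/-- A `K`-linear subvariety of (pure) dimension `d`: an algebraic subvariety of the stratum that is,
locally in period coordinates, a finite union of `d`-dimensional linear subspaces defined over `K`. -/
def IsLinearVariety (e : Fin (m + 1) → ℕ) (K : Subfield ℂ) (d : ℕ) (S : Set (Coord m n)) : Prop :=
  IsSubvariety S ∧ ∀ s ∈ S, ∃ U φ, IsPeriodChart e U φ ∧ s ∈ U ∧
    ∃ 𝒯 : Finset (Submodule ℂ (PeriodSpace m n)),
      (∀ T ∈ 𝒯, Module.finrank ℂ T = d ∧ DefinedOver K T) ∧
      ∀ u ∈ U, u ∈ S ↔ ∃ T ∈ 𝒯, φ u ∈ T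

/-- The real numbers as a subfield of `ℂ`. -/
def realSubfield : Subfield ℂ := Complex.ofRealHom.fieldRange

/-- A (meromorphic) Teichmüller curve: an irreducible linear bi-algebraic variety of dimension two
that is defined by real linear subspaces in period coordinates. -/
def IsTeichmullerCurve (e : Fin (m + 1) → ℕ) (C : Set (Coord m n)) : Prop :=
  IsIrredSubvariety C ∧ IsBiAlgebraic e C ∧ IsLinearVariety e realSubfield 2 C

/-! ### Residue varieties, covering constructions and "obvious" varieties -/

/-- The residue variety of all differentials whose residues at `y₀, …, yₙ` satisfy the algebraic
equations in `J` (the residue at `∞` is minus the sum of the others). -/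
def residueVariety (e : Fin (m + 1) → ℕ) (J : Ideal (MvPolynomial (Fin (n + 1)) ℂ)) :
    Set (Coord m n) :=
  {s | s ∈ stratum m n ∧ res e s ∈ MvPolynomial.zeroLocus ℂ J}

open Polynomial in
/-- For the rational function `f = P / Q`, the polynomial whose zeros are the points over `c`. -/
def fiberPoly (P Q : ℂ[X]) : OnePoint ℂ → ℂ[X]
  | none => Q
  | some c => P - C c * Q

open Polynomial in
/-- The multiplicity of a point of the Riemann sphere as a zero of `F`, considered as a binary form of
degree `d`. -/
def multAt (F : ℂ[X]) (d : ℕ) : OnePoint ℂ → ℕ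
  | none => d - F.natDegree
  | some z => F.rootMultiplicity z

open Polynomial in
/-- For coprime `P` and `Q`, the multiplicity with which `f = P / Q` takes the value `c` at the point
`z` of the Riemann sphere; it is `0` if `f z ≠ c`, and otherwise the ramification index at `z`. -/
def ramIndex (P Q : ℂ[X]) (c z : OnePoint ℂ) : ℕ :=
  multAt (fiberPoly P Q c) (max P.natDegree Q.natDegree) z

open Polynomial in
/-- The order of the rational differential `(N / D) dz` at a point of the Riemann sphere. -/
def ordAt (N D : ℂ[X]) : OnePoint ℂ → ℤ
  | none => (D.natDegree : ℤ) - N.natDegree - 2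
  | some z => (N.rootMultiplicity z : ℤ) - D.rootMultiplicity z

/-- Labels of the zeros `x₀, …, xₘ` and the poles `y₀, …, yₙ, ∞`. -/
abbrev SingIdx (m n : ℕ) : Type := Fin (m + 1) ⊕ Option (Fin (n + 1))

/-- The zeros and poles of `ω` as points of the Riemann sphere. -/
def singPt (s : Coord m n) : SingIdx m n → OnePoint ℂ
  | Sum.inl i => (zeroPt s i : OnePoint ℂ)
  | Sum.inr none => OnePoint.infty
  | Sum.inr (some j) => (polePt s j : OnePoint ℂ)

/-- The combinatorial data of a covering construction: a ramification profile for coverings `f : X → C`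
of degree `deg` of marked spheres, together with a stratum of differentials on `C` (a sphere is
covered by spheres only). There are `numBase` marked points on `C`; the marked points on `X` are the
zeros and poles of the differential on `X`, and `numExtra` regular points. -/
structure CoveringData (m n : ℕ) where
  /-- the degree of the covering -/
  deg : ℕ
  /-- the number of marked points on `C` -/
  numBase : ℕ
  /-- the number of marked points on `X` that are neither zeros nor poles -/
  numExtra : ℕ
  /-- the marked point of `C` to which a marked point of `X` is mapped -/
  target : SingIdx m n ⊕ Fin numExtra → Fin numBase
  /-- the ramification index at a marked point of `X` -/
  mult : SingIdx m n ⊕ Fin numExtra → ℕ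
  /-- the order of the differential on `C` at a marked point -/
  order : Fin numBase → ℤ
  deg_pos : 0 < deg
  mult_pos : ∀ a, 0 < mult a

open Polynomial in
/-- The covering construction: all differentials `ω` of the form `f^* η`, where `f = P / Q` is a
covering of the sphere with the given ramification profile, `η = (N / D) dz` is a differential in the
given stratum, all zeros and poles of `η` and all branch points of `f` are marked, and the marked
points of the source are exactly the points over the marked points of the target. -/
def coveringLocus (e : Fin (m + 1) → ℕ) (ρ : CoveringData m n) : Set (Coord m n) :=
  {s | s ∈ stratum m n ∧
    ∃ (p : Fin ρ.numExtra → OnePoint ℂ) (c : Fin ρ.numBase → OnePoint ℂ) (P Q N D : ℂ[X]),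
      Function.Injective (Sum.elim (singPt s) p) ∧ Function.Injective c ∧
      -- `f = P / Q` is a rational function of degree `deg` with the given ramification profile
      IsCoprime P Q ∧ max P.natDegree Q.natDegree = ρ.deg ∧
      (∀ a, ramIndex P Q (c (ρ.target a)) (Sum.elim (singPt s) p a) = ρ.mult a) ∧
      (∀ q z, 0 < ramIndex P Q (c q) z → ∃ a, z = Sum.elim (singPt s) p a) ∧
      (∀ w z, 2 ≤ ramIndex P Q w z → ∃ q, w = c q) ∧
      -- `η = (N / D) dz` belongs to the given stratum
      N ≠ 0 ∧ D ≠ 0 ∧ (∀ q, ordAt N D (c q) = ρ.order q) ∧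
      (∀ w, ordAt N D w ≠ 0 → ∃ q, w = c q) ∧
      -- `ω = f^* η`
      ∀ᶠ z in Filter.cofinite,
        omega e s z = N.eval (P.eval z / Q.eval z) / D.eval (P.eval z / Q.eval z) *
          deriv (fun w => P.eval w / Q.eval w) z}

/-- An "obvious" variety: an irreducible component of (the Zariski closure of) the intersection of a
covering construction with a residue variety. -/
def IsObvious (e : Fin (m + 1) → ℕ) (C : Set (Coord m n)) : Prop :=
  ∃ (ρ : CoveringData m n) (J : Ideal (MvPolynomial (Fin (n + 1)) ℂ)),
    IsIrredComponent C (zariskiClosure (coveringLocus e ρ ∩ residueVariety e J))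

/-! ### The loci `S_M` -/

/-- The `n × (n + 1)` matrix `(I | q)`. -/
def residueBlock (q : Fin n → ℚ) : Matrix (Fin n) (Fin (n + 1)) ℚ :=
  fun i j => if j = Fin.last n then q i else if j = i.castSucc then 1 else 0

/-- The block matrix `M = (A, B; 0, (I | q))`. -/
def periodMatrix {k : ℕ} (A : Matrix (Fin k) (Fin m) ℚ) (B : Matrix (Fin k) (Fin (n + 1)) ℂ)
    (q : Fin n → ℚ) : Matrix (Fin k ⊕ Fin n) (PeriodIdx m n) ℂ :=
  Matrix.fromBlocks (A.map (fun a : ℚ => (a : ℂ))) B 0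
    ((residueBlock q).map (fun a : ℚ => (a : ℂ)))

/-- The admissible matrices `M`: all `q_j` are nonzero and `M` is in reduced row echelon form (rows
and columns in their usual order, the first block before the second). -/
def IsAdmissible {k : ℕ} (A : Matrix (Fin k) (Fin m) ℚ) (B : Matrix (Fin k) (Fin (n + 1)) ℂ)
    (q : Fin n → ℚ) : Prop :=
  (∀ j, q j ≠ 0) ∧
    (((periodMatrix A B q).submatrix ofLex ofLex :
      Matrix (Fin k ⊕ₗ Fin n) (Fin m ⊕ₗ Fin (n + 1)) ℂ)).IsReducedRowEchelon

/-- The locus `S_M` of all differentials that have, for some choice of paths, a period vector in the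
kernel of `M`; in other words, the image in the stratum of the preimage of `ker M` under the period
map on the universal covering. -/
def periodLocus {k : ℕ} (e : Fin (m + 1) → ℕ) (A : Matrix (Fin k) (Fin m) ℚ)
    (B : Matrix (Fin k) (Fin (n + 1)) ℂ) (q : Fin n → ℚ) : Set (Coord m n) :=
  {s | s ∈ stratum m n ∧ ∃ v, IsPeriodVector e s v ∧ (periodMatrix A B q).mulVec v = 0}

end SimplePoleStratum

end

/-!
The proof rests on explicit formulas for the periods. The decomposition `ω = ∑ R_j dz / (z - y_j)`
into partial fractions shows that the relative periods from `x_0` to `x_i` are the sums `∑ R_j c_j`,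
where `c_j` runs through *all* logarithms of `(x_i - y_j) / (x_0 - y_j)`, independently for each `j`
(`joined_of_exp_eq`, `isRelPeriod_iff`). Choosing branches of the logarithms gives period maps. They
are immersions, since a first order deformation with constant periods has to be trivial by a count of
zeros (`deformation_trivial`), hence they are period charts (`exists_isLocalChart`).

*The loci `S_M`.* The lower block of `M` makes the residues proportional to a primitive integral
vector `a`, so that `ω` is a multiple of `dF / F` for `F = ∏ (z - y_j) ^ a_j`, and the relative periods
are the corresponding multiples of arbitrary logarithms of `F(x_i) / F(x_0)`. As `A` is rational, the
conditions given by `A` and `B` hold for some choice of the logarithms if and only if certain monomials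
in the `F(x_i) / F(x_0)` take prescribed values, and these are algebraic equations
(`isSubvariety_periodLocus`). The ambiguity of the relative periods changes `M v` by vectors in a
discrete set only, so that `S_M` agrees locally with the linear space `M φ = 0`
(`eventually_mem_periodLocus_iff`).

*Components.* The differentials of the algebraic equations of `S_M` cut out the space `ker M` in
period coordinates (`IsTangent.mulVec_fderiv_eq_zero`), so that `S_M` is smooth. By Krull's
intersection theorem, polynomials that vanish on `S_M` near a point vanish on `S_M` in a Zariski
neighbourhood of the point (`exists_mul_mem_vanishingIdeal`). Hence the Zariski closures of the germs
of `S_M` are the irreducible components of `S_M`, and they are open in `S_M`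
(`isIrredComponent_germClosure`, `exists_isLocalChart_germClosure`).

*Abundance.* The image of a period chart is open, so there are differentials with rational residues and
rational real parts of the relative periods that avoid finitely many hyperplanes
(`exists_generic_point`). Every such differential lies on a locus `S_M` with given upper left block.
Infinitely many loci arise, because the ratio of the residues at `y_0` and `y_n` can take infinitely
many values and is constant on each of them (`infinite_periodLocus`).

*Teichmüller curves.* Take `k = m - 1` and choose `A` such that `A` annihilates the real parts `u` of
the relative periods. Then `A` maps the relative periods to purely imaginary numbers, which are real
multiples of `2πi R_n`, so that `B` can be chosen real and the components of `S_M` are Teichmüller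
curves. Suppose that such a component `C` is obvious, a component of the closure of the
intersection `Z` of a covering construction with a residue variety. At a point of `C ∩ Z`, the
Riemann-Hurwitz formula and the genericity of the residues imply that the covering has degree one, or
that `η` has two simple poles and no zeros (`CoveringData.IsNumerical.dichotomy`). In the second case,
the covering is a function `∏ (z - y_j) ^ t_j` up to a Möbius transformation, and outside of a proper
closed subset of `C` it separates the zeros (`exists_zeroValue_ne`). Conversely, in both cases each
nearby differential with proportional residues belongs to the same covering construction, by means of
`f = z` or of `f = ∏ (z - y_j) ^ t_j` (`eventually_mem_coveringLocus`). It also belongs to the residue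
variety, which is invariant under scaling along `C` (`smul_res_mem_zeroLocus`). So the closure of `Z`
contains the locus with `k = 0` near the point, which is strictly larger than `C` as `m ≥ 2`, and `C`
is no component (`not_isObvious_germClosure`).
-/

noncomputable section

namespace SimplePoleStratum

variable {m n : ℕ}

/-! ### Polynomials vanishing near a smooth point -/

section Krull

open MvPolynomial

variable {σ : Type*}

lemma sub_C_coeff_zero_mem (p : MvPolynomial σ ℂ) : p - C (coeff 0 p) ∈ idealOfVars σ ℂ := by
  rw [← pow_one (idealOfVars σ ℂ), mem_pow_idealOfVars_iff']
  intro d hd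
  have : d = 0 := (Finsupp.degree_eq_zero_iff d).1 (by omega)
  simp [this]

lemma sup_mul_pow_le (I J : Ideal (MvPolynomial σ ℂ)) (a b : ℕ) :
    (I ⊔ J ^ a) * J ^ b ≤ I ⊔ J ^ (a + b) := by
  rw [Ideal.sup_mul, pow_add]
  exact sup_le_sup_right Ideal.mul_le_left _

/-- If a substitution `φ` preserving the origin changes each variable only by an element of `I` and
terms of order two, then it changes a polynomial of order `d` only by an element of `I` and terms of
order greater than `d`. -/
lemma sub_algHom_mem {I : Ideal (MvPolynomial σ ℂ)}
    (φ : MvPolynomial σ ℂ →ₐ[ℂ] MvPolynomial σ ℂ) (hφ : ∀ l, φ (X l) ∈ idealOfVars σ ℂ)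
    (hI : ∀ l, X l - φ (X l) ∈ I ⊔ idealOfVars σ ℂ ^ 2) (d : ℕ) :
    ∀ p ∈ idealOfVars σ ℂ ^ d, p - φ p ∈ I ⊔ idealOfVars σ ℂ ^ (d + 1) := by
  have hvars : ∀ p ∈ idealOfVars σ ℂ, φ p ∈ idealOfVars σ ℂ := by
    have : idealOfVars σ ℂ ≤ (idealOfVars σ ℂ).comap φ := by
      rw [Ideal.span_le]
      rintro _ ⟨l, rfl⟩
      exact hφ l
    exact fun p hp => this hp
  have hone : ∀ p, p - φ p ∈ idealOfVars σ ℂ := by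
    intro p
    have h1 := sub_C_coeff_zero_mem p
    have h2 := hvars _ h1
    have h3 : φ (C (coeff 0 p)) = C (coeff 0 p) := φ.commutes _
    rw [map_sub, h3] at h2
    have := sub_mem h1 h2
    rwa [sub_sub_sub_cancel_right] at this
  have hX : ∀ p ∈ idealOfVars σ ℂ, p - φ p ∈ I ⊔ idealOfVars σ ℂ ^ 2 := by
    intro p hp
    refine Submodule.span_induction ?_ ?_ ?_ ?_ hp
    · rintro _ ⟨l, rfl⟩
      exact hI l
    · simp
    · intro x y _ _ hx hy
      rw [map_add, add_sub_add_comm]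
      exact add_mem hx hy
    · intro a x hxm hx
      have : a • x - φ (a • x) = (a - φ a) * x + φ a * (x - φ x) := by
        simp only [smul_eq_mul, map_mul]; ring
      rw [this]
      refine add_mem (Ideal.mem_sup_right ?_) (Ideal.mul_mem_left _ _ hx)
      rw [pow_two]
      exact Ideal.mul_mem_mul (hone a) hxm
  induction d with
  | zero =>
    intro p _
    exact Ideal.mem_sup_right (by simpa using hone p)
  | succ d ih =>
    intro p hp
    rw [pow_succ'] at hp
    refine Submodule.mul_induction_on hp ?_ ?_
    · intro x hx p hp
      have : x * p - φ (x * p) = (x - φ x) * p + (p - φ p) * φ x := by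
        simp only [map_mul]; ring
      rw [this]
      refine add_mem ?_ ?_
      · have := sup_mul_pow_le _ _ _ _ (Ideal.mul_mem_mul (hX x hx) hp)
        rwa [show d + 1 + 1 = 2 + d by ring]
      · have h1 : φ x ∈ idealOfVars σ ℂ ^ 1 := by simpa using hvars x hx
        exact sup_mul_pow_le _ _ _ _ (Ideal.mul_mem_mul (ih p hp) h1)
    · intro x y hx hy
      rw [map_add, add_sub_add_comm]
      exact add_mem hx hy

lemma homogeneousComponent_mem_pow (p : MvPolynomial σ ℂ) (k : ℕ) :
    homogeneousComponent k p ∈ idealOfVars σ ℂ ^ k := by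
  rw [mem_pow_idealOfVars_iff']
  intro d hd
  rw [coeff_homogeneousComponent, if_neg (by omega)]

lemma sub_homogeneousComponent_mem_pow {p : MvPolynomial σ ℂ} {k : ℕ}
    (hp : p ∈ idealOfVars σ ℂ ^ k) :
    p - homogeneousComponent k p ∈ idealOfVars σ ℂ ^ (k + 1) := by
  rw [mem_pow_idealOfVars_iff'] at hp ⊢
  intro d hd
  rw [coeff_sub, coeff_homogeneousComponent]
  split_ifs with h
  · simp
  · simp [hp d (by omega)]

lemma homogeneousComponent_eq_zero_of_mem_pow {p : MvPolynomial σ ℂ} {k j : ℕ}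
    (hp : p ∈ idealOfVars σ ℂ ^ k) (hj : j < k) : homogeneousComponent j p = 0 := by
  rw [mem_pow_idealOfVars_iff'] at hp
  ext d
  rw [coeff_homogeneousComponent]
  split_ifs with h
  · simp [hp d (by omega)]
  · simp

variable [Fintype σ]

lemma eval_smul_of_isHomogeneous {p : MvPolynomial σ ℂ} {k : ℕ} (hp : p.IsHomogeneous k) (c : ℂ)
    (w : σ → ℂ) : eval (c • w) p = c ^ k * eval w p := by
  rw [eval_eq', eval_eq', Finset.mul_sum]
  refine Finset.sum_congr rfl fun d hd => ?_
  have h := hp.degree_eq_sum_deg_support hd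
  have h2 : ∑ i, d i = k := by
    rw [h]
    refine (Finset.sum_subset (Finset.subset_univ _) fun i _ hi => ?_).symm
    simpa using hi
  simp only [Pi.smul_apply, smul_eq_mul, mul_pow, Finset.prod_mul_distrib,
    Finset.prod_pow_eq_pow_sum, h2]
  ring

lemma eval_smul_eq_sum (p : MvPolynomial σ ℂ) (c : ℂ) (w : σ → ℂ) :
    eval (c • w) p =
      ∑ j ∈ Finset.range (p.totalDegree + 1), c ^ j * eval w (homogeneousComponent j p) := by
  conv_lhs => rw [← sum_homogeneousComponent p, map_sum]
  exact Finset.sum_congr rfl fun j _ =>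
    eval_smul_of_isHomogeneous (homogeneousComponent_isHomogeneous j p) c w

/-- The linear part of a polynomial at the origin, as a linear functional. -/
def linearPart : MvPolynomial σ ℂ →ₗ[ℂ] Module.Dual ℂ (σ → ℂ) where
  toFun p :=
    { toFun := fun v => ∑ l, coeff (Finsupp.single l 1) p * v l
      map_add' := fun v w => by simp [mul_add, Finset.sum_add_distrib]
      map_smul' := fun c v => by simp [Finset.mul_sum, mul_left_comm] }
  map_add' p q := by ext v; simp [add_mul, Finset.sum_add_distrib]
  map_smul' c p := by
    ext v
    simp [mul_assoc, Finset.mul_sum]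

lemma linearPart_apply (p : MvPolynomial σ ℂ) (v : σ → ℂ) :
    linearPart p v = ∑ l, coeff (Finsupp.single l 1) p * v l := rfl

lemma sub_linear_mem (p : MvPolynomial σ ℂ) (h0 : coeff 0 p = 0) :
    p - ∑ l, C (coeff (Finsupp.single l 1) p) * X l ∈ idealOfVars σ ℂ ^ 2 := by
  classical
  rw [mem_pow_idealOfVars_iff']
  intro d hd
  simp only [coeff_sub, coeff_sum, coeff_C_mul, coeff_X]
  have hd' : Finsupp.degree d = 0 ∨ Finsupp.degree d = 1 := by omega
  rcases hd' with hd' | hd'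
  · rw [Finsupp.degree_eq_zero_iff] at hd'
    subst hd'
    simp [h0]
  · obtain ⟨l, rfl⟩ : ∃ l, d = Finsupp.single l 1 := by
      have h1 : d ∈ Set.range fun l : σ => Finsupp.single l 1 := by
        rw [Finsupp.range_single_one]
        exact hd'
      exact h1.imp fun _ h => h.symm
    rw [Finset.sum_eq_single l]
    · simp
    · intro b _ hb
      rw [if_neg, mul_zero]
      intro h
      exact hb (Finsupp.single_left_injective one_ne_zero h)
    · simp

lemma eval_sum_C_mul_X (a : σ → ℂ) (v : σ → ℂ) :
    eval v (∑ l, C (a l) * X l : MvPolynomial σ ℂ) = ∑ l, a l * v l := by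
  simp

/-- Homogeneous polynomials vanishing on the common kernel of the linear parts of the elements of `I`
belong to `I` up to terms of higher order. -/
lemma mem_sup_of_vanish_on_tangent {I : Ideal (MvPolynomial σ ℂ)} (h0 : ∀ p ∈ I, coeff 0 p = 0)
    {k : ℕ} {h : MvPolynomial σ ℂ} (hh : h ∈ idealOfVars σ ℂ ^ k)
    (hv : ∀ v, (∀ p ∈ I, linearPart p v = 0) → eval v h = 0) :
    h ∈ I ⊔ idealOfVars σ ℂ ^ (k + 1) := by
  classical
  set Λ : Submodule ℂ (Module.Dual ℂ (σ → ℂ)) := (I.restrictScalars ℂ).map linearPart with hΛ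
  set T := Λ.dualCoannihilator with hT
  have hmemT : ∀ v, v ∈ T ↔ ∀ p ∈ I, linearPart p v = 0 := by
    intro v
    rw [hT, Submodule.mem_dualCoannihilator]
    simp [hΛ]
  obtain ⟨pr, hpr⟩ := T.subtype.exists_leftInverse_of_injective (by simp)
  set pi : (σ → ℂ) →ₗ[ℂ] (σ → ℂ) := T.subtype ∘ₗ pr with hpi
  have hpiT : ∀ v, pi v ∈ T := fun v => (pr v).2
  have hpi_id : ∀ v ∈ T, pi v = v := by
    intro v hv
    have := LinearMap.congr_fun hpr ⟨v, hv⟩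
    simp only [LinearMap.comp_apply, LinearMap.id_apply, Submodule.subtype_apply] at this
    simp [hpi, this]
  set φ : MvPolynomial σ ℂ →ₐ[ℂ] MvPolynomial σ ℂ :=
    aeval fun l => ∑ j, C (pi (Pi.single j 1) l) * X j with hφdef
  have hφX : ∀ l, φ (X l) = ∑ j, C (pi (Pi.single j 1) l) * X j := fun l => by simp [hφdef]
  have hpisum : ∀ v l, ∑ j, pi (Pi.single j 1) l * v j = pi v l := by
    intro v l
    conv_rhs => rw [pi_eq_sum_univ' v, map_sum, Finset.sum_apply]
    refine Finset.sum_congr rfl fun j _ => ?_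
    rw [map_smul, Pi.smul_apply, smul_eq_mul, mul_comm]
  have heval : ∀ v p, eval v (φ p) = eval (pi v) p := by
    intro v p
    rw [hφdef, ← coe_aeval_eq_eval, ← coe_aeval_eq_eval, RingHom.coe_coe, RingHom.coe_coe,
      ← AlgHom.comp_apply, comp_aeval]
    congr 2
    ext l
    simp [hpisum]
  have hφh : φ h = 0 := by
    refine MvPolynomial.funext fun v => ?_
    rw [heval, map_zero]
    exact hv _ ((hmemT _).1 (hpiT v))
  have key := sub_algHom_mem (I := I) φ ?_ ?_ k h hh
  · rwa [hφh, sub_zero] at key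
  · intro l
    rw [hφX]
    exact Ideal.sum_mem _ fun j _ => Ideal.mul_mem_left _ _ (Ideal.subset_span ⟨j, rfl⟩)
  · intro l
    -- the functional `v ↦ v l - (π v) l` vanishes on `T`, so it is the linear part of some `p ∈ I`
    have hmem : (LinearMap.proj l - LinearMap.proj l ∘ₗ pi : Module.Dual ℂ (σ → ℂ)) ∈ Λ := by
      rw [← Subspace.dualCoannihilator_dualAnnihilator_eq (W := Λ), Submodule.mem_dualAnnihilator]
      intro v hv
      simp [hpi_id v hv]
    obtain ⟨p, hp, hpl⟩ := hmem
    have hXp : X l - φ (X l) = ∑ j, C (coeff (Finsupp.single j 1) p) * X j := by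
      refine MvPolynomial.funext fun v => ?_
      rw [map_sub, heval, eval_X, eval_X, eval_sum_C_mul_X, ← linearPart_apply, hpl]
      simp
    have h1 := sub_linear_mem p (h0 p hp)
    rw [← hXp] at h1
    have : X l - φ (X l) = p - (p - (X l - φ (X l))) := by ring
    rw [this]
    exact sub_mem (Ideal.mem_sup_left hp) (Ideal.mem_sup_right h1)

/-- The initial form of a polynomial vanishing along a curve vanishes on the velocity vector. -/
lemma eval_homogeneousComponent_eq_zero {p : MvPolynomial σ ℂ} {k : ℕ}
    (hp : p ∈ idealOfVars σ ℂ ^ k) {v : σ → ℂ} {γ : ℝ → σ → ℂ}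
    (hγ : Filter.Tendsto (fun t : ℝ => (t : ℂ)⁻¹ • γ t) (𝓝[>] 0) (𝓝 v))
    (h0 : ∀ᶠ t in 𝓝[>] (0 : ℝ), eval (γ t) p = 0) : eval v (homogeneousComponent k p) = 0 := by
  set N := p.totalDegree
  obtain ⟨G, hG⟩ : ∃ G : ℂ → (σ → ℂ) → ℂ, ∀ c w, G c w =
    ∑ j ∈ Finset.range (N + 1), c ^ (j - k) * eval w (homogeneousComponent j p) := ⟨_, fun _ _ => rfl⟩
  have hGp : ∀ c w, eval (c • w) p = c ^ k * G c w := by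
    intro c w
    rw [eval_smul_eq_sum, hG, Finset.mul_sum]
    refine Finset.sum_congr rfl fun j _ => ?_
    rcases lt_or_ge j k with h | h
    · rw [homogeneousComponent_eq_zero_of_mem_pow hp h]; simp
    · rw [← mul_assoc, ← pow_add, Nat.add_sub_cancel' h]
  have hGcont : Continuous fun x : ℂ × (σ → ℂ) => G x.1 x.2 := by
    simp only [hG]
    refine continuous_finsetSum _ fun j _ => ?_
    have h2 : Continuous fun x : ℂ × (σ → ℂ) => eval x.2 (homogeneousComponent j p) :=
      (MvPolynomial.continuous_eval _).comp continuous_snd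
    exact (continuous_fst.pow _).mul h2
  have hlim : Filter.Tendsto (fun t : ℝ => G (t : ℂ) ((t : ℂ)⁻¹ • γ t)) (𝓝[>] 0) (𝓝 (G 0 v)) := by
    have h1 : Filter.Tendsto (fun t : ℝ => ((t : ℂ), (t : ℂ)⁻¹ • γ t)) (𝓝[>] 0) (𝓝 ((0 : ℂ), v)) := by
      refine Filter.Tendsto.prodMk_nhds ?_ hγ
      have := (Complex.continuous_ofReal.tendsto 0).mono_left (nhdsWithin_le_nhds (s := Set.Ioi 0))
      simpa using this
    have h2 : Filter.Tendsto (fun x : ℂ × (σ → ℂ) => G x.1 x.2) (𝓝 ((0 : ℂ), v)) (𝓝 (G 0 v)) :=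
      hGcont.tendsto ((0 : ℂ), v)
    exact h2.comp h1
  have hzero : ∀ᶠ t : ℝ in 𝓝[>] (0 : ℝ), G (t : ℂ) ((t : ℂ)⁻¹ • γ t) = 0 := by
    filter_upwards [h0, self_mem_nhdsWithin] with t ht htpos
    have htne : (t : ℂ) ≠ 0 := by exact_mod_cast (ne_of_gt htpos)
    have := hGp t ((t : ℂ)⁻¹ • γ t)
    rw [smul_inv_smul₀ htne, ht] at this
    exact (mul_eq_zero.1 this.symm).resolve_left (pow_ne_zero _ htne)
  have hG0 : G 0 v = 0 :=
    tendsto_nhds_unique (hlim.congr' hzero) tendsto_const_nhds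
  have hGk : G 0 v = eval v (homogeneousComponent k p) := by
    rw [hG]
    rcases le_or_gt k N with h | h
    · rw [Finset.sum_eq_single k]
      · simp
      · intro j _ hj
        rcases lt_or_gt_of_ne hj with h | h
        · rw [homogeneousComponent_eq_zero_of_mem_pow hp h]; simp
        · rw [zero_pow (by omega), zero_mul]
      · intro hk
        exact absurd (Finset.mem_range.2 (by omega)) hk
    · rw [homogeneousComponent_eq_zero _ _ h, map_zero]
      refine Finset.sum_eq_zero fun j hj => ?_
      rw [homogeneousComponent_eq_zero_of_mem_pow hp (by rw [Finset.mem_range] at hj; omega)]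
      simp
  rw [← hGk, hG0]

/-- If every vector in the common kernel of the linear parts of `I` at the origin is the velocity of
an arc contained in the zero locus of `I` and of `f`, then `f` belongs to the localisation of `I` at
the origin. -/
lemma exists_one_sub_mul_mem {I : Ideal (MvPolynomial σ ℂ)} {f : MvPolynomial σ ℂ}
    (hT : ∀ v, (∀ p ∈ I, linearPart p v = 0) → ∃ γ : ℝ → σ → ℂ,
      Filter.Tendsto (fun t : ℝ => (t : ℂ)⁻¹ • γ t) (𝓝[>] 0) (𝓝 v) ∧
      ∀ᶠ t in 𝓝[>] (0 : ℝ), (∀ p ∈ I, eval (γ t) p = 0) ∧ eval (γ t) f = 0) :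
    ∃ r ∈ idealOfVars σ ℂ, (1 - r) * f ∈ I := by
  have h0 : ∀ p ∈ I, coeff 0 p = 0 := by
    intro p hp
    obtain ⟨γ, hγ, hz⟩ := hT 0 (by simp)
    have := eval_homogeneousComponent_eq_zero (p := p) (k := 0) (by simp) hγ
      (hz.mono fun t ht => ht.1 p hp)
    simpa using this
  have hmem : ∀ k, ∃ p ∈ I, f - p ∈ idealOfVars σ ℂ ^ k := by
    intro k
    induction k with
    | zero => exact ⟨0, I.zero_mem, by simp⟩
    | succ k ih =>
      obtain ⟨p, hp, hfp⟩ := ih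
      have h1 : homogeneousComponent k (f - p) ∈ I ⊔ idealOfVars σ ℂ ^ (k + 1) := by
        refine mem_sup_of_vanish_on_tangent h0 (homogeneousComponent_mem_pow _ _) fun v hv => ?_
        obtain ⟨γ, hγ, hz⟩ := hT v hv
        refine eval_homogeneousComponent_eq_zero hfp hγ (hz.mono fun t ht => ?_)
        rw [map_sub, ht.2, ht.1 p hp, sub_zero]
      have h2 := add_mem h1 (Ideal.mem_sup_right (S := I) (sub_homogeneousComponent_mem_pow hfp))
      rw [add_sub_cancel] at h2
      obtain ⟨a, ha, b, hb, hab⟩ := Submodule.mem_sup.1 h2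
      refine ⟨p + a, add_mem hp ha, ?_⟩
      rw [← sub_sub, ← hab, add_sub_cancel_left]
      exact hb
  have hx : (Ideal.Quotient.mk I f : MvPolynomial σ ℂ ⧸ I) ∈
      (⨅ i : ℕ, idealOfVars σ ℂ ^ i • ⊤ : Submodule (MvPolynomial σ ℂ) (MvPolynomial σ ℂ ⧸ I)) := by
    rw [Submodule.mem_iInf]
    intro k
    obtain ⟨p, hp, hfp⟩ := hmem k
    have : (Ideal.Quotient.mk I f : MvPolynomial σ ℂ ⧸ I) =
        (f - p) • (1 : MvPolynomial σ ℂ ⧸ I) := by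
      have h4 : (f - p) • (1 : MvPolynomial σ ℂ ⧸ I) = Ideal.Quotient.mk I (f - p) := by
        rw [← map_one (Ideal.Quotient.mk I)]
        exact congrArg (Ideal.Quotient.mk I) (mul_one (f - p))
      rw [h4, Ideal.Quotient.eq]
      simpa using hp
    rw [this]
    exact Submodule.smul_mem_smul hfp Submodule.mem_top
  obtain ⟨⟨r, hr⟩, hrf⟩ := (Ideal.mem_iInf_smul_pow_eq_bot_iff _ _).1 hx
  refine ⟨r, hr, ?_⟩
  have h3 : Ideal.Quotient.mk I (r * f) = Ideal.Quotient.mk I f := by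
    rw [map_mul]; exact hrf
  rw [Ideal.Quotient.eq] at h3
  have := I.neg_mem h3
  convert this using 1
  ring

end Krull

/-! ### Zariski closed sets and regular functions -/

section Zariski

open MvPolynomial

lemma mem_zeroLocus_iff_eval {σ : Type*} {I : Ideal (MvPolynomial σ ℂ)} {x : σ → ℂ} :
    x ∈ zeroLocus ℂ I ↔ ∀ p ∈ I, eval x p = 0 := by
  simp [mem_zeroLocus_iff, aeval_eq_eval]

lemma mem_vanishingIdeal_iff_eval {σ : Type*} {V : Set (σ → ℂ)} {p : MvPolynomial σ ℂ} :
    p ∈ vanishingIdeal ℂ V ↔ ∀ x ∈ V, eval x p = 0 := by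
  simp [mem_vanishingIdeal_iff, aeval_eq_eval]

lemma isSubvariety_of_family {ι : Type*} (P : ι → MvPolynomial (CoordIdx m n) ℂ) :
    IsSubvariety {s | s ∈ stratum m n ∧ ∀ i, eval s (P i) = 0} := by
  refine ⟨Ideal.span (Set.range P), ?_⟩
  ext s
  rw [zeroLocus_span]
  simp [aeval_eq_eval]

lemma IsSubvariety.subset_stratum {S : Set (Coord m n)} (hS : IsSubvariety S) :
    S ⊆ stratum m n := by
  obtain ⟨I, rfl⟩ := hS
  exact Set.inter_subset_left

lemma isSubvariety_empty : IsSubvariety (∅ : Set (Coord m n)) :=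
  ⟨⊤, by simp⟩

lemma IsSubvariety.inter {S T : Set (Coord m n)} (hS : IsSubvariety S) (hT : IsSubvariety T) :
    IsSubvariety (S ∩ T) := by
  obtain ⟨I, rfl⟩ := hS
  obtain ⟨J, rfl⟩ := hT
  refine ⟨I ⊔ J, ?_⟩
  ext s
  simp only [Set.mem_inter_iff, mem_zeroLocus_iff_eval]
  constructor
  · rintro ⟨⟨h, hI⟩, _, hJ⟩
    refine ⟨h, fun p hp => ?_⟩
    obtain ⟨a, ha, b, hb, rfl⟩ := Submodule.mem_sup.1 hp
    rw [map_add, hI a ha, hJ b hb, add_zero]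
  · rintro ⟨h, hIJ⟩
    exact ⟨⟨h, fun p hp => hIJ p (Ideal.mem_sup_left hp)⟩, h,
      fun p hp => hIJ p (Ideal.mem_sup_right hp)⟩

lemma IsSubvariety.union {S T : Set (Coord m n)} (hS : IsSubvariety S) (hT : IsSubvariety T) :
    IsSubvariety (S ∪ T) := by
  obtain ⟨I, rfl⟩ := hS
  obtain ⟨J, rfl⟩ := hT
  refine ⟨I * J, ?_⟩
  ext s
  simp only [Set.mem_inter_iff, Set.mem_union, mem_zeroLocus_iff_eval]
  constructor
  · rintro (⟨h, hI⟩ | ⟨h, hJ⟩)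
    · exact ⟨h, fun p hp => hI p (Ideal.mul_le_left hp)⟩
    · exact ⟨h, fun p hp => hJ p (Ideal.mul_le_right hp)⟩
  · rintro ⟨h, hIJ⟩
    by_contra hcon
    simp only [not_or, not_and, not_forall] at hcon
    obtain ⟨a, ha, ha0⟩ := hcon.1 h
    obtain ⟨b, hb, hb0⟩ := hcon.2 h
    have := hIJ (a * b) (Ideal.mul_mem_mul ha hb)
    rw [map_mul] at this
    exact (mul_ne_zero ha0 hb0) this

/-- A Zariski closed set is the zero set of its vanishing ideal. -/
lemma IsSubvariety.mem_of_vanish {S : Set (Coord m n)} (hS : IsSubvariety S) {s : Coord m n}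
    (hs : s ∈ stratum m n) (h : ∀ p ∈ vanishingIdeal ℂ S, eval s p = 0) : s ∈ S := by
  obtain ⟨I, rfl⟩ := hS
  refine ⟨hs, mem_zeroLocus_iff_eval.2 fun p hp => h p ?_⟩
  rw [mem_vanishingIdeal_iff_eval]
  exact fun x hx => (mem_zeroLocus_iff_eval.1 hx.2) p hp

lemma IsSubvariety.subset_iff {S T : Set (Coord m n)} (hS : IsSubvariety S)
    (hT : T ⊆ stratum m n) : T ⊆ S ↔ vanishingIdeal ℂ S ≤ vanishingIdeal ℂ T := by
  refine ⟨fun h => vanishingIdeal_anti_mono h, fun h s hs => hS.mem_of_vanish (hT hs) fun p hp => ?_⟩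
  exact (mem_vanishingIdeal_iff_eval.1 (h hp)) s hs

lemma isSubvariety_zariskiClosure (S : Set (Coord m n)) : IsSubvariety (zariskiClosure S) :=
  ⟨_, rfl⟩

lemma subset_zariskiClosure {S : Set (Coord m n)} (hS : S ⊆ stratum m n) :
    S ⊆ zariskiClosure S := fun _ hs => ⟨hS hs, zeroLocus_vanishingIdeal_le S hs⟩

lemma zariskiClosure_subset {S T : Set (Coord m n)} (hT : IsSubvariety T) (h : S ⊆ T) :
    zariskiClosure S ⊆ T := by
  rintro s ⟨hs, hsz⟩
  exact hT.mem_of_vanish hs fun p hp =>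
    mem_zeroLocus_iff_eval.1 hsz p (vanishingIdeal_anti_mono h hp)

/-- Every Zariski closed set is a finite union of irreducible ones. -/
lemma IsSubvariety.exists_finite_decomposition {S : Set (Coord m n)} (hS : IsSubvariety S) :
    ∃ F : Set (Set (Coord m n)), F.Finite ∧ (∀ D ∈ F, IsIrredSubvariety D) ∧ S = ⋃₀ F := by
  generalize hI : vanishingIdeal ℂ S = I
  induction I using WellFoundedGT.induction generalizing S with
  | ind I ih =>
    subst hI
    by_cases hne : S.Nonempty
    · by_cases hirr : ∀ A B : Set (Coord m n), IsSubvariety A → IsSubvariety B →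
          S ⊆ A ∪ B → S ⊆ A ∨ S ⊆ B
      · exact ⟨{S}, Set.finite_singleton S, by rintro D rfl; exact ⟨hS, hne, hirr⟩, by simp⟩
      · push Not at hirr
        obtain ⟨A, B, hA, hB, hAB, hnA, hnB⟩ := hirr
        have key : ∀ A, IsSubvariety A → ¬ S ⊆ A →
            ∃ F : Set (Set (Coord m n)), F.Finite ∧ (∀ D ∈ F, IsIrredSubvariety D) ∧
              S ∩ A = ⋃₀ F := by
          intro A hA hnA
          refine ih _ (lt_of_le_of_ne (vanishingIdeal_anti_mono Set.inter_subset_left) fun h => ?_)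
            (hS.inter hA) rfl
          refine hnA fun s hs => ?_
          have : S ⊆ S ∩ A :=
            ((hS.inter hA).subset_iff hS.subset_stratum).2 h.symm.le
          exact (this hs).2
        obtain ⟨F, hF, hFi, hFu⟩ := key A hA hnA
        obtain ⟨G, hG, hGi, hGu⟩ := key B hB hnB
        refine ⟨F ∪ G, hF.union hG, ?_, ?_⟩
        · rintro D (hD | hD)
          · exact hFi D hD
          · exact hGi D hD
        · rw [Set.sUnion_union, ← hFu, ← hGu, ← Set.inter_union_distrib_left,
            Set.inter_eq_left.2 hAB]
    · exact ⟨∅, Set.finite_empty, by simp, by simpa using Set.not_nonempty_iff_eq_empty.1 hne⟩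

lemma IsIrredSubvariety.subset_of_subset_sUnion {C : Set (Coord m n)} (hC : IsIrredSubvariety C)
    {F : Set (Set (Coord m n))} (hF : F.Finite) (hFi : ∀ D ∈ F, IsSubvariety D)
    (h : C ⊆ ⋃₀ F) : ∃ D ∈ F, C ⊆ D := by
  have aux : ∀ F : Set (Set (Coord m n)), F.Finite → (∀ D ∈ F, IsSubvariety D) →
      IsSubvariety (⋃₀ F) ∧ (C ⊆ ⋃₀ F → ∃ D ∈ F, C ⊆ D) := by
    intro F hF
    induction F, hF using Set.Finite.induction_on with
    | empty =>
      intro _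
      refine ⟨by simpa using isSubvariety_empty, fun h => ?_⟩
      rw [Set.sUnion_empty] at h
      exact absurd (h hC.2.1.some_mem) (by simp)
    | @insert D F _ _ ih =>
      intro hF
      obtain ⟨h1, h2⟩ := ih fun D hD => hF D (Set.mem_insert_of_mem _ hD)
      rw [Set.sUnion_insert]
      refine ⟨(hF D (Set.mem_insert _ _)).union h1, fun h => ?_⟩
      rcases hC.2.2 _ _ (hF D (Set.mem_insert _ _)) h1 h with h | h
      · exact ⟨D, Set.mem_insert _ _, h⟩
      · obtain ⟨E, hE, hCE⟩ := h2 h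
        exact ⟨E, Set.mem_insert_of_mem _ hE, hCE⟩
  exact (aux F hF hFi).2 h

/-- If `C` is an irreducible component of the Zariski closure of `Z`, then `C ∩ Z` is Zariski dense
in `C`. -/
lemma IsIrredComponent.exists_mem_of_zariskiClosure {C Z : Set (Coord m n)}
    (hZ : Z ⊆ stratum m n) (hC : IsIrredComponent C (zariskiClosure Z)) {T : Set (Coord m n)}
    (hT : IsSubvariety T) (hCT : ¬ C ⊆ T) : ∃ s ∈ C, s ∈ Z ∧ s ∉ T := by
  by_contra hcon
  push Not at hcon
  obtain ⟨F, hF, hFi, hFu⟩ := (isSubvariety_zariskiClosure Z).exists_finite_decomposition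
  set F' : Set (Set (Coord m n)) := insert (C ∩ T) (F \ {C}) with hF'
  have hF'fin : F'.Finite := (hF.subset Set.sdiff_subset).insert _
  have hF'sub : ∀ D ∈ F', IsSubvariety D := by
    rintro D (rfl | hD)
    · exact hC.1.1.inter hT
    · exact (hFi D hD.1).1
  have hZF : Z ⊆ ⋃₀ F' := by
    intro s hs
    have hsF : s ∈ ⋃₀ F := hFu ▸ subset_zariskiClosure hZ hs
    obtain ⟨D, hD, hsD⟩ := hsF
    by_cases hDC : D = C
    · subst hDC
      exact ⟨D ∩ T, Set.mem_insert _ _, hsD, hcon s hsD hs⟩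
    · exact ⟨D, Set.mem_insert_of_mem _ ⟨hD, hDC⟩, hsD⟩
  have hsubU : IsSubvariety (⋃₀ F') := by
    have aux : ∀ F : Set (Set (Coord m n)), F.Finite → (∀ D ∈ F, IsSubvariety D) →
        IsSubvariety (⋃₀ F) := by
      intro F hF
      induction F, hF using Set.Finite.induction_on with
      | empty => intro _; simpa using isSubvariety_empty
      | @insert D F _ _ ih =>
        intro hF
        rw [Set.sUnion_insert]
        exact (hF D (Set.mem_insert _ _)).union
          (ih fun D hD => hF D (Set.mem_insert_of_mem _ hD))
    exact aux F' hF'fin hF'sub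
  have hCF : C ⊆ ⋃₀ F' := hC.2.1.trans (zariskiClosure_subset hsubU hZF)
  obtain ⟨D, hD, hCD⟩ := hC.1.subset_of_subset_sUnion hF'fin hF'sub hCF
  rcases hD with rfl | ⟨hD, hDC⟩
  · exact hCT fun s hs => (hCD hs).2
  · refine hDC (hC.2.2 D (hFi D hD) hCD ?_)
    rw [hFu]
    exact Set.subset_sUnion_of_mem hD

/-- Regular functions on the stratum: quotients of polynomials with denominators that do not vanish
on the stratum. -/
def IsRegular (f : Coord m n → ℂ) : Prop :=
  ∃ P Q : MvPolynomial (CoordIdx m n) ℂ, ∀ s ∈ stratum m n, eval s Q ≠ 0 ∧ f s = eval s P / eval s Q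

lemma isRegular_const (c : ℂ) : IsRegular fun _ : Coord m n => c :=
  ⟨C c, 1, fun s _ => by simp⟩

lemma isRegular_coord (i : CoordIdx m n) : IsRegular fun s : Coord m n => s i :=
  ⟨X i, 1, fun s _ => by simp⟩

lemma IsRegular.add {f g : Coord m n → ℂ} (hf : IsRegular f) (hg : IsRegular g) :
    IsRegular fun s => f s + g s := by
  obtain ⟨P, Q, h⟩ := hf
  obtain ⟨P', Q', h'⟩ := hg
  refine ⟨P * Q' + Q * P', Q * Q', fun s hs => ?_⟩
  obtain ⟨hQ, hf⟩ := h s hs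
  obtain ⟨hQ', hg⟩ := h' s hs
  refine ⟨by simp [hQ, hQ'], ?_⟩
  beta_reduce
  rw [hf, hg, div_add_div _ _ hQ hQ']
  simp

lemma IsRegular.mul {f g : Coord m n → ℂ} (hf : IsRegular f) (hg : IsRegular g) :
    IsRegular fun s => f s * g s := by
  obtain ⟨P, Q, h⟩ := hf
  obtain ⟨P', Q', h'⟩ := hg
  refine ⟨P * P', Q * Q', fun s hs => ?_⟩
  obtain ⟨hQ, hf⟩ := h s hs
  obtain ⟨hQ', hg⟩ := h' s hs
  refine ⟨by simp [hQ, hQ'], ?_⟩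
  beta_reduce
  rw [hf, hg, div_mul_div_comm]
  simp

lemma IsRegular.sub {f g : Coord m n → ℂ} (hf : IsRegular f) (hg : IsRegular g) :
    IsRegular fun s => f s - g s := by
  simpa [sub_eq_add_neg] using hf.add ((isRegular_const (-1)).mul hg)

lemma IsRegular.inv {f : Coord m n → ℂ} (hf : IsRegular f) (h0 : ∀ s ∈ stratum m n, f s ≠ 0) :
    IsRegular fun s => (f s)⁻¹ := by
  obtain ⟨P, Q, h⟩ := hf
  refine ⟨Q, P, fun s hs => ?_⟩
  obtain ⟨hQ, hf⟩ := h s hs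
  have := h0 s hs
  rw [hf] at this
  exact ⟨fun h => this (by simp [h]), by beta_reduce; rw [hf, inv_div]⟩

lemma IsRegular.div {f g : Coord m n → ℂ} (hf : IsRegular f) (hg : IsRegular g)
    (h0 : ∀ s ∈ stratum m n, g s ≠ 0) : IsRegular fun s => f s / g s := by
  simpa [div_eq_mul_inv] using hf.mul (hg.inv h0)

lemma IsRegular.prod {ι : Type*} (t : Finset ι) {f : ι → Coord m n → ℂ}
    (hf : ∀ i ∈ t, IsRegular (f i)) : IsRegular fun s => ∏ i ∈ t, f i s := by
  classical
  induction t using Finset.induction_on with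
  | empty => simpa using isRegular_const 1
  | insert a t ha ih =>
    simp only [Finset.prod_insert ha]
    exact (hf a (Finset.mem_insert_self _ _)).mul
      (ih fun i hi => hf i (Finset.mem_insert_of_mem hi))

lemma IsRegular.pow {f : Coord m n → ℂ} (hf : IsRegular f) (k : ℕ) :
    IsRegular fun s => f s ^ k := by
  induction k with
  | zero => simpa using isRegular_const 1
  | succ k ih => simpa only [pow_succ] using ih.mul hf

lemma IsRegular.zpow {f : Coord m n → ℂ} (hf : IsRegular f) (h0 : ∀ s ∈ stratum m n, f s ≠ 0)
    (k : ℤ) : IsRegular fun s => f s ^ k := by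
  cases k with
  | ofNat k => simpa using hf.pow k
  | negSucc k =>
    simp only [zpow_negSucc]
    exact (hf.pow _).inv fun s hs => pow_ne_zero _ (h0 s hs)

/-- The common zero set of regular functions is Zariski closed. -/
lemma isSubvariety_of_isRegular {ι : Type*} {f : ι → Coord m n → ℂ} (hf : ∀ i, IsRegular (f i)) :
    IsSubvariety {s | s ∈ stratum m n ∧ ∀ i, f i s = 0} := by
  choose P Q h using hf
  convert isSubvariety_of_family P using 1
  ext s
  refine and_congr_right fun hs => forall_congr' fun i => ?_
  rw [(h i s hs).2, div_eq_zero_iff, or_iff_left (h i s hs).1]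

lemma isOpen_stratum : IsOpen (stratum m n) := by
  have h : stratum m n = {s | scale s ≠ 0} ∩ ⋂ a : Fin (m + 1) ⊕ Fin (n + 1),
      ⋂ b : Fin (m + 1) ⊕ Fin (n + 1), ⋂ _ : a ≠ b,
        {s | Sum.elim (zeroPt s) (polePt s) a ≠ Sum.elim (zeroPt s) (polePt s) b} := by
    ext s
    simp only [stratum, Set.mem_ofPred_eq, Set.mem_inter_iff, Set.mem_iInter]
    refine and_congr_right fun _ => ⟨fun h a b hab => fun h' => hab (h h'), fun h a b hab => ?_⟩
    by_contra hne
    exact h a b hne hab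
  have hcont : ∀ a, Continuous fun s : Coord m n => Sum.elim (zeroPt s) (polePt s) a := by
    rintro (a | a)
    · refine Fin.cases ?_ (fun i => ?_) a
      · simpa [zeroPt] using continuous_const
      · simpa [zeroPt] using continuous_apply _
    · refine Fin.cases ?_ (fun i => ?_) a
      · simpa [polePt] using continuous_const
      · simpa [polePt] using continuous_apply _
  rw [h]
  refine IsOpen.inter (isOpen_ne_fun (continuous_apply _) continuous_const) ?_
  exact isOpen_iInter_of_finite fun a => isOpen_iInter_of_finite fun b =>
    isOpen_iInter_of_finite fun _ => isOpen_ne_fun (hcont a) (hcont b)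

end Zariski

/-! ### Paths with prescribed logarithmic periods -/

section Paths

variable {ι : Type*} {y : ι → ℂ}

/-- There is a `C¹` path from `a` to `b` in the complement of the points `y j` along which
`log (z - y j)` increases by `κ j`. The path rests before time `0` and after time `1`, so that paths
can be concatenated; the branches `L j` of `log (z - y j)` along the path are part of the data. -/
def Joined (y : ι → ℂ) (a b : ℂ) (κ : ι → ℂ) : Prop :=
  ∃ (γ : ℝ → ℂ) (L : ι → ℝ → ℂ), ContDiff ℝ 1 γ ∧ (∀ t ≤ 0, γ t = a) ∧ (∀ t, 1 ≤ t → γ t = b) ∧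
    ∀ j, ContDiff ℝ 1 (L j) ∧ (∀ t ≤ 0, L j t = L j 0) ∧ (∀ t, 1 ≤ t → L j t = L j 1) ∧
      (∀ t, Complex.exp (L j t) = γ t - y j) ∧ κ j = L j 1 - L j 0

lemma Joined.trans {a b c : ℂ} {κ κ' : ι → ℂ} (h : Joined y a b κ) (h' : Joined y b c κ') :
    Joined y a c (κ + κ') := by
  obtain ⟨γ, L, hγ, hγ0, hγ1, hL⟩ := h
  obtain ⟨γ', L', hγ', hγ'0, hγ'1, hL'⟩ := h'
  have h2 : ContDiff ℝ 1 fun t : ℝ => 2 * t := contDiff_const.mul contDiff_id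
  have h2' : ContDiff ℝ 1 fun t : ℝ => 2 * t - 1 := h2.sub contDiff_const
  refine ⟨fun t => γ (2 * t) + γ' (2 * t - 1) - b,
    fun j t => L j (2 * t) + L' j (2 * t - 1) - L' j 0,
    ((hγ.comp h2).add (hγ'.comp h2')).sub contDiff_const, ?_, ?_, fun j => ?_⟩
  · intro t ht
    simp [hγ0 (2 * t) (by linarith), hγ'0 (2 * t - 1) (by linarith)]
  · intro t ht
    simp [hγ1 (2 * t) (by linarith), hγ'1 (2 * t - 1) (by linarith)]
  · obtain ⟨hc, h0, h1, he, hκ⟩ := hL j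
    obtain ⟨hc', h0', h1', he', hκ'⟩ := hL' j
    refine ⟨((hc.comp h2).add (hc'.comp h2')).sub contDiff_const, ?_, ?_, ?_, ?_⟩
    · intro t ht
      simp [h0 (2 * t) (by linarith), h0' (2 * t - 1) (by linarith), h0' (-1) (by norm_num)]
    · intro t ht
      have : L j 2 = L j 1 := h1 2 (by norm_num)
      simp [h1 (2 * t) (by linarith), h1' (2 * t - 1) (by linarith), this,
        show (2 : ℝ) - 1 = 1 by norm_num]
    · intro t
      have e0 : Complex.exp (L' j 0) = b - y j := by rw [he', hγ'0 0 le_rfl]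
      have hne : b - y j ≠ 0 := e0 ▸ Complex.exp_ne_zero _
      beta_reduce
      rcases le_total t (1 / 2) with ht | ht
      · rw [h0' (2 * t - 1) (by linarith), add_sub_cancel_right, he,
          hγ'0 (2 * t - 1) (by linarith)]
        ring
      · rw [Complex.exp_sub, Complex.exp_add, he, he', e0, hγ1 (2 * t) (by linarith),
          mul_div_cancel_left₀ _ hne]
        ring
    · have e1 : L j (2 * 1) = L j 1 := h1 _ (by norm_num)
      have e2 : L' j (2 * 1 - 1) = L' j 1 := by norm_num
      have e3 : L' j (2 * 0 - 1) = L' j 0 := h0' _ (by norm_num)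
      have e4 : L j (2 * 0) = L j 0 := by norm_num
      simp only [Pi.add_apply, hκ, hκ', e1, e2, e3, e4]
      ring

lemma Joined.symm {a b : ℂ} {κ : ι → ℂ} (h : Joined y a b κ) : Joined y b a (-κ) := by
  obtain ⟨γ, L, hγ, hγ0, hγ1, hL⟩ := h
  have h2 : ContDiff ℝ 1 fun t : ℝ => 1 - t := contDiff_const.sub contDiff_id
  refine ⟨fun t => γ (1 - t), fun j t => L j (1 - t), hγ.comp h2,
    fun t ht => hγ1 _ (by linarith), fun t ht => hγ0 _ (by linarith), fun j => ?_⟩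
  obtain ⟨hc, h0, h1, he, hκ⟩ := hL j
  refine ⟨hc.comp h2, ?_, ?_, fun t => he _, ?_⟩
  · intro t ht
    beta_reduce
    rw [h1 (1 - t) (by linarith), h1 (1 - 0) (by norm_num)]
  · intro t ht
    beta_reduce
    rw [h0 (1 - t) (by linarith), h0 (1 - 1) (by norm_num)]
  · simp [hκ]

lemma contDiff_log_comp {f : ℝ → ℂ} (hf : ContDiff ℝ 1 f) (h : ∀ t, f t ∈ Complex.slitPlane) :
    ContDiff ℝ 1 fun t => Complex.log (f t) := by
  rw [contDiff_iff_contDiffAt] at hf ⊢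
  intro t
  exact ((Complex.contDiffAt_log (h t)).restrict_scalars ℝ).comp t (hf t)

lemma contDiff_smoothTransition : ContDiff ℝ 1 fun t : ℝ => (Real.smoothTransition t : ℂ) :=
  Complex.ofRealCLM.contDiff.comp Real.smoothTransition.contDiff

lemma mem_slitPlane_of_norm_sub_one_lt {z : ℂ} (h : ‖z - 1‖ < 1) : z ∈ Complex.slitPlane := by
  have := Complex.mem_slitPlane_of_norm_lt_one h
  simpa using this

/-- Straight segments. -/
lemma joined_segment {a b : ℂ} (h : ∀ j, ‖b - a‖ < ‖a - y j‖) : ∃ κ, Joined y a b κ := by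
  have ha : ∀ j, a - y j ≠ 0 := fun j h0 => by
    have := h j
    rw [h0, norm_zero] at this
    exact absurd this (not_lt.2 (norm_nonneg _))
  set γ : ℝ → ℂ := fun t => a + (Real.smoothTransition t : ℂ) * (b - a) with hγ
  have hγc : ContDiff ℝ 1 γ := contDiff_const.add (contDiff_smoothTransition.mul contDiff_const)
  have hγ0 : ∀ t ≤ 0, γ t = a := fun t ht => by
    simp [hγ, Real.smoothTransition.zero_of_nonpos ht]
  have hγ1 : ∀ t, 1 ≤ t → γ t = b := fun t ht => by
    simp [hγ, Real.smoothTransition.one_of_one_le ht]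
  have hslit : ∀ j t, (γ t - y j) / (a - y j) ∈ Complex.slitPlane := by
    intro j t
    apply mem_slitPlane_of_norm_sub_one_lt
    rw [div_sub_one (ha j), norm_div, div_lt_one (norm_pos_iff.2 (ha j))]
    have : γ t - y j - (a - y j) = (Real.smoothTransition t : ℂ) * (b - a) := by
      rw [hγ]; ring
    rw [this, norm_mul, Complex.norm_real, Real.norm_eq_abs,
      abs_of_nonneg (Real.smoothTransition.nonneg t)]
    calc _ ≤ 1 * ‖b - a‖ := by gcongr; exact Real.smoothTransition.le_one t
      _ < _ := by simpa using h j
  refine ⟨_, γ, fun j t => Complex.log ((γ t - y j) / (a - y j)) + Complex.log (a - y j), hγc,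
    hγ0, hγ1, fun j => ⟨(contDiff_log_comp ((hγc.sub contDiff_const).div_const _)
      (hslit j)).add contDiff_const, ?_, ?_, ?_, rfl⟩⟩
  · intro t ht
    beta_reduce
    rw [hγ0 t ht, hγ0 0 le_rfl]
  · intro t ht
    beta_reduce
    rw [hγ1 t ht, hγ1 1 le_rfl]
  · intro t
    rw [Complex.exp_add, Complex.exp_log (Complex.slitPlane_ne_zero (hslit j t)),
      Complex.exp_log (ha j), div_mul_cancel₀ _ (ha j)]

/-- Small circles. -/
lemma joined_circle [DecidableEq ι] {j : ι} {ρ : ℂ} (hρ : ρ ≠ 0)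
    (h : ∀ l, l ≠ j → ‖ρ‖ < ‖y j - y l‖) :
    Joined y (y j + ρ) (y j + ρ) (Pi.single j (2 * Real.pi * Complex.I)) := by
  set θ : ℝ → ℂ := fun t => (Real.smoothTransition t : ℂ) * (2 * Real.pi * Complex.I) with hθ
  have hθc : ContDiff ℝ 1 θ := contDiff_smoothTransition.mul contDiff_const
  have hθ0 : ∀ t ≤ 0, θ t = 0 := fun t ht => by simp [hθ, Real.smoothTransition.zero_of_nonpos ht]
  have hθ1 : ∀ t, 1 ≤ t → θ t = 2 * Real.pi * Complex.I := fun t ht => by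
    simp [hθ, Real.smoothTransition.one_of_one_le ht]
  have hne : ∀ l, l ≠ j → y j - y l ≠ 0 := fun l hl h0 => by
    have := h l hl
    rw [h0, norm_zero] at this
    exact absurd this (not_lt.2 (norm_nonneg _))
  set γ : ℝ → ℂ := fun t => y j + ρ * Complex.exp (θ t) with hγ
  have hγc : ContDiff ℝ 1 γ := contDiff_const.add (contDiff_const.mul hθc.cexp)
  have hγ0 : ∀ t ≤ 0, γ t = y j + ρ := fun t ht => by simp [hγ, hθ0 t ht]
  have hγ1 : ∀ t, 1 ≤ t → γ t = y j + ρ := fun t ht => by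
    simp [hγ, hθ1 t ht, Complex.exp_two_pi_mul_I]
  have hnorm : ∀ t, ‖Complex.exp (θ t)‖ = 1 := by
    intro t
    have : θ t = ((Real.smoothTransition t * (2 * Real.pi) : ℝ) : ℂ) * Complex.I := by
      rw [hθ]; push_cast; ring
    rw [this, Complex.norm_exp_ofReal_mul_I]
  have hslit : ∀ l, l ≠ j → ∀ t, (γ t - y l) / (y j - y l) ∈ Complex.slitPlane := by
    intro l hl t
    apply mem_slitPlane_of_norm_sub_one_lt
    rw [div_sub_one (hne l hl), norm_div, div_lt_one (norm_pos_iff.2 (hne l hl))]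
    have : γ t - y l - (y j - y l) = ρ * Complex.exp (θ t) := by
      rw [hγ]; ring
    rw [this, norm_mul, hnorm, mul_one]
    exact h l hl
  refine ⟨γ, fun l t => if l = j then Complex.log ρ + θ t else
      Complex.log ((γ t - y l) / (y j - y l)) + Complex.log (y j - y l), hγc, hγ0, hγ1,
    fun l => ?_⟩
  by_cases hl : l = j
  · subst hl
    simp only [if_true, Pi.single_eq_same]
    refine ⟨contDiff_const.add hθc, ?_, ?_, ?_, ?_⟩
    · intro t ht
      rw [hθ0 t ht, hθ0 0 le_rfl]
    · intro t ht
      rw [hθ1 t ht, hθ1 1 le_rfl]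
    · intro t
      rw [Complex.exp_add, Complex.exp_log hρ, hγ]
      ring
    · rw [hθ1 1 le_rfl, hθ0 0 le_rfl]
      ring
  · simp only [if_neg hl, Pi.single_eq_of_ne hl]
    refine ⟨(contDiff_log_comp ((hγc.sub contDiff_const).div_const _)
      (hslit l hl)).add contDiff_const, ?_, ?_, ?_, ?_⟩
    · intro t ht
      rw [hγ0 t ht, hγ0 0 le_rfl]
    · intro t ht
      rw [hγ1 t ht, hγ1 1 le_rfl]
    · intro t
      rw [Complex.exp_add, Complex.exp_log (Complex.slitPlane_ne_zero (hslit l hl t)),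
        Complex.exp_log (hne l hl), div_mul_cancel₀ _ (hne l hl)]
    · rw [hγ1 1 le_rfl, hγ0 0 le_rfl]
      ring

lemma Joined.exp_eq {a b : ℂ} {κ : ι → ℂ} (h : Joined y a b κ) (j : ι) :
    Complex.exp (κ j) = (b - y j) / (a - y j) := by
  obtain ⟨γ, L, -, hγ0, hγ1, hL⟩ := h
  obtain ⟨-, -, -, he, hκ⟩ := hL j
  rw [hκ, Complex.exp_sub, he, he, hγ0 0 le_rfl, hγ1 1 le_rfl]

lemma joined_refl {a : ℂ} (ha : ∀ j, a ≠ y j) : Joined y a a 0 := by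
  obtain ⟨κ, h⟩ := joined_segment (y := y) (a := a) (b := a) fun j => by
    simpa [sub_eq_zero] using ha j
  simpa using h.trans h.symm

lemma exists_pos_lt_norm_sub [Finite ι] {a : ℂ} {P : ι → Prop} (ha : ∀ j, P j → a ≠ y j) :
    ∃ ε > 0, ∀ j, P j → ε < ‖a - y j‖ := by
  have h : ∀ᶠ ε in 𝓝[>] (0 : ℝ), ∀ j, P j → ε < ‖a - y j‖ := by
    rw [Filter.eventually_all]
    intro j
    by_cases hj : P j
    · have : 0 < ‖a - y j‖ := norm_pos_iff.2 (sub_ne_zero.2 (ha j hj))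
      filter_upwards [nhdsWithin_le_nhds (Iio_mem_nhds this)] with ε hε _ using hε
    · exact Filter.Eventually.of_forall fun ε h => absurd h hj
  obtain ⟨ε, hε, hpos⟩ := (h.and self_mem_nhdsWithin).exists
  exact ⟨ε, hpos, hε⟩

variable [Finite ι]

lemma exists_joined {a b : ℂ} (ha : ∀ j, a ≠ y j) (hb : ∀ j, b ≠ y j) : ∃ κ, Joined y a b κ := by
  have hconn : IsPreconnected (Set.range y)ᶜ :=
    ((Set.finite_range y).countable.isConnected_compl_of_one_lt_rank (by
      rw [Complex.rank_real_complex]; norm_num)).isPreconnected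
  refine hconn.induction₂ (fun a b => ∃ κ, Joined y a b κ) ?_ ?_ ?_ (x := a) (y := b) ?_ ?_
  · intro x hx
    have hx' : ∀ j, x ≠ y j := fun j h => hx ⟨j, h.symm⟩
    obtain ⟨ε, hε, h⟩ := exists_pos_lt_norm_sub (P := fun _ => True) fun j _ => hx' j
    filter_upwards [nhdsWithin_le_nhds (Metric.ball_mem_nhds x hε)] with z hz
    refine joined_segment fun j => lt_trans ?_ (h j trivial)
    rwa [Metric.mem_ball, dist_eq_norm] at hz
  · rintro x z w - - - ⟨κ, h⟩ ⟨κ', h'⟩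
    exact ⟨_, h.trans h'⟩
  · rintro x z - - ⟨κ, h⟩
    exact ⟨_, h.symm⟩
  · rintro ⟨j, h⟩; exact ha j h.symm
  · rintro ⟨j, h⟩; exact hb j h.symm

/-- Any choice of logarithms of `(b - y j) / (a - y j)` is realised by a path from `a` to `b`. -/
theorem joined_of_exp_eq (hy : Function.Injective y) {a b : ℂ} (ha : ∀ j, a ≠ y j)
    (hb : ∀ j, b ≠ y j) {κ : ι → ℂ} (h : ∀ j, Complex.exp (κ j) = (b - y j) / (a - y j)) :
    Joined y a b κ := by
  classical
  have := Fintype.ofFinite ι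
  obtain ⟨κ', hκ'⟩ := exists_joined ha hb
  let loops : AddSubgroup (ι → ℂ) :=
    { carrier := {κ | Joined y b b κ}
      add_mem' := fun h h' => Joined.trans h h'
      zero_mem' := joined_refl hb
      neg_mem' := fun h => Joined.symm h }
  have hgen : ∀ j, Pi.single j (2 * Real.pi * Complex.I) ∈ loops := by
    intro j
    obtain ⟨ε, hε, hlt⟩ := exists_pos_lt_norm_sub (y := y) (a := y j) (P := fun l => l ≠ j)
      fun l hl h => hl (hy h.symm)
    have hc := joined_circle (y := y) (j := j) (ρ := (ε : ℂ)) (by exact_mod_cast hε.ne')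
      fun l hl => by simpa [abs_of_pos hε] using hlt l hl
    have hp : ∀ l, y j + (ε : ℂ) ≠ y l := by
      intro l hl
      by_cases hlj : l = j
      · subst hlj
        exact hε.ne' (by simpa using hl)
      · have := hlt l hlj
        rw [← hl] at this
        simp [abs_of_pos hε] at this
    obtain ⟨κ₁, h₁⟩ := exists_joined hb hp
    have := (h₁.trans hc).trans h₁.symm
    rwa [add_assoc, add_comm (Pi.single j _), add_neg_cancel_left] at this
  have hex : ∀ j, ∃ N : ℤ, κ j = κ' j + N * (2 * Real.pi * Complex.I) := by
    intro j
    apply Complex.exp_eq_exp_iff_exists_int.1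
    rw [h, hκ'.exp_eq]
  choose N hN using hex
  have hsum : κ = κ' + ∑ j, N j • (Pi.single j (2 * Real.pi * Complex.I) : ι → ℂ) := by
    ext l
    rw [Pi.add_apply, Finset.sum_apply, Finset.sum_eq_single l]
    · rw [hN l]; simp
    · intro j _ hj
      simp [Pi.single_eq_of_ne hj.symm]
    · simp
  rw [hsum]
  exact hκ'.trans (show _ ∈ loops from sum_mem fun j _ => loops.zsmul_mem (hgen j) _)

end Paths

section PathIntegral

/-- The exponential of `∫ dz / (z - w)` along a path. -/
lemma exp_integral_eq {γ : ℝ → ℂ} (hγ : ContDiff ℝ 1 γ) {w : ℂ}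
    (h : ∀ t ∈ Set.Icc (0 : ℝ) 1, γ t ≠ w) :
    Complex.exp (∫ t in (0 : ℝ)..1, deriv γ t / (γ t - w)) = (γ 1 - w) / (γ 0 - w) := by
  have hd : ∀ t, HasDerivAt γ (deriv γ t) t :=
    fun t => (hγ.differentiable (by norm_num) t).hasDerivAt
  have hcont : ContinuousOn (fun t => deriv γ t / (γ t - w)) (Set.Icc 0 1) :=
    (hγ.continuous_deriv le_rfl).continuousOn.div
      (hγ.continuous.continuousOn.sub continuousOn_const) fun t ht => sub_ne_zero.2 (h t ht)
  -- a globally continuous extension of the integrand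
  set g : ℝ → ℂ := Set.IccExtend (zero_le_one' ℝ)
    ((Set.Icc (0 : ℝ) 1).domRestrict fun t => deriv γ t / (γ t - w)) with hg
  have hgc : Continuous g := (continuousOn_iff_continuous_domRestrict.1 hcont).Icc_extend'
  have hge : ∀ t ∈ Set.Icc (0 : ℝ) 1, g t = deriv γ t / (γ t - w) := fun t ht => by
    rw [hg, Set.IccExtend_of_mem _ _ ht, Set.domRestrict_apply]
  have hint : ∫ t in (0 : ℝ)..1, deriv γ t / (γ t - w) = ∫ t in (0 : ℝ)..1, g t := by
    refine intervalIntegral.integral_congr fun t ht => ?_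
    rw [Set.uIcc_of_le zero_le_one] at ht
    exact (hge t ht).symm
  set G : ℝ → ℂ := fun u => ∫ t in (0 : ℝ)..u, g t with hG
  have hGd : ∀ t, HasDerivAt G (g t) t := fun t =>
    intervalIntegral.integral_hasDerivAt_right (hgc.intervalIntegrable _ _)
      (hgc.stronglyMeasurableAtFilter _ _) hgc.continuousAt
  set F : ℝ → ℂ := fun t => Complex.exp (-G t) * (γ t - w) with hF
  have hFd : ∀ t ∈ Set.Icc (0 : ℝ) 1, HasDerivAt F 0 t := by
    intro t ht
    have h1 := ((hGd t).neg.cexp).mul ((hd t).sub_const w)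
    have h2 : Complex.exp (-G t) * -g t * (γ t - w) + Complex.exp (-G t) * deriv γ t = 0 := by
      rw [hge t ht]
      have := sub_ne_zero.2 (h t ht)
      field_simp
      ring
    exact h2 ▸ h1
  have hconst := constant_of_has_deriv_right_zero (f := F) (a := 0) (b := 1)
    (fun t ht => (hFd t ht).continuousAt.continuousWithinAt)
    (fun t ht => (hFd t ⟨ht.1, ht.2.le⟩).hasDerivWithinAt) 1 (by simp)
  have hG0 : G 0 = 0 := by simp [hG]
  have h0 : γ 0 - w ≠ 0 := sub_ne_zero.2 (h 0 (by simp))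
  rw [hint]
  change Complex.exp (G 1) = _
  simp only [hF, hG0, neg_zero, Complex.exp_zero, one_mul] at hconst
  rw [← hconst, Complex.exp_neg]
  have h1 : γ 1 - w ≠ 0 := sub_ne_zero.2 (h 1 (by simp))
  have := Complex.exp_ne_zero (G 1)
  field_simp

lemma integral_deriv_div_sub {γ L : ℝ → ℂ} (hγ : ContDiff ℝ 1 γ) (hL : ContDiff ℝ 1 L) {w : ℂ}
    (h : ∀ t, Complex.exp (L t) = γ t - w) :
    ∫ t in (0 : ℝ)..1, deriv γ t / (γ t - w) = L 1 - L 0 := by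
  have hd : ∀ t, HasDerivAt L (deriv L t) t :=
    fun t => (hL.differentiable (by norm_num) t).hasDerivAt
  have heq : ∀ t, deriv γ t / (γ t - w) = deriv L t := by
    intro t
    have h1 : HasDerivAt (fun t => Complex.exp (L t)) (Complex.exp (L t) * deriv L t) t :=
      (hd t).cexp
    have h2 : HasDerivAt (fun t => Complex.exp (L t)) (deriv γ t) t := by
      simp only [h]
      exact (hγ.differentiable (by norm_num) t).hasDerivAt.sub_const w
    rw [h1.unique h2 |>.symm, ← h, mul_div_cancel_left₀ _ (Complex.exp_ne_zero _)]
  simp only [heq]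
  exact intervalIntegral.integral_eq_sub_of_hasDerivAt (fun t _ => hd t)
    ((hL.continuous_deriv le_rfl).intervalIntegrable _ _)

end PathIntegral

/-! ### Residues and periods as functions on the stratum -/

section Basics

@[simp] lemma zeroPt_zero (s : Coord m n) : zeroPt s 0 = 0 := rfl

@[simp] lemma zeroPt_succ (s : Coord m n) (i : Fin m) :
    zeroPt s i.succ = s (Sum.inr (Sum.inl i)) := rfl

@[simp] lemma polePt_zero (s : Coord m n) : polePt s 0 = 1 := rfl

@[simp] lemma polePt_succ (s : Coord m n) (j : Fin n) :
    polePt s j.succ = s (Sum.inr (Sum.inr j)) := rfl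

variable {s : Coord m n}

lemma scale_ne_zero (hs : s ∈ stratum m n) : scale s ≠ 0 := hs.1

lemma zeroPt_injective (hs : s ∈ stratum m n) : Function.Injective (zeroPt s) :=
  fun _ _ h => Sum.inl_injective (hs.2 h)

lemma polePt_injective (hs : s ∈ stratum m n) : Function.Injective (polePt s) :=
  fun _ _ h => Sum.inr_injective (hs.2 h)

lemma zeroPt_ne_polePt (hs : s ∈ stratum m n) (i : Fin (m + 1)) (j : Fin (n + 1)) :
    zeroPt s i ≠ polePt s j := fun h => by
  have := hs.2 (a₁ := Sum.inl i) (a₂ := Sum.inr j) h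
  exact Sum.inl_ne_inr this

lemma zeroPt_sub_ne_zero (hs : s ∈ stratum m n) (i : Fin (m + 1)) (j : Fin (n + 1)) :
    zeroPt s i - polePt s j ≠ 0 := sub_ne_zero.2 (zeroPt_ne_polePt hs i j)

lemma isRegular_scale : IsRegular (scale : Coord m n → ℂ) := isRegular_coord _

lemma isRegular_zeroPt (i : Fin (m + 1)) : IsRegular fun s : Coord m n => zeroPt s i := by
  refine Fin.cases ?_ (fun i => ?_) i
  · simpa using isRegular_const 0
  · simpa using isRegular_coord _

lemma isRegular_polePt (j : Fin (n + 1)) : IsRegular fun s : Coord m n => polePt s j := by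
  refine Fin.cases ?_ (fun i => ?_) j
  · simpa using isRegular_const 1
  · simpa using isRegular_coord _

variable (e : Fin (m + 1) → ℕ)

lemma isRegular_res (j : Fin (n + 1)) : IsRegular fun s : Coord m n => res e s j := by
  refine (isRegular_scale.mul (.prod _ fun i _ =>
    ((isRegular_polePt j).sub (isRegular_zeroPt i)).pow _)).div
      (.prod _ fun l _ => (isRegular_polePt j).sub (isRegular_polePt l)) fun s hs => ?_
  refine Finset.prod_ne_zero_iff.2 fun l hl => sub_ne_zero.2 fun h => ?_
  exact (Finset.ne_of_mem_erase hl) (polePt_injective hs h).symm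

lemma res_ne_zero (hs : s ∈ stratum m n) (j : Fin (n + 1)) : res e s j ≠ 0 := by
  refine div_ne_zero (mul_ne_zero (scale_ne_zero hs) (Finset.prod_ne_zero_iff.2 fun i _ =>
    pow_ne_zero _ (sub_ne_zero.2 (zeroPt_ne_polePt hs i j).symm))) ?_
  refine Finset.prod_ne_zero_iff.2 fun l hl => sub_ne_zero.2 fun h => ?_
  exact (Finset.ne_of_mem_erase hl) (polePt_injective hs h).symm

open Polynomial

/-- The numerator of `ω`. -/
def numPoly (s : Coord m n) : ℂ[X] := C (scale s) * ∏ i, (X - C (zeroPt s i)) ^ e i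

/-- The denominator of `ω`. -/
def polePoly (s : Coord m n) : ℂ[X] := ∏ j, (X - C (polePt s j))

lemma eval_numPoly (s : Coord m n) (z : ℂ) :
    (numPoly e s).eval z = scale s * ∏ i, (z - zeroPt s i) ^ e i := by
  simp [numPoly, eval_prod]

lemma eval_polePoly (s : Coord m n) (z : ℂ) :
    (polePoly s).eval z = ∏ j, (z - polePt s j) := by
  simp [polePoly, eval_prod]

lemma omega_eq_div (s : Coord m n) (z : ℂ) :
    omega e s z = (numPoly e s).eval z / (polePoly s).eval z := by
  rw [eval_numPoly, eval_polePoly, omega]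

lemma polePoly_eval_ne_zero {z : ℂ} (h : ∀ j, z ≠ polePt s j) : (polePoly s).eval z ≠ 0 := by
  rw [eval_polePoly]
  exact Finset.prod_ne_zero_iff.2 fun j _ => sub_ne_zero.2 (h j)

lemma natDegree_numPoly (hs : scale s ≠ 0) : (numPoly e s).natDegree = ∑ i, e i := by
  rw [numPoly, natDegree_C_mul hs, natDegree_prod_of_monic _ _ fun i _ => (monic_X_sub_C _).pow _]
  simp [natDegree_pow]

lemma natDegree_polePoly (s : Coord m n) : (polePoly s).natDegree = n + 1 := by
  rw [polePoly, natDegree_prod_of_monic _ _ fun i _ => monic_X_sub_C _]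
  simp

variable {e}

/-- The partial fraction decomposition of `ω`. -/
lemma omega_eq_sum (hn : ∑ i, e i = n) (hs : s ∈ stratum m n) {z : ℂ}
    (hz : ∀ j, z ≠ polePt s j) : omega e s z = ∑ j, res e s j / (z - polePt s j) := by
  have hinj : Set.InjOn (polePt s) (Finset.univ : Finset (Fin (n + 1))) :=
    (polePt_injective hs).injOn
  have hdeg : (numPoly e s).degree < (Finset.univ : Finset (Fin (n + 1))).card := by
    rw [Finset.card_univ, Fintype.card_fin]
    refine lt_of_le_of_lt degree_le_natDegree ?_
    rw [natDegree_numPoly e hs.1, hn]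
    exact_mod_cast Nat.lt_succ_self n
  have h := Lagrange.eq_interpolate hinj hdeg
  rw [omega_eq_div, h, Lagrange.eval_interpolate_not_at_node _ fun j _ => hz j]
  have hnodal : eval z (Lagrange.nodal Finset.univ (polePt s)) = (polePoly s).eval z := by
    rw [Lagrange.eval_nodal, eval_polePoly]
  rw [hnodal, mul_div_cancel_left₀ _ (polePoly_eval_ne_zero hz)]
  refine Finset.sum_congr rfl fun j _ => ?_
  rw [res, Lagrange.nodalWeight, eval_numPoly, Finset.prod_inv_distrib]
  ring

lemma sum_res_eq (hn : ∑ i, e i = n) (hs : s ∈ stratum m n) (i : Fin (m + 1)) (hi : e i ≠ 0) :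
    ∑ j, res e s j / (zeroPt s i - polePt s j) = 0 := by
  rw [← omega_eq_sum hn hs fun j => zeroPt_ne_polePt hs i j, omega,
    Finset.prod_eq_zero (Finset.mem_univ i) (by simp [hi])]
  simp

/-- The relative periods of `ω` are the sums `∑ R_j c_j`, where `c_j` are arbitrary logarithms of
`(x_i - y_j) / (x_0 - y_j)`. -/
theorem isRelPeriod_iff (hn : ∑ i, e i = n) (hs : s ∈ stratum m n) (i : Fin m) (c : ℂ) :
    IsRelPeriod e s i c ↔ ∃ κ : Fin (n + 1) → ℂ,
      (∀ j, Complex.exp (κ j) = (zeroPt s i.succ - polePt s j) / (zeroPt s 0 - polePt s j)) ∧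
        c = ∑ j, res e s j * κ j := by
  have hint : ∀ γ : ℝ → ℂ, ContDiff ℝ 1 γ → (∀ t ∈ Set.Icc (0 : ℝ) 1, ∀ j, γ t ≠ polePt s j) →
      ∫ t in (0 : ℝ)..1, omega e s (γ t) * deriv γ t =
        ∑ j, res e s j * ∫ t in (0 : ℝ)..1, deriv γ t / (γ t - polePt s j) := by
    intro γ hγ h
    have h1 : ∫ t in (0 : ℝ)..1, omega e s (γ t) * deriv γ t =
        ∫ t in (0 : ℝ)..1, ∑ j, res e s j * (deriv γ t / (γ t - polePt s j)) := by
      refine intervalIntegral.integral_congr fun t ht => ?_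
      rw [Set.uIcc_of_le zero_le_one] at ht
      rw [omega_eq_sum hn hs (h t ht), Finset.sum_mul]
      exact Finset.sum_congr rfl fun j _ => by ring
    rw [h1, intervalIntegral.integral_finsetSum]
    · exact Finset.sum_congr rfl fun j _ => intervalIntegral.integral_const_mul _ _
    · intro j _
      refine ContinuousOn.intervalIntegrable (continuousOn_const.mul ?_)
      rw [Set.uIcc_of_le zero_le_one]
      exact (hγ.continuous_deriv le_rfl).continuousOn.div
        (hγ.continuous.continuousOn.sub continuousOn_const) fun t ht => sub_ne_zero.2 (h t ht j)
  constructor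
  · rintro ⟨γ, hγ, h0, h1, hav, rfl⟩
    refine ⟨fun j => ∫ t in (0 : ℝ)..1, deriv γ t / (γ t - polePt s j), fun j => ?_,
      hint γ hγ hav⟩
    rw [exp_integral_eq hγ fun t ht => hav t ht j, h0, h1]
  · rintro ⟨κ, hκ, rfl⟩
    obtain ⟨γ, L, hγ, h0, h1, hL⟩ := joined_of_exp_eq (polePt_injective hs)
      (zeroPt_ne_polePt hs 0) (zeroPt_ne_polePt hs i.succ) hκ
    have hav : ∀ t j, γ t ≠ polePt s j := fun t j h => by
      have := (hL j).2.2.2.1 t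
      rw [h, sub_self] at this
      exact Complex.exp_ne_zero _ this
    refine ⟨γ, hγ, h0 0 le_rfl, h1 1 le_rfl, fun t _ j => hav t j, ?_⟩
    rw [hint γ hγ fun t _ j => hav t j]
    refine Finset.sum_congr rfl fun j _ => ?_
    rw [integral_deriv_div_sub hγ (hL j).1 (hL j).2.2.2.1, (hL j).2.2.2.2]

end Basics

/-! ### Infinitesimal rigidity -/

section Wronskian

open Polynomial

/-- At a zero `a` of `H` that is no zero of `Y`, the Wronskian of `H` and `Y` vanishes to one order
less than `H`. -/
lemma rootMultiplicity_wronskian {H Y : ℂ[X]} {a : ℂ} (hH : H ≠ 0) (hHa : H.eval a = 0)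
    (hY : Y.eval a ≠ 0) : derivative H * Y - H * derivative Y ≠ 0 ∧
      (derivative H * Y - H * derivative Y).rootMultiplicity a + 1 = H.rootMultiplicity a := by
  obtain ⟨q, hq, hnd⟩ := exists_eq_pow_rootMultiplicity_mul_and_not_dvd H hH a
  set r := H.rootMultiplicity a with hr
  have hr1 : 0 < r := (rootMultiplicity_pos hH).2 hHa
  obtain ⟨k, hk⟩ : ∃ k, r = k + 1 := ⟨r - 1, by omega⟩
  rw [hk] at hq
  set B := (C ((k : ℂ) + 1) * q + (X - C a) * derivative q) * Y - (X - C a) * q * derivative Y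
    with hB
  have hW : derivative H * Y - H * derivative Y = (X - C a) ^ k * B := by
    rw [hq, hB]
    simp only [derivative_mul, derivative_X_sub_C_pow, Nat.add_sub_cancel]
    push_cast
    simp only [map_add, map_natCast, map_one]
    ring
  have hBa : B.eval a ≠ 0 := by
    have hqa : q.eval a ≠ 0 := fun h => hnd (dvd_iff_isRoot.2 h)
    rw [hB]
    simp only [eval_sub, eval_mul, eval_add, eval_C, eval_X, sub_self, zero_mul, add_zero, sub_zero]
    exact mul_ne_zero (mul_ne_zero (by exact_mod_cast Nat.succ_ne_zero k) hqa) hY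
  have hB0 : B ≠ 0 := fun h => hBa (by rw [h, eval_zero])
  have hX : (X - C a : ℂ[X]) ^ k ≠ 0 := pow_ne_zero _ (X_sub_C_ne_zero a)
  refine ⟨hW ▸ mul_ne_zero hX hB0, ?_⟩
  rw [hW, rootMultiplicity_mul (mul_ne_zero hX hB0), rootMultiplicity_X_sub_C_pow,
    rootMultiplicity_eq_zero hBa, hk]

lemma pow_dvd_of_pow_dvd_wronskian {H Y : ℂ[X]} {a : ℂ} {k : ℕ} (hHa : H.eval a = 0)
    (hY : Y.eval a ≠ 0) (h : (X - C a) ^ k ∣ derivative H * Y - H * derivative Y) :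
    (X - C a) ^ (k + 1) ∣ H := by
  by_cases hH : H = 0
  · simp [hH]
  obtain ⟨h0, hr⟩ := rootMultiplicity_wronskian hH hHa hY
  rw [← le_rootMultiplicity_iff hH, ← hr]
  exact Nat.succ_le_succ ((le_rootMultiplicity_iff h0).2 h)

lemma hasDerivAt_const_div_sub (a : ℂ) {b z : ℂ} (h : z ≠ b) :
    HasDerivAt (fun w => a / (w - b)) (-(a / (z - b) ^ 2)) z := by
  have := (hasDerivAt_const z a).fun_div ((hasDerivAt_id' z).sub_const b) (sub_ne_zero.2 h)
  simpa [neg_div] using this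

lemma eq_of_eval_eq_of_finite {P Q : ℂ[X]} {F : Set ℂ} (hF : F.Finite)
    (h : ∀ z ∉ F, P.eval z = Q.eval z) : P = Q :=
  eq_of_infinite_eval_eq P Q (hF.infinite_compl.mono fun z hz => h z hz)

variable {e : Fin (m + 1) → ℕ} {x dx : Fin (m + 1) → ℂ} {y dy R : Fin (n + 1) → ℂ} {l dl : ℂ}

/-- Infinitesimal rigidity: a first order deformation `(dl, dx, dy)` of
`ω = l ∏ (z - x i) ^ e i / ∏ (z - y j) dz` that fixes the residues `R j`, the zero `x 0`, the pole
`y 0` and all relative periods is trivial. The function `h = ∑ R j * dy j / (z - y j)` takes the same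
value at all zeros; subtracting it, `h` vanishes to order `e i` at `x i`, and even to order
`e 0 + 1` at `x 0`, since its derivative is the derivative of `ω`. This is more than the number `n`
of its poles permits. -/
lemma deformation_trivial (hx : Function.Injective x) (hy : Function.Injective y)
    (hxy : ∀ i j, x i ≠ y j) (hl : l ≠ 0) (hR : ∀ j, R j ≠ 0) (he : ∀ i, 1 ≤ e i)
    (hn : ∑ i, e i = n) (hdx : dx 0 = 0) (hdy : dy 0 = 0)
    (hω : ∀ z, (∀ i, z ≠ x i) → (∀ j, z ≠ y j) → ∑ j, R j * dy j / (z - y j) ^ 2 =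
      (l * ∏ i, (z - x i) ^ e i) / (∏ j, (z - y j)) *
        (dl / l - ∑ i, e i * dx i / (z - x i) + ∑ j, dy j / (z - y j)))
    (hper : ∀ i, ∑ j, R j * dy j / (x i - y j) = ∑ j, R j * dy j / (x 0 - y j)) :
    dl = 0 ∧ (∀ i, dx i = 0) ∧ ∀ j, dy j = 0 := by
  classical
  set c := ∑ j, R j * dy j / (x 0 - y j) with hc
  set J := Finset.univ.erase (0 : Fin (n + 1)) with hJ
  have hsumJ : ∀ f : Fin (n + 1) → ℂ, f 0 = 0 → ∑ j, f j = ∑ j ∈ J, f j := fun f hf =>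
    (Finset.sum_erase _ hf).symm
  set Y1 : ℂ[X] := ∏ j ∈ J, (X - C (y j)) with hY1
  set H : ℂ[X] := ∑ j ∈ J, C (R j * dy j) * ∏ k ∈ J.erase j, (X - C (y k)) - C c * Y1 with hH
  set E : ℂ[X] := C l * ∏ i, (X - C (x i)) ^ e i with hE
  set G : ℂ[X] := ∏ i, (X - C (x i)) with hG
  set B : ℂ[X] := C (dl / l) * G * Y1
    - Y1 * ∑ i, C (e i * dx i) * ∏ k ∈ Finset.univ.erase i, (X - C (x k))
    + G * ∑ j ∈ J, C (dy j) * ∏ k ∈ J.erase j, (X - C (y k)) with hB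
  set W : ℂ[X] := derivative H * Y1 - H * derivative Y1 with hW
  have hY1e : ∀ z, (∀ j, z ≠ y j) → Y1.eval z ≠ 0 := fun z hz => by
    rw [hY1, eval_prod]
    exact Finset.prod_ne_zero_iff.2 fun j _ => by simpa [sub_eq_zero] using hz j
  have hGe : ∀ z, (∀ i, z ≠ x i) → G.eval z ≠ 0 := fun z hz => by
    rw [hG, eval_prod]
    exact Finset.prod_ne_zero_iff.2 fun j _ => by simpa [sub_eq_zero] using hz j
  have herase : ∀ z, (∀ j, z ≠ y j) → ∀ j ∈ J,
      ∏ k ∈ J.erase j, (z - y k) = Y1.eval z / (z - y j) := by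
    intro z hz j hj
    rw [eq_div_iff (sub_ne_zero.2 (hz j)), hY1, eval_prod]
    simp only [eval_sub, eval_X, eval_C]
    exact Finset.prod_erase_mul _ _ hj
  have heraseG : ∀ z, (∀ i, z ≠ x i) → ∀ i,
      ∏ k ∈ Finset.univ.erase i, (z - x k) = G.eval z / (z - x i) := by
    intro z hz i
    rw [eq_div_iff (sub_ne_zero.2 (hz i)), hG, eval_prod]
    simp only [eval_sub, eval_X, eval_C]
    exact Finset.prod_erase_mul _ _ (Finset.mem_univ i)
  have hHe : ∀ z, (∀ j, z ≠ y j) →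
      H.eval z = Y1.eval z * (∑ j, R j * dy j / (z - y j) - c) := by
    intro z hz
    rw [hsumJ _ (by simp [hdy]), hH]
    simp only [eval_sub, eval_finsetSum, eval_mul, eval_C, eval_prod, eval_X]
    rw [mul_sub, Finset.mul_sum, mul_comm c]
    congr 1
    refine Finset.sum_congr rfl fun j hj => ?_
    rw [herase z hz j hj]
    ring
  -- the derivative of `H / Y1`
  have hWe : ∀ z, (∀ j, z ≠ y j) →
      W.eval z = -(Y1.eval z) ^ 2 * ∑ j, R j * dy j / (z - y j) ^ 2 := by
    intro z hz
    have hev : ∀ᶠ w in 𝓝 z, ∀ j, w ≠ y j :=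
      Filter.eventually_all.2 fun j => isOpen_ne.mem_nhds (hz j)
    have h1 : HasDerivAt (fun w => H.eval w / Y1.eval w)
        ((H.derivative.eval z * Y1.eval z - H.eval z * Y1.derivative.eval z) / (Y1.eval z) ^ 2) z :=
      (H.hasDerivAt z).div (Y1.hasDerivAt z) (hY1e z hz)
    have h2 : HasDerivAt (fun w => ∑ j, R j * dy j / (w - y j) - c)
        (∑ j, -(R j * dy j / (z - y j) ^ 2)) z := by
      refine (HasDerivAt.fun_sum fun j _ => ?_).sub_const c
      exact hasDerivAt_const_div_sub _ (hz j)
    have h3 : (fun w => H.eval w / Y1.eval w) =ᶠ[𝓝 z] fun w => ∑ j, R j * dy j / (w - y j) - c := by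
      filter_upwards [hev] with w hw
      rw [hHe w hw, mul_div_cancel_left₀ _ (hY1e w hw)]
    have h4 := h1.unique (h2.congr_of_eventuallyEq h3)
    rw [div_eq_iff (pow_ne_zero _ (hY1e z hz)), Finset.sum_neg_distrib] at h4
    rw [hW]
    simp only [eval_sub, eval_mul]
    rw [h4]
    ring
  have hident : (X - C (y 0)) * G * W = -(E * B) := by
    refine eq_of_eval_eq_of_finite ((Set.finite_range x).union (Set.finite_range y)) fun z hz => ?_
    have hzx : ∀ i, z ≠ x i := fun i h => hz (Or.inl ⟨i, h.symm⟩)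
    have hzy : ∀ j, z ≠ y j := fun i h => hz (Or.inr ⟨i, h.symm⟩)
    have hYe : ∏ j, (z - y j) = (z - y 0) * Y1.eval z := by
      rw [hY1, eval_prod, hJ]
      simp only [eval_sub, eval_X, eval_C]
      exact (Finset.mul_prod_erase _ _ (Finset.mem_univ 0)).symm
    have hEe : E.eval z = l * ∏ i, (z - x i) ^ e i := by
      simp [hE, eval_prod]
    have hBe : B.eval z = G.eval z * Y1.eval z *
        (dl / l - ∑ i, e i * dx i / (z - x i) + ∑ j, dy j / (z - y j)) := by
      rw [hsumJ (fun j => dy j / (z - y j)) (by simp [hdy]), hB]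
      simp only [eval_sub, eval_add, eval_finsetSum, eval_mul, eval_C, eval_prod, eval_X]
      have e1 : ∑ i, (e i : ℂ) * dx i * ∏ k ∈ Finset.univ.erase i, (z - x k) =
          G.eval z * ∑ i, e i * dx i / (z - x i) := by
        rw [Finset.mul_sum]
        exact Finset.sum_congr rfl fun i _ => by rw [heraseG z hzx i]; ring
      have e2 : ∑ j ∈ J, dy j * ∏ k ∈ J.erase j, (z - y k) =
          Y1.eval z * ∑ j ∈ J, dy j / (z - y j) := by
        rw [Finset.mul_sum]
        exact Finset.sum_congr rfl fun j hj => by rw [herase z hzy j hj]; ring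
      rw [e1, e2]
      ring
    simp only [eval_mul, eval_neg, eval_sub, eval_X, eval_C]
    rw [hWe z hzy, hω z hzx hzy, hYe, ← hEe, hBe]
    have h1 := hY1e z hzy
    have h2 := sub_ne_zero.2 (hzy 0)
    field_simp
  have hHx : ∀ i, H.eval (x i) = 0 := fun i => by
    rw [hHe _ (hxy i), hper i, sub_self, mul_zero]
  have hWdvd : ∀ i k, (X - C (x i)) ^ (k + 1) ∣ E * B → (X - C (x i)) ^ k ∣ W := by
    intro i k hk
    have hGi : G = (X - C (x i)) * ∏ k ∈ Finset.univ.erase i, (X - C (x k)) :=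
      (Finset.mul_prod_erase _ _ (Finset.mem_univ i)).symm
    rw [← neg_neg (E * B), ← hident, dvd_neg, hGi, pow_succ'] at hk
    have hk' : (X - C (x i)) * (X - C (x i)) ^ k ∣ (X - C (x i)) *
        (((X - C (y 0)) * ∏ k ∈ Finset.univ.erase i, (X - C (x k))) * W) := by
      convert hk using 1
      ring
    have hk2 := (mul_dvd_mul_iff_left (X_sub_C_ne_zero (x i))).1 hk'
    refine IsCoprime.dvd_of_dvd_mul_left ?_ hk2
    refine IsCoprime.pow_left (IsCoprime.mul_right ?_ (IsCoprime.prod_right fun k hk => ?_))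
    · exact isCoprime_X_sub_C_of_isUnit_sub (sub_ne_zero.2 (hxy i 0)).isUnit
    · exact isCoprime_X_sub_C_of_isUnit_sub
        (sub_ne_zero.2 fun h => (Finset.ne_of_mem_erase hk) (hx h).symm).isUnit
  have hEdvd : ∀ i, (X - C (x i)) ^ e i ∣ E := fun i =>
    dvd_mul_of_dvd_right (Finset.dvd_prod_of_mem (fun i => (X - C (x i)) ^ e i)
      (Finset.mem_univ i)) _
  have hB0 : (X - C (x 0)) ∣ B := by
    have hG0 : (X - C (x 0)) ∣ G := Finset.dvd_prod_of_mem (fun i => X - C (x i)) (Finset.mem_univ 0)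
    rw [hB]
    refine dvd_add (dvd_sub ((hG0.mul_left _).mul_right _) (Dvd.dvd.mul_left ?_ _)) (hG0.mul_right _)
    refine Finset.dvd_sum fun i _ => ?_
    by_cases hi : i = 0
    · simp [hi, hdx]
    · exact Dvd.dvd.mul_left (Finset.dvd_prod_of_mem (fun i => X - C (x i))
        (Finset.mem_erase.2 ⟨Ne.symm hi, Finset.mem_univ 0⟩)) _
  set e' : Fin (m + 1) → ℕ := fun i => if i = 0 then e 0 + 1 else e i with he'
  have hHdvd : ∀ i, (X - C (x i)) ^ e' i ∣ H := by
    intro i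
    by_cases hi : i = 0
    · subst hi
      simp only [he', if_true]
      refine pow_dvd_of_pow_dvd_wronskian (hHx 0) (hY1e _ (hxy 0)) (hWdvd 0 (e 0) ?_)
      rw [pow_succ]
      exact mul_dvd_mul (hEdvd 0) hB0
    · simp only [he', if_neg hi]
      obtain ⟨k, hk⟩ : ∃ k, e i = k + 1 := ⟨e i - 1, by have := he i; omega⟩
      rw [hk]
      refine pow_dvd_of_pow_dvd_wronskian (hHx i) (hY1e _ (hxy i)) (hWdvd i k ?_)
      rw [← hk]
      exact (hEdvd i).mul_right _
  have hprod : ∏ i, (X - C (x i)) ^ e' i ∣ H := by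
    refine Finset.prod_dvd_of_coprime (fun i _ j _ hij => ?_) fun i _ => hHdvd i
    exact (isCoprime_X_sub_C_of_isUnit_sub (sub_ne_zero.2 fun h => hij (hx h)).isUnit).pow
  have hcardJ : J.card = n := by rw [hJ, Finset.card_erase_of_mem (Finset.mem_univ _)]; simp
  have hdegH : H.natDegree ≤ n := by
    refine (natDegree_sub_le_of_le (m := n) (n := n)
      (natDegree_sum_le_of_forall_le _ _ fun j hj => ?_) ?_).trans (max_self n).le
    · refine (natDegree_C_mul_le _ _).trans ?_
      rw [natDegree_prod_of_monic _ _ fun i _ => monic_X_sub_C _]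
      simp only [natDegree_X_sub_C, Finset.sum_const, smul_eq_mul, mul_one]
      exact (Finset.card_le_card (Finset.erase_subset _ _)).trans hcardJ.le
    · refine (natDegree_C_mul_le _ _).trans ?_
      rw [natDegree_prod_of_monic _ _ fun i _ => monic_X_sub_C _]
      simp [hcardJ]
  have hdege : (∏ i, (X - C (x i)) ^ e' i).natDegree = n + 1 := by
    rw [natDegree_prod_of_monic _ _ fun i _ => (monic_X_sub_C _).pow _]
    simp only [natDegree_pow, natDegree_X_sub_C, mul_one]
    rw [Fin.sum_univ_succ, ← hn, Fin.sum_univ_succ e]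
    simp only [he', if_true, Fin.succ_ne_zero, if_false]
    ring
  have hH0 : H = 0 := by
    by_contra h0
    have := natDegree_le_of_dvd hprod h0
    omega
  have hdy0 : ∀ j, dy j = 0 := by
    intro j
    by_cases hj : j = 0
    · rw [hj, hdy]
    have hjJ : j ∈ J := Finset.mem_erase.2 ⟨hj, Finset.mem_univ j⟩
    have h1 : H.eval (y j) = 0 := by rw [hH0, eval_zero]
    rw [hH] at h1
    simp only [eval_sub, eval_finsetSum, eval_mul, eval_C, eval_prod, eval_X, hY1] at h1
    rw [Finset.sum_eq_single j, Finset.prod_eq_zero hjJ (sub_self _), mul_zero, sub_zero] at h1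
    · have h2 : ∏ k ∈ J.erase j, (y j - y k) ≠ 0 := Finset.prod_ne_zero_iff.2 fun k hk =>
        sub_ne_zero.2 fun h => (Finset.ne_of_mem_erase hk) (hy h).symm
      exact (mul_eq_zero.1 ((mul_eq_zero.1 h1).resolve_right h2)).resolve_left (hR j)
    · intro k hk hkj
      rw [Finset.prod_eq_zero (Finset.mem_erase.2 ⟨hkj.symm, hjJ⟩) (sub_self _), mul_zero]
    · exact fun h => absurd hjJ h
  have hE0 : E ≠ 0 := mul_ne_zero (C_ne_zero.2 hl)
    (Finset.prod_ne_zero_iff.2 fun i _ => pow_ne_zero _ (X_sub_C_ne_zero _))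
  have hBz : B = 0 := by
    have hW0 : W = 0 := by rw [hW, hH0]; simp
    rw [hW0, mul_zero, eq_comm, neg_eq_zero] at hident
    exact (mul_eq_zero.1 hident).resolve_left hE0
  have hdx0 : ∀ i, dx i = 0 := by
    intro i
    have h1 : B.eval (x i) = 0 := by rw [hBz, eval_zero]
    rw [hB] at h1
    simp only [eval_sub, eval_add, eval_finsetSum, eval_mul, eval_C, eval_prod, eval_X, hG, hdy0,
      zero_mul, Finset.sum_const_zero, mul_zero, add_zero] at h1
    rw [Finset.prod_eq_zero (Finset.mem_univ i) (sub_self _), mul_zero, zero_mul, zero_sub,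
      neg_eq_zero, Finset.sum_eq_single i] at h1
    · have h2 : ∏ k ∈ Finset.univ.erase i, (x i - x k) ≠ 0 := Finset.prod_ne_zero_iff.2 fun k hk =>
        sub_ne_zero.2 fun h => (Finset.ne_of_mem_erase hk) (hx h).symm
      have h3 := (mul_eq_zero.1 ((mul_eq_zero.1 h1).resolve_left (hY1e _ (hxy i)))).resolve_right h2
      have h4 : (e i : ℂ) ≠ 0 := by exact_mod_cast (by have := he i; omega : e i ≠ 0)
      exact (mul_eq_zero.1 h3).resolve_left h4
    · intro k _ hki
      rw [Finset.prod_eq_zero (Finset.mem_erase.2 ⟨hki.symm, Finset.mem_univ i⟩) (sub_self _),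
        mul_zero]
    · exact fun h => absurd (Finset.mem_univ i) h
  refine ⟨?_, hdx0, hdy0⟩
  rw [hB] at hBz
  simp only [hdx0, hdy0, mul_zero, map_zero, zero_mul, Finset.sum_const_zero, sub_zero,
    add_zero] at hBz
  have hG0 : G ≠ 0 := Finset.prod_ne_zero_iff.2 fun i _ => X_sub_C_ne_zero _
  have hY0 : Y1 ≠ 0 := Finset.prod_ne_zero_iff.2 fun i _ => X_sub_C_ne_zero _
  have h5 := (mul_eq_zero.1 ((mul_eq_zero.1 hBz).resolve_right hY0)).resolve_right hG0
  rw [C_eq_zero] at h5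
  exact (div_eq_zero_iff.1 h5).resolve_right hl

end Wronskian

/-! ### Period charts -/

section Charts

lemma IsRegular.analyticAt {f : Coord m n → ℂ} (hf : IsRegular f) {s : Coord m n}
    (hs : s ∈ stratum m n) : AnalyticAt ℂ f s := by
  obtain ⟨P, Q, h⟩ := hf
  have hP := AnalyticOnNhd.eval_mvPolynomial P s (Set.mem_univ s)
  have hQ := AnalyticOnNhd.eval_mvPolynomial Q s (Set.mem_univ s)
  refine (hP.fun_div hQ (h s hs).1).congr ?_
  filter_upwards [isOpen_stratum.mem_nhds hs] with u hu
  exact (h u hu).2.symm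

/-- The branch of `log ((x_{i+1} - y_j) / (x_0 - y_j))` near `s₀` that takes the value `κ i j`
at `s₀`. -/
def logBranch (s₀ : Coord m n) (κ : Fin m → Fin (n + 1) → ℂ) (s : Coord m n) (i : Fin m)
    (j : Fin (n + 1)) : ℂ :=
  κ i j + Complex.log ((zeroPt s i.succ - polePt s j) / (zeroPt s₀ i.succ - polePt s₀ j)) -
    Complex.log ((zeroPt s 0 - polePt s j) / (zeroPt s₀ 0 - polePt s₀ j))

/-- The periods of `ω`, computed with the branches `logBranch s₀ κ` of the logarithms. -/
def periodMap (e : Fin (m + 1) → ℕ) (s₀ : Coord m n) (κ : Fin m → Fin (n + 1) → ℂ)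
    (s : Coord m n) : PeriodSpace m n :=
  Sum.elim (fun i => ∑ j, res e s j * logBranch s₀ κ s i j)
    fun j => 2 * Real.pi * Complex.I * res e s j

/-- `κ i j` is a logarithm of `(x_{i+1} - y_j) / (x_0 - y_j)` for all `i` and `j`. -/
def IsLogSystem (s : Coord m n) (κ : Fin m → Fin (n + 1) → ℂ) : Prop :=
  ∀ i j, Complex.exp (κ i j) = (zeroPt s i.succ - polePt s j) / (zeroPt s 0 - polePt s j)

variable {e : Fin (m + 1) → ℕ} {s₀ s : Coord m n} {κ : Fin m → Fin (n + 1) → ℂ}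

lemma isPeriodVector_iff (hn : ∑ i, e i = n) (hs : s ∈ stratum m n) (v : PeriodSpace m n) :
    IsPeriodVector e s v ↔ ∃ κ, IsLogSystem s κ ∧
      v = Sum.elim (fun i => ∑ j, res e s j * κ i j)
        fun j => 2 * Real.pi * Complex.I * res e s j := by
  simp only [IsPeriodVector, isRelPeriod_iff hn hs]
  constructor
  · rintro ⟨h1, h2⟩
    choose κ hκ hv using h1
    refine ⟨κ, hκ, ?_⟩
    ext (i | j)
    · exact hv i
    · exact h2 j
  · rintro ⟨κ, hκ, rfl⟩
    exact ⟨fun i => ⟨κ i, hκ i, rfl⟩, fun j => rfl⟩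

lemma logBranch_self : logBranch s₀ κ s₀ = κ := by
  ext i j
  simp [logBranch]

lemma IsLogSystem.logBranch (hs₀ : s₀ ∈ stratum m n) (hs : s ∈ stratum m n)
    (hκ : IsLogSystem s₀ κ) : IsLogSystem s (logBranch s₀ κ s) := by
  intro i j
  have h1 := zeroPt_sub_ne_zero hs₀ i.succ j
  have h2 := zeroPt_sub_ne_zero hs₀ 0 j
  have h3 := zeroPt_sub_ne_zero hs i.succ j
  have h4 := zeroPt_sub_ne_zero hs 0 j
  rw [SimplePoleStratum.logBranch, Complex.exp_sub, Complex.exp_add, hκ i j,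
    Complex.exp_log (div_ne_zero h3 h1), Complex.exp_log (div_ne_zero h4 h2)]
  field_simp

lemma isPeriodVector_periodMap (hn : ∑ i, e i = n) (hs₀ : s₀ ∈ stratum m n)
    (hs : s ∈ stratum m n) (hκ : IsLogSystem s₀ κ) : IsPeriodVector e s (periodMap e s₀ κ s) :=
  (isPeriodVector_iff hn hs _).2 ⟨_, hκ.logBranch hs₀ hs, rfl⟩

lemma analyticAt_logBranch (hs : s₀ ∈ stratum m n) (i : Fin m) (j : Fin (n + 1)) :
    AnalyticAt ℂ (fun s => logBranch s₀ κ s i j) s₀ := by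
  have key : ∀ l : Fin (m + 1), AnalyticAt ℂ
      (fun s => Complex.log ((zeroPt s l - polePt s j) / (zeroPt s₀ l - polePt s₀ j))) s₀ := by
    intro l
    refine AnalyticAt.clog ?_ ?_
    · exact (((isRegular_zeroPt l).sub (isRegular_polePt j)).analyticAt hs).fun_div
        analyticAt_const (zeroPt_sub_ne_zero hs l j)
    · rw [div_self (zeroPt_sub_ne_zero hs l j)]
      exact Complex.one_mem_slitPlane
  exact (analyticAt_const.add (key i.succ)).sub (key 0)

lemma analyticAt_periodMap (hs : s₀ ∈ stratum m n) : AnalyticAt ℂ (periodMap e s₀ κ) s₀ := by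
  rw [analyticAt_pi_iff]
  rintro (i | j)
  · change AnalyticAt ℂ (fun s => ∑ j, res e s j * logBranch s₀ κ s i j) s₀
    refine Finset.analyticAt_fun_sum _ fun j _ => ?_
    exact ((isRegular_res e j).analyticAt hs).mul (analyticAt_logBranch hs i j)
  · exact analyticAt_const.mul ((isRegular_res e j).analyticAt hs)

/-- The derivative of the poles `y_j` in the direction `v`. -/
def dirPole (v : Coord m n) : Fin (n + 1) → ℂ := Fin.cons 0 fun j => v (Sum.inr (Sum.inr j))

lemma zeroPt_add_smul (s v : Coord m n) (t : ℂ) (i : Fin (m + 1)) :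
    zeroPt (s + t • v) i = zeroPt s i + t * zeroPt v i := by
  refine Fin.cases ?_ (fun i => ?_) i <;> simp

lemma polePt_add_smul (s v : Coord m n) (t : ℂ) (j : Fin (n + 1)) :
    polePt (s + t • v) j = polePt s j + t * dirPole v j := by
  refine Fin.cases ?_ (fun i => ?_) j <;> simp [dirPole]

lemma hasDerivAt_line (s v : Coord m n) : HasDerivAt (fun t : ℂ => s + t • v) v 0 := by
  simpa using ((hasDerivAt_id (0 : ℂ)).smul_const v).const_add s

lemma hasDerivAt_comp_line {F : Type*} [NormedAddCommGroup F] [NormedSpace ℂ F]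
    {f : Coord m n → F} (hf : AnalyticAt ℂ f s) (v : Coord m n) :
    HasDerivAt (fun t : ℂ => f (s + t • v)) (fderiv ℂ f s v) 0 := by
  have h1 : HasFDerivAt f (fderiv ℂ f s) (s + (0 : ℂ) • v) := by
    simpa using hf.differentiableAt.hasFDerivAt
  exact h1.comp_hasDerivAt 0 (hasDerivAt_line s v)

lemma hasDerivAt_zeroPt (s v : Coord m n) (i : Fin (m + 1)) (t : ℂ) :
    HasDerivAt (fun t : ℂ => zeroPt (s + t • v) i) (zeroPt v i) t := by
  simp only [zeroPt_add_smul]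
  simpa using ((hasDerivAt_id t).mul_const (zeroPt v i)).const_add (zeroPt s i)

lemma hasDerivAt_polePt (s v : Coord m n) (j : Fin (n + 1)) (t : ℂ) :
    HasDerivAt (fun t : ℂ => polePt (s + t • v) j) (dirPole v j) t := by
  simp only [polePt_add_smul]
  simpa using ((hasDerivAt_id t).mul_const (dirPole v j)).const_add (polePt s j)

/-- The logarithmic derivative of `(x_{i+1} - y_j) / (x_0 - y_j)` in the direction `v`. -/
def dirLog (s v : Coord m n) (i : Fin m) (j : Fin (n + 1)) : ℂ :=
  (zeroPt v i.succ - dirPole v j) / (zeroPt s i.succ - polePt s j) -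
    (zeroPt v 0 - dirPole v j) / (zeroPt s 0 - polePt s j)

lemma hasDerivAt_logBranch (hs : s ∈ stratum m n) (v : Coord m n) (i : Fin m)
    (j : Fin (n + 1)) :
    HasDerivAt (fun t : ℂ => logBranch s κ (s + t • v) i j) (dirLog s v i j) 0 := by
  have key : ∀ l : Fin (m + 1), HasDerivAt (fun t : ℂ => Complex.log
      ((zeroPt (s + t • v) l - polePt (s + t • v) j) / (zeroPt s l - polePt s j)))
      ((zeroPt v l - dirPole v j) / (zeroPt s l - polePt s j)) 0 := by
    intro l
    have h0 := zeroPt_sub_ne_zero hs l j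
    have h1 := ((hasDerivAt_zeroPt s v l 0).sub (hasDerivAt_polePt s v j 0)).div_const
      (zeroPt s l - polePt s j)
    have h2 : (zeroPt (s + (0 : ℂ) • v) l - polePt (s + (0 : ℂ) • v) j) /
        (zeroPt s l - polePt s j) = 1 := by
      simp [div_self h0]
    have h3 := h1.clog (by
      simp only [Pi.sub_apply]
      rw [h2]; exact Complex.one_mem_slitPlane)
    simp only [Pi.sub_apply] at h3
    rw [h2, div_one] at h3
    exact h3
  exact ((key i.succ).const_add (κ i j)).sub (key 0)

lemma fderiv_periodMap_inl (hs : s ∈ stratum m n) (v : Coord m n) (i : Fin m) :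
    fderiv ℂ (periodMap e s κ) s v (Sum.inl i) =
      ∑ j, (fderiv ℂ (fun u => res e u j) s v * κ i j + res e s j * dirLog s v i j) := by
  have h1 := hasDerivAt_pi.1 (hasDerivAt_comp_line (analyticAt_periodMap (e := e) (κ := κ) hs) v)
    (Sum.inl i)
  have h3 : HasDerivAt (fun t : ℂ => ∑ j, res e (s + t • v) j * logBranch s κ (s + t • v) i j)
    (∑ j, (fderiv ℂ (fun u => res e u j) s v * κ i j + res e s j * dirLog s v i j)) 0 := by
    refine HasDerivAt.fun_sum fun j _ => ?_
    have h2 := (hasDerivAt_comp_line ((isRegular_res e j).analyticAt hs) v).mul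
      (hasDerivAt_logBranch (κ := κ) hs v i j)
    simp only [zero_smul, add_zero, logBranch_self] at h2
    exact h2
  exact h1.unique h3

lemma fderiv_periodMap_inr (hs : s ∈ stratum m n) (v : Coord m n) (j : Fin (n + 1)) :
    fderiv ℂ (periodMap e s κ) s v (Sum.inr j) =
      2 * Real.pi * Complex.I * fderiv ℂ (fun u => res e u j) s v := by
  have h1 := hasDerivAt_pi.1 (hasDerivAt_comp_line (analyticAt_periodMap (e := e) (κ := κ) hs) v)
    (Sum.inr j)
  exact h1.unique ((hasDerivAt_comp_line ((isRegular_res e j).analyticAt hs) v).const_mul _)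

/-- The period map is an immersion. -/
lemma fderiv_periodMap_injective (he : ∀ i, 1 ≤ e i) (hn : ∑ i, e i = n) (hs : s ∈ stratum m n) :
    Function.Injective (fderiv ℂ (periodMap e s κ) s) := by
  rw [injective_iff_map_eq_zero]
  intro v hv
  have hI : (2 * Real.pi * Complex.I : ℂ) ≠ 0 := Complex.two_pi_I_ne_zero
  have hres : ∀ j, fderiv ℂ (fun u => res e u j) s v = 0 := by
    intro j
    have h := fderiv_periodMap_inr (e := e) (κ := κ) hs v j
    rw [hv, Pi.zero_apply, eq_comm] at h
    exact (mul_eq_zero.1 h).resolve_left hI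
  have hresd : ∀ j, HasDerivAt (fun t : ℂ => res e (s + t • v) j) 0 0 := fun j => by
    have := hasDerivAt_comp_line ((isRegular_res e j).analyticAt hs) v
    rwa [hres j] at this
  have hline : Filter.Tendsto (fun t : ℂ => s + t • v) (𝓝 0) (𝓝 s) := by
    have := (hasDerivAt_line s v).continuousAt.tendsto
    simpa using this
  have hω : ∀ z, (∀ i, z ≠ zeroPt s i) → (∀ j, z ≠ polePt s j) →
      ∑ j, res e s j * dirPole v j / (z - polePt s j) ^ 2 =
        (scale s * ∏ i, (z - zeroPt s i) ^ e i) / (∏ j, (z - polePt s j)) *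
          (scale v / scale s - ∑ i, e i * zeroPt v i / (z - zeroPt s i) +
            ∑ j, dirPole v j / (z - polePt s j)) := by
    intro z hzx hzy
    -- differentiate both expressions for `ω` at the point `z`
    have hL : HasDerivAt (fun t : ℂ => omega e (s + t • v) z)
        (∑ j, res e s j * dirPole v j / (z - polePt s j) ^ 2) 0 := by
      have h1 : HasDerivAt (fun t : ℂ => ∑ j, res e (s + t • v) j / (z - polePt (s + t • v) j))
          (∑ j, res e s j * dirPole v j / (z - polePt s j) ^ 2) 0 := by
        refine HasDerivAt.fun_sum fun j _ => ?_
        have h2 := (hresd j).fun_div ((hasDerivAt_polePt s v j 0).const_sub z) (by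
          simpa [sub_eq_zero] using hzy j)
        simpa using h2
      refine h1.congr_of_eventuallyEq ?_
      have hev : ∀ᶠ t : ℂ in 𝓝 0, ∀ j, z ≠ polePt (s + t • v) j := by
        rw [Filter.eventually_all]
        intro j
        have hc := (hasDerivAt_polePt s v j 0).continuousAt
        have h0 : polePt (s + (0 : ℂ) • v) j ∈ ({z}ᶜ : Set ℂ) := by
          simpa using (hzy j).symm
        filter_upwards [hc.preimage_mem_nhds (isOpen_compl_singleton.mem_nhds h0)] with t ht
        exact fun h => ht (by simp [← h])
      filter_upwards [hev, hline (isOpen_stratum.mem_nhds hs)] with t ht hts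
      exact omega_eq_sum hn hts ht
    have hR : HasDerivAt (fun t : ℂ => omega e (s + t • v) z)
        ((scale s * ∏ i, (z - zeroPt s i) ^ e i) / (∏ j, (z - polePt s j)) *
        (scale v / scale s - ∑ i, e i * zeroPt v i / (z - zeroPt s i) +
          ∑ j, dirPole v j / (z - polePt s j))) 0 := by
      have hsc : HasDerivAt (fun t : ℂ => scale (s + t • v)) (scale v) 0 := by
        have : (fun t : ℂ => scale (s + t • v)) = fun t => scale s + t * scale v := by
          ext t; simp [scale]
        rw [this]
        simpa using ((hasDerivAt_id (0 : ℂ)).mul_const (scale v)).const_add (scale s)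
      have hz0 : ∀ i, z - zeroPt s i ≠ 0 := fun i => sub_ne_zero.2 (hzx i)
      have hp0 : ∀ i, z - polePt s i ≠ 0 := fun i => sub_ne_zero.2 (hzy i)
      have hnum : HasDerivAt (fun t : ℂ => ∏ i, (z - zeroPt (s + t • v) i) ^ e i)
          ((∏ i, (z - zeroPt s i) ^ e i) * -∑ i, e i * zeroPt v i / (z - zeroPt s i)) 0 := by
        have h1 := HasDerivAt.fun_finsetProd (u := Finset.univ)
          (f := fun i (t : ℂ) => (z - zeroPt (s + t • v) i) ^ e i) (x := 0)
          fun i _ => ((hasDerivAt_zeroPt s v i 0).const_sub z).fun_pow (e i)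
        simp only [zero_smul, add_zero] at h1
        refine h1.congr_deriv (Eq.symm ?_)
        rw [← Finset.sum_neg_distrib, Finset.mul_sum]
        refine Finset.sum_congr rfl fun i hi => ?_
        obtain ⟨k, hk⟩ : ∃ k, e i = k + 1 := ⟨e i - 1, by have := he i; omega⟩
        rw [← Finset.mul_prod_erase _ _ hi, hk, Nat.add_sub_cancel, smul_eq_mul, pow_succ]
        have := hz0 i
        field_simp
      have hden : HasDerivAt (fun t : ℂ => ∏ j, (z - polePt (s + t • v) j))
          ((∏ j, (z - polePt s j)) * -∑ j, dirPole v j / (z - polePt s j)) 0 := by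
        have h1 := HasDerivAt.fun_finsetProd (u := Finset.univ)
          (f := fun i (t : ℂ) => (z - polePt (s + t • v) i)) (x := 0)
          fun i _ => ((hasDerivAt_polePt s v i 0).const_sub z)
        simp only [zero_smul, add_zero] at h1
        refine h1.congr_deriv (Eq.symm ?_)
        rw [← Finset.sum_neg_distrib, Finset.mul_sum]
        refine Finset.sum_congr rfl fun i hi => ?_
        rw [← Finset.mul_prod_erase _ _ hi, smul_eq_mul]
        have := hp0 i
        field_simp
      have hP : ∏ j, (z - polePt s j) ≠ 0 := Finset.prod_ne_zero_iff.2 fun j _ => hp0 j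
      have h := (hsc.fun_mul hnum).fun_div hden (by simpa using hP)
      simp only [zero_smul, add_zero] at h
      refine h.congr_deriv (Eq.symm ?_)
      have := scale_ne_zero hs
      field_simp
      ring
    exact hL.unique hR
  have hper : ∀ i, ∑ j, res e s j * dirPole v j / (zeroPt s i - polePt s j) =
      ∑ j, res e s j * dirPole v j / (zeroPt s 0 - polePt s j) := by
    intro i
    refine Fin.cases rfl (fun i => ?_) i
    have h := fderiv_periodMap_inl (e := e) (κ := κ) hs v i
    rw [hv, Pi.zero_apply] at h
    simp only [hres, zero_mul, zero_add, dirLog, zeroPt_zero] at h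
    have h0 : ∑ j, res e s j * (zeroPt v i.succ / (zeroPt s i.succ - polePt s j)) = 0 := by
      have := sum_res_eq hn hs i.succ (by have := he i.succ; omega)
      rw [← mul_zero (zeroPt v i.succ), ← this, Finset.mul_sum]
      exact Finset.sum_congr rfl fun j _ => by ring
    have h1 : ∑ j, res e s j * (zeroPt v i.succ / (zeroPt s i.succ - polePt s j)) -
        (∑ j, res e s j * dirPole v j / (zeroPt s i.succ - polePt s j) -
          ∑ j, res e s j * dirPole v j / (zeroPt s 0 - polePt s j)) = 0 := by
      rw [h, ← Finset.sum_sub_distrib, ← Finset.sum_sub_distrib]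
      refine Finset.sum_congr rfl fun j _ => ?_
      rw [zeroPt_zero]
      ring
    rw [h0, zero_sub, neg_eq_zero, sub_eq_zero] at h1
    exact h1
  obtain ⟨h1, h2, h3⟩ := deformation_trivial (x := zeroPt s) (y := polePt s) (dx := zeroPt v)
    (dy := dirPole v) (R := res e s) (l := scale s) (dl := scale v) (zeroPt_injective hs)
    (polePt_injective hs) (zeroPt_ne_polePt hs) (scale_ne_zero hs) (res_ne_zero e hs) he hn rfl rfl
    hω hper
  ext (i | i | i)
  · exact h1
  · simpa using h2 i.succ
  · simpa [dirPole] using h3 i.succ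

end Charts

section LocalCharts

/-- Period coordinates around a point `s` with period vector `v`: the map `periodMap e s κ` is a
bijection from the open set `U` to the ball of radius `ε` around `v`, and `ψ` is its inverse. -/
structure IsLocalChart (e : Fin (m + 1) → ℕ) (s : Coord m n) (v : PeriodSpace m n)
    (κ : Fin m → Fin (n + 1) → ℂ) (U : Set (Coord m n)) (ψ : PeriodSpace m n → Coord m n)
    (ε : ℝ) : Prop where
  isPeriodChart : IsPeriodChart e U (periodMap e s κ)
  mem : s ∈ U
  isLogSystem : IsLogSystem s κ
  pos : 0 < ε
  map_self : periodMap e s κ s = v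
  map_mem : ∀ u ∈ U, periodMap e s κ u ∈ Metric.ball v ε
  inv_mem : ∀ w ∈ Metric.ball v ε, ψ w ∈ U
  left_inv : ∀ u ∈ U, ψ (periodMap e s κ u) = u
  right_inv : ∀ w ∈ Metric.ball v ε, periodMap e s κ (ψ w) = w
  analytic : AnalyticOnNhd ℂ ψ (Metric.ball v ε)

variable {e : Fin (m + 1) → ℕ} {s : Coord m n} {v : PeriodSpace m n}

/-- Every period vector of `s` is the value at `s` of one of the maps `periodMap e s κ`. -/
lemma exists_periodMap_self_eq (hn : ∑ i, e i = n) (hs : s ∈ stratum m n)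
    (hv : IsPeriodVector e s v) : ∃ κ, IsLogSystem s κ ∧ periodMap e s κ s = v := by
  obtain ⟨κ, hκ, hvκ⟩ := (isPeriodVector_iff hn hs v).1 hv
  exact ⟨κ, hκ, by rw [hvκ, periodMap, logBranch_self]⟩

/-- The maps `periodMap e s κ` are period charts on arbitrarily small neighbourhoods of `s`. -/
theorem exists_isLocalChart (he : ∀ i, 1 ≤ e i) (hn : ∑ i, e i = n) (hs : s ∈ stratum m n)
    {κ : Fin m → Fin (n + 1) → ℂ} (hκ : IsLogSystem s κ) (hself : periodMap e s κ s = v)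
    {V : Set (Coord m n)} (hV : V ∈ 𝓝 s) : ∃ U ψ ε, IsLocalChart e s v κ U ψ ε ∧ U ⊆ V := by
  have han : AnalyticAt ℂ (periodMap e s κ) s := analyticAt_periodMap hs
  have hdim : Module.finrank ℂ (Coord m n) = Module.finrank ℂ (PeriodSpace m n) := by
    simp; ring
  set L : Coord m n ≃L[ℂ] PeriodSpace m n := (LinearMap.linearEquivOfInjective
    (fderiv ℂ (periodMap e s κ) s : Coord m n →ₗ[ℂ] PeriodSpace m n)
      (fderiv_periodMap_injective he hn hs) hdim).toContinuousLinearEquiv with hL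
  have hd : HasFDerivAt (periodMap e s κ) (L : Coord m n →L[ℂ] PeriodSpace m n) s := by
    have : (L : Coord m n →L[ℂ] PeriodSpace m n) = fderiv ℂ (periodMap e s κ) s := by
      ext1 w
      simp [hL, LinearMap.linearEquivOfInjective_apply]
    rw [this]
    exact han.differentiableAt.hasFDerivAt
  have hC : ContDiffAt ℂ 1 (periodMap e s κ) s := han.contDiffAt
  have hCω : ContDiffAt ℂ ⊤ (periodMap e s κ) s := han.contDiffAt
  set Φ := hC.toOpenPartialHomeomorph (periodMap e s κ) hd one_ne_zero with hΦ
  have hΦc : (Φ : Coord m n → PeriodSpace m n) = periodMap e s κ := rfl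
  have hsΦ : s ∈ Φ.source := hC.mem_toOpenPartialHomeomorph_source hd one_ne_zero
  have hvΦ : v ∈ Φ.target := by
    rw [← hself, ← hΦc]
    exact Φ.map_source hsΦ
  have hsymm : Φ.symm v = s := by
    rw [← hself, ← hΦc]
    exact Φ.left_inv hsΦ
  have hinv : AnalyticAt ℂ Φ.symm v := by
    refine ContDiffAt.analyticAt (Φ.contDiffAt_symm hvΦ (f₀' := L) ?_ ?_)
    · rw [hsymm]; exact hd
    · rw [hsymm]; exact hCω
  have hev1 : ∀ᶠ w in 𝓝 v, AnalyticAt ℂ Φ.symm w := hinv.eventually_analyticAt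
  have hev2 : ∀ᶠ w in 𝓝 v, w ∈ Φ.target := Φ.open_target.mem_nhds hvΦ
  have hev3 : ∀ᶠ w in 𝓝 v, Φ.symm w ∈ V ∩ stratum m n ∧
      AnalyticAt ℂ (periodMap e s κ) (Φ.symm w) := by
    have ht : Filter.Tendsto Φ.symm (𝓝 v) (𝓝 s) := by
      have := hinv.continuousAt
      rwa [ContinuousAt, hsymm] at this
    have h1 : ∀ᶠ u in 𝓝 s, u ∈ V ∩ stratum m n :=
      Filter.inter_mem hV (isOpen_stratum.mem_nhds hs)
    exact ht.eventually (h1.and han.eventually_analyticAt)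
  obtain ⟨ε, hε, hball⟩ := Metric.mem_nhds_iff.1 (hev1.and (hev2.and hev3))
  set U := Φ.source ∩ Φ ⁻¹' Metric.ball v ε with hU
  have hUeq : U = Φ.symm '' Metric.ball v ε := by
    ext u
    constructor
    · rintro ⟨hu, hub⟩
      exact ⟨Φ u, hub, Φ.left_inv hu⟩
    · rintro ⟨w, hw, rfl⟩
      have hwt := (hball hw).2.1
      exact ⟨Φ.map_target hwt, by simpa [Φ.right_inv hwt] using hw⟩
  have hUim : Φ '' U = Metric.ball v ε := by
    rw [hUeq, Set.image_image]
    ext w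
    constructor
    · rintro ⟨w', hw', rfl⟩
      have := Φ.right_inv (hball hw').2.1
      simpa only [this] using hw'
    · intro hw
      exact ⟨w, hw, Φ.right_inv (hball hw).2.1⟩
  have hUV : ∀ u ∈ U, u ∈ V ∩ stratum m n ∧ AnalyticAt ℂ (periodMap e s κ) u := by
    intro u hu
    rw [hUeq] at hu
    obtain ⟨w, hw, rfl⟩ := hu
    exact (hball hw).2.2
  refine ⟨U, Φ.symm, ε, ⟨⟨?_, ?_, fun u hu => (hUV u hu).1.2, fun u hu =>
    (hUV u hu).2.differentiableAt.differentiableWithinAt, fun u hu u' hu' h =>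
    Φ.injOn hu.1 hu'.1 h, ?_, fun u hu => isPeriodVector_periodMap hn hs (hUV u hu).1.2 hκ⟩,
    ⟨hsΦ, ?_⟩, hκ, hε, hself, fun u hu => hu.2, ?_, fun u hu => Φ.left_inv hu.1,
    fun w hw => Φ.right_inv (hball hw).2.1, fun w hw => (hball hw).1⟩, fun u hu => (hUV u hu).1.1⟩
  · exact Φ.isOpen_inter_preimage Metric.isOpen_ball
  · rw [hUeq]
    refine IsConnected.image ?_ _ fun w hw => (hball hw).1.continuousAt.continuousWithinAt
    exact (convex_ball v ε).isConnected ⟨v, Metric.mem_ball_self hε⟩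
  · rw [← hΦc, hUim]
    exact Metric.isOpen_ball
  · rw [Set.mem_preimage, hΦc, hself]
    exact Metric.mem_ball_self hε
  · intro w hw
    rw [hUeq]
    exact ⟨w, hw, rfl⟩

end LocalCharts

/-! ### The matrices `M` -/

section LinearAlgebra

lemma residueBlock_last (q : Fin n → ℚ) (j : Fin n) : residueBlock q j (Fin.last n) = q j := by
  simp [residueBlock]

lemma residueBlock_castSucc (q : Fin n → ℚ) (j l : Fin n) :
    residueBlock q j l.castSucc = if l = j then 1 else 0 := by
  simp [residueBlock, (Fin.castSucc_lt_last l).ne]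

lemma isLeadingEntry_residueBlock (q : Fin n → ℚ) (j : Fin n) :
    (residueBlock q).IsLeadingEntry j j.castSucc := by
  refine ⟨fun l hl => ?_, by simp [residueBlock_castSucc]⟩
  obtain ⟨l, rfl⟩ := Fin.eq_castSucc_of_ne_last (hl.trans (Fin.castSucc_lt_last j)).ne
  rw [residueBlock_castSucc, if_neg (Fin.castSucc_lt_castSucc_iff.1 hl).ne]

lemma isReducedRowEchelon_residueBlock (q : Fin n → ℚ) :
    (residueBlock q).IsReducedRowEchelon := by
  refine ⟨fun a b hab d hd => ?_, fun j c hc => ?_, fun a b c hab hc => ?_⟩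
  · have hda : d ≤ a.castSucc := by
      by_contra h
      have := hd a.castSucc (not_le.1 h)
      simp [residueBlock_castSucc] at this
    exact (isLeadingEntry_residueBlock q b).1 d (lt_of_le_of_lt hda (by simpa using hab))
  · rw [hc.unique (isLeadingEntry_residueBlock q j), residueBlock_castSucc, if_pos rfl]
  · rw [hc.unique (isLeadingEntry_residueBlock q b), residueBlock_castSucc, if_neg hab.ne']

variable {k : ℕ} {A : Matrix (Fin k) (Fin m) ℚ} {B : Matrix (Fin k) (Fin (n + 1)) ℂ}
  {q : Fin n → ℚ}

lemma mulVec_periodMatrix_eq_zero_iff (v : PeriodSpace m n) :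
    (periodMatrix A B q).mulVec v = 0 ↔
      (∀ l, ∑ i, (A l i : ℂ) * v (Sum.inl i) + ∑ j, B l j * v (Sum.inr j) = 0) ∧
        ∀ j : Fin n, v (Sum.inr j.castSucc) + q j * v (Sum.inr (Fin.last n)) = 0 := by
  have h2 : ∀ j : Fin n, ∑ l, ((residueBlock q j l : ℚ) : ℂ) * v (Sum.inr l) =
      v (Sum.inr j.castSucc) + q j * v (Sum.inr (Fin.last n)) := by
    intro j
    rw [Fin.sum_univ_castSucc, residueBlock_last, Finset.sum_eq_single j]
    · simp [residueBlock_castSucc]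
    · intro l _ hl
      simp [residueBlock_castSucc, hl]
    · simp
  rw [funext_iff, Sum.forall]
  simp only [periodMatrix, Matrix.mulVec, dotProduct, Fintype.sum_sum_type, Matrix.fromBlocks_apply₁₁,
    Matrix.fromBlocks_apply₁₂, Matrix.fromBlocks_apply₂₁, Matrix.fromBlocks_apply₂₂,
    Matrix.map_apply, Matrix.zero_apply, zero_mul, Finset.sum_const_zero, zero_add, h2,
    Pi.zero_apply]

/-- The upper left block of an admissible matrix contains an identity matrix in its pivot columns. -/
lemma IsAdmissible.exists_pivots (hn : 1 ≤ n) (h : IsAdmissible A B q) :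
    ∃ p : Fin k → Fin m, ∀ l l', A l (p l') = if l = l' then 1 else 0 := by
  obtain ⟨n, rfl⟩ : ∃ n', n = n' + 1 := ⟨n - 1, by omega⟩
  obtain ⟨-, hN⟩ := h
  set N : Matrix (Fin k ⊕ₗ Fin (n + 1)) (Fin m ⊕ₗ Fin (n + 1 + 1)) ℂ :=
    (periodMatrix A B q).submatrix ofLex ofLex with hNdef
  have hNA : ∀ l i, N (toLex (Sum.inl l)) (toLex (Sum.inl i)) = A l i := fun l i => rfl
  have hlead : ∀ l, ∃ c, A.IsLeadingEntry l c := by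
    intro l
    rw [← Matrix.row_ne_zero_iff_exists_isLeadingEntry]
    intro hl
    have h1 : N (toLex (Sum.inr 0)) (toLex (Sum.inr 0)) = 0 := by
      refine hN.isRowEchelon (i₁ := toLex (Sum.inl l)) (Sum.Lex.inl_lt_inr _ _) fun j hj => ?_
      induction j using Lex.rec with
      | h j =>
        rcases j with j | j
        · rw [hNA, hl]; simp
        · exact absurd (Sum.Lex.inr_lt_inr_iff.1 hj) (not_lt.2 (Fin.zero_le j))
    have h2 : N (toLex (Sum.inr 0)) (toLex (Sum.inr 0)) = ((residueBlock q 0 0 : ℚ) : ℂ) := rfl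
    rw [h2, show (0 : Fin (n + 1 + 1)) = Fin.castSucc 0 from rfl, residueBlock_castSucc] at h1
    simp at h1
  choose p hp using hlead
  have hpN : ∀ l, N.IsLeadingEntry (toLex (Sum.inl l)) (toLex (Sum.inl (p l))) := by
    intro l
    refine ⟨fun j hj => ?_, ?_⟩
    · induction j using Lex.rec with
      | h j =>
        rcases j with j | j
        · rw [hNA, (hp l).1 j (Sum.Lex.inl_lt_inl_iff.1 hj)]; simp
        · exact absurd hj (Sum.Lex.not_inr_lt_inl)
    · rw [hNA]
      exact_mod_cast (hp l).2
  refine ⟨p, fun l l' => ?_⟩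
  split_ifs with hll
  · subst hll
    have := hN.eq_one (hpN l)
    rw [hNA] at this
    exact_mod_cast this
  · have := hN.eq_zero_of_ne_of_isLeadingEntry (i₁ := toLex (Sum.inl l)) (by simpa using hll) (hpN l')
    rw [hNA] at this
    exact_mod_cast this

/-- If `A` is in reduced row echelon form without zero rows, then the matrices `(A, (0 | b); 0, (I | q))`
are admissible. -/
lemma isAdmissible_of_isReducedRowEchelon (hA : A.IsReducedRowEchelon) (hA0 : ∀ i, A i ≠ 0)
    (hq : ∀ j, q j ≠ 0) (b : Fin k → ℂ) :
    IsAdmissible A (fun l j => if j = Fin.last n then b l else 0) q := by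
  refine ⟨hq, ?_⟩
  set N : Matrix (Fin k ⊕ₗ Fin n) (Fin m ⊕ₗ Fin (n + 1)) ℂ :=
    (periodMatrix A (fun l j => if j = Fin.last n then b l else 0) q).submatrix ofLex ofLex
    with hNdef
  have hNA : ∀ l i, N (toLex (Sum.inl l)) (toLex (Sum.inl i)) = A l i := fun l i => rfl
  have hN0 : ∀ l i, N (toLex (Sum.inr l)) (toLex (Sum.inl i)) = 0 := fun l i => rfl
  have hNB : ∀ l j, N (toLex (Sum.inl l)) (toLex (Sum.inr j)) =
    if j = Fin.last n then b l else 0 := fun l i => rfl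
  have hNC : ∀ l j, N (toLex (Sum.inr l)) (toLex (Sum.inr j)) = (residueBlock q l j : ℚ) :=
    fun l i => rfl
  have hC := isReducedRowEchelon_residueBlock q
  -- a row of the upper block cannot vanish on all columns of the first block
  have hupper : ∀ l (j : Fin (n + 1)),
      ¬ ∀ c < (toLex (Sum.inr j) : Fin m ⊕ₗ Fin (n + 1)), N (toLex (Sum.inl l)) c = 0 := by
    intro l j h
    refine hA0 l (funext fun i => ?_)
    have := h (toLex (Sum.inl i)) (Sum.Lex.inl_lt_inr _ _)
    rw [hNA] at this
    exact_mod_cast this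
  have hleadA : ∀ l c, N.IsLeadingEntry (toLex (Sum.inl l)) c →
      ∃ i, c = toLex (Sum.inl i) ∧ A.IsLeadingEntry l i := by
    intro l c hc
    induction c using Lex.rec with
    | h c =>
      rcases c with c | c
      · refine ⟨c, rfl, fun i hi => ?_, ?_⟩
        · have := hc.1 (toLex (Sum.inl i)) (Sum.Lex.inl_lt_inl_iff.2 hi)
          rw [hNA] at this
          exact_mod_cast this
        · have := hc.2
          rw [hNA] at this
          exact_mod_cast this
      · exact absurd hc.1 (hupper l c)
  have hleadC : ∀ l c, N.IsLeadingEntry (toLex (Sum.inr l)) c → c = toLex (Sum.inr l.castSucc) := by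
    intro l c hc
    refine hc.unique ⟨fun j hj => ?_, ?_⟩
    · induction j using Lex.rec with
      | h j =>
        rcases j with j | j
        · rw [hN0]
        · rw [hNC, (isLeadingEntry_residueBlock q l).1 j (Sum.Lex.inr_lt_inr_iff.1 hj)]; simp
    · rw [hNC, residueBlock_castSucc]; simp
  refine ⟨fun a a' haa c hc => ?_, fun a c hc => ?_, fun a a' c haa hc => ?_⟩
  · induction a using Lex.rec with | h a =>
    induction a' using Lex.rec with | h a' =>
    induction c using Lex.rec with | h c =>
    rcases a with a | a <;> rcases a' with a' | a' <;> rcases c with c | c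
    · rw [hNA]
      have := hA.isRowEchelon (Sum.Lex.inl_lt_inl_iff.1 haa) (j₂ := c) fun j hj => by
        have := hc (toLex (Sum.inl j)) (Sum.Lex.inl_lt_inl_iff.2 hj)
        rw [hNA] at this
        exact_mod_cast this
      rw [this]; simp
    · exact absurd hc (hupper a c)
    · exact hN0 _ _
    · exact absurd hc (hupper a c)
    · exact absurd haa Sum.Lex.not_inr_lt_inl
    · exact absurd haa Sum.Lex.not_inr_lt_inl
    · exact hN0 _ _
    · rw [hNC]
      have := hC.isRowEchelon (Sum.Lex.inr_lt_inr_iff.1 haa) (j₂ := c) fun j hj => by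
        have := hc (toLex (Sum.inr j)) (Sum.Lex.inr_lt_inr_iff.2 hj)
        rw [hNC] at this
        exact_mod_cast this
      rw [this]; simp
  · induction a using Lex.rec with | h a =>
    rcases a with a | a
    · obtain ⟨i, rfl, hi⟩ := hleadA a c hc
      rw [hNA, hA.eq_one hi]; simp
    · rw [hleadC a c hc, hNC, residueBlock_castSucc]; simp
  · induction a using Lex.rec with | h a =>
    induction a' using Lex.rec with | h a' =>
    rcases a' with a' | a'
    · obtain ⟨i, rfl, hi⟩ := hleadA a' c hc
      rcases a with a | a
      · rw [hNA, hA.eq_zero (Sum.Lex.inl_lt_inl_iff.1 haa) hi]; simp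
      · exact hN0 _ _
    · rw [hleadC a' c hc]
      rcases a with a | a
      · rw [hNB, if_neg (Fin.castSucc_lt_last a').ne]
      · rw [hNC, residueBlock_castSucc, if_neg (Sum.Lex.inr_lt_inr_iff.1 haa).ne']; simp

lemma sum_mul_pivot {p : Fin k → Fin m} (hp : ∀ l l', A l (p l') = if l = l' then 1 else 0)
    (β : Fin k → ℂ) (l : Fin k) :
    ∑ i, (A l i : ℂ) * (∑ l', if p l' = i then β l' else 0) = β l := by
  simp_rw [Finset.mul_sum]
  rw [Finset.sum_comm, Finset.sum_eq_single l]
  · simp [hp]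
  · intro l' _ hl'
    simp [hp, hl'.symm]
  · simp

lemma mulVec_periodMatrix_surjective {p : Fin k → Fin m}
    (hp : ∀ l l', A l (p l') = if l = l' then 1 else 0) :
    Function.Surjective (periodMatrix A B q).mulVecLin := by
  intro γ
  set R : Fin (n + 1) → ℂ := Fin.snoc (fun j => γ (Sum.inr j)) 0 with hR
  set β : Fin k → ℂ := fun l => γ (Sum.inl l) - ∑ j, B l j * R j with hβ
  refine ⟨Sum.elim (fun i => ∑ l', if p l' = i then β l' else 0) R, ?_⟩
  rw [Matrix.mulVecLin_apply]
  ext (l | j)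
  · simp only [periodMatrix, Matrix.mulVec, dotProduct, Fintype.sum_sum_type,
      Matrix.fromBlocks_apply₁₁, Matrix.fromBlocks_apply₁₂, Matrix.map_apply, Sum.elim_inl,
      Sum.elim_inr, sum_mul_pivot hp β l]
    simp [hβ]
  · simp only [periodMatrix, Matrix.mulVec, dotProduct, Fintype.sum_sum_type,
      Matrix.fromBlocks_apply₂₁, Matrix.fromBlocks_apply₂₂, Matrix.map_apply, Sum.elim_inl,
      Sum.elim_inr, Matrix.zero_apply, zero_mul, Finset.sum_const_zero, zero_add]
    rw [Fin.sum_univ_castSucc, Finset.sum_eq_single j]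
    · simp [hR, residueBlock_castSucc]
    · intro l _ hl
      simp [residueBlock_castSucc, hl]
    · simp

lemma finrank_ker_periodMatrix {p : Fin k → Fin m}
    (hp : ∀ l l', A l (p l') = if l = l' then 1 else 0) :
    Module.finrank ℂ (LinearMap.ker (periodMatrix A B q).mulVecLin) + (k + n) = m + n + 1 := by
  have h := LinearMap.finrank_range_add_finrank_ker (periodMatrix A B q).mulVecLin
  rw [LinearMap.range_eq_top.2 (mulVec_periodMatrix_surjective hp), finrank_top] at h
  simp only [Module.finrank_fintype_fun_eq_card, Fintype.card_sum, Fintype.card_fin] at h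
  omega

/-- The kernel of a matrix with entries in a subfield `K` is spanned by vectors with entries
in `K`. -/
lemma definedOver_ker {κ : Type*} [Fintype κ] {K : Subfield ℂ} {M : Matrix κ (PeriodIdx m n) ℂ}
    (hM : ∀ a i, M a i ∈ K) : DefinedOver K (LinearMap.ker M.mulVecLin) := by
  refine ⟨{w | (∀ i, w i ∈ K) ∧ M.mulVec w = 0}, fun w hw => hw.1, le_antisymm ?_ ?_⟩
  · intro v hv
    rw [LinearMap.mem_ker, Matrix.mulVecLin_apply] at hv
    -- expand the coordinates of `v` in a basis of `ℂ` over `K`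
    set b := Module.Basis.ofVectorSpace K ℂ with hb
    classical
    set F : Finset (Module.Basis.ofVectorSpaceIndex K ℂ) :=
      Finset.univ.biUnion fun i => (b.repr (v i)).support with hF
    have hexp : ∀ i, v i = ∑ α ∈ F, ((b.repr (v i) α : K) : ℂ) * b α := by
      intro i
      conv_lhs => rw [← b.linearCombination_repr (v i), Finsupp.linearCombination_apply,
        Finsupp.sum_of_support_subset _ (Finset.subset_biUnion_of_mem
          (fun i => (b.repr (v i)).support) (Finset.mem_univ i)) _ (by simp)]
      rfl
    have hveq : v = ∑ α ∈ F, b α • (fun i => ((b.repr (v i) α : K) : ℂ)) := by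
      ext i
      rw [Finset.sum_apply]
      conv_lhs => rw [hexp i]
      exact Finset.sum_congr rfl fun α _ => by simp [mul_comm]
    rw [hveq]
    refine Submodule.sum_mem _ fun α _ => Submodule.smul_mem _ _ (Submodule.subset_span
      ⟨fun i => (b.repr (v i) α).2, ?_⟩)
    ext a
    have h1 : ∑ i, (⟨M a i, hM a i⟩ : K) • v i = 0 := by
      have := congrFun hv a
      simpa [Matrix.mulVec, dotProduct, Subfield.smul_def] using this
    have h2 := congrArg (fun z => ((b.repr z α : K) : ℂ)) h1
    simp only [map_sum, map_smul, Finsupp.finsetSum_apply, Finsupp.smul_apply, map_zero,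
      Finsupp.zero_apply, smul_eq_mul] at h2
    simpa [Matrix.mulVec, dotProduct] using h2
  · rw [Submodule.span_le]
    intro w hw
    simpa using hw.2

lemma periodMatrix_mem {K : Subfield ℂ} (hB : ∀ i j, B i j ∈ K) :
    ∀ a i, periodMatrix A B q a i ∈ K := by
  rintro (a | a) (i | i)
  · exact SubfieldClass.ratCast_mem K (A a i)
  · exact hB a i
  · exact K.zero_mem
  · exact SubfieldClass.ratCast_mem K (residueBlock q a i)

end LinearAlgebra

/-! ### The loci `S_M` are Zariski closed -/

section TorusSubgroups

/-- A homomorphism to `ℤ` from a saturated subgroup of `ℤ ^ m` extends to `ℤ ^ m`. -/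
lemma exists_extension_of_saturated (L : Submodule ℤ (Fin m → ℤ))
    (hL : ∀ (N : ℤ) (c : Fin m → ℤ), N ≠ 0 → N • c ∈ L → c ∈ L) (h : L →ₗ[ℤ] ℤ) :
    ∃ N : Fin m → ℤ, ∀ c : L, h c = ∑ i, (c : Fin m → ℤ) i * N i := by
  have htf : Module.IsTorsionFree ℤ ((Fin m → ℤ) ⧸ L) := by
    refine Module.IsTorsionFree.of_smul_eq_zero fun N x hx => ?_
    obtain ⟨c, rfl⟩ := L.mkQ_surjective x
    by_cases hN : N = 0
    · exact Or.inl hN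
    · right
      rw [← map_smul, Submodule.mkQ_apply, Submodule.Quotient.mk_eq_zero] at hx
      rw [Submodule.mkQ_apply, Submodule.Quotient.mk_eq_zero]
      exact hL N c hN hx
  obtain ⟨g, hg⟩ := Module.projective_lifting_property L.mkQ LinearMap.id L.mkQ_surjective
  have hmem : ∀ c, c - g (L.mkQ c) ∈ L := by
    intro c
    rw [← Submodule.Quotient.mk_eq_zero, ← Submodule.mkQ_apply, map_sub, sub_eq_zero]
    exact (LinearMap.congr_fun hg (L.mkQ c)).symm
  let P : (Fin m → ℤ) →ₗ[ℤ] ℤ :=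
    h ∘ₗ LinearMap.codRestrict L (LinearMap.id - g ∘ₗ L.mkQ) hmem
  refine ⟨fun i => P (Pi.single i 1), fun c => ?_⟩
  have h1 : P (c : Fin m → ℤ) = h c := by
    refine congrArg h (Subtype.ext ?_)
    change (c : Fin m → ℤ) - g (L.mkQ c) = c
    rw [Submodule.mkQ_apply, (Submodule.Quotient.mk_eq_zero L).2 c.2, map_zero, sub_zero]
  rw [← h1]
  conv_lhs => rw [pi_eq_sum_univ' (c : Fin m → ℤ)]
  rw [map_sum]
  refine Finset.sum_congr rfl fun i _ => ?_
  rw [map_smul, smul_eq_mul]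

variable {k : ℕ}

/-- The integral linear forms that vanish on the kernel of `A`. -/
def annihilator (A : Matrix (Fin k) (Fin m) ℚ) : Submodule ℤ (Fin m → ℤ) where
  carrier := {c | ∀ x : Fin m → ℂ, (∀ l, ∑ i, (A l i : ℂ) * x i = 0) → ∑ i, (c i : ℂ) * x i = 0}
  add_mem' := by
    intro c d hc hd x hx
    simp only [Pi.add_apply, Int.cast_add, add_mul, Finset.sum_add_distrib, hc x hx, hd x hx,
      add_zero]
  zero_mem' := by intro x _; simp
  smul_mem' := by
    intro N c hc x hx
    simp only [Pi.smul_apply, smul_eq_mul, Int.cast_mul, mul_assoc, ← Finset.mul_sum, hc x hx,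
      mul_zero]

lemma mem_annihilator {A : Matrix (Fin k) (Fin m) ℚ} {c : Fin m → ℤ} : c ∈ annihilator A ↔
    ∀ x : Fin m → ℂ, (∀ l, ∑ i, (A l i : ℂ) * x i = 0) → ∑ i, (c i : ℂ) * x i = 0 := Iff.rfl

/-- The rows of a rational matrix are rational multiples of integral vectors. -/
lemma exists_int_multiple {κ : Type*} [Fintype κ] (r : κ → ℚ) :
    ∃ (d : ℤ) (c : κ → ℤ), d ≠ 0 ∧ ∀ i, (c i : ℚ) = d * r i := by
  classical
  refine ⟨∏ i, ((r i).den : ℤ), fun i => (∏ l ∈ Finset.univ.erase i, ((r l).den : ℤ)) * (r i).num,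
    Finset.prod_ne_zero_iff.2 fun i _ => by simp, fun i => ?_⟩
  rw [← Finset.mul_prod_erase _ _ (Finset.mem_univ i)]
  push_cast
  conv_rhs => rw [← Rat.num_div_den (r i)]
  have : ((r i).den : ℚ) ≠ 0 := by simp
  field_simp
  simp [Rat.num_div_den]

lemma sum_eq_zero_of_annihilator {A : Matrix (Fin k) (Fin m) ℚ} {x : Fin m → ℂ}
    (h : ∀ c ∈ annihilator A, ∑ i, (c i : ℂ) * x i = 0) (l : Fin k) :
    ∑ i, (A l i : ℂ) * x i = 0 := by
  obtain ⟨d, c, hd, hc⟩ := exists_int_multiple (A l)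
  have hc' : ∀ i, (c i : ℂ) = d * (A l i : ℂ) := fun i => by exact_mod_cast hc i
  have hd' : (d : ℂ) ≠ 0 := by exact_mod_cast hd
  have h1 := h c (mem_annihilator.2 fun y hy => by
    simp only [hc', mul_assoc, ← Finset.mul_sum, hy l, mul_zero])
  simp only [hc', mul_assoc, ← Finset.mul_sum] at h1
  exact (mul_eq_zero.1 h1).resolve_left hd'

/-- A point of the torus has logarithms that satisfy `A w = A w₀` if and only if all characters that
vanish on the kernel of `A` take the same values at the point and at `exp w₀`: the image of an affine
subspace with rational direction under the exponential map is a translate of a subtorus. -/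
lemma exists_log_iff (A : Matrix (Fin k) (Fin m) ℚ) (w₀ z : Fin m → ℂ) (hz : ∀ i, z i ≠ 0) :
    (∃ w : Fin m → ℂ, (∀ i, Complex.exp (w i) = z i) ∧
      ∀ l, ∑ i, (A l i : ℂ) * w i = ∑ i, (A l i : ℂ) * w₀ i) ↔
    ∀ c : annihilator A, ∏ i, z i ^ (c : Fin m → ℤ) i =
      Complex.exp (∑ i, ((c : Fin m → ℤ) i : ℂ) * w₀ i) := by
  have hpow : ∀ (c : Fin m → ℤ) (w : Fin m → ℂ), (∀ i, Complex.exp (w i) = z i) →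
      ∏ i, z i ^ c i = Complex.exp (∑ i, (c i : ℂ) * w i) := by
    intro c w hw
    rw [Complex.exp_sum]
    exact Finset.prod_congr rfl fun i _ => by rw [Complex.exp_int_mul, hw]
  constructor
  · rintro ⟨w, hw, hA⟩ c
    rw [hpow c w hw]
    have := mem_annihilator.1 c.2 (fun i => w i - w₀ i) fun l => by
      simp only [mul_sub, Finset.sum_sub_distrib, hA l, sub_self]
    simp only [mul_sub, Finset.sum_sub_distrib, sub_eq_zero] at this
    rw [this]
  · intro h
    have hlog : ∀ i, Complex.exp (Complex.log (z i)) = z i := fun i => Complex.exp_log (hz i)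
    have h1 : ∀ c : annihilator A, ∃ N : ℤ, ∑ i, ((c : Fin m → ℤ) i : ℂ) *
        (Complex.log (z i) - w₀ i) = N * (2 * Real.pi * Complex.I) := by
      intro c
      have := h c
      rw [hpow c _ hlog, Complex.exp_eq_exp_iff_exists_int] at this
      obtain ⟨N, hN⟩ := this
      refine ⟨N, ?_⟩
      simp only [mul_sub, Finset.sum_sub_distrib, hN]
      ring
    choose f hf using h1
    have h2πI : (2 * Real.pi * Complex.I : ℂ) ≠ 0 := Complex.two_pi_I_ne_zero
    have hinj : ∀ {a b : ℤ}, (a : ℂ) * (2 * Real.pi * Complex.I) =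
        b * (2 * Real.pi * Complex.I) → a = b := fun hab => by
      exact_mod_cast mul_right_cancel₀ h2πI hab
    let F : annihilator A →ₗ[ℤ] ℤ :=
      { toFun := f
        map_add' := fun c d => hinj (by
          rw [Int.cast_add, add_mul, ← hf, ← hf, ← hf, ← Finset.sum_add_distrib]
          exact Finset.sum_congr rfl fun i _ => by
            rw [Submodule.coe_add, Pi.add_apply]; push_cast; ring)
        map_smul' := fun N c => hinj (by
          rw [RingHom.id_apply, smul_eq_mul, Int.cast_mul, mul_assoc (N : ℂ), ← hf, ← hf,
            Finset.mul_sum]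
          exact Finset.sum_congr rfl fun i _ => by
            rw [Submodule.coe_smul, Pi.smul_apply, smul_eq_mul]; push_cast; ring) }
    obtain ⟨N, hN⟩ := exists_extension_of_saturated (annihilator A) (fun N c hN hc => by
      rw [mem_annihilator] at hc ⊢
      intro x hx
      have := hc x hx
      simp only [Pi.smul_apply, smul_eq_mul, Int.cast_mul, mul_assoc, ← Finset.mul_sum] at this
      exact (mul_eq_zero.1 this).resolve_left (by exact_mod_cast hN)) F
    refine ⟨fun i => Complex.log (z i) - N i * (2 * Real.pi * Complex.I), fun i => ?_, fun l => ?_⟩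
    · rw [Complex.exp_sub, hlog, Complex.exp_int_mul_two_pi_mul_I, div_one]
    · rw [← sub_eq_zero, ← Finset.sum_sub_distrib]
      simp_rw [← mul_sub]
      refine sum_eq_zero_of_annihilator (fun c hc => ?_) l
      have h3 := hf ⟨c, hc⟩
      have h4 : f ⟨c, hc⟩ = ∑ i, c i * N i := hN ⟨c, hc⟩
      rw [h4] at h3
      push_cast at h3
      rw [Finset.sum_mul] at h3
      rw [← sub_eq_zero, ← Finset.sum_sub_distrib] at h3
      rw [← h3]
      exact Finset.sum_congr rfl fun i _ => by ring

end TorusSubgroups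

section Weights

/-- `a` is a primitive integral vector such that the equations `R_j + q_j R_n = 0` say that the vector
of the residues is proportional to `a`. -/
structure IsWeight (q : Fin n → ℚ) (a : Fin (n + 1) → ℤ) : Prop where
  eq : ∀ j : Fin n, (a j.castSucc : ℚ) = -q j * a (Fin.last n)
  ne_zero : a (Fin.last n) ≠ 0
  primitive : ∃ b : Fin (n + 1) → ℤ, ∑ j, b j * a j = 1

lemma exists_isWeight (q : Fin n → ℚ) : ∃ a, IsWeight q a := by
  obtain ⟨d, c, hd, hc⟩ := exists_int_multiple q
  set f : Fin (n + 1) → ℤ := Fin.snoc (fun j => -c j) d with hf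
  obtain ⟨a, ha, hgcd⟩ := Finset.extract_gcd f (Finset.univ_nonempty (α := Fin (n + 1)))
  obtain ⟨b, hb⟩ := Finset.gcd_eq_sum_mul Finset.univ a
  set g := Finset.univ.gcd f
  have hlast : d = g * a (Fin.last n) := by
    rw [← ha _ (Finset.mem_univ _), hf, Fin.snoc_last]
  have hg : g ≠ 0 := fun h => hd (by rw [hlast, h, zero_mul])
  refine ⟨a, fun j => ?_, fun h => hd (by rw [hlast, h, mul_zero]), b, ?_⟩
  · have h1 : -c j = g * a j.castSucc := by
      rw [← ha _ (Finset.mem_univ _), hf, Fin.snoc_castSucc]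
    have h2 : (g : ℚ) * a j.castSucc = g * (-q j * a (Fin.last n)) := by
      have h3 : (d : ℚ) = g * a (Fin.last n) := by exact_mod_cast hlast
      have h4 : -(c j : ℚ) = g * a j.castSucc := by exact_mod_cast h1
      rw [← h4, hc, h3]
      ring
    exact mul_left_cancel₀ (by exact_mod_cast hg) h2
  · rw [← hgcd, hb]
    exact Finset.sum_congr rfl fun j _ => mul_comm _ _

/-- The function `∏ (x_{i+1} - y_j) ^ a_j / ∏ (x_0 - y_j) ^ a_j`. -/
def crossRatio (a : Fin (n + 1) → ℤ) (s : Coord m n) (i : Fin m) : ℂ :=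
  ∏ j, ((zeroPt s i.succ - polePt s j) / (zeroPt s 0 - polePt s j)) ^ a j

variable {q : Fin n → ℚ} {a : Fin (n + 1) → ℤ} {e : Fin (m + 1) → ℕ} {s : Coord m n}

lemma crossRatio_ne_zero (hs : s ∈ stratum m n) (i : Fin m) : crossRatio a s i ≠ 0 :=
  Finset.prod_ne_zero_iff.2 fun j _ => zpow_ne_zero _
    (div_ne_zero (zeroPt_sub_ne_zero hs _ j) (zeroPt_sub_ne_zero hs _ j))

lemma isRegular_crossRatio (a : Fin (n + 1) → ℤ) (i : Fin m) :
    IsRegular fun s : Coord m n => crossRatio a s i := by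
  have h : ∀ (l : Fin (m + 1)) (j : Fin (n + 1)),
      IsRegular fun s : Coord m n => zeroPt s l - polePt s j :=
    fun l j => (isRegular_zeroPt l).sub (isRegular_polePt j)
  exact .prod _ fun j _ => ((h _ j).div (h _ j) fun s hs => zeroPt_sub_ne_zero hs 0 j).zpow
    (fun s hs => div_ne_zero (zeroPt_sub_ne_zero hs _ j) (zeroPt_sub_ne_zero hs _ j)) _

lemma IsLogSystem.exp_sum {κ : Fin m → Fin (n + 1) → ℂ} (hκ : IsLogSystem s κ)
    (a : Fin (n + 1) → ℤ) (i : Fin m) :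
    Complex.exp (∑ j, (a j : ℂ) * κ i j) = crossRatio a s i := by
  rw [Complex.exp_sum, crossRatio]
  exact Finset.prod_congr rfl fun j _ => by rw [Complex.exp_int_mul, hκ]

lemma exists_isLogSystem (hs : s ∈ stratum m n) : ∃ κ, IsLogSystem s κ :=
  ⟨_, fun i j => Complex.exp_log (div_ne_zero (zeroPt_sub_ne_zero hs i.succ j)
    (zeroPt_sub_ne_zero hs 0 j))⟩

lemma IsWeight.res_eq (ha : IsWeight q a)
    (hq : ∀ j : Fin n, res e s j.castSucc + q j * res e s (Fin.last n) = 0) (j : Fin (n + 1)) :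
    res e s j = res e s (Fin.last n) / a (Fin.last n) * a j := by
  have h0 : (a (Fin.last n) : ℂ) ≠ 0 := by exact_mod_cast ha.ne_zero
  refine Fin.lastCases ?_ (fun j => ?_) j
  · field_simp
  · have h1 : (a j.castSucc : ℂ) = -q j * a (Fin.last n) := by exact_mod_cast ha.eq j
    rw [eq_neg_of_add_eq_zero_left (hq j), h1]
    field_simp

/-- If the residues are proportional to `a`, then `ω` is a multiple of the logarithmic differential of
`∏ (z - y_j) ^ a_j`, and its relative periods are multiples of logarithms of the numbers
`crossRatio a s i`. -/
lemma IsWeight.isPeriodVector_iff (ha : IsWeight q a) (hn : ∑ i, e i = n) (hs : s ∈ stratum m n)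
    (hq : ∀ j : Fin n, res e s j.castSucc + q j * res e s (Fin.last n) = 0)
    (v : PeriodSpace m n) :
    IsPeriodVector e s v ↔ ∃ w : Fin m → ℂ, (∀ i, Complex.exp (w i) = crossRatio a s i) ∧
      v = Sum.elim (fun i => res e s (Fin.last n) / a (Fin.last n) * w i)
        fun j => 2 * Real.pi * Complex.I * res e s j := by
  set r := res e s (Fin.last n) / a (Fin.last n) with hr
  have hsum : ∀ κ : Fin m → Fin (n + 1) → ℂ, ∀ i,
      ∑ j, res e s j * κ i j = r * ∑ j, (a j : ℂ) * κ i j := by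
    intro κ i
    rw [Finset.mul_sum]
    exact Finset.sum_congr rfl fun j _ => by rw [ha.res_eq hq j, mul_assoc]
  rw [SimplePoleStratum.isPeriodVector_iff hn hs]
  constructor
  · rintro ⟨κ, hκ, rfl⟩
    exact ⟨fun i => ∑ j, (a j : ℂ) * κ i j, hκ.exp_sum a, by simp only [hsum]⟩
  · rintro ⟨w, hw, rfl⟩
    obtain ⟨κ, hκ⟩ := exists_isLogSystem hs
    obtain ⟨b, hb⟩ := ha.primitive
    have h1 : ∀ i, ∃ N : ℤ, w i = ∑ j, (a j : ℂ) * κ i j + N * (2 * Real.pi * Complex.I) := by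
      intro i
      rw [← Complex.exp_eq_exp_iff_exists_int, hw, hκ.exp_sum a]
    choose N hN using h1
    -- `b` distributes the integers `N i` over the logarithms
    refine ⟨fun i j => κ i j + (N i * b j : ℤ) * (2 * Real.pi * Complex.I), fun i j => ?_, ?_⟩
    · rw [Complex.exp_add, Complex.exp_int_mul_two_pi_mul_I, mul_one, hκ]
    · congr 1
      ext i
      rw [hsum fun i j => κ i j + (N i * b j : ℤ) * (2 * Real.pi * Complex.I), hN]
      congr 1
      have hb' : ∑ j, (b j : ℂ) * a j = 1 := by exact_mod_cast hb
      simp only [mul_add, Finset.sum_add_distrib]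
      congr 1
      calc (N i : ℂ) * (2 * Real.pi * Complex.I)
          = (∑ j, (b j : ℂ) * a j) * (N i * (2 * Real.pi * Complex.I)) := by rw [hb', one_mul]
        _ = _ := by
          rw [Finset.sum_mul]
          exact Finset.sum_congr rfl fun j _ => by push_cast; ring

variable {k : ℕ} {A : Matrix (Fin k) (Fin m) ℚ} {B : Matrix (Fin k) (Fin (n + 1)) ℂ}

/-- The locus `S_M` in terms of the functions `crossRatio a s i`. -/
lemma IsWeight.mem_periodLocus_iff (ha : IsWeight q a) (hn : ∑ i, e i = n) :
    s ∈ periodLocus e A B q ↔ s ∈ stratum m n ∧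
      (∀ j : Fin n, res e s j.castSucc + q j * res e s (Fin.last n) = 0) ∧
      ∃ w : Fin m → ℂ, (∀ i, Complex.exp (w i) = crossRatio a s i) ∧
        ∀ l, ∑ i, (A l i : ℂ) * w i = -∑ j, B l j * (2 * Real.pi * Complex.I * a j) := by
  have hI : (2 * Real.pi * Complex.I : ℂ) ≠ 0 := Complex.two_pi_I_ne_zero
  have h0 : (a (Fin.last n) : ℂ) ≠ 0 := by exact_mod_cast ha.ne_zero
  have key : s ∈ stratum m n →
      (∀ j : Fin n, res e s j.castSucc + q j * res e s (Fin.last n) = 0) →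
      ∀ w : Fin m → ℂ, (∀ l, ∑ i, (A l i : ℂ) * (res e s (Fin.last n) / a (Fin.last n) * w i) +
          ∑ j, B l j * (2 * Real.pi * Complex.I * res e s j) = 0) ↔
        ∀ l, ∑ i, (A l i : ℂ) * w i = -∑ j, B l j * (2 * Real.pi * Complex.I * a j) := by
    intro hs hq w
    refine forall_congr' fun l => ?_
    have hr : res e s (Fin.last n) / a (Fin.last n) ≠ 0 := div_ne_zero (res_ne_zero e hs _) h0
    have h1 : ∑ i, (A l i : ℂ) * (res e s (Fin.last n) / a (Fin.last n) * w i) +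
          ∑ j, B l j * (2 * Real.pi * Complex.I * res e s j) =
        res e s (Fin.last n) / a (Fin.last n) * (∑ i, (A l i : ℂ) * w i +
          ∑ j, B l j * (2 * Real.pi * Complex.I * a j)) := by
      rw [mul_add, Finset.mul_sum, Finset.mul_sum]
      congr 1
      · exact Finset.sum_congr rfl fun i _ => by ring
      · exact Finset.sum_congr rfl fun j _ => by rw [ha.res_eq hq j]; ring
    rw [h1, mul_eq_zero, or_iff_right hr, eq_neg_iff_add_eq_zero]
  constructor
  · rintro ⟨hs, v, hv, hM⟩
    obtain ⟨h1, h2⟩ := (mulVec_periodMatrix_eq_zero_iff v).1 hM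
    have hq : ∀ j : Fin n, res e s j.castSucc + q j * res e s (Fin.last n) = 0 := by
      intro j
      have := h2 j
      rw [hv.2, hv.2] at this
      refine (mul_eq_zero.1 ?_).resolve_left hI
      rw [← this]
      ring
    obtain ⟨w, hw, rfl⟩ := (ha.isPeriodVector_iff hn hs hq v).1 hv
    exact ⟨hs, hq, w, hw, (key hs hq w).1 h1⟩
  · rintro ⟨hs, hq, w, hw, h1⟩
    refine ⟨hs, _, (ha.isPeriodVector_iff hn hs hq _).2 ⟨w, hw, rfl⟩,
      (mulVec_periodMatrix_eq_zero_iff _).2 ⟨(key hs hq w).2 h1, fun j => ?_⟩⟩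
    simp only [Sum.elim_inr]
    linear_combination (2 * Real.pi * Complex.I) * hq j

/-- The algebraic equations of `S_M`. -/
lemma exists_equations_periodLocus (hn : ∑ i, e i = n) {p : Fin k → Fin m}
    (hp : ∀ l l', A l (p l') = if l = l' then 1 else 0) (ha : IsWeight q a) :
    ∃ w₀ : Fin m → ℂ, ∀ s, s ∈ periodLocus e A B q ↔ s ∈ stratum m n ∧
      (∀ j : Fin n, res e s j.castSucc + q j * res e s (Fin.last n) = 0) ∧
      ∀ c : annihilator A, ∏ i, crossRatio a s i ^ (c : Fin m → ℤ) i =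
        Complex.exp (∑ i, ((c : Fin m → ℤ) i : ℂ) * w₀ i) := by
  set β : Fin k → ℂ := fun l => -∑ j, B l j * (2 * Real.pi * Complex.I * a j)
  refine ⟨fun i => ∑ l', if p l' = i then β l' else 0, fun s => ?_⟩
  rw [ha.mem_periodLocus_iff hn]
  refine and_congr_right fun hs => and_congr_right fun _ => ?_
  rw [← exists_log_iff A _ _ (crossRatio_ne_zero hs)]
  simp only [sum_mul_pivot hp β]
  rfl

theorem isSubvariety_periodLocus (hn : ∑ i, e i = n) {p : Fin k → Fin m}
    (hp : ∀ l l', A l (p l') = if l = l' then 1 else 0) :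
    IsSubvariety (periodLocus e A B q : Set (Coord m n)) := by
  obtain ⟨a, ha⟩ := exists_isWeight q
  obtain ⟨w₀, h⟩ := exists_equations_periodLocus (e := e) (B := B) hn hp ha
  have hfam := isSubvariety_of_isRegular (m := m) (n := n) (ι := Fin n ⊕ annihilator A)
    (f := Sum.elim (fun j s => res e s j.castSucc + q j * res e s (Fin.last n))
      fun c s => ∏ i, crossRatio a s i ^ (c : Fin m → ℤ) i -
        Complex.exp (∑ i, ((c : Fin m → ℤ) i : ℂ) * w₀ i)) (by
      rintro (j | c)
      · exact (isRegular_res e _).add ((isRegular_const _).mul (isRegular_res e _))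
      · refine IsRegular.sub (.prod _ fun i _ => (isRegular_crossRatio a i).zpow
          (fun s hs => crossRatio_ne_zero hs i) _) (isRegular_const _))
  convert hfam using 1
  ext s
  rw [h, Set.mem_ofPred_eq]
  refine and_congr_right fun _ => ?_
  rw [Sum.forall]
  simp only [Sum.elim_inl, Sum.elim_inr, sub_eq_zero]

end Weights

/-! ### The loci `S_M` are linear in period coordinates -/

section Linear

variable {e : Fin (m + 1) → ℕ}

lemma isBiAlgebraic_of_charts {κ : Type*} {M : Matrix κ (PeriodIdx m n) ℂ}
    {S : Set (Coord m n)} (hS : IsSubvariety S) (h : ∀ s ∈ S, ∃ U φ, IsPeriodChart e U φ ∧ s ∈ U ∧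
      ∀ u ∈ U, u ∈ S ↔ M.mulVec (φ u) = 0) : IsBiAlgebraic e S := by
  refine ⟨hS, fun s hs => ?_⟩
  obtain ⟨U, φ, hU, hsU, hiff⟩ := h s hs
  refine ⟨U, φ, hU, hsU, Ideal.span (Set.range fun a : κ =>
    ∑ i, MvPolynomial.C (M a i) * MvPolynomial.X i), fun u hu => ?_⟩
  rw [hiff u hu, MvPolynomial.zeroLocus_span]
  simp only [Set.mem_ofPred_eq, Set.forall_mem_range, map_sum, map_mul, MvPolynomial.aeval_X,
    MvPolynomial.aeval_C, funext_iff]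
  rfl

lemma isLinearVariety_of_charts {κ : Type*} [Fintype κ] {M : Matrix κ (PeriodIdx m n) ℂ}
    {S : Set (Coord m n)} (hS : IsSubvariety S) (h : ∀ s ∈ S, ∃ U φ, IsPeriodChart e U φ ∧ s ∈ U ∧
      ∀ u ∈ U, u ∈ S ↔ M.mulVec (φ u) = 0) {K : Subfield ℂ} (hM : ∀ a i, M a i ∈ K) {d : ℕ}
    (hd : Module.finrank ℂ (LinearMap.ker M.mulVecLin) = d) : IsLinearVariety e K d S := by
  refine ⟨hS, fun s hs => ?_⟩
  obtain ⟨U, φ, hU, hsU, hiff⟩ := h s hs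
  refine ⟨U, φ, hU, hsU, {LinearMap.ker M.mulVecLin}, ?_, fun u hu => ?_⟩
  · simp only [Finset.mem_singleton, forall_eq]
    exact ⟨hd, definedOver_ker hM⟩
  · simp [hiff u hu]

variable {k : ℕ} {A : Matrix (Fin k) (Fin m) ℚ} {B : Matrix (Fin k) (Fin (n + 1)) ℂ} {q : Fin n → ℚ}

/-- Locally in any period chart, `S_M` is given by the equations `M v = 0`: other choices of the paths
change the equations by elements of a discrete group, since `A` is rational. -/
theorem eventually_mem_periodLocus_iff (hn : ∑ i, e i = n) {U : Set (Coord m n)}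
    {φ : Coord m n → PeriodSpace m n} (hU : IsPeriodChart e U φ) {s : Coord m n} (hs : s ∈ U)
    (h0 : (periodMatrix A B q).mulVec (φ s) = 0) :
    ∀ᶠ u in 𝓝 s, u ∈ periodLocus e A B q ↔ (periodMatrix A B q).mulVec (φ u) = 0 := by
  obtain ⟨a, ha⟩ := exists_isWeight q
  choose d c hd hc using fun l => exists_int_multiple (A l)
  have hpi : (2 * Real.pi * Complex.I : ℂ) ≠ 0 := Complex.two_pi_I_ne_zero
  have han : (a (Fin.last n) : ℂ) ≠ 0 := by exact_mod_cast ha.ne_zero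
  have hUs : U ∈ 𝓝 s := hU.isOpen.mem_nhds hs
  set r : Coord m n → ℂ := fun u => res e u (Fin.last n) / a (Fin.last n) with hr
  have hr0 : ∀ u ∈ U, r u ≠ 0 := fun u hu =>
    div_ne_zero (res_ne_zero e (hU.subset_stratum hu) _) han
  set g : Fin k → Coord m n → ℂ := fun l u => (d l : ℂ) / (2 * Real.pi * Complex.I) *
    ((∑ i, (A l i : ℂ) * φ u (Sum.inl i) + ∑ j, B l j * φ u (Sum.inr j)) / r u) with hg
  have hgs : ∀ l, g l s = 0 := by
    intro l
    simp only [hg, ((mulVec_periodMatrix_eq_zero_iff _).1 h0).1 l, zero_div, mul_zero]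
  have hgc : ∀ l, ContinuousAt (g l) s := by
    intro l
    have hφ : ∀ i, ContinuousAt (fun u => φ u i) s := fun i =>
      continuousAt_pi.1 (hU.holomorphic.continuousOn.continuousAt hUs) i
    have hrc : ContinuousAt r s :=
      ((isRegular_res e _).analyticAt (hU.subset_stratum hs)).continuousAt.div_const _
    refine continuousAt_const.mul (ContinuousAt.div ?_ hrc (hr0 s hs))
    exact (tendsto_finsetSum _ fun i _ => (hφ _).const_mul _).add
      (tendsto_finsetSum _ fun i _ => (hφ _).const_mul _)
  have hsmall : ∀ᶠ u in 𝓝 s, ∀ l, ‖g l u‖ < 1 := by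
    rw [Filter.eventually_all]
    intro l
    exact (hgc l).norm.eventually_lt_const (by simp [hgs])
  filter_upwards [hsmall, hUs] with u hu huU
  refine ⟨fun hmem => ?_, fun h => ⟨hU.subset_stratum huU, φ u, hU.isPeriodVector u huU, h⟩⟩
  obtain ⟨hust, hq, w, hw, hA⟩ := (ha.mem_periodLocus_iff hn).1 hmem
  obtain ⟨w', hw', hφu⟩ := (ha.isPeriodVector_iff hn hust hq _).1 (hU.isPeriodVector u huU)
  have hdiff : ∀ i, ∃ N : ℤ, w' i = w i + N * (2 * Real.pi * Complex.I) := fun i =>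
    Complex.exp_eq_exp_iff_exists_int.1 ((hw' i).trans (hw i).symm)
  choose N hN using hdiff
  have hru := hr0 u huU
  have hgint : ∀ l, g l u = (∑ i, c l i * N i : ℤ) := by
    intro l
    have h1 : ∑ i, (A l i : ℂ) * φ u (Sum.inl i) + ∑ j, B l j * φ u (Sum.inr j) =
        r u * ∑ i, (A l i : ℂ) * (N i * (2 * Real.pi * Complex.I)) := by
      have h2 : ∑ i, (A l i : ℂ) * φ u (Sum.inl i) = r u * ∑ i, (A l i : ℂ) * w i +
          r u * ∑ i, (A l i : ℂ) * (N i * (2 * Real.pi * Complex.I)) := by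
        rw [← mul_add, ← Finset.sum_add_distrib, Finset.mul_sum]
        refine Finset.sum_congr rfl fun i _ => ?_
        rw [hφu, Sum.elim_inl, hN]
        ring
      have h3 : ∑ j, B l j * φ u (Sum.inr j) =
          r u * ∑ j, B l j * (2 * Real.pi * Complex.I * a j) := by
        rw [Finset.mul_sum]
        refine Finset.sum_congr rfl fun j _ => ?_
        rw [hφu, Sum.elim_inr, ha.res_eq hq j]
        ring
      rw [h2, h3, hA l]
      ring
    have hcc : ∀ i, (c l i : ℂ) = d l * (A l i : ℂ) := fun i => by exact_mod_cast hc l i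
    simp only [hg]
    rw [h1, mul_div_cancel_left₀ _ hru, Finset.mul_sum]
    push_cast
    refine Finset.sum_congr rfl fun i _ => ?_
    rw [hcc]
    field_simp
  refine (mulVec_periodMatrix_eq_zero_iff _).2 ⟨fun l => ?_, fun j => ?_⟩
  · have h1 : (∑ i, c l i * N i : ℤ) = 0 := by
      have := hu l
      rw [hgint l, Complex.norm_intCast] at this
      exact Int.abs_lt_one_iff.1 (by exact_mod_cast this)
    have h2 := hgint l
    rw [h1, Int.cast_zero] at h2
    simp only [hg] at h2
    have hdl : (d l : ℂ) ≠ 0 := by exact_mod_cast hd l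
    rcases mul_eq_zero.1 h2 with h3 | h3
    · exact absurd h3 (div_ne_zero hdl hpi)
    · exact (div_eq_zero_iff.1 h3).resolve_right hru
  · rw [hφu]
    simp only [Sum.elim_inr]
    linear_combination (2 * Real.pi * Complex.I) * hq j

/-- Around each of its points, `S_M` is the preimage of the kernel of `M` under a period chart. -/
theorem exists_isLocalChart_periodLocus (he : ∀ i, 1 ≤ e i) (hn : ∑ i, e i = n) {s : Coord m n}
    (hs : s ∈ periodLocus e A B q) {V : Set (Coord m n)} (hV : V ∈ 𝓝 s) :
    ∃ v κ U ψ ε, IsLocalChart e s v κ U ψ ε ∧ U ⊆ V ∧ (periodMatrix A B q).mulVec v = 0 ∧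
      ∀ u ∈ U, u ∈ periodLocus e A B q ↔ (periodMatrix A B q).mulVec (periodMap e s κ u) = 0 := by
  obtain ⟨hst, v, hv, hM⟩ := hs
  obtain ⟨κ, hκ, hself⟩ := exists_periodMap_self_eq hn hst hv
  obtain ⟨U₁, ψ₁, ε₁, h₁, -⟩ := exists_isLocalChart he hn hst hκ hself Filter.univ_mem
  have hev := eventually_mem_periodLocus_iff (A := A) (B := B) (q := q) hn h₁.isPeriodChart h₁.mem
    (by rw [hself]; exact hM)
  obtain ⟨U, ψ, ε, h, hUV⟩ := exists_isLocalChart he hn hst hκ hself (Filter.inter_mem hV hev)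
  exact ⟨v, κ, U, ψ, ε, h, fun u hu => (hUV hu).1, hM, fun u hu => (hUV hu).2⟩

theorem exists_isPeriodChart_periodLocus (he : ∀ i, 1 ≤ e i) (hn : ∑ i, e i = n) :
    ∀ s ∈ periodLocus e A B q, ∃ U φ, IsPeriodChart e U φ ∧ s ∈ U ∧
      ∀ u ∈ U, u ∈ periodLocus e A B q ↔ (periodMatrix A B q).mulVec (φ u) = 0 := by
  intro s hs
  obtain ⟨v, κ, U, ψ, ε, h, -, -, hiff⟩ := exists_isLocalChart_periodLocus he hn hs Filter.univ_mem
  exact ⟨U, _, h.isPeriodChart, h.mem, hiff⟩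

lemma one_le_of_sum_eq (he : ∀ i, 1 ≤ e i) (hn : ∑ i, e i = n) : 1 ≤ n := by
  rw [← hn]
  exact (he 0).trans (Finset.single_le_sum (f := e) (fun i _ => Nat.zero_le _) (Finset.mem_univ 0))

end Linear

/-! ### Irreducible components of the loci `S_M` -/

section Tangent

open MvPolynomial

lemma hasDerivAt_eval_smul {σ : Type*} [Fintype σ] (p : MvPolynomial σ ℂ) (v : σ → ℂ) :
    HasDerivAt (fun t : ℂ => eval (t • v) p) (linearPart p v) 0 := by
  classical
  induction p using MvPolynomial.induction_on with
  | C a => simpa [linearPart_apply, coeff_C, Finsupp.single_eq_zero, eq_comm] using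
      hasDerivAt_const (0 : ℂ) a
  | add p q hp hq => simpa using hp.fun_add hq
  | mul_X p i hp =>
    have h1 : HasDerivAt (fun t : ℂ => t * v i) (v i) 0 := by
      simpa using (hasDerivAt_id (0 : ℂ)).mul_const (v i)
    have h2 := hp.fun_mul h1
    simp only [zero_smul, zero_mul, mul_zero, zero_add] at h2
    simp only [map_mul, eval_X, Pi.smul_apply, smul_eq_mul]
    refine h2.congr_deriv ?_
    rw [linearPart_apply, Finset.sum_eq_single i]
    · simp [coeff_mul_X', constantCoeff_eq]
    · intro l _ hl
      rw [coeff_mul_X', if_neg, zero_mul]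
      rw [Finsupp.mem_support_iff, Finsupp.single_apply, if_neg hl]
      simp
    · simp

/-- The polynomial `p (x + s)`. -/
def translate {σ : Type*} (s : σ → ℂ) : MvPolynomial σ ℂ →ₐ[ℂ] MvPolynomial σ ℂ :=
  aeval fun i => X i + C (s i)

lemma eval_translate {σ : Type*} (s x : σ → ℂ) (p : MvPolynomial σ ℂ) :
    eval x (translate s p) = eval (x + s) p := by
  induction p using MvPolynomial.induction_on with
  | C a => simp [translate]
  | add p q hp hq => rw [map_add, map_add, map_add, hp, hq]
  | mul_X p i hp =>
    rw [map_mul, map_mul, map_mul, hp]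
    simp [translate]

/-- `v` is a tangent vector at `s` of the set `S`: it is annihilated by the differentials at `s` of all
polynomials that vanish on `S`. -/
def IsTangent (S : Set (Coord m n)) (s v : Coord m n) : Prop :=
  ∀ p ∈ vanishingIdeal ℂ S, HasDerivAt (fun t : ℂ => eval (s + t • v) p) 0 0

lemma IsTangent.hasDerivAt {S : Set (Coord m n)} (hS : S ⊆ stratum m n) {s v : Coord m n}
    (hs : s ∈ S) (hv : IsTangent S s v) {f : Coord m n → ℂ} (hf : IsRegular f)
    (hfS : ∀ u ∈ S, f u = 0) : HasDerivAt (fun t : ℂ => f (s + t • v)) 0 0 := by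
  obtain ⟨P, Q, h⟩ := hf
  have hP : P ∈ vanishingIdeal ℂ S := by
    rw [mem_vanishingIdeal_iff_eval]
    intro u hu
    have := hfS u hu
    rw [(h u (hS hu)).2] at this
    exact (div_eq_zero_iff.1 this).resolve_right (h u (hS hu)).1
  have h1 := hv P hP
  have h2 := hasDerivAt_comp_line (AnalyticOnNhd.eval_mvPolynomial Q s (Set.mem_univ s)) v
  have h3 := h1.fun_div h2 (by simpa using (h s (hS hs)).1)
  simp only [zero_smul, add_zero, mem_vanishingIdeal_iff_eval.1 hP s hs, zero_mul, sub_zero,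
    zero_div] at h3
  refine h3.congr_of_eventuallyEq ?_
  have hc : Filter.Tendsto (fun t : ℂ => s + t • v) (𝓝 0) (𝓝 s) := by
    simpa using (hasDerivAt_line s v).continuousAt.tendsto
  filter_upwards [hc (isOpen_stratum.mem_nhds (hS hs))] with t ht
  exact (h _ ht).2

end Tangent

section Components

variable {e : Fin (m + 1) → ℕ} {k : ℕ} {A : Matrix (Fin k) (Fin m) ℚ}
  {B : Matrix (Fin k) (Fin (n + 1)) ℂ} {q : Fin n → ℚ}

lemma IsWeight.eq_of_proportional {a : Fin (n + 1) → ℤ} (ha : IsWeight q a) {x : Fin (n + 1) → ℂ}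
    (hx : ∀ j : Fin n, x j.castSucc + q j * x (Fin.last n) = 0) (j : Fin (n + 1)) :
    x j = x (Fin.last n) / a (Fin.last n) * a j := by
  have h0 : (a (Fin.last n) : ℂ) ≠ 0 := by exact_mod_cast ha.ne_zero
  refine Fin.lastCases ?_ (fun j => ?_) j
  · field_simp
  · have h1 : (a j.castSucc : ℂ) = -q j * a (Fin.last n) := by exact_mod_cast ha.eq j
    rw [eq_neg_of_add_eq_zero_left (hx j), h1]
    field_simp

/-- The tangent space of `S_M` is mapped to the kernel of `M` by the differential of a period chart:
the algebraic equations of `S_M` have linearly independent differentials, up to the expected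
relations. -/
lemma IsTangent.mulVec_fderiv_eq_zero (hn : ∑ i, e i = n) {p : Fin k → Fin m}
    (hp : ∀ l l', A l (p l') = if l = l' then 1 else 0) {s v : Coord m n}
    (hs : s ∈ periodLocus e A B q) (hv : IsTangent (periodLocus e A B q) s v)
    {κ : Fin m → Fin (n + 1) → ℂ} (hκ : IsLogSystem s κ)
    (hM : (periodMatrix A B q).mulVec (periodMap e s κ s) = 0) :
    (periodMatrix A B q).mulVec (fderiv ℂ (periodMap e s κ) s v) = 0 := by
  obtain ⟨a, ha⟩ := exists_isWeight q
  obtain ⟨w₀, hw₀⟩ := exists_equations_periodLocus (e := e) (B := B) hn hp ha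
  have hsub : periodLocus e A B q ⊆ stratum m n := fun u hu => hu.1
  have hst := hsub hs
  have hpi : (2 * Real.pi * Complex.I : ℂ) ≠ 0 := Complex.two_pi_I_ne_zero
  have hres : ∀ j, HasDerivAt (fun t : ℂ => res e (s + t • v) j)
      (fderiv ℂ (fun u => res e u j) s v) 0 := fun j =>
    hasDerivAt_comp_line ((isRegular_res e j).analyticAt hst) v
  set R' : Fin (n + 1) → ℂ := fun j => fderiv ℂ (fun u => res e u j) s v with hR'
  have hR'q : ∀ j : Fin n, R' j.castSucc + q j * R' (Fin.last n) = 0 := by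
    intro j
    have h1 := hv.hasDerivAt hsub hs (f := fun s => res e s j.castSucc + q j * res e s (Fin.last n))
      ((isRegular_res e _).add ((isRegular_const _).mul (isRegular_res e _)))
      fun u hu => ((hw₀ u).1 hu).2.1 j
    exact ((hres _).fun_add ((hres _).const_mul _)).unique h1
  have hRq := ((hw₀ s).1 hs).2.1
  set F' : Fin m → ℂ := fun i => ∑ j, (a j : ℂ) * dirLog s v i j with hF'
  have hF'0 : ∀ c ∈ annihilator A, ∑ i, (c i : ℂ) * F' i = 0 := by
    intro c hc
    have h1 := hv.hasDerivAt hsub hs (f := fun s => ∏ i, crossRatio a s i ^ c i -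
        Complex.exp (∑ i, (c i : ℂ) * w₀ i)) (IsRegular.sub (.prod _ fun i _ =>
          (isRegular_crossRatio a i).zpow (fun s hs => crossRatio_ne_zero hs i) _)
            (isRegular_const _)) fun u hu => by
        rw [((hw₀ u).1 hu).2.2 ⟨c, hc⟩, sub_self]
    have h2 : HasDerivAt (fun t : ℂ => Complex.exp (∑ i, (c i : ℂ) * ∑ j, (a j : ℂ) *
        logBranch s κ (s + t • v) i j) - Complex.exp (∑ i, (c i : ℂ) * w₀ i))
        (Complex.exp (∑ i, (c i : ℂ) * ∑ j, (a j : ℂ) * κ i j) * ∑ i, (c i : ℂ) * F' i) 0 := by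
      have h3 : HasDerivAt (fun t : ℂ => ∑ i, (c i : ℂ) * ∑ j, (a j : ℂ) *
          logBranch s κ (s + t • v) i j) (∑ i, (c i : ℂ) * F' i) 0 :=
        HasDerivAt.fun_sum fun i _ => HasDerivAt.const_mul _ (HasDerivAt.fun_sum fun j _ =>
          (hasDerivAt_logBranch hst v i j).const_mul _)
      have h4 := h3.cexp.sub_const (Complex.exp (∑ i, (c i : ℂ) * w₀ i))
      simpa [logBranch_self] using h4
    have h5 : (fun t : ℂ => Complex.exp (∑ i, (c i : ℂ) * ∑ j, (a j : ℂ) *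
        logBranch s κ (s + t • v) i j) - Complex.exp (∑ i, (c i : ℂ) * w₀ i)) =ᶠ[𝓝 0]
        fun t : ℂ => ∏ i, crossRatio a (s + t • v) i ^ c i -
          Complex.exp (∑ i, (c i : ℂ) * w₀ i) := by
      have hc : Filter.Tendsto (fun t : ℂ => s + t • v) (𝓝 0) (𝓝 s) := by
        simpa using (hasDerivAt_line s v).continuousAt.tendsto
      filter_upwards [hc (isOpen_stratum.mem_nhds hst)] with t ht
      rw [Complex.exp_sum]
      congr 1
      refine Finset.prod_congr rfl fun i _ => ?_
      rw [Complex.exp_int_mul, (hκ.logBranch hst ht).exp_sum a i]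
    have h6 := h2.unique (h1.congr_of_eventuallyEq h5)
    exact (mul_eq_zero.1 h6).resolve_left (Complex.exp_ne_zero _)
  have hAF := sum_eq_zero_of_annihilator hF'0
  set r := res e s (Fin.last n) / a (Fin.last n) with hr
  set r' := R' (Fin.last n) / a (Fin.last n) with hr'
  have hr0 : r ≠ 0 := div_ne_zero (res_ne_zero e hst _) (by exact_mod_cast ha.ne_zero)
  set W : Fin m → ℂ := fun i => ∑ j, (a j : ℂ) * κ i j with hW
  obtain ⟨hM1, -⟩ := (mulVec_periodMatrix_eq_zero_iff _).1 hM
  have hWA : ∀ l, ∑ i, (A l i : ℂ) * W i + ∑ j, B l j * (2 * Real.pi * Complex.I * a j) = 0 := by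
    intro l
    refine (mul_eq_zero.1 ?_).resolve_left hr0
    rw [← hM1 l, mul_add, Finset.mul_sum, Finset.mul_sum]
    congr 1
    · refine Finset.sum_congr rfl fun i _ => ?_
      simp only [periodMap, Sum.elim_inl, logBranch_self, hW, Finset.mul_sum]
      exact Finset.sum_congr rfl fun j _ => by rw [ha.res_eq hRq j]; ring
    · refine Finset.sum_congr rfl fun j _ => ?_
      simp only [periodMap, Sum.elim_inr]
      rw [ha.res_eq hRq j]
      ring
  refine (mulVec_periodMatrix_eq_zero_iff _).2 ⟨fun l => ?_, fun j => ?_⟩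
  · have h1 : ∀ i, fderiv ℂ (periodMap e s κ) s v (Sum.inl i) = r' * W i + r * F' i := by
      intro i
      rw [fderiv_periodMap_inl hst, hW, hF', Finset.mul_sum, Finset.mul_sum,
        ← Finset.sum_add_distrib]
      refine Finset.sum_congr rfl fun j _ => ?_
      have := ha.eq_of_proportional hR'q j
      simp only [hR'] at this
      rw [this, ha.res_eq hRq j]
      ring
    have h2 : ∀ j, fderiv ℂ (periodMap e s κ) s v (Sum.inr j) =
        r' * (2 * Real.pi * Complex.I * a j) := by
      intro j
      rw [fderiv_periodMap_inr hst]
      have := ha.eq_of_proportional hR'q j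
      simp only [hR'] at this
      rw [this]
      ring
    have h3 : ∑ i, (A l i : ℂ) * (r' * W i + r * F' i) +
        ∑ j, B l j * (r' * (2 * Real.pi * Complex.I * a j)) =
        r' * (∑ i, (A l i : ℂ) * W i + ∑ j, B l j * (2 * Real.pi * Complex.I * a j)) +
          r * ∑ i, (A l i : ℂ) * F' i := by
      simp only [mul_add, Finset.mul_sum, Finset.sum_add_distrib]
      have h4 : ∑ i, (A l i : ℂ) * (r' * W i) = ∑ i, r' * ((A l i : ℂ) * W i) :=
        Finset.sum_congr rfl fun i _ => by ring
      have h5 : ∑ i, (A l i : ℂ) * (r * F' i) = ∑ i, r * ((A l i : ℂ) * F' i) :=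
        Finset.sum_congr rfl fun i _ => by ring
      have h6 : ∑ j, B l j * (r' * (2 * Real.pi * Complex.I * a j)) =
          ∑ j, r' * (B l j * (2 * Real.pi * Complex.I * a j)) :=
        Finset.sum_congr rfl fun i _ => by ring
      rw [h4, h5, h6]
      ring
    simp only [h1, h2]
    rw [h3, hWA l, hAF l, mul_zero, mul_zero, add_zero]
  · rw [fderiv_periodMap_inr hst, fderiv_periodMap_inr hst]
    linear_combination (2 * Real.pi * Complex.I) * hR'q j

open MvPolynomial

/-- A polynomial that vanishes on a neighbourhood of a point of `S_M` vanishes on `S_M` in a Zariski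
neighbourhood of the point. -/
theorem exists_mul_mem_vanishingIdeal (he : ∀ i, 1 ≤ e i) (hn : ∑ i, e i = n) {p : Fin k → Fin m}
    (hp : ∀ l l', A l (p l') = if l = l' then 1 else 0) {s : Coord m n}
    (hs : s ∈ periodLocus e A B q) {f : MvPolynomial (CoordIdx m n) ℂ}
    (hf : ∀ᶠ u in 𝓝 s, u ∈ periodLocus e A B q → eval u f = 0) :
    ∃ g, eval s g ≠ 0 ∧ g * f ∈ vanishingIdeal ℂ (periodLocus e A B q) := by
  set S : Set (Coord m n) := periodLocus e A B q with hS
  set I : Ideal (MvPolynomial (CoordIdx m n) ℂ) := vanishingIdeal ℂ {x | x + s ∈ S} with hI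
  have hback : ∀ {p}, p ∈ vanishingIdeal ℂ S → translate s p ∈ I := by
    intro p hp
    rw [hI, mem_vanishingIdeal_iff_eval]
    intro x hx
    rw [eval_translate]
    exact mem_vanishingIdeal_iff_eval.1 hp _ hx
  obtain ⟨v₀, κ, U, ψ, ε, hch, hUV, hM, hiff⟩ := exists_isLocalChart_periodLocus he hn hs hf
  obtain ⟨r, hr, hrI⟩ := exists_one_sub_mul_mem (I := I) (f := translate s f) (by
    intro v hv
    have htan : IsTangent S s v := by
      intro p hp
      have h1 := hv _ (hback hp)
      have h2 := hasDerivAt_eval_smul (translate s p) v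
      rw [h1] at h2
      simpa only [eval_translate, add_comm] using h2
    set w := fderiv ℂ (periodMap e s κ) s v with hw
    have hker : (periodMatrix A B q).mulVec w = 0 :=
      htan.mulVec_fderiv_eq_zero hn hp hs hch.isLogSystem (by rw [hch.map_self]; exact hM)
    have hψv : ψ v₀ = s := by rw [← hch.map_self, hch.left_inv s hch.mem]
    -- the arc with constant velocity in period coordinates
    have hline : HasDerivAt (fun t : ℂ => v₀ + t • w) w 0 := by
      simpa using ((hasDerivAt_id (0 : ℂ)).smul_const w).const_add v₀
    have hψd : HasFDerivAt ψ (fderiv ℂ ψ v₀) v₀ :=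
      (hch.analytic v₀ (Metric.mem_ball_self hch.pos)).differentiableAt.hasFDerivAt
    have hψw : fderiv ℂ ψ v₀ w = v := by
      have hφd : HasFDerivAt (periodMap e s κ) (fderiv ℂ (periodMap e s κ) s) s :=
        (analyticAt_periodMap hs.1).differentiableAt.hasFDerivAt
      have h1 : HasFDerivAt (ψ ∘ periodMap e s κ)
          ((fderiv ℂ ψ v₀).comp (fderiv ℂ (periodMap e s κ) s)) s :=
        HasFDerivAt.comp s (by rw [hch.map_self]; exact hψd) hφd
      have h2 : ψ ∘ periodMap e s κ =ᶠ[𝓝 s] id := by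
        filter_upwards [hch.isPeriodChart.isOpen.mem_nhds hch.mem] with u hu
        exact hch.left_inv u hu
      have h3 := h1.unique ((hasFDerivAt_id s).congr_of_eventuallyEq h2)
      have h4 := congrArg (fun L : Coord m n →L[ℂ] Coord m n => L v) h3
      exact h4
    have hd : HasDerivAt (fun t : ℂ => ψ (v₀ + t • w)) v 0 := by
      have h1 : HasFDerivAt ψ (fderiv ℂ ψ v₀) (v₀ + (0 : ℂ) • w) := by simpa using hψd
      have h2 := h1.comp_hasDerivAt (0 : ℂ) hline
      rw [hψw] at h2
      exact h2
    have hof : Filter.Tendsto (fun t : ℝ => (t : ℂ)) (𝓝[>] 0) (𝓝[≠] 0) := by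
      refine tendsto_nhdsWithin_iff.2 ⟨?_, ?_⟩
      · exact (Complex.continuous_ofReal.tendsto' 0 0 (by simp)).mono_left nhdsWithin_le_nhds
      · filter_upwards [self_mem_nhdsWithin] with t ht
        exact Complex.ofReal_ne_zero.2 (ne_of_gt ht)
    refine ⟨fun t : ℝ => ψ (v₀ + (t : ℂ) • w) - s, ?_, ?_⟩
    · have h1 := hd.tendsto_slope_zero
      simp only [zero_add, zero_smul, add_zero, hψv] at h1
      exact h1.comp hof
    · have hball : ∀ᶠ t : ℝ in 𝓝[>] 0, v₀ + (t : ℂ) • w ∈ Metric.ball v₀ ε := by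
        have h1 : Filter.Tendsto (fun t : ℂ => v₀ + t • w) (𝓝[≠] 0) (𝓝 v₀) := by
          have := hline.continuousAt.tendsto
          simp only [zero_smul, add_zero] at this
          exact this.mono_left nhdsWithin_le_nhds
        exact (h1.comp hof).eventually (Metric.ball_mem_nhds v₀ hch.pos)
      filter_upwards [hball] with t ht
      have hmem : ψ (v₀ + (t : ℂ) • w) ∈ S := by
        refine (hiff _ (hch.inv_mem _ ht)).2 ?_
        rw [hch.right_inv _ ht, Matrix.mulVec_add, Matrix.mulVec_smul, hM, hker]
        simp
      refine ⟨fun p hp => ?_, ?_⟩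
      · rw [hI, mem_vanishingIdeal_iff_eval] at hp
        exact hp _ (by simpa using hmem)
      · rw [eval_translate, sub_add_cancel]
        exact hUV (hch.inv_mem _ ht) hmem)
  refine ⟨translate (-s) (1 - r), ?_, ?_⟩
  · rw [eval_translate, add_neg_cancel, map_sub, map_one]
    have : eval 0 r = 0 := by
      have h0 : coeff 0 r = 0 := by
        rw [← pow_one (idealOfVars _ ℂ), mem_pow_idealOfVars_iff'] at hr
        exact hr 0 (by simp)
      rw [MvPolynomial.eval_zero, constantCoeff_eq, h0]
    rw [this]
    simp
  · rw [mem_vanishingIdeal_iff_eval]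
    intro u hu
    rw [hI, mem_vanishingIdeal_iff_eval] at hrI
    have h1 := hrI (u - s) (by simpa using hu)
    rw [map_mul, eval_translate, sub_add_cancel] at h1
    rw [map_mul, eval_translate, ← sub_eq_add_neg]
    exact h1

end Components

section GermClosure

open MvPolynomial

variable {e : Fin (m + 1) → ℕ} {k : ℕ} {A : Matrix (Fin k) (Fin m) ℚ}
  {B : Matrix (Fin k) (Fin (n + 1)) ℂ} {q : Fin n → ℚ}

/-- The ideal of all polynomials that vanish on a neighbourhood of `s` in `S`. -/
def germIdeal (S : Set (Coord m n)) (s : Coord m n) : Ideal (MvPolynomial (CoordIdx m n) ℂ) where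
  carrier := {f | ∀ᶠ u in 𝓝 s, u ∈ S → eval u f = 0}
  add_mem' := by
    intro f g hf hg
    filter_upwards [hf, hg] with u h1 h2 hu
    rw [map_add, h1 hu, h2 hu, add_zero]
  zero_mem' := by simp
  smul_mem' := by
    intro c f hf
    filter_upwards [hf] with u h1 hu
    rw [smul_eq_mul, map_mul, h1 hu, mul_zero]

lemma mem_germIdeal {S : Set (Coord m n)} {s : Coord m n} {f : MvPolynomial (CoordIdx m n) ℂ} :
    f ∈ germIdeal S s ↔ ∀ᶠ u in 𝓝 s, u ∈ S → eval u f = 0 := Iff.rfl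

/-- The Zariski closure of the germ of `S` at `s`. -/
def germClosure (S : Set (Coord m n)) (s : Coord m n) : Set (Coord m n) :=
  stratum m n ∩ zeroLocus ℂ (germIdeal S s)

lemma isSubvariety_germClosure (S : Set (Coord m n)) (s : Coord m n) :
    IsSubvariety (germClosure S s) := ⟨_, rfl⟩

lemma germClosure_subset {S T : Set (Coord m n)} {s : Coord m n} (hT : IsSubvariety T)
    (h : ∀ᶠ u in 𝓝 s, u ∈ S → u ∈ T) : germClosure S s ⊆ T := by
  rintro u ⟨hu, hz⟩
  refine hT.mem_of_vanish hu fun p hp => mem_zeroLocus_iff_eval.1 hz p ?_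
  filter_upwards [h] with x hx hxS
  exact mem_vanishingIdeal_iff_eval.1 hp x (hx hxS)

lemma mem_germClosure_self {S : Set (Coord m n)} (hS : S ⊆ stratum m n) {s : Coord m n}
    (hs : s ∈ S) : s ∈ germClosure S s :=
  ⟨hS hs, mem_zeroLocus_iff_eval.2 fun _ hp => (mem_germIdeal.1 hp).self_of_nhds hs⟩

lemma eventually_mem_germClosure {S : Set (Coord m n)} (hS : S ⊆ stratum m n) (s : Coord m n) :
    ∀ᶠ u in 𝓝 s, u ∈ S → u ∈ germClosure S s := by
  obtain ⟨F, hF⟩ := IsNoetherian.noetherian (germIdeal S s)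
  have h1 : ∀ᶠ u in 𝓝 s, ∀ f ∈ F, u ∈ S → eval u f = 0 := by
    rw [Filter.eventually_all_finset]
    intro f hf
    have : f ∈ germIdeal S s := by
      rw [← hF]
      exact Ideal.subset_span hf
    exact mem_germIdeal.1 this
  filter_upwards [h1] with u hu huS
  refine ⟨hS huS, ?_⟩
  rw [← hF]
  change u ∈ zeroLocus ℂ (Ideal.span (F : Set (MvPolynomial (CoordIdx m n) ℂ)))
  rw [zeroLocus_span]
  intro f hf
  rw [aeval_eq_eval]
  exact hu f hf huS

/-- The germs of `S_M` are irreducible, since they are linear in period coordinates. -/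
lemma mem_germIdeal_of_mul_mem (he : ∀ i, 1 ≤ e i) (hn : ∑ i, e i = n) {s : Coord m n}
    (hs : s ∈ periodLocus e A B q) {f g : MvPolynomial (CoordIdx m n) ℂ}
    (h : f * g ∈ germIdeal (periodLocus e A B q) s) :
    f ∈ germIdeal (periodLocus e A B q) s ∨ g ∈ germIdeal (periodLocus e A B q) s := by
  obtain ⟨v₀, κ, U, ψ, ε, hch, hUV, hM, hiff⟩ :=
    exists_isLocalChart_periodLocus he hn hs (mem_germIdeal.1 h)
  set T := LinearMap.ker (periodMatrix A B q).mulVecLin with hT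
  set v₁ : T := ⟨v₀, hM⟩ with hv₁
  have hTS : ∀ w : T, (w : PeriodSpace m n) ∈ Metric.ball v₀ ε →
      ψ w ∈ periodLocus e A B q := fun w hw => by
    refine (hiff _ (hch.inv_mem _ hw)).2 ?_
    rw [hch.right_inv _ hw]
    exact w.2
  have han : ∀ f : MvPolynomial (CoordIdx m n) ℂ,
      AnalyticOnNhd ℂ (fun w : T => eval (ψ w) f) (Metric.ball v₁ ε) := by
    intro f w hw
    have h1 : AnalyticAt ℂ (fun x => eval x f) (ψ w) :=
      AnalyticOnNhd.eval_mvPolynomial f _ (Set.mem_univ _)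
    have h2 : AnalyticAt ℂ ψ (T.subtypeL w) := hch.analytic _ hw
    have h3 : AnalyticAt ℂ (ψ ∘ T.subtypeL) w := h2.comp (T.subtypeL.analyticAt w)
    exact AnalyticAt.comp (g := fun x => eval x f) (f := ψ ∘ T.subtypeL) h1 h3
  have hmem : ∀ f, (∀ w ∈ Metric.ball v₁ ε, eval (ψ w) f = 0) →
      f ∈ germIdeal (periodLocus e A B q) s := by
    intro f hf
    rw [mem_germIdeal]
    filter_upwards [hch.isPeriodChart.isOpen.mem_nhds hch.mem] with u hu huS
    have h1 := hf ⟨periodMap e s κ u, (hiff u hu).1 huS⟩ (hch.map_mem u hu)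
    simp only [hch.left_inv u hu] at h1
    exact h1
  by_contra hcon
  rw [not_or] at hcon
  have hex : ∃ w ∈ Metric.ball v₁ ε, eval (ψ w) f ≠ 0 := by
    by_contra hc
    push Not at hc
    exact hcon.1 (hmem f hc)
  obtain ⟨w₁, hw₁, hfw⟩ := hex
  refine hcon.2 (hmem g fun w hw => ?_)
  refine (han g).eqOn_zero_of_preconnected_of_eventuallyEq_zero
    (convex_ball v₁ ε).isPreconnected hw₁ ?_ hw
  filter_upwards [(han f w₁ hw₁).continuousAt.eventually_ne hfw,
    Metric.isOpen_ball.mem_nhds hw₁] with x hx hxb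
  have h1 := hUV (hch.inv_mem x hxb) (hTS x hxb)
  rw [map_mul] at h1
  exact (mul_eq_zero.1 h1).resolve_left hx

variable {p : Fin k → Fin m}

/-- An irreducible subset of `S_M` that contains `s` is contained in the closure of the germ of `S_M`
at `s`. -/
theorem IsIrredSubvariety.subset_germClosure (he : ∀ i, 1 ≤ e i) (hn : ∑ i, e i = n)
    (hp : ∀ l l', A l (p l') = if l = l' then 1 else 0) {D : Set (Coord m n)}
    (hD : IsIrredSubvariety D) (hDS : D ⊆ periodLocus e A B q) {s : Coord m n} (hs : s ∈ D) :
    D ⊆ germClosure (periodLocus e A B q) s := by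
  refine fun u hu => ⟨hD.1.subset_stratum hu, mem_zeroLocus_iff_eval.2 fun f hf => ?_⟩
  obtain ⟨g, hg, hgf⟩ := exists_mul_mem_vanishingIdeal he hn hp (hDS hs) (mem_germIdeal.1 hf)
  have hsub : ∀ f : MvPolynomial (CoordIdx m n) ℂ,
      IsSubvariety {s : Coord m n | s ∈ stratum m n ∧ eval s f = 0} := fun f => by
    simpa using isSubvariety_of_family (m := m) (n := n) fun _ : Unit => f
  have hcov : D ⊆ {s | s ∈ stratum m n ∧ eval s g = 0} ∪ {s | s ∈ stratum m n ∧ eval s f = 0} := by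
    intro x hx
    have h1 := mem_vanishingIdeal_iff_eval.1 hgf x (hDS hx)
    rw [map_mul] at h1
    exact (mul_eq_zero.1 h1).imp (fun h => ⟨hD.1.subset_stratum hx, h⟩)
      fun h => ⟨hD.1.subset_stratum hx, h⟩
  rcases hD.2.2 _ _ (hsub g) (hsub f) hcov with h | h
  · exact absurd (h hs).2 hg
  · exact (h hu).2

theorem isIrredSubvariety_germClosure (he : ∀ i, 1 ≤ e i) (hn : ∑ i, e i = n) {s : Coord m n}
    (hs : s ∈ periodLocus e A B q) : IsIrredSubvariety (germClosure (periodLocus e A B q) s) := by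
  have hsub : periodLocus e A B q ⊆ stratum m n := fun u hu => hu.1
  refine ⟨isSubvariety_germClosure _ _, ⟨s, mem_germClosure_self hsub hs⟩, fun X Y hX hY h => ?_⟩
  by_contra hcon
  rw [not_or] at hcon
  have key : ∀ X : Set (Coord m n), IsSubvariety X → ¬ germClosure (periodLocus e A B q) s ⊆ X →
      ∃ f ∈ vanishingIdeal ℂ X, f ∉ germIdeal (periodLocus e A B q) s := by
    intro X hX hn
    obtain ⟨u, hu, huX⟩ := Set.not_subset.1 hn
    by_contra hc
    push Not at hc
    exact huX (hX.mem_of_vanish hu.1 fun p hp => mem_zeroLocus_iff_eval.1 hu.2 p (hc p hp))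
  obtain ⟨f, hf, hf'⟩ := key X hX hcon.1
  obtain ⟨g, hg, hg'⟩ := key Y hY hcon.2
  have hfg : f * g ∈ germIdeal (periodLocus e A B q) s := by
    rw [mem_germIdeal]
    filter_upwards [eventually_mem_germClosure hsub s] with u hu huS
    rw [map_mul]
    rcases h (hu huS) with h | h
    · rw [mem_vanishingIdeal_iff_eval.1 hf u h, zero_mul]
    · rw [mem_vanishingIdeal_iff_eval.1 hg u h, mul_zero]
  exact (mem_germIdeal_of_mul_mem he hn hs hfg).elim hf' hg'

lemma germClosure_subset_periodLocus (hn : ∑ i, e i = n)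
    (hp : ∀ l l', A l (p l') = if l = l' then 1 else 0) (s : Coord m n) :
    germClosure (periodLocus e A B q) s ⊆ periodLocus e A B q :=
  germClosure_subset (isSubvariety_periodLocus hn hp) (Filter.Eventually.of_forall fun _ h => h)

theorem isIrredComponent_germClosure (he : ∀ i, 1 ≤ e i) (hn : ∑ i, e i = n)
    (hp : ∀ l l', A l (p l') = if l = l' then 1 else 0) {s : Coord m n}
    (hs : s ∈ periodLocus e A B q) :
    IsIrredComponent (germClosure (periodLocus e A B q) s) (periodLocus e A B q) := by
  refine ⟨isIrredSubvariety_germClosure he hn hs, germClosure_subset_periodLocus hn hp s,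
    fun D hD h1 h2 => Set.Subset.antisymm ?_ h1⟩
  exact hD.subset_germClosure he hn hp h2 (h1 (mem_germClosure_self (fun u hu => hu.1) hs))

/-- The irreducible components of `S_M` are disjoint, open in `S_M`, and given by the equations
`M v = 0` in suitable period charts around their points. -/
theorem exists_isLocalChart_germClosure (he : ∀ i, 1 ≤ e i) (hn : ∑ i, e i = n)
    (hp : ∀ l l', A l (p l') = if l = l' then 1 else 0) {s : Coord m n}
    (hs : s ∈ periodLocus e A B q) :
    ∀ t ∈ germClosure (periodLocus e A B q) s, ∀ V ∈ 𝓝 t, ∃ v κ U ψ ε,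
      IsLocalChart e t v κ U ψ ε ∧ U ⊆ V ∧ (periodMatrix A B q).mulVec v = 0 ∧
      ∀ u ∈ U, u ∈ germClosure (periodLocus e A B q) s ↔
        (periodMatrix A B q).mulVec (periodMap e t κ u) = 0 := by
  intro t ht V hV
  have hsub : periodLocus e A B q ⊆ stratum m n := fun u hu => hu.1
  have htS := germClosure_subset_periodLocus hn hp s ht
  have h1 : germClosure (periodLocus e A B q) s ⊆ germClosure (periodLocus e A B q) t :=
    (isIrredSubvariety_germClosure he hn hs).subset_germClosure he hn hp
      (germClosure_subset_periodLocus hn hp s) ht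
  have h2 : germClosure (periodLocus e A B q) t = germClosure (periodLocus e A B q) s :=
    (isIrredComponent_germClosure he hn hp hs).2.2 _ (isIrredSubvariety_germClosure he hn htS) h1
      (germClosure_subset_periodLocus hn hp t)
  have hev := eventually_mem_germClosure hsub t
  rw [h2] at hev
  obtain ⟨v, κ, U, ψ, ε, hch, hUV, hM, hiff⟩ :=
    exists_isLocalChart_periodLocus he hn htS (Filter.inter_mem hV hev)
  refine ⟨v, κ, U, ψ, ε, hch, fun u hu => (hUV hu).1, hM, fun u hu => ?_⟩
  rw [← hiff u hu]
  exact ⟨fun h => germClosure_subset_periodLocus hn hp s h, fun h => (hUV hu).2 h⟩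

end GermClosure

/-! ### Differentials with generic rational residues -/

section Abundance

/-- A nonempty open subset of `ℝ ^ ι` contains a rational point outside of finitely many
hyperplanes. -/
lemma exists_rat_mem_of_isOpen {ι : Type*} [Fintype ι] {V : Set (ι → ℝ)} (hV : IsOpen V)
    (hne : V.Nonempty) {T : Set ((ι → ℝ) →ₗ[ℝ] ℝ)} (hT : T.Finite) :
    ∃ x : ι → ℚ, (fun i => (x i : ℝ)) ∈ V ∧ ∀ L ∈ T, L ≠ 0 → L (fun i => (x i : ℝ)) ≠ 0 := by
  have hfin : (T \ {0}).Finite := hT.subset Set.sdiff_subset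
  have ho : ∀ L : (ι → ℝ) →ₗ[ℝ] ℝ, IsOpen {x | L x ≠ 0} := fun L =>
    isOpen_ne_fun (LinearMap.continuous_of_finiteDimensional L) continuous_const
  have hd : ∀ L ∈ T \ {0}, Dense {x | L x ≠ 0} := by
    rintro L ⟨-, hL⟩
    have h1 : {x | L x ≠ 0} = (LinearMap.ker L : Set (ι → ℝ))ᶜ := by ext x; simp
    rw [h1, ← interior_eq_empty_iff_dense_compl, ← Set.not_nonempty_iff_eq_empty]
    intro h
    exact hL (LinearMap.ker_eq_top.1 (Submodule.eq_top_of_nonempty_interior' _ h))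
  have hdense : Dense (⋂ L ∈ T \ {0}, {x | L x ≠ 0}) :=
    dense_biInter_of_isOpen (fun L _ => ho L) hfin.countable hd
  have hopen : IsOpen (V ∩ ⋂ L ∈ T \ {0}, {x | L x ≠ 0}) :=
    hV.inter (hfin.isOpen_biInter fun L _ => ho L)
  have hrat : DenseRange fun (x : ι → ℚ) (i : ι) => (x i : ℝ) :=
    DenseRange.piMap fun _ => Rat.denseRange_cast
  obtain ⟨x, hxV, hx⟩ := hrat.exists_mem_open hopen (hdense.inter_open_nonempty V hV hne)
  refine ⟨x, hxV, fun L hL hL0 => ?_⟩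
  exact Set.mem_iInter₂.1 hx L ⟨hL, hL0⟩

/-- The residues at all poles, including `∞`, when the residues at the finite poles are `R`. -/
def extendRes {𝕜 : Type*} [Field 𝕜] (R : Fin (n + 1) → 𝕜) : Option (Fin (n + 1)) → 𝕜
  | none => -∑ j, R j
  | some j => R j

/-- No two residues have a ratio `r / r'` with positive integers `r, r' ≤ n`. -/
def IsGenericRes {𝕜 : Type*} [Field 𝕜] (R : Fin (n + 1) → 𝕜) : Prop :=
  ∀ a b, a ≠ b → ∀ r r' : ℕ, 1 ≤ r → r ≤ n → 1 ≤ r' → r' ≤ n →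
    (r' : 𝕜) * extendRes R a ≠ r * extendRes R b

/-- A point of the stratum with real coordinates. -/
def realPoint (m n : ℕ) : Coord m n :=
  Sum.elim (fun _ => 1) (Sum.elim (fun i => ((-(i + 1 : ℝ) : ℝ) : ℂ))
    fun j => ((j + 2 : ℝ) : ℂ))

lemma zeroPt_realPoint (i : Fin (m + 1)) : zeroPt (realPoint m n) i = ((-(i : ℝ) : ℝ) : ℂ) := by
  refine Fin.cases ?_ (fun i => ?_) i <;> simp [realPoint]

lemma polePt_realPoint (j : Fin (n + 1)) : polePt (realPoint m n) j = ((j + 1 : ℝ) : ℂ) := by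
  refine Fin.cases ?_ (fun i => ?_) j
  · simp
  · simp [realPoint]; ring

lemma realPoint_mem_stratum : realPoint m n ∈ stratum m n := by
  refine ⟨by simp [scale, realPoint], ?_⟩
  have hp : ∀ (i : Fin (m + 1)) (j : Fin (n + 1)),
      zeroPt (realPoint m n) i ≠ polePt (realPoint m n) j := by
    intro i j h
    rw [zeroPt_realPoint, polePt_realPoint, Complex.ofReal_inj] at h
    have h1 : (0 : ℝ) ≤ (i : ℕ) := Nat.cast_nonneg _
    have h2 : (0 : ℝ) ≤ (j : ℕ) := Nat.cast_nonneg _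
    linarith
  rintro (i | i) (j | j) h
  · simp only [Sum.elim_inl, zeroPt_realPoint, Complex.ofReal_inj, neg_inj, Nat.cast_inj] at h
    rw [Fin.ext h]
  · exact absurd h (hp i j)
  · exact absurd h.symm (hp j i)
  · simp only [Sum.elim_inr, polePt_realPoint, Complex.ofReal_inj, add_left_inj, Nat.cast_inj] at h
    rw [Fin.ext h]

lemma res_realPoint (e : Fin (m + 1) → ℕ) (j : Fin (n + 1)) :
    ((res e (realPoint m n) j).re : ℂ) = res e (realPoint m n) j := by
  have : ∃ x : ℝ, res e (realPoint m n) j = x := by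
    refine ⟨(∏ i : Fin (m + 1), ((j + 1 : ℝ) - (-(i : ℝ))) ^ e i) /
      ∏ l ∈ Finset.univ.erase j, ((j + 1 : ℝ) - (l + 1)), ?_⟩
    rw [res]
    simp only [zeroPt_realPoint, polePt_realPoint]
    push_cast
    simp [scale, realPoint]
  obtain ⟨x, hx⟩ := this
  rw [hx, Complex.ofReal_re]

variable {e : Fin (m + 1) → ℕ}

/-- There are differentials with generic rational residues and generic relative periods with
rational real parts. -/
theorem exists_generic_point (he : ∀ i, 1 ≤ e i) (hn : ∑ i, e i = n) (F : Finset ℚ) :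
    ∃ (s : Coord m n) (v : PeriodSpace m n) (r : Fin (n + 1) → ℚ) (u : Fin m → ℚ),
      s ∈ stratum m n ∧ IsPeriodVector e s v ∧ (∀ j, res e s j = r j) ∧
      (∀ i, (v (Sum.inl i)).re = u i) ∧ (∀ i, u i ≠ 0) ∧ Function.Injective u ∧
      IsGenericRes r ∧ ∀ f ∈ F, r 0 ≠ f * r (Fin.last n) := by
  classical
  have hn1 : 1 ≤ n := one_le_of_sum_eq he hn
  have hs₀ := realPoint_mem_stratum (m := m) (n := n)
  obtain ⟨κ, hκ⟩ := exists_isLogSystem hs₀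
  set v₀ := periodMap e (realPoint m n) κ (realPoint m n) with hv₀
  obtain ⟨U, ψ, ε, hch, -⟩ := exists_isLocalChart he hn hs₀ hκ hv₀.symm Filter.univ_mem
  set Θ : (PeriodIdx m n → ℝ) → PeriodSpace m n := fun x =>
    Sum.elim (fun i => (x (Sum.inl i) : ℂ) + (v₀ (Sum.inl i)).im * Complex.I)
      fun j => 2 * Real.pi * Complex.I * (x (Sum.inr j) : ℂ) with hΘ
  have hΘc : Continuous Θ := by
    refine continuous_pi ?_
    rintro (i | j)
    · exact (Complex.continuous_ofReal.comp (continuous_apply _)).add continuous_const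
    · exact continuous_const.mul (Complex.continuous_ofReal.comp (continuous_apply _))
  have hV : IsOpen (Θ ⁻¹' Metric.ball v₀ ε) := Metric.isOpen_ball.preimage hΘc
  have hne : (Θ ⁻¹' Metric.ball v₀ ε).Nonempty := by
    refine ⟨Sum.elim (fun i => (v₀ (Sum.inl i)).re) fun j => (res e (realPoint m n) j).re, ?_⟩
    rw [Set.mem_preimage]
    convert Metric.mem_ball_self hch.pos using 1
    ext (i | j)
    · simp [hΘ, Complex.re_add_im]
    · simp only [hΘ, Sum.elim_inr, res_realPoint]
      rfl
  let π : PeriodIdx m n → ((PeriodIdx m n → ℝ) →ₗ[ℝ] ℝ) := fun i => LinearMap.proj i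
  let π' : Option (Fin (n + 1)) → ((PeriodIdx m n → ℝ) →ₗ[ℝ] ℝ) := fun a =>
    a.elim (-∑ j, π (Sum.inr j)) fun j => π (Sum.inr j)
  let f₁ : Fin m → ((PeriodIdx m n → ℝ) →ₗ[ℝ] ℝ) := fun i => π (Sum.inl i)
  let f₂ : Fin m × Fin m → ((PeriodIdx m n → ℝ) →ₗ[ℝ] ℝ) := fun i =>
    π (Sum.inl i.1) - π (Sum.inl i.2)
  let f₃ : (Option (Fin (n + 1)) × Option (Fin (n + 1))) × (Fin (n + 1) × Fin (n + 1)) →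
    ((PeriodIdx m n → ℝ) →ₗ[ℝ] ℝ) := fun c =>
      ((c.2.2 : ℕ) : ℝ) • π' c.1.1 - ((c.2.1 : ℕ) : ℝ) • π' c.1.2
  let f₄ : F → ((PeriodIdx m n → ℝ) →ₗ[ℝ] ℝ) := fun c =>
    π (Sum.inr 0) - ((c : ℚ) : ℝ) • π (Sum.inr (Fin.last n))
  obtain ⟨x, hxV, hx⟩ := exists_rat_mem_of_isOpen hV hne
    (T := (Set.range f₁ ∪ Set.range f₂) ∪ (Set.range f₃ ∪ Set.range f₄))
    (((Set.finite_range _).union (Set.finite_range _)).union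
      ((Set.finite_range _).union (Set.finite_range _)))
  set w := Θ fun i => (x i : ℝ) with hw
  have hψU := hch.inv_mem _ hxV
  have hper : IsPeriodVector e (ψ w) w := by
    have := hch.isPeriodChart.isPeriodVector _ hψU
    rwa [hch.right_inv _ hxV] at this
  have hne_zero : ∀ (L : (PeriodIdx m n → ℝ) →ₗ[ℝ] ℝ) (i : PeriodIdx m n),
      L (Pi.single i 1) ≠ 0 → L ≠ 0 := by
    rintro L i h rfl
    exact h rfl
  refine ⟨ψ w, w, fun j => x (Sum.inr j), fun i => x (Sum.inl i),
    hch.isPeriodChart.subset_stratum hψU, hper, fun j => ?_, fun i => ?_, fun i hi => ?_,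
    fun i i' hii => ?_, fun a b hab r r' hr hrn hr' hrn' => ?_, fun f hf h => ?_⟩
  · have h1 := hper.2 j
    have h2 : w (Sum.inr j) = 2 * Real.pi * Complex.I * (x (Sum.inr j) : ℂ) := by simp [hw, hΘ]
    rw [h2] at h1
    exact (mul_left_cancel₀ Complex.two_pi_I_ne_zero h1).symm
  · simp [hw, hΘ]
  · exact hx (f₁ i) (Or.inl (Or.inl ⟨i, rfl⟩)) (hne_zero _ (Sum.inl i) (by simp [f₁, π]))
      (by simp [f₁, π, hi])
  · by_contra hne
    exact hx (f₂ (i, i')) (Or.inl (Or.inr ⟨_, rfl⟩))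
      (hne_zero _ (Sum.inl i) (by simp [f₂, π, hne]))
      (by simp [f₂, π]; simpa [sub_eq_zero] using hii)
  · have hπ' : ∀ a, π' a (fun i => (x i : ℝ)) =
        ((extendRes (fun j => x (Sum.inr j)) a : ℚ) : ℝ) := by
      rintro (_ | j)
      · simp [π', π, extendRes]
      · simp [π', π, extendRes]
    have hr0 : (r : ℝ) ≠ 0 := by exact_mod_cast (by omega : r ≠ 0)
    have hr0' : (r' : ℝ) ≠ 0 := by exact_mod_cast (by omega : r' ≠ 0)
    intro h
    have hother : ∀ j : Fin (n + 1), ∃ l, l ≠ j := by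
      have : Nontrivial (Fin (n + 1)) := Fin.nontrivial_iff_two_le.2 (by omega)
      exact fun j => exists_ne j
    refine hx (f₃ ((a, b), (⟨r, by omega⟩, ⟨r', by omega⟩))) (Or.inr (Or.inl ⟨_, rfl⟩)) ?_ ?_
    · rcases a with _ | a <;> rcases b with _ | b
      · exact absurd rfl hab
      · obtain ⟨l, hl⟩ := hother b
        exact hne_zero _ (Sum.inr l) (by simp [f₃, π', π, hl.symm, hr0', Pi.single_apply])
      · obtain ⟨l, hl⟩ := hother a
        exact hne_zero _ (Sum.inr l) (by simp [f₃, π', π, hl.symm, hr0, Pi.single_apply])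
      · have hab' : a ≠ b := fun h => hab (by rw [h])
        exact hne_zero _ (Sum.inr a) (by simp [f₃, π', π, hab'.symm, hr0'])
    · simp only [f₃, LinearMap.sub_apply, LinearMap.smul_apply, hπ', smul_eq_mul, sub_eq_zero]
      exact_mod_cast h
  · have h0 : (0 : Fin (n + 1)) ≠ Fin.last n := by
      intro h
      have := congrArg Fin.val h
      simp at this
      omega
    refine hx (f₄ ⟨f, hf⟩) (Or.inr (Or.inr ⟨_, rfl⟩))
      (hne_zero _ (Sum.inr 0) (by simp [f₄, π, h0.symm])) ?_
    simp only [f₄, π, LinearMap.sub_apply, LinearMap.smul_apply, LinearMap.proj_apply, smul_eq_mul,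
      sub_eq_zero]
    exact_mod_cast h

/-- Loci with infinitely many values of the first ratio of residues are pairwise distinct. -/
lemma infinite_of_forall_exists {𝒮 : Set (Set (Coord m n))}
    (h : ∀ F : Finset ℚ, ∃ S ∈ 𝒮, S.Nonempty ∧ ∃ c : ℚ, c ∉ F ∧
      ∀ s ∈ S, res e s 0 / res e s (Fin.last n) = c) : 𝒮.Infinite := by
  intro hfin
  set g : Set (Coord m n) → Set ℂ := fun S =>
    (fun s => res e s 0 / res e s (Fin.last n)) '' S with hg
  have h1 : {c : ℚ | ∃ S ∈ 𝒮, S.Nonempty ∧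
      ∀ s ∈ S, res e s 0 / res e s (Fin.last n) = c}.Finite := by
    refine Set.Finite.of_finite_image (f := fun c : ℚ => ({(c : ℂ)} : Set ℂ))
      ((hfin.image g).subset ?_) ?_
    · rintro _ ⟨c, ⟨S, hS, hne, hc⟩, rfl⟩
      refine ⟨S, hS, Set.eq_singleton_iff_nonempty_unique_mem.2 ⟨hne.image _, ?_⟩⟩
      rintro _ ⟨s, hs, rfl⟩
      exact hc s hs
    · intro c _ c' _ hcc
      simpa using hcc
  obtain ⟨S, hS, hne, c, hc, hcS⟩ := h h1.toFinset
  exact hc (h1.mem_toFinset.2 ⟨S, hS, hne, hcS⟩)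

variable {k : ℕ} {A : Matrix (Fin k) (Fin m) ℚ} {B : Matrix (Fin k) (Fin (n + 1)) ℂ} {q : Fin n → ℚ}

lemma res_add_eq_zero_of_mem_periodLocus {s : Coord m n} (hs : s ∈ periodLocus e A B q)
    (j : Fin n) : res e s j.castSucc + q j * res e s (Fin.last n) = 0 := by
  obtain ⟨-, v, hv, hM⟩ := hs
  have := ((mulVec_periodMatrix_eq_zero_iff v).1 hM).2 j
  rw [hv.2, hv.2] at this
  refine (mul_eq_zero.1 ?_).resolve_left Complex.two_pi_I_ne_zero
  rw [← this]
  ring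

lemma res_div_eq_of_mem_periodLocus {s : Coord m n} (hs : s ∈ periodLocus e A B q) (h0 : 0 < n) :
    res e s 0 / res e s (Fin.last n) = ((-q ⟨0, h0⟩ : ℚ) : ℂ) := by
  have h := res_add_eq_zero_of_mem_periodLocus hs ⟨0, h0⟩
  have h0 : (Fin.castSucc ⟨0, h0⟩ : Fin (n + 1)) = 0 := rfl
  rw [h0] at h
  rw [div_eq_iff (res_ne_zero e hs.1 _)]
  push_cast
  linear_combination h

/-- A differential with rational residues belongs to loci `S_M` with arbitrary upper left block. -/
lemma mem_periodLocus_of_rat {s : Coord m n} {v : PeriodSpace m n} (hs : s ∈ stratum m n)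
    (hv : IsPeriodVector e s v) {r : Fin (n + 1) → ℚ} (hr : ∀ j, res e s j = r j) :
    s ∈ periodLocus e A (fun l j => if j = Fin.last n then
        -(∑ i, (A l i : ℂ) * v (Sum.inl i)) / (2 * Real.pi * Complex.I * r (Fin.last n)) else 0)
      (fun j => -(r j.castSucc / r (Fin.last n))) := by
  have hrn : (r (Fin.last n) : ℂ) ≠ 0 := by
    rw [← hr]
    exact res_ne_zero e hs _
  have hpi : (2 * Real.pi * Complex.I : ℂ) ≠ 0 := Complex.two_pi_I_ne_zero
  refine ⟨hs, v, hv, (mulVec_periodMatrix_eq_zero_iff v).2 ⟨fun l => ?_, fun j => ?_⟩⟩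
  · simp only [ite_mul, zero_mul, Finset.sum_ite_eq', Finset.mem_univ, if_true]
    rw [hv.2, hr, div_mul_cancel₀ _ (mul_ne_zero hpi hrn), add_neg_cancel]
  · rw [hv.2, hv.2, hr, hr]
    push_cast
    field_simp
    ring

theorem infinite_periodLocus (he : ∀ i, 1 ≤ e i) (hn : ∑ i, e i = n) (hA : A.IsReducedRowEchelon)
    (hA0 : ∀ i, A i ≠ 0) :
    {S : Set (Coord m n) | ∃ B q, IsAdmissible A B q ∧ S = periodLocus e A B q ∧
      S.Nonempty}.Infinite := by
  have hn1 := one_le_of_sum_eq he hn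
  refine infinite_of_forall_exists (e := e) fun F => ?_
  obtain ⟨s, v, r, -, hs, hv, hr, -, -, -, -, hF⟩ := exists_generic_point he hn F
  have hr0 : ∀ j, r j ≠ 0 := fun j => by
    have := res_ne_zero e hs j
    rw [hr] at this
    exact_mod_cast this
  have hmem := mem_periodLocus_of_rat (A := A) hs hv hr
  refine ⟨_, ⟨_, _, isAdmissible_of_isReducedRowEchelon hA hA0 (fun j => neg_ne_zero.2
    (div_ne_zero (hr0 _) (hr0 _))) _, rfl, ⟨s, hmem⟩⟩, ⟨s, hmem⟩, _, ?_,
    fun t ht => res_div_eq_of_mem_periodLocus ht hn1⟩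
  intro hc
  rw [neg_neg] at hc
  exact hF _ hc (div_mul_cancel₀ _ (hr0 _)).symm

end Abundance

/-! ### Ramification of rational functions -/

section Ramification

open Polynomial

/-- The embedding of the affine line into the Riemann sphere. -/
def coeEmb : ℂ ↪ OnePoint ℂ := ⟨fun z => z, OnePoint.coe_injective⟩

lemma eq_infty_or_coe (z : OnePoint ℂ) :
    z = OnePoint.infty ∨ ∃ c : ℂ, z = (c : OnePoint ℂ) := by
  induction z using OnePoint.rec with
  | infty => exact Or.inl rfl
  | coe c => exact Or.inr ⟨c, rfl⟩

/-- The value of a binary form of degree `d` at a point of the Riemann sphere; the coordinates of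
the point `∞` are `(1, 0)`. -/
def evalAt (F : ℂ[X]) (d : ℕ) : OnePoint ℂ → ℂ
  | none => F.coeff d
  | some z => F.eval z

lemma multAt_pos_iff {F : ℂ[X]} (hF : F ≠ 0) {d : ℕ} (hd : F.natDegree ≤ d) (z : OnePoint ℂ) :
    0 < multAt F d z ↔ evalAt F d z = 0 := by
  rcases eq_infty_or_coe z with rfl | ⟨z, rfl⟩
  · change 0 < d - F.natDegree ↔ F.coeff d = 0
    constructor
    · intro h
      exact coeff_eq_zero_of_natDegree_lt (by omega)
    · intro h
      by_contra hcon
      have : F.natDegree = d := by omega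
      rw [← this, coeff_natDegree, leadingCoeff_eq_zero] at h
      exact hF h
  · exact rootMultiplicity_pos hF

lemma multAt_mul {F G : ℂ[X]} (hF : F ≠ 0) (hG : G ≠ 0) {d d' : ℕ} (hd : F.natDegree ≤ d)
    (hd' : G.natDegree ≤ d') (z : OnePoint ℂ) :
    multAt (F * G) (d + d') z = multAt F d z + multAt G d' z := by
  rcases eq_infty_or_coe z with rfl | ⟨z, rfl⟩
  · change d + d' - (F * G).natDegree = d - F.natDegree + (d' - G.natDegree)
    rw [natDegree_mul hF hG]
    omega
  · exact rootMultiplicity_mul (mul_ne_zero hF hG)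

lemma multAt_pow {F : ℂ[X]} (hF : F ≠ 0) {d : ℕ} (hd : F.natDegree ≤ d) (k : ℕ) (z : OnePoint ℂ) :
    multAt (F ^ k) (k * d) z = k * multAt F d z := by
  rcases eq_infty_or_coe z with rfl | ⟨z, rfl⟩
  · change k * d - (F ^ k).natDegree = k * (d - F.natDegree)
    rw [natDegree_pow, Nat.mul_sub]
  · induction k with
    | zero => simp [multAt, ← C_1, -map_one]
    | succ k ih =>
      rw [pow_succ, Nat.succ_mul, multAt_mul (pow_ne_zero _ hF) hF (by
        rw [natDegree_pow]; exact Nat.mul_le_mul le_rfl hd) hd, ih]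
      ring

lemma sum_eq_sum_of_mem {ι M : Type*} [AddCommMonoid M] {f : ι → M} {Z Z' : Finset ι}
    (hZ : ∀ w, f w ≠ 0 → w ∈ Z) (hZ' : ∀ w, f w ≠ 0 → w ∈ Z') : ∑ w ∈ Z, f w = ∑ w ∈ Z', f w := by
  rw [← finsum_eq_sum_of_support_subset f fun w hw => hZ w hw,
    finsum_eq_sum_of_support_subset f fun w hw => hZ' w hw]

/-- The multiplicities of the zeros of a binary form add up to its degree. -/
lemma sum_multAt {F : ℂ[X]} {d : ℕ} (hd : F.natDegree ≤ d)
    (Z : Finset (OnePoint ℂ)) (hZ : ∀ z, multAt F d z ≠ 0 → z ∈ Z) :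
    ∑ z ∈ Z, multAt F d z = d := by
  classical
  have h1 : ∑ z ∈ Z, multAt F d z =
      ∑ z ∈ insert OnePoint.infty (F.roots.toFinset.map coeEmb), multAt F d z := by
    have hfib : ∀ z, multAt F d z ≠ 0 →
        z ∈ insert OnePoint.infty (F.roots.toFinset.map coeEmb) := by
      intro z hz
      rcases eq_infty_or_coe z with rfl | ⟨z, rfl⟩
      · exact Finset.mem_insert_self _ _
      · refine Finset.mem_insert_of_mem (Finset.mem_map.2 ⟨z, ?_, rfl⟩)
        rw [Multiset.mem_toFinset, ← Multiset.count_pos, count_roots]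
        exact Nat.pos_of_ne_zero hz
    exact sum_eq_sum_of_mem hZ hfib
  rw [h1, Finset.sum_insert (by simp [coeEmb]), Finset.sum_map]
  change d - F.natDegree + ∑ z ∈ F.roots.toFinset, F.rootMultiplicity z = d
  simp_rw [← count_roots]
  rw [Multiset.toFinset_sum_count_eq, IsAlgClosed.card_roots_eq_natDegree]
  omega

variable {P Q : ℂ[X]}

lemma natDegree_fiberPoly_le (w : OnePoint ℂ) :
    (fiberPoly P Q w).natDegree ≤ max P.natDegree Q.natDegree := by
  rcases eq_infty_or_coe w with rfl | ⟨c, rfl⟩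
  · exact le_max_right _ _
  · refine (natDegree_sub_le _ _).trans (max_le_max le_rfl ?_)
    exact natDegree_C_mul_le _ _

lemma evalAt_fiberPoly_coe (c : ℂ) (d : ℕ) (z : OnePoint ℂ) :
    evalAt (fiberPoly P Q (c : OnePoint ℂ)) d z = evalAt P d z - c * evalAt Q d z := by
  rcases eq_infty_or_coe z with rfl | ⟨z, rfl⟩
  · simp [evalAt, fiberPoly]
  · simp [evalAt, fiberPoly]

lemma fiberPoly_ne_zero (hPQ : IsCoprime P Q) (hd : 0 < max P.natDegree Q.natDegree)
    (w : OnePoint ℂ) : fiberPoly P Q w ≠ 0 := by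
  intro h
  rcases eq_infty_or_coe w with rfl | ⟨c, rfl⟩
  · change Q = 0 at h
    rw [h, isCoprime_zero_right] at hPQ
    simp [h, natDegree_eq_zero_of_isUnit hPQ] at hd
  · change P - C c * Q = 0 at h
    rw [sub_eq_zero] at h
    have hQ : IsUnit Q := by
      rw [h] at hPQ
      exact hPQ.isUnit_of_dvd' (dvd_mul_left _ _) dvd_rfl
    have h1 := natDegree_eq_zero_of_isUnit hQ
    have h2 : P.natDegree ≤ Q.natDegree := by rw [h]; exact natDegree_C_mul_le _ _
    omega

lemma evalAt_ne_zero_of_isCoprime (hPQ : IsCoprime P Q)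
    (hd : 0 < max P.natDegree Q.natDegree) {z : OnePoint ℂ}
    (hP : evalAt P (max P.natDegree Q.natDegree) z = 0) :
    evalAt Q (max P.natDegree Q.natDegree) z ≠ 0 := by
  intro hQ
  rcases eq_infty_or_coe z with rfl | ⟨z, rfl⟩
  · change P.coeff _ = 0 at hP
    change Q.coeff _ = 0 at hQ
    rcases le_total P.natDegree Q.natDegree with h | h
    · rw [max_eq_right h] at hQ hd
      rw [coeff_natDegree, leadingCoeff_eq_zero] at hQ
      simp [hQ] at hd
    · rw [max_eq_left h] at hP hd
      rw [coeff_natDegree, leadingCoeff_eq_zero] at hP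
      simp [hP] at hd
  · obtain ⟨a, b, hab⟩ := hPQ
    change P.eval z = 0 at hP
    change Q.eval z = 0 at hQ
    have := congrArg (eval z) hab
    simp [hP, hQ] at this

lemma ramIndex_pos_iff (hPQ : IsCoprime P Q) (hd : 0 < max P.natDegree Q.natDegree)
    (w z : OnePoint ℂ) :
    0 < ramIndex P Q w z ↔ evalAt (fiberPoly P Q w) (max P.natDegree Q.natDegree) z = 0 :=
  multAt_pos_iff (fiberPoly_ne_zero hPQ hd w) (natDegree_fiberPoly_le w) z

/-- The values of `P` and `Q` are proportional at two points with the same image. -/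
lemma evalAt_mul_eq_of_ramIndex_pos (hPQ : IsCoprime P Q)
    (hd : 0 < max P.natDegree Q.natDegree) {w z z' : OnePoint ℂ} (h : 0 < ramIndex P Q w z)
    (h' : 0 < ramIndex P Q w z') :
    evalAt P (max P.natDegree Q.natDegree) z * evalAt Q (max P.natDegree Q.natDegree) z' =
      evalAt P (max P.natDegree Q.natDegree) z' * evalAt Q (max P.natDegree Q.natDegree) z := by
  rw [ramIndex_pos_iff hPQ hd] at h h'
  rcases eq_infty_or_coe w with rfl | ⟨c, rfl⟩
  · change evalAt Q _ z = 0 at h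
    change evalAt Q _ z' = 0 at h'
    rw [h, h', mul_zero, mul_zero]
  · rw [evalAt_fiberPoly_coe, sub_eq_zero] at h h'
    rw [h, h']
    ring

lemma eq_of_ramIndex_pos (hPQ : IsCoprime P Q) (hd : 0 < max P.natDegree Q.natDegree)
    {w w' z : OnePoint ℂ} (h : 0 < ramIndex P Q w z) (h' : 0 < ramIndex P Q w' z) : w = w' := by
  rw [ramIndex_pos_iff hPQ hd] at h h'
  have key : ∀ c : ℂ, evalAt (fiberPoly P Q (c : OnePoint ℂ)) (max P.natDegree Q.natDegree) z = 0 →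
      evalAt Q (max P.natDegree Q.natDegree) z ≠ 0 := by
    intro c hc hQ
    rw [evalAt_fiberPoly_coe, hQ, mul_zero, sub_zero] at hc
    exact evalAt_ne_zero_of_isCoprime hPQ hd hc hQ
  rcases eq_infty_or_coe w with rfl | ⟨c, rfl⟩ <;> rcases eq_infty_or_coe w' with rfl | ⟨c', rfl⟩
  · rfl
  · exact absurd h (key c' h')
  · exact absurd h' (key c h)
  · have hQ := key c h
    rw [evalAt_fiberPoly_coe, sub_eq_zero] at h h'
    rw [h] at h'
    rw [mul_right_cancel₀ hQ h']

lemma exists_ramIndex_pos (hPQ : IsCoprime P Q) (hd : 0 < max P.natDegree Q.natDegree)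
    (z : OnePoint ℂ) : ∃ w, 0 < ramIndex P Q w z := by
  by_cases hQ : evalAt Q (max P.natDegree Q.natDegree) z = 0
  · exact ⟨OnePoint.infty, (ramIndex_pos_iff hPQ hd _ _).2 hQ⟩
  · refine ⟨(evalAt P (max P.natDegree Q.natDegree) z /
      evalAt Q (max P.natDegree Q.natDegree) z : ℂ), (ramIndex_pos_iff hPQ hd _ _).2 ?_⟩
    rw [evalAt_fiberPoly_coe]
    field_simp
    ring

/-- The ramification indices over a point add up to the degree. -/
lemma sum_ramIndex (w : OnePoint ℂ)
    (Z : Finset (OnePoint ℂ)) (hZ : ∀ z, ramIndex P Q w z ≠ 0 → z ∈ Z) :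
    ∑ z ∈ Z, ramIndex P Q w z = max P.natDegree Q.natDegree :=
  sum_multAt (natDegree_fiberPoly_le w) Z hZ

/-- The numerator `P' Q - P Q'` of the derivative of `P / Q`. -/
def wronskianPoly (P Q : ℂ[X]) : ℂ[X] := derivative P * Q - P * derivative Q

lemma wronskianPoly_fiberPoly_coe (c : ℂ) :
    wronskianPoly (fiberPoly P Q (c : OnePoint ℂ)) Q = wronskianPoly P Q := by
  simp only [wronskianPoly, fiberPoly, derivative_sub, derivative_mul, derivative_C]
  ring

lemma multAt_neg (F : ℂ[X]) (d : ℕ) (z : OnePoint ℂ) : multAt (-F) d z = multAt F d z := by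
  rcases eq_infty_or_coe z with rfl | ⟨z, rfl⟩
  · change d - (-F).natDegree = d - F.natDegree
    rw [natDegree_neg]
  · change rootMultiplicity z (-F) = rootMultiplicity z F
    rw [← count_roots, ← count_roots, roots_neg]

lemma natDegree_wronskianPoly {H Y : ℂ[X]} (hH : H ≠ 0) (hHY : H.natDegree < Y.natDegree) :
    wronskianPoly H Y ≠ 0 ∧ (wronskianPoly H Y).natDegree + 1 = H.natDegree + Y.natDegree := by
  have hY : Y ≠ 0 := by rintro rfl; simp at hHY
  have hcoeff : (wronskianPoly H Y).coeff (H.natDegree + Y.natDegree - 1) =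
      ((H.natDegree : ℂ) - Y.natDegree) * (H.leadingCoeff * Y.leadingCoeff) := by
    have h1 : (derivative H * Y).coeff (H.natDegree + Y.natDegree - 1) =
        H.natDegree * (H.leadingCoeff * Y.leadingCoeff) := by
      rcases Nat.eq_zero_or_pos H.natDegree with h0 | h0
      · have : derivative H = 0 := by
          rw [eq_C_of_natDegree_eq_zero h0, derivative_C]
        simp [this, h0]
      · have h2 : H.natDegree + Y.natDegree - 1 = (H.natDegree - 1) + Y.natDegree := by omega
        rw [h2, coeff_mul_add_eq_of_natDegree_le (natDegree_derivative_le H) le_rfl,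
          coeff_derivative, coeff_natDegree]
        have h3 : H.natDegree - 1 + 1 = H.natDegree := by omega
        have h4 : ((H.natDegree - 1 : ℕ) : ℂ) + 1 = H.natDegree := by
          rw [← Nat.cast_succ, Nat.succ_eq_add_one, h3]
        rw [h3, coeff_natDegree, h4]
        ring
    have h1' : (H * derivative Y).coeff (H.natDegree + Y.natDegree - 1) =
        Y.natDegree * (H.leadingCoeff * Y.leadingCoeff) := by
      have h2 : H.natDegree + Y.natDegree - 1 = H.natDegree + (Y.natDegree - 1) := by omega
      rw [h2, coeff_mul_add_eq_of_natDegree_le le_rfl (natDegree_derivative_le Y),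
        coeff_derivative, coeff_natDegree]
      have h3 : Y.natDegree - 1 + 1 = Y.natDegree := by omega
      have h4 : ((Y.natDegree - 1 : ℕ) : ℂ) + 1 = Y.natDegree := by
        rw [← Nat.cast_succ, Nat.succ_eq_add_one, h3]
      rw [h3, coeff_natDegree, h4]
      ring
    rw [wronskianPoly, coeff_sub, h1, h1']
    ring
  have hne : (wronskianPoly H Y).coeff (H.natDegree + Y.natDegree - 1) ≠ 0 := by
    rw [hcoeff]
    refine mul_ne_zero (sub_ne_zero.2 ?_) (mul_ne_zero (leadingCoeff_ne_zero.2 hH)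
      (leadingCoeff_ne_zero.2 hY))
    exact_mod_cast hHY.ne
  have hle : (wronskianPoly H Y).natDegree ≤ H.natDegree + Y.natDegree - 1 := by
    refine (natDegree_sub_le _ _).trans (max_le ?_ ?_)
    · rcases Nat.eq_zero_or_pos H.natDegree with h0 | h0
      · have : derivative H = 0 := by
          rw [eq_C_of_natDegree_eq_zero h0, derivative_C]
        simp [this]
      · refine natDegree_mul_le.trans ?_
        have := natDegree_derivative_le H
        omega
    · refine natDegree_mul_le.trans ?_
      have := natDegree_derivative_le Y
      omega
  refine ⟨fun h => hne (by rw [h, coeff_zero]), ?_⟩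
  have := le_antisymm hle (le_natDegree_of_ne_zero hne)
  omega

/-- The order of vanishing of the derivative is one less than the ramification index. -/
lemma multAt_wronskianPoly (hPQ : IsCoprime P Q) (hd : 0 < max P.natDegree Q.natDegree)
    {w z : OnePoint ℂ} (h : 0 < ramIndex P Q w z) :
    wronskianPoly P Q ≠ 0 ∧
      (wronskianPoly P Q).natDegree ≤ 2 * max P.natDegree Q.natDegree - 2 ∧
      multAt (wronskianPoly P Q) (2 * max P.natDegree Q.natDegree - 2) z + 1 =
        ramIndex P Q w z := by
  -- it suffices to consider the pair of the equation of the fiber and one of `P`, `Q`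
  have hloc : ∀ w z, 0 < ramIndex P Q w z → ∃ Y : ℂ[X],
      (wronskianPoly (fiberPoly P Q w) Y = wronskianPoly P Q ∨
        wronskianPoly (fiberPoly P Q w) Y = -wronskianPoly P Q) ∧
      Y.natDegree ≤ max P.natDegree Q.natDegree ∧
      evalAt Y (max P.natDegree Q.natDegree) z ≠ 0 := by
    intro w z h
    rw [ramIndex_pos_iff hPQ hd] at h
    rcases eq_infty_or_coe w with rfl | ⟨c, rfl⟩
    · refine ⟨P, Or.inr ?_, le_max_left _ _, fun hP => evalAt_ne_zero_of_isCoprime hPQ hd hP h⟩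
      simp only [wronskianPoly, fiberPoly]
      ring
    · refine ⟨Q, Or.inl (wronskianPoly_fiberPoly_coe c), le_max_right _ _, fun hQ => ?_⟩
      rw [evalAt_fiberPoly_coe, hQ, mul_zero, sub_zero] at h
      exact evalAt_ne_zero_of_isCoprime hPQ hd h hQ
  have hinf : wronskianPoly P Q ≠ 0 ∧ ∀ w, 0 < ramIndex P Q w OnePoint.infty →
      (wronskianPoly P Q).natDegree + 1 + ramIndex P Q w OnePoint.infty =
        2 * max P.natDegree Q.natDegree := by
    have key : ∀ w, 0 < ramIndex P Q w OnePoint.infty → wronskianPoly P Q ≠ 0 ∧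
        (wronskianPoly P Q).natDegree + 1 + ramIndex P Q w OnePoint.infty =
          2 * max P.natDegree Q.natDegree := by
      intro w h
      obtain ⟨Y, hW, hY, hYz⟩ := hloc w OnePoint.infty h
      change 0 < max P.natDegree Q.natDegree - (fiberPoly P Q w).natDegree at h
      have hYd : Y.natDegree = max P.natDegree Q.natDegree :=
        le_antisymm hY (le_natDegree_of_ne_zero hYz)
      obtain ⟨h1, h2⟩ := natDegree_wronskianPoly (Y := Y) (fiberPoly_ne_zero hPQ hd w) (by omega)
      have h3 : wronskianPoly P Q ≠ 0 ∧
          (wronskianPoly (fiberPoly P Q w) Y).natDegree = (wronskianPoly P Q).natDegree := by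
        rcases hW with hW | hW
        · rw [hW] at h1 ⊢; exact ⟨h1, rfl⟩
        · rw [hW] at h1 ⊢; exact ⟨neg_ne_zero.1 h1, natDegree_neg _⟩
      refine ⟨h3.1, ?_⟩
      change _ + 1 + (max P.natDegree Q.natDegree - (fiberPoly P Q w).natDegree) = _
      rw [← h3.2]
      omega
    obtain ⟨w, hw⟩ := exists_ramIndex_pos hPQ hd OnePoint.infty
    exact ⟨(key w hw).1, fun w hw => (key w hw).2⟩
  obtain ⟨w₀, hw₀⟩ := exists_ramIndex_pos hPQ hd OnePoint.infty
  have hdeg := hinf.2 w₀ hw₀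
  have hram : ramIndex P Q w₀ OnePoint.infty ≤ max P.natDegree Q.natDegree := Nat.sub_le _ _
  refine ⟨hinf.1, by omega, ?_⟩
  rcases eq_infty_or_coe z with rfl | ⟨z, rfl⟩
  · have h1 := hinf.2 w h
    change 2 * max P.natDegree Q.natDegree - 2 - (wronskianPoly P Q).natDegree + 1 = _
    omega
  · obtain ⟨Y, hW, -, hYz⟩ := hloc w (z : OnePoint ℂ) h
    have h0 := (ramIndex_pos_iff hPQ hd _ _).1 h
    have h1 := (rootMultiplicity_wronskian (fiberPoly_ne_zero hPQ hd w) h0 hYz).2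
    change multAt (wronskianPoly (fiberPoly P Q w) Y) (2 * max P.natDegree Q.natDegree - 2)
      (z : OnePoint ℂ) + 1 = _ at h1
    rcases hW with hW | hW
    · rw [hW] at h1; exact h1
    · rw [hW, multAt_neg] at h1; exact h1

end Ramification

/-! ### Orders and residues of pulled back differentials -/

section Pullback

open Polynomial

variable {P Q N D : ℂ[X]}

lemma eventually_eval_ne_zero {F : ℂ[X]} (hF : F ≠ 0) :
    ∀ᶠ z in Filter.cofinite, F.eval z ≠ 0 := by
  rw [Filter.eventually_cofinite]
  simpa using F.finite_setOfPred_isRoot hF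

lemma eq_of_eventually_eval_eq {F G : ℂ[X]}
    (h : ∀ᶠ z in Filter.cofinite, F.eval z = G.eval z) : F = G :=
  eq_of_eval_eq_of_finite (Filter.eventually_cofinite.1 h) fun z hz => by simpa using hz

/-- The numerator of `N (P / Q)`, which has degree `deg N * deg (P / Q)` as a binary form. -/
def homogEval (N P Q : ℂ[X]) : ℂ[X] :=
  C N.leadingCoeff * (N.roots.map fun α : ℂ => fiberPoly P Q (α : OnePoint ℂ)).prod

lemma eval_homogEval {z : ℂ} (hz : Q.eval z ≠ 0) :
    (homogEval N P Q).eval z = N.eval (P.eval z / Q.eval z) * Q.eval z ^ N.natDegree := by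
  rw [homogEval, eval_mul, eval_C, eval_multiset_prod, Multiset.map_map,
    (IsAlgClosed.splits N).eval_eq_prod_roots, mul_assoc]
  congr 1
  have h1 : ∀ α : ℂ, (eval z ∘ fun α : ℂ => fiberPoly P Q (α : OnePoint ℂ)) α =
      (P.eval z / Q.eval z - α) * Q.eval z := by
    intro α
    change (P - C α * Q).eval z = _
    rw [eval_sub, eval_mul, eval_C]
    field_simp
  rw [Multiset.map_congr rfl fun α _ => h1 α, Multiset.prod_map_mul, Multiset.map_const',
    Multiset.prod_replicate, IsAlgClosed.card_roots_eq_natDegree]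

lemma sum_map_ite_eq (S : Multiset ℂ) (c : ℂ) (r : ℕ) :
    (S.map fun α => if α = c then r else 0).sum = S.count c * r := by
  induction S using Multiset.induction_on with
  | empty => simp
  | cons a S ih =>
    rw [Multiset.map_cons, Multiset.sum_cons, ih, Multiset.count_cons]
    split_ifs with h1 h2 h2
    · ring
    · exact absurd h1.symm h2
    · exact absurd h2.symm h1
    · ring

lemma ramIndex_eq_zero (hPQ : IsCoprime P Q) (hd : 0 < max P.natDegree Q.natDegree)
    {w w' z : OnePoint ℂ} (h : 0 < ramIndex P Q w z) (hw : w' ≠ w) : ramIndex P Q w' z = 0 := by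
  by_contra hcon
  exact hw (eq_of_ramIndex_pos hPQ hd (Nat.pos_of_ne_zero hcon) h)

lemma multAt_homogEval (hPQ : IsCoprime P Q) (hd : 0 < max P.natDegree Q.natDegree) (hN : N ≠ 0)
    {w z : OnePoint ℂ} (h : 0 < ramIndex P Q w z) :
    homogEval N P Q ≠ 0 ∧
      (homogEval N P Q).natDegree ≤ N.natDegree * max P.natDegree Q.natDegree ∧
      multAt (homogEval N P Q) (N.natDegree * max P.natDegree Q.natDegree) z =
        multAt N N.natDegree w * ramIndex P Q w z := by
  have key : ∀ S : Multiset ℂ, (S.map fun α : ℂ => fiberPoly P Q (α : OnePoint ℂ)).prod ≠ 0 ∧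
      (S.map fun α : ℂ => fiberPoly P Q (α : OnePoint ℂ)).prod.natDegree ≤
        S.card * max P.natDegree Q.natDegree ∧
      multAt (S.map fun α : ℂ => fiberPoly P Q (α : OnePoint ℂ)).prod
        (S.card * max P.natDegree Q.natDegree) z =
        (S.map fun α : ℂ => ramIndex P Q (α : OnePoint ℂ) z).sum := by
    intro S
    induction S using Multiset.induction_on with
    | empty =>
      refine ⟨by simp, by simp, ?_⟩
      simp only [Multiset.map_zero, Multiset.prod_zero, Multiset.card_zero, zero_mul,
        Multiset.sum_zero]
      rcases eq_infty_or_coe z with rfl | ⟨z, rfl⟩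
      · simp [multAt]
      · change rootMultiplicity z (1 : ℂ[X]) = 0
        rw [← C_1, rootMultiplicity_C]
    | cons a S ih =>
      obtain ⟨h1, h2, h3⟩ := ih
      have ha := fiberPoly_ne_zero hPQ hd (a : OnePoint ℂ)
      have had := natDegree_fiberPoly_le (P := P) (Q := Q) (a : OnePoint ℂ)
      rw [Multiset.map_cons, Multiset.prod_cons, Multiset.card_cons, Multiset.map_cons,
        Multiset.sum_cons, ← h3]
      refine ⟨mul_ne_zero ha h1, natDegree_mul_le.trans (by rw [add_mul]; omega), ?_⟩
      rw [add_mul, one_mul, add_comm (Multiset.card S * _), multAt_mul ha h1 had h2]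
      rfl
  obtain ⟨h1, h2, h3⟩ := key N.roots
  have hlc : C N.leadingCoeff ≠ 0 := by simpa using hN
  rw [IsAlgClosed.card_roots_eq_natDegree] at h2 h3
  refine ⟨mul_ne_zero hlc h1, (natDegree_C_mul_le _ _).trans h2, ?_⟩
  rw [homogEval, ← zero_add (N.natDegree * _),
    multAt_mul hlc h1 (by simp) h2, h3]
  have h4 : multAt (C N.leadingCoeff) 0 z = 0 := by
    rcases eq_infty_or_coe z with rfl | ⟨z, rfl⟩
    · simp [multAt]
    · exact rootMultiplicity_C _ _
  rw [h4, zero_add]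
  rcases eq_infty_or_coe w with rfl | ⟨c, rfl⟩
  · change _ = (N.natDegree - N.natDegree) * _
    rw [Nat.sub_self, zero_mul]
    refine Multiset.sum_eq_zero fun x hx => ?_
    obtain ⟨α, -, rfl⟩ := Multiset.mem_map.1 hx
    exact ramIndex_eq_zero hPQ hd h (OnePoint.coe_ne_infty α)
  · change _ = N.rootMultiplicity c * _
    rw [← count_roots, ← sum_map_ite_eq]
    congr 1
    refine Multiset.map_congr rfl fun α _ => ?_
    split_ifs with hα
    · rw [hα]
    · exact ramIndex_eq_zero hPQ hd h (by simpa using hα)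

lemma deriv_div_eval {z : ℂ} (hz : Q.eval z ≠ 0) :
    deriv (fun w => P.eval w / Q.eval w) z = (wronskianPoly P Q).eval z / Q.eval z ^ 2 := by
  rw [((P.hasDerivAt z).fun_div (Q.hasDerivAt z) hz).deriv]
  simp [wronskianPoly]

/-- The order of vanishing of the pullback of `(N / D) dw` under the map `P / Q`. -/
theorem order_pullback (hPQ : IsCoprime P Q) (hd : 0 < max P.natDegree Q.natDegree) (hN : N ≠ 0)
    (hD : D ≠ 0) {G E : ℂ[X]} (hG : G ≠ 0) (hE : E ≠ 0) {d : ℕ} (hGd : G.natDegree ≤ d)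
    (hEd : E.natDegree ≤ d + 2)
    (hω : ∀ᶠ z in Filter.cofinite, G.eval z / E.eval z =
      N.eval (P.eval z / Q.eval z) / D.eval (P.eval z / Q.eval z) *
        deriv (fun w => P.eval w / Q.eval w) z)
    {w z : OnePoint ℂ} (h : 0 < ramIndex P Q w z) :
    (multAt G d z : ℤ) - multAt E (d + 2) z + 1 = ramIndex P Q w z * (ordAt N D w + 1) := by
  obtain ⟨hN1, hN2, hN3⟩ := multAt_homogEval hPQ hd hN h
  obtain ⟨hD1, hD2, hD3⟩ := multAt_homogEval hPQ hd hD h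
  obtain ⟨hW1, hW2, hW3⟩ := multAt_wronskianPoly hPQ hd h
  have hQ : Q ≠ 0 := fiberPoly_ne_zero hPQ hd OnePoint.infty
  set δ := max P.natDegree Q.natDegree with hδ
  have hQd : Q.natDegree ≤ δ := le_max_right _ _
  have hid : G * homogEval D P Q * Q ^ (N.natDegree + 2) =
      E * homogEval N P Q * wronskianPoly P Q * Q ^ D.natDegree := by
    refine eq_of_eventually_eval_eq ?_
    filter_upwards [hω, eventually_eval_ne_zero hQ, eventually_eval_ne_zero hE,
      eventually_eval_ne_zero hD1] with z h1 h2 h3 h4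
    rw [deriv_div_eval h2] at h1
    simp only [eval_mul, eval_pow]
    rw [eval_homogEval h2] at h4
    have h5 : D.eval (P.eval z / Q.eval z) ≠ 0 := left_ne_zero_of_mul h4
    rw [eval_homogEval h2, eval_homogEval h2]
    have h6 : G.eval z = N.eval (P.eval z / Q.eval z) / D.eval (P.eval z / Q.eval z) *
        ((wronskianPoly P Q).eval z / Q.eval z ^ 2) * E.eval z := by
      rw [← h1, div_mul_cancel₀ _ h3]
    rw [h6]
    field_simp
    ring
  have hL := multAt_mul (mul_ne_zero hG hD1) (pow_ne_zero (N.natDegree + 2) hQ)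
    (d := d + D.natDegree * δ) (d' := (N.natDegree + 2) * δ)
    (natDegree_mul_le.trans (add_le_add hGd hD2))
    (by rw [natDegree_pow]; exact Nat.mul_le_mul le_rfl hQd) z
  rw [multAt_mul hG hD1 hGd hD2, multAt_pow hQ hQd] at hL
  have hR := multAt_mul (mul_ne_zero (mul_ne_zero hE hN1) hW1) (pow_ne_zero D.natDegree hQ)
    (d := d + 2 + N.natDegree * δ + (2 * δ - 2)) (d' := D.natDegree * δ)
    (natDegree_mul_le.trans (add_le_add (natDegree_mul_le.trans (add_le_add hEd hN2)) hW2))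
    (by rw [natDegree_pow]; exact Nat.mul_le_mul le_rfl hQd) z
  rw [multAt_mul (mul_ne_zero hE hN1) hW1 (natDegree_mul_le.trans (add_le_add hEd hN2)) hW2,
    multAt_mul hE hN1 hEd hN2, multAt_pow hQ hQd] at hR
  have hdeg : d + D.natDegree * δ + (N.natDegree + 2) * δ =
      d + 2 + N.natDegree * δ + (2 * δ - 2) + D.natDegree * δ := by
    have : 2 * δ - 2 + 2 = 2 * δ := by omega
    nlinarith
  rw [hid, hdeg, hR, hD3, hN3] at hL
  have hL' : (multAt E (d + 2) z : ℤ) + multAt N N.natDegree w * ramIndex P Q w z +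
      multAt (wronskianPoly P Q) (2 * δ - 2) z + D.natDegree * multAt Q δ z =
      multAt G d z + multAt D D.natDegree w * ramIndex P Q w z +
        (N.natDegree + 2) * multAt Q δ z := by exact_mod_cast hL
  have hW3' : (multAt (wronskianPoly P Q) (2 * δ - 2) z : ℤ) + 1 = ramIndex P Q w z := by
    exact_mod_cast hW3
  have hQm : multAt Q δ z = ramIndex P Q OnePoint.infty z := rfl
  rcases eq_infty_or_coe w with rfl | ⟨c, rfl⟩
  · have h1 : ∀ F : ℂ[X], multAt F F.natDegree OnePoint.infty = 0 := fun F => Nat.sub_self _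
    have h2 : ordAt N D OnePoint.infty = (D.natDegree : ℤ) - N.natDegree - 2 := rfl
    rw [h1, h1, hQm] at hL'
    rw [h2]
    push_cast at hL'
    linear_combination -hL' + hW3'
  · have h2 : ordAt N D (c : OnePoint ℂ) =
      (multAt N N.natDegree (c : OnePoint ℂ) : ℤ) - multAt D D.natDegree (c : OnePoint ℂ) := rfl
    rw [hQm, ramIndex_eq_zero hPQ hd h (OnePoint.infty_ne_coe c)] at hL'
    rw [h2]
    push_cast at hL'
    linear_combination -hL' + hW3'

/-- Partial fractions: the coefficients of `∑ b_ζ / (z - ζ)` are determined by its values. -/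
lemma eq_zero_of_sum_div_eq_zero {T : Finset ℂ} {b : ℂ → ℂ}
    (h : ∀ᶠ z in Filter.cofinite, ∑ ζ ∈ T, b ζ / (z - ζ) = 0) : ∀ ζ ∈ T, b ζ = 0 := by
  classical
  have h1 : ∑ ζ ∈ T, C (b ζ) * ∏ ξ ∈ T.erase ζ, (X - C ξ) = 0 := by
    refine eq_of_eventually_eval_eq ?_
    have hT : ∀ᶠ z in Filter.cofinite, z ∉ T :=
      Filter.eventually_cofinite.2 (T.finite_toSet.subset fun z hz => by simpa using hz)
    filter_upwards [h, hT] with z hz hzT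
    rw [eval_finsetSum, eval_zero, ← mul_zero (∏ ξ ∈ T, (z - ξ)), ← hz, Finset.mul_sum]
    refine Finset.sum_congr rfl fun ζ hζ => ?_
    rw [← Finset.mul_prod_erase _ _ hζ]
    have : z - ζ ≠ 0 := sub_ne_zero.2 fun h => hzT (h ▸ hζ)
    simp only [eval_mul, eval_C, eval_prod, eval_sub, eval_X]
    field_simp
  intro ζ hζ
  have h2 := congrArg (eval ζ) h1
  rw [eval_finsetSum, Finset.sum_eq_single ζ] at h2
  · simp only [eval_mul, eval_C, eval_prod, eval_sub, eval_X, eval_zero, mul_eq_zero] at h2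
    refine h2.resolve_right (Finset.prod_ne_zero_iff.2 fun ξ hξ => sub_ne_zero.2 ?_)
    exact (Finset.ne_of_mem_erase hξ).symm
  · intro ξ _ hξ
    rw [eval_mul, eval_prod, Finset.prod_eq_zero (i := ζ), mul_zero]
    · exact Finset.mem_erase.2 ⟨hξ.symm, hζ⟩
    · simp
  · exact fun h => absurd hζ h

lemma eval_derivative_div_eval_eq_sum {H : ℂ[X]} {z : ℂ} (hz : H.eval z ≠ 0) {T : Finset ℂ}
    (hT : H.roots.toFinset ⊆ T) :
    (derivative H).eval z / H.eval z = ∑ ζ ∈ T, (H.rootMultiplicity ζ : ℂ) / (z - ζ) := by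
  rw [(IsAlgClosed.splits H).eval_derivative_div_eval_of_ne_zero hz,
    Finset.sum_multiset_map_count]
  simp_rw [count_roots, nsmul_eq_mul, mul_one_div]
  refine Finset.sum_subset hT fun ζ _ hζ => ?_
  rw [Multiset.mem_toFinset, ← Multiset.count_eq_zero, count_roots] at hζ
  rw [hζ]
  simp

lemma sum_rootMultiplicity (H : ℂ[X]) {T : Finset ℂ} (hT : H.roots.toFinset ⊆ T) :
    ∑ ζ ∈ T, H.rootMultiplicity ζ = H.natDegree := by
  rw [← IsAlgClosed.card_roots_eq_natDegree, ← Multiset.toFinset_sum_count_eq]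
  simp_rw [count_roots]
  refine (Finset.sum_subset hT fun ζ _ hζ => ?_).symm
  rw [Multiset.mem_toFinset, ← Multiset.count_eq_zero, count_roots] at hζ
  exact hζ

/-- The decomposition into partial fractions of a rational differential with simple poles. -/
lemma exists_partial_fractions (hN : N ≠ 0) (hD : D ≠ 0) (hord : ∀ w, -1 ≤ ordAt N D w) :
    ∃ (Z : Finset ℂ) (τ : ℂ → ℂ), (∀ c ∈ Z, ordAt N D (c : OnePoint ℂ) = -1) ∧
      (-(∑ c ∈ Z, τ c) ≠ 0 → ordAt N D OnePoint.infty = -1) ∧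
      ∀ w, D.eval w ≠ 0 → N.eval w / D.eval w = ∑ c ∈ Z, τ c / (w - c) := by
  classical
  set Z : Finset ℂ := D.roots.toFinset.filter fun c => ordAt N D (c : OnePoint ℂ) = -1 with hZ
  set D₁ : ℂ[X] := Lagrange.nodal Z id with hD₁
  have hD₁0 : D₁ ≠ 0 := Lagrange.nodal_ne_zero
  have hdvd : D ∣ N * D₁ := by
    rw [IsAlgClosed.dvd_iff_roots_le_roots hD (mul_ne_zero hN hD₁0), Multiset.le_iff_count]
    intro c
    rw [count_roots, count_roots, rootMultiplicity_mul (mul_ne_zero hN hD₁0)]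
    have h1 : -1 ≤ (N.rootMultiplicity c : ℤ) - D.rootMultiplicity c := hord (c : OnePoint ℂ)
    by_cases hc : c ∈ Z
    · have : 0 < D₁.rootMultiplicity c := by
        rw [rootMultiplicity_pos hD₁0]
        exact Lagrange.eval_nodal_at_node (v := id) hc
      omega
    · by_contra hcon
      refine hc (Finset.mem_filter.2 ⟨?_, ?_⟩)
      · rw [Multiset.mem_toFinset, ← Multiset.count_pos, count_roots]
        omega
      · change (N.rootMultiplicity c : ℤ) - D.rootMultiplicity c = -1
        omega
  obtain ⟨N₁, hN₁⟩ := hdvd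
  have hN₁0 : N₁ ≠ 0 := by
    rintro rfl
    rw [mul_zero] at hN₁
    exact mul_ne_zero hN hD₁0 hN₁
  have hdeg : N.natDegree + Z.card = D.natDegree + N₁.natDegree := by
    rw [← natDegree_mul hD hN₁0, ← hN₁, natDegree_mul hN hD₁0, hD₁, Lagrange.natDegree_nodal]
  have hinf : -1 ≤ (D.natDegree : ℤ) - N.natDegree - 2 := hord OnePoint.infty
  have hlt : N₁.degree < Z.card := by
    refine lt_of_le_of_lt degree_le_natDegree ?_
    exact_mod_cast (by omega : N₁.natDegree < Z.card)
  have hint := Lagrange.eq_interpolate (v := id) (Set.injOn_id _) hlt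
  set τ : ℂ → ℂ := fun c => Lagrange.nodalWeight Z id c * N₁.eval c with hτ
  refine ⟨Z, τ, fun c hc => (Finset.mem_filter.1 hc).2, fun h => ?_, fun w hw => ?_⟩
  · -- the sum of the residues is the coefficient of `N₁` in degree `|Z| - 1`
    by_contra hcon
    have hne : (D.natDegree : ℤ) - N.natDegree - 2 ≠ -1 := hcon
    refine h (neg_eq_zero.2 ?_)
    have hZ1 : N₁.natDegree < Z.card - 1 := by omega
    have hc := coeff_eq_zero_of_natDegree_lt hZ1
    rw [Lagrange.coeff_eq_sum (v := id) (Set.injOn_id _) hlt] at hc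
    rw [← hc]
    refine Finset.sum_congr rfl fun c hc => ?_
    simp only [hτ, Lagrange.nodalWeight, Finset.prod_inv_distrib, id]
    ring
  · by_cases hwZ : w ∈ Z
    · have h1 := (Finset.mem_filter.1 hwZ).1
      rw [Multiset.mem_toFinset, mem_roots hD] at h1
      exact absurd h1 hw
    · have hD₁w : D₁.eval w ≠ 0 := by
        rw [hD₁]
        rw [Lagrange.eval_nodal]
        exact Finset.prod_ne_zero_iff.2 fun c hc => sub_ne_zero.2 fun h => hwZ (by rw [h]; exact hc)
      have h1 : N.eval w / D.eval w = N₁.eval w / D₁.eval w := by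
        rw [div_eq_div_iff hw hD₁w, ← eval_mul, hN₁, eval_mul, mul_comm]
      rw [h1, hint, Lagrange.eval_interpolate_not_at_node _ fun c hc h => hwZ (by
        rw [h]; exact hc)]
      rw [← hD₁, mul_div_cancel_left₀ _ hD₁w]
      refine Finset.sum_congr rfl fun c _ => ?_
      simp only [hτ, id]
      ring

/-- The residue of a pulled back differential at a simple pole is the product of the ramification
index and the residue at the image. -/
theorem exists_residues_pullback (hPQ : IsCoprime P Q) (hd : 0 < max P.natDegree Q.natDegree)
    (hN : N ≠ 0) (hD : D ≠ 0) (hord : ∀ w, -1 ≤ ordAt N D w) {y R : Fin (n + 1) → ℂ}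
    (hy : Function.Injective y)
    (hω : ∀ᶠ z in Filter.cofinite, ∑ j, R j / (z - y j) =
      N.eval (P.eval z / Q.eval z) / D.eval (P.eval z / Q.eval z) *
        deriv (fun w => P.eval w / Q.eval w) z) :
    ∃ τ : OnePoint ℂ → ℂ, (∀ w, τ w ≠ 0 → ordAt N D w = -1) ∧
      (∀ Z : Finset (OnePoint ℂ), (∀ w, τ w ≠ 0 → w ∈ Z) → ∑ w ∈ Z, τ w = 0) ∧
      (∀ j w, 0 < ramIndex P Q w (y j : OnePoint ℂ) →
        R j = ramIndex P Q w (y j : OnePoint ℂ) * τ w) ∧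
      ∀ w, 0 < ramIndex P Q w OnePoint.infty →
        -∑ j, R j = ramIndex P Q w OnePoint.infty * τ w := by
  classical
  obtain ⟨Z, τ₀, hZ, hinf, hpf⟩ := exists_partial_fractions hN hD hord
  have hQ : Q ≠ 0 := fiberPoly_ne_zero hPQ hd OnePoint.infty
  have hH : ∀ c : ℂ, fiberPoly P Q (c : OnePoint ℂ) ≠ 0 := fun c => fiberPoly_ne_zero hPQ hd _
  set τ : OnePoint ℂ → ℂ := fun w =>
    if w = OnePoint.infty then -∑ c ∈ Z, τ₀ c else ∑ c ∈ Z, if w = (c : OnePoint ℂ) then τ₀ c else 0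
    with hτ
  have hτinf : τ OnePoint.infty = -∑ c ∈ Z, τ₀ c := by simp [hτ]
  have hτcoe : ∀ c : ℂ, τ (c : OnePoint ℂ) = if c ∈ Z then τ₀ c else 0 := by
    intro c
    simp [hτ]
  set T : Finset ℂ := Finset.univ.image y ∪ (Q.roots.toFinset ∪
    Z.biUnion fun c => (fiberPoly P Q (c : OnePoint ℂ)).roots.toFinset) with hT
  have hTQ : Q.roots.toFinset ⊆ T :=
    (Finset.subset_union_left).trans Finset.subset_union_right
  have hTH : ∀ c ∈ Z, (fiberPoly P Q (c : OnePoint ℂ)).roots.toFinset ⊆ T := fun c hc =>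
    ((Finset.subset_biUnion_of_mem (fun c : ℂ =>
      (fiberPoly P Q (c : OnePoint ℂ)).roots.toFinset) hc).trans
      Finset.subset_union_right).trans Finset.subset_union_right
  have hTy : ∀ j, y j ∈ T := fun j =>
    Finset.mem_union_left _ (Finset.mem_image_of_mem _ (Finset.mem_univ j))
  set b : ℂ → ℂ := fun ζ => ∑ c ∈ Z, τ₀ c *
    ((fiberPoly P Q (c : OnePoint ℂ)).rootMultiplicity ζ - Q.rootMultiplicity ζ : ℂ) with hb
  -- compare the partial fractions of the two expressions for the differential
  have hb_eq : ∀ ζ ∈ T, (∑ j, if y j = ζ then R j else 0) - b ζ = 0 := by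
    refine eq_zero_of_sum_div_eq_zero ?_
    have hev : ∀ᶠ z in Filter.cofinite, ∀ c ∈ Z, (fiberPoly P Q (c : OnePoint ℂ)).eval z ≠ 0 := by
      rw [Filter.eventually_all_finset]
      exact fun c _ => eventually_eval_ne_zero (hH c)
    obtain ⟨w₀, hw₀⟩ := exists_ramIndex_pos hPQ hd OnePoint.infty
    filter_upwards [hω, hev, eventually_eval_ne_zero hQ,
      eventually_eval_ne_zero (multAt_homogEval hPQ hd hD hw₀).1] with z h1 h2 h3 h4
    rw [eval_homogEval h3] at h4
    rw [deriv_div_eval h3, hpf _ (left_ne_zero_of_mul h4)] at h1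
    simp_rw [sub_div, Finset.sum_sub_distrib]
    have hleft : ∑ ζ ∈ T, (∑ j, if y j = ζ then R j else 0) / (z - ζ) =
        ∑ j, R j / (z - y j) := by
      simp_rw [Finset.sum_div]
      rw [Finset.sum_comm]
      refine Finset.sum_congr rfl fun j _ => ?_
      rw [Finset.sum_eq_single (y j)]
      · simp
      · intro ζ _ hζ
        simp [hζ.symm]
      · exact fun h => absurd (hTy j) h
    have hright : ∑ ζ ∈ T, b ζ / (z - ζ) = (∑ c ∈ Z, τ₀ c / (P.eval z / Q.eval z - c)) *
        ((wronskianPoly P Q).eval z / Q.eval z ^ 2) := by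
      simp_rw [hb, Finset.sum_div]
      rw [Finset.sum_comm, Finset.sum_mul]
      refine Finset.sum_congr rfl fun c hc => ?_
      have hHz := h2 c hc
      have hHQ : (fiberPoly P Q (c : OnePoint ℂ)).eval z = P.eval z - c * Q.eval z := by
        change (P - C c * Q).eval z = _
        simp
      have hW : (wronskianPoly P Q).eval z =
          (derivative (fiberPoly P Q (c : OnePoint ℂ))).eval z * Q.eval z -
            (fiberPoly P Q (c : OnePoint ℂ)).eval z * (derivative Q).eval z := by
        rw [← wronskianPoly_fiberPoly_coe c, wronskianPoly, eval_sub, eval_mul, eval_mul]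
      calc ∑ ζ ∈ T, τ₀ c * ((fiberPoly P Q (c : OnePoint ℂ)).rootMultiplicity ζ -
            Q.rootMultiplicity ζ : ℂ) / (z - ζ)
          = τ₀ c * (∑ ζ ∈ T, ((fiberPoly P Q (c : OnePoint ℂ)).rootMultiplicity ζ : ℂ) / (z - ζ) -
            ∑ ζ ∈ T, (Q.rootMultiplicity ζ : ℂ) / (z - ζ)) := by
            rw [← Finset.sum_sub_distrib, Finset.mul_sum]
            exact Finset.sum_congr rfl fun ζ _ => by ring
        _ = _ := by
            rw [← eval_derivative_div_eval_eq_sum hHz (hTH c hc),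
              ← eval_derivative_div_eval_eq_sum h3 hTQ, hW]
            have h5 : P.eval z / Q.eval z - c =
                (fiberPoly P Q (c : OnePoint ℂ)).eval z / Q.eval z := by
              rw [hHQ]; field_simp
            rw [h5]
            field_simp
    rw [hleft, hright, h1, sub_self]
  have hkey : ∀ w z, 0 < ramIndex P Q w z →
      ∑ c ∈ Z, τ₀ c * ((ramIndex P Q (c : OnePoint ℂ) z : ℂ) - ramIndex P Q OnePoint.infty z) =
        ramIndex P Q w z * τ w := by
    intro w z h
    rcases eq_infty_or_coe w with rfl | ⟨c, rfl⟩
    · rw [hτinf, mul_neg, Finset.mul_sum, ← Finset.sum_neg_distrib]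
      refine Finset.sum_congr rfl fun c _ => ?_
      rw [ramIndex_eq_zero hPQ hd h (OnePoint.coe_ne_infty c)]
      push_cast
      ring
    · rw [hτcoe, ramIndex_eq_zero hPQ hd h (OnePoint.infty_ne_coe c)]
      have h0 : ∀ c' ∈ Z, c' ≠ c → τ₀ c' *
          ((ramIndex P Q (c' : OnePoint ℂ) z : ℂ) - (0 : ℕ)) = 0 := by
        intro c' _ hc
        rw [ramIndex_eq_zero hPQ hd h (w' := (c' : OnePoint ℂ)) (by simpa using hc)]
        simp
      split_ifs with hc
      · rw [Finset.sum_eq_single_of_mem c hc h0]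
        push_cast
        ring
      · rw [mul_zero]
        exact Finset.sum_eq_zero fun c' hc' => h0 c' hc' fun h => hc (h ▸ hc')
  refine ⟨τ, fun w hw => ?_, fun Z' hZ' => ?_, fun j w h => ?_, fun w h => ?_⟩
  · rcases eq_infty_or_coe w with rfl | ⟨c, rfl⟩
    · exact hinf (by rwa [hτinf] at hw)
    · rw [hτcoe] at hw
      exact hZ c (by by_contra hc; rw [if_neg hc] at hw; exact hw rfl)
  · have h1 : ∑ w ∈ Z', τ w = ∑ w ∈ insert OnePoint.infty (Z.map coeEmb), τ w := by
      have h2 : ∀ w, τ w ≠ 0 → w ∈ insert OnePoint.infty (Z.map coeEmb) := by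
        intro w hw
        rcases eq_infty_or_coe w with rfl | ⟨c, rfl⟩
        · exact Finset.mem_insert_self _ _
        · rw [hτcoe] at hw
          refine Finset.mem_insert_of_mem (Finset.mem_map.2 ⟨c, ?_, rfl⟩)
          by_contra hc
          rw [if_neg hc] at hw
          exact hw rfl
      exact sum_eq_sum_of_mem hZ' h2
    rw [h1, Finset.sum_insert (by simp [coeEmb]), hτinf, Finset.sum_map, neg_add_eq_zero]
    refine Finset.sum_congr rfl fun c hc => ?_
    change τ₀ c = τ (c : OnePoint ℂ)
    rw [hτcoe, if_pos hc]
  · have h1 := hb_eq (y j) (hTy j)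
    rw [sub_eq_zero, Finset.sum_eq_single j] at h1
    · rw [if_pos rfl] at h1
      rw [h1, ← hkey w _ h]
      rfl
    · intro l _ hl
      rw [if_neg fun h => hl (hy h)]
    · simp
  · rw [← hkey w _ h]
    have h1 : ∑ j, R j = ∑ ζ ∈ T, b ζ := by
      rw [← Finset.sum_congr rfl fun ζ hζ => sub_eq_zero.1 (hb_eq ζ hζ), Finset.sum_comm]
      refine Finset.sum_congr rfl fun j _ => ?_
      rw [Finset.sum_ite_eq T (y j) fun _ => R j, if_pos (hTy j)]
    rw [h1, hb, Finset.sum_comm, ← Finset.sum_neg_distrib]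
    refine Finset.sum_congr rfl fun c hc => ?_
    rw [← Finset.mul_sum, Finset.sum_sub_distrib]
    have h2 := sum_rootMultiplicity _ (hTH c hc)
    have h3 := sum_rootMultiplicity _ hTQ
    have h4 : ramIndex P Q (c : OnePoint ℂ) OnePoint.infty +
        (fiberPoly P Q (c : OnePoint ℂ)).natDegree = max P.natDegree Q.natDegree :=
      Nat.sub_add_cancel (natDegree_fiberPoly_le _)
    have h5 : ramIndex P Q OnePoint.infty OnePoint.infty + Q.natDegree =
        max P.natDegree Q.natDegree := Nat.sub_add_cancel (le_max_right _ _)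
    have h6 : (ramIndex P Q (c : OnePoint ℂ) OnePoint.infty : ℂ) +
        (fiberPoly P Q (c : OnePoint ℂ)).natDegree =
        ramIndex P Q OnePoint.infty OnePoint.infty + Q.natDegree := by
      exact_mod_cast h4.trans h5.symm
    rw [← Nat.cast_sum, ← Nat.cast_sum, h2, h3]
    linear_combination -(τ₀ c) * h6

end Pullback

/-! ### Numerical properties of covering constructions -/

section CoveringAnalysis

open Polynomial

variable {e : Fin (m + 1) → ℕ} {s : Coord m n}

lemma singPt_injective (hs : s ∈ stratum m n) : Function.Injective (singPt s) := by
  rintro (i | _ | i) (j | _ | j) h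
  · rw [zeroPt_injective hs (OnePoint.coe_injective h)]
  · exact absurd h (OnePoint.coe_ne_infty _)
  · exact absurd (OnePoint.coe_injective h) (zeroPt_ne_polePt hs i j)
  · exact absurd h (OnePoint.infty_ne_coe _)
  · rfl
  · exact absurd h (OnePoint.infty_ne_coe _)
  · exact absurd (OnePoint.coe_injective h).symm (zeroPt_ne_polePt hs j i)
  · exact absurd h (OnePoint.coe_ne_infty _)
  · rw [polePt_injective hs (OnePoint.coe_injective h)]

/-- The orders of `ω` at its zeros and poles. -/
def singOrd (e : Fin (m + 1) → ℕ) : SingIdx m n → ℤ := Sum.elim (fun i => e i) fun _ => -1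

lemma rootMultiplicity_prod_X_sub_C_pow {ι : Type*} [Fintype ι] {x : ι → ℂ}
    (hx : Function.Injective x) (k : ι → ℕ) (i : ι) :
    (∏ l, (X - C (x l)) ^ k l).rootMultiplicity (x i) = k i := by
  classical
  have h0 : ∏ l, (X - C (x l)) ^ k l ≠ 0 :=
    Finset.prod_ne_zero_iff.2 fun l _ => pow_ne_zero _ (X_sub_C_ne_zero _)
  rw [← count_roots, roots_prod _ _ h0, Multiset.count_bind]
  simp only [roots_pow, roots_X_sub_C, Multiset.count_nsmul, Multiset.count_singleton]
  change ∑ l, k l * (if x i = x l then 1 else 0) = k i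
  rw [Finset.sum_eq_single i]
  · simp
  · intro l _ hl
    rw [if_neg fun h => hl (hx h).symm, mul_zero]
  · simp

lemma rootMultiplicity_numPoly (hs : s ∈ stratum m n) (i : Fin (m + 1)) :
    (numPoly e s).rootMultiplicity (zeroPt s i) = e i := by
  have h1 : C (scale s) ≠ 0 := C_ne_zero.2 (scale_ne_zero hs)
  have h0 : ∏ i, (X - C (zeroPt s i)) ^ e i ≠ 0 :=
    Finset.prod_ne_zero_iff.2 fun l _ => pow_ne_zero _ (X_sub_C_ne_zero _)
  rw [numPoly, rootMultiplicity_mul (mul_ne_zero h1 h0), rootMultiplicity_C, zero_add,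
    rootMultiplicity_prod_X_sub_C_pow (zeroPt_injective hs)]

lemma rootMultiplicity_polePoly (hs : s ∈ stratum m n) (j : Fin (n + 1)) :
    (polePoly s).rootMultiplicity (polePt s j) = 1 := by
  have := rootMultiplicity_prod_X_sub_C_pow (polePt_injective hs) (fun _ => 1) j
  simpa [polePoly] using this

lemma numPoly_ne_zero (hs : s ∈ stratum m n) : numPoly e s ≠ 0 :=
  mul_ne_zero (C_ne_zero.2 (scale_ne_zero hs))
    (Finset.prod_ne_zero_iff.2 fun _ _ => pow_ne_zero _ (X_sub_C_ne_zero _))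

lemma polePoly_ne_zero (s : Coord m n) : polePoly s ≠ 0 :=
  Finset.prod_ne_zero_iff.2 fun _ _ => X_sub_C_ne_zero _

lemma rootMultiplicity_numPoly_eq_zero {z : ℂ} (hs : s ∈ stratum m n)
    (hz : ∀ i, z ≠ zeroPt s i) : (numPoly e s).rootMultiplicity z = 0 := by
  refine rootMultiplicity_eq_zero ?_
  rw [IsRoot, eval_numPoly]
  exact mul_ne_zero (scale_ne_zero hs) (Finset.prod_ne_zero_iff.2 fun i _ =>
    pow_ne_zero _ (sub_ne_zero.2 (hz i)))

lemma rootMultiplicity_polePoly_eq_zero {z : ℂ} (hz : ∀ j, z ≠ polePt s j) :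
    (polePoly s).rootMultiplicity z = 0 :=
  rootMultiplicity_eq_zero (polePoly_eval_ne_zero hz)

lemma ordAt_singPt (hn : ∑ i, e i = n) (hs : s ∈ stratum m n) (a : SingIdx m n) :
    ordAt (numPoly e s) (polePoly s) (singPt s a) = singOrd e a := by
  rcases a with i | _ | j
  · change ((numPoly e s).rootMultiplicity (zeroPt s i) : ℤ) -
      (polePoly s).rootMultiplicity (zeroPt s i) = e i
    rw [rootMultiplicity_numPoly hs, rootMultiplicity_polePoly_eq_zero (zeroPt_ne_polePt hs i)]
    simp
  · change ((polePoly s).natDegree : ℤ) - (numPoly e s).natDegree - 2 = -1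
    rw [natDegree_polePoly, natDegree_numPoly e hs.1, hn]
    push_cast
    ring
  · change ((numPoly e s).rootMultiplicity (polePt s j) : ℤ) -
      (polePoly s).rootMultiplicity (polePt s j) = -1
    rw [rootMultiplicity_numPoly_eq_zero hs fun i => (zeroPt_ne_polePt hs i j).symm,
      rootMultiplicity_polePoly hs]
    simp

lemma ordAt_eq_zero (hs : s ∈ stratum m n) {z : OnePoint ℂ} (hz : ∀ a, z ≠ singPt s a) :
    ordAt (numPoly e s) (polePoly s) z = 0 := by
  rcases eq_infty_or_coe z with rfl | ⟨z, rfl⟩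
  · exact absurd rfl (hz (Sum.inr none))
  · change ((numPoly e s).rootMultiplicity z : ℤ) - (polePoly s).rootMultiplicity z = 0
    rw [rootMultiplicity_numPoly_eq_zero hs fun i h => hz (Sum.inl i) (by rw [h]; rfl),
      rootMultiplicity_polePoly_eq_zero fun j h => hz (Sum.inr (some j)) (by rw [h]; rfl)]
    simp

lemma neg_one_le_singOrd (a : SingIdx m n) : -1 ≤ singOrd e a := by
  rcases a with i | a
  · exact le_trans (by norm_num) (Int.natCast_nonneg (e i))
  · exact le_rfl

lemma multAt_sub_multAt (hn : ∑ i, e i = n) (hs : s ∈ stratum m n) (z : OnePoint ℂ) :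
    (multAt (numPoly e s) n z : ℤ) - multAt (polePoly s) (n + 2) z =
      ordAt (numPoly e s) (polePoly s) z := by
  rcases eq_infty_or_coe z with rfl | ⟨z, rfl⟩
  · change ((n - (numPoly e s).natDegree : ℕ) : ℤ) - (n + 2 - (polePoly s).natDegree : ℕ) =
      ((polePoly s).natDegree : ℤ) - (numPoly e s).natDegree - 2
    rw [natDegree_polePoly, natDegree_numPoly e hs.1, hn]
    omega
  · rfl

/-- The degree of the canonical bundle of the Riemann sphere. -/
lemma sum_ordAt {N D : ℂ[X]} (Z : Finset (OnePoint ℂ))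
    (hZ : ∀ w, ordAt N D w ≠ 0 → w ∈ Z) : ∑ w ∈ Z, ordAt N D w = -2 := by
  classical
  set T := N.roots.toFinset ∪ D.roots.toFinset with hT
  have h1 : ∑ w ∈ Z, ordAt N D w = ∑ w ∈ insert OnePoint.infty (T.map coeEmb), ordAt N D w := by
    refine sum_eq_sum_of_mem hZ fun w hw => ?_
    rcases eq_infty_or_coe w with rfl | ⟨c, rfl⟩
    · exact Finset.mem_insert_self _ _
    · refine Finset.mem_insert_of_mem (Finset.mem_map.2 ⟨c, ?_, rfl⟩)
      by_contra hc
      rw [hT, Finset.mem_union, not_or, Multiset.mem_toFinset, Multiset.mem_toFinset,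
        ← Multiset.count_eq_zero, ← Multiset.count_eq_zero, count_roots, count_roots] at hc
      refine hw ?_
      change (N.rootMultiplicity c : ℤ) - D.rootMultiplicity c = 0
      rw [hc.1, hc.2, sub_self]
  rw [h1, Finset.sum_insert (by simp [coeEmb]), Finset.sum_map]
  change (D.natDegree : ℤ) - N.natDegree - 2 +
    ∑ c ∈ T, ((N.rootMultiplicity c : ℤ) - D.rootMultiplicity c) = -2
  rw [Finset.sum_sub_distrib, ← Nat.cast_sum, ← Nat.cast_sum,
    sum_rootMultiplicity N Finset.subset_union_left,
    sum_rootMultiplicity D Finset.subset_union_right]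
  ring

/-- The numerical properties of a covering construction that contains a differential: every fiber has
`deg` points, the orders of the two differentials are compatible, and the orders of the differential on
the base add up to `-2`. -/
structure CoveringData.IsNumerical (ρ : CoveringData m n) (e : Fin (m + 1) → ℕ) : Prop where
  sum_mult : ∀ q, ∑ a with ρ.target a = q, ρ.mult a = ρ.deg
  mult_mul : ∀ a, (ρ.mult a : ℤ) * (ρ.order (ρ.target a) + 1) = Sum.elim (singOrd e) 0 a + 1
  sum_order : ∑ q, ρ.order q = -2

/-- The multiplicity of the finite pole `y_j` in the difference of the fibers over two marked
points `q₁` and `q₂`. -/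
def CoveringData.fiberDiff (ρ : CoveringData m n) (q₁ q₂ : Fin ρ.numBase) (j : Fin (n + 1)) : ℤ :=
  (if ρ.target (Sum.inl (Sum.inr (some j))) = q₁ then
    (ρ.mult (Sum.inl (Sum.inr (some j))) : ℤ) else 0) -
  if ρ.target (Sum.inl (Sum.inr (some j))) = q₂ then
    (ρ.mult (Sum.inl (Sum.inr (some j))) : ℤ) else 0

lemma exists_ramIndex_pos_fiber {P Q : ℂ[X]} (hd : 0 < max P.natDegree Q.natDegree)
    (w : OnePoint ℂ) : ∃ z, 0 < ramIndex P Q w z := by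
  by_contra hcon
  push Not at hcon
  have := sum_ramIndex (P := P) (Q := Q) w ∅ fun z hz => absurd (Nat.le_zero.1 (hcon z)) hz
  rw [Finset.sum_empty] at this
  omega

variable {ρ : CoveringData m n}

lemma CoveringData.IsNumerical.mult_le (hρ : ρ.IsNumerical e) (a : SingIdx m n ⊕ Fin ρ.numExtra) :
    ρ.mult a ≤ ρ.deg := by
  rw [← hρ.sum_mult (ρ.target a)]
  exact Finset.single_le_sum (f := ρ.mult) (fun _ _ => Nat.zero_le _) (by simp)

/-- The information on a differential in a covering construction that is used below: numerical
properties, the relation between the residues upstairs and downstairs, and the fact that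
zeros over the same point cannot be separated by functions that factor through the covering. -/
theorem analysis_of_mem_coveringLocus (hn : ∑ i, e i = n) (hs : s ∈ coveringLocus e ρ) :
    ρ.IsNumerical e ∧
    (∃ τ : Fin ρ.numBase → ℂ, (∀ q, τ q ≠ 0 → ρ.order q = -1) ∧ ∑ q, τ q = 0 ∧
      ∀ a, extendRes (res e s) a = ρ.mult (Sum.inl (Sum.inr a)) *
        τ (ρ.target (Sum.inl (Sum.inr a)))) ∧
    ∀ q₁ q₂, q₁ ≠ q₂ →
      (∀ a, ρ.target a = q₁ ∨ ρ.target a = q₂ → ∃ b, a = Sum.inl (Sum.inr b)) →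
      ∀ i l, ρ.target (Sum.inl (Sum.inl i)) = ρ.target (Sum.inl (Sum.inl l)) →
        ∏ j, (zeroPt s i - polePt s j) ^ ρ.fiberDiff q₁ q₂ j =
          ∏ j, (zeroPt s l - polePt s j) ^ ρ.fiberDiff q₁ q₂ j := by
  classical
  obtain ⟨hst, p, c, P, Q, N, D, hinj, hc, hPQ, hdeg, hram, hfib, -, hN, hD, hord, hmark, hω⟩ := hs
  set π : SingIdx m n ⊕ Fin ρ.numExtra → OnePoint ℂ := Sum.elim (singPt s) p with hπ
  have hd : 0 < max P.natDegree Q.natDegree := by rw [hdeg]; exact ρ.deg_pos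
  have hpos : ∀ a, 0 < ramIndex P Q (c (ρ.target a)) (π a) := fun a => by
    rw [hram]; exact ρ.mult_pos a
  have htarget : ∀ a q, 0 < ramIndex P Q (c q) (π a) → ρ.target a = q := fun a q h =>
    hc (eq_of_ramIndex_pos hPQ hd (hpos a) h)
  have hramif : ∀ a q, ramIndex P Q (c q) (π a) = if ρ.target a = q then ρ.mult a else 0 := by
    intro a q
    split_ifs with h
    · rw [← h, hram]
    · by_contra hcon
      exact h (htarget a q (Nat.pos_of_ne_zero hcon))
  have hpull : ∀ w z, 0 < ramIndex P Q w z → ordAt (numPoly e s) (polePoly s) z + 1 =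
      ramIndex P Q w z * (ordAt N D w + 1) := by
    intro w z h
    rw [← multAt_sub_multAt hn hst]
    refine order_pullback hPQ hd hN hD (numPoly_ne_zero hst) (polePoly_ne_zero s) ?_ ?_ ?_ h
    · rw [natDegree_numPoly e hst.1, hn]
    · rw [natDegree_polePoly]; omega
    · simpa only [omega_eq_div] using hω
  have hordπ : ∀ a, ordAt (numPoly e s) (polePoly s) (π a) = Sum.elim (singOrd e) 0 a := by
    rintro (a | x)
    · exact ordAt_singPt hn hst a
    · refine ordAt_eq_zero hst fun a h => ?_
      have := hinj (a₁ := Sum.inr x) (a₂ := Sum.inl a) h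
      exact Sum.inr_ne_inl this
  have hle : ∀ w, -1 ≤ ordAt N D w := by
    intro w
    obtain ⟨z, hz⟩ := exists_ramIndex_pos_fiber (P := P) (Q := Q) hd w
    have h1 := hpull w z hz
    have h2 : -1 ≤ ordAt (numPoly e s) (polePoly s) z := by
      by_cases h : ∃ a, z = singPt s a
      · obtain ⟨a, rfl⟩ := h
        rw [ordAt_singPt hn hst]
        exact neg_one_le_singOrd a
      · push Not at h
        rw [ordAt_eq_zero hst h]
        norm_num
    by_contra hcon
    have h3 : (ramIndex P Q w z : ℤ) * (ordAt N D w + 1) < 0 :=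
      mul_neg_of_pos_of_neg (by exact_mod_cast hz) (by omega)
    omega
  refine ⟨⟨fun q => ?_, fun a => ?_, ?_⟩, ?_, ?_⟩
  · have h1 := sum_ramIndex (P := P) (Q := Q) (c q) ((Finset.univ.filter fun a =>
      ρ.target a = q).map ⟨π, hinj⟩) fun z hz => by
        obtain ⟨a, ha⟩ := hfib q z (Nat.pos_of_ne_zero hz)
        refine Finset.mem_map.2 ⟨a, Finset.mem_filter.2 ⟨Finset.mem_univ _, ?_⟩, ha.symm⟩
        refine htarget a q ?_
        rw [ha] at hz
        exact Nat.pos_of_ne_zero hz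
    rw [Finset.sum_map, hdeg] at h1
    rw [← h1]
    refine Finset.sum_congr rfl fun a ha => ?_
    change _ = ramIndex P Q (c q) (π a)
    rw [hramif, if_pos (Finset.mem_filter.1 ha).2]
  · rw [← hordπ, hpull _ _ (hpos a), hram, hord]
  · rw [← sum_ordAt (N := N) (D := D) (Finset.univ.map ⟨c, hc⟩) fun w hw => by
      obtain ⟨q, rfl⟩ := hmark w hw
      exact Finset.mem_map_of_mem _ (Finset.mem_univ q), Finset.sum_map]
    exact Finset.sum_congr rfl fun q _ => (hord q).symm
  · obtain ⟨τ, h1, h2, h3, h4⟩ := exists_residues_pullback hPQ hd hN hD hle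
      (polePt_injective hst) (R := res e s) (by
        have hy : ∀ᶠ z in Filter.cofinite, ∀ j, z ≠ polePt s j := by
          rw [Filter.eventually_all]
          intro j
          exact Filter.eventually_cofinite.2 (by simp)
        filter_upwards [hω, hy] with z hz hzy
        rw [← omega_eq_sum hn hst hzy, hz])
    refine ⟨fun q => τ (c q), fun q hq => by rw [← hord]; exact h1 _ hq, ?_, ?_⟩
    · rw [← h2 (Finset.univ.map ⟨c, hc⟩) fun w hw => by
        obtain ⟨q, rfl⟩ := hmark w (by rw [h1 w hw]; norm_num)
        exact Finset.mem_map_of_mem _ (Finset.mem_univ q), Finset.sum_map]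
      rfl
    · rintro (_ | j)
      · rw [← hram]
        exact h4 _ (hpos (Sum.inl (Sum.inr none)))
      · rw [← hram]
        exact h3 j _ (hpos (Sum.inl (Sum.inr (some j))))
  · intro q₁ q₂ hq hpole i l hil
    -- the equations of the two fibers over the poles of `η` are products of the `z - y_j`
    have hprod : ∀ q, (q = q₁ ∨ q = q₂) → ∃ lc : ℂ, lc ≠ 0 ∧ ∀ z,
        (fiberPoly P Q (c q)).eval z = lc * ∏ j, (z - polePt s j) ^
          (if ρ.target (Sum.inl (Sum.inr (some j))) = q then
            ρ.mult (Sum.inl (Sum.inr (some j))) else 0) := by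
      intro q hq
      have hH := fiberPoly_ne_zero hPQ hd (c q)
      refine ⟨_, leadingCoeff_ne_zero.2 hH, fun z => ?_⟩
      have hsub : (fiberPoly P Q (c q)).roots.toFinset ⊆
          Finset.univ.map ⟨polePt s, polePt_injective hst⟩ := by
        intro ζ hζ
        rw [Multiset.mem_toFinset, ← Multiset.count_pos, count_roots] at hζ
        have hζ' : 0 < ramIndex P Q (c q) (ζ : OnePoint ℂ) := hζ
        obtain ⟨a, ha⟩ := hfib q _ hζ'
        rw [ha] at hζ'
        have ht := htarget a q hζ'
        obtain ⟨b, rfl⟩ := hpole a (by rw [ht]; exact hq)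
        rcases b with _ | j
        · exact absurd ha (OnePoint.coe_ne_infty ζ)
        · have : ζ = polePt s j := OnePoint.coe_injective ha
          rw [this]
          exact Finset.mem_map_of_mem _ (Finset.mem_univ j)
      rw [(IsAlgClosed.splits _).eval_eq_prod_roots, Finset.prod_multiset_map_count,
        Finset.prod_subset hsub, Finset.prod_map]
      · congr 1
        refine Finset.prod_congr rfl fun j _ => ?_
        rw [← hramif, count_roots]
        rfl
      · intro ζ _ hζ
        rw [Multiset.mem_toFinset, ← Multiset.count_eq_zero] at hζ
        rw [hζ, pow_zero]
    have hx := hpos (Sum.inl (Sum.inl i))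
    have hx' := hpos (Sum.inl (Sum.inl l))
    rw [hil] at hx
    have hcross := evalAt_mul_eq_of_ramIndex_pos hPQ hd hx hx'
    change P.eval (zeroPt s i) * Q.eval (zeroPt s l) =
      P.eval (zeroPt s l) * Q.eval (zeroPt s i) at hcross
    have hcross' : ∀ w w', (fiberPoly P Q w).eval (zeroPt s i) *
        (fiberPoly P Q w').eval (zeroPt s l) = (fiberPoly P Q w).eval (zeroPt s l) *
        (fiberPoly P Q w').eval (zeroPt s i) := by
      have hcoe : ∀ (c z : ℂ), (fiberPoly P Q (c : OnePoint ℂ)).eval z =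
          P.eval z - c * Q.eval z := fun c z => by
        change (P - C c * Q).eval z = _
        simp
      have hinf : ∀ z : ℂ, (fiberPoly P Q OnePoint.infty).eval z = Q.eval z := fun _ => rfl
      intro w w'
      rcases eq_infty_or_coe w with rfl | ⟨c, rfl⟩ <;>
        rcases eq_infty_or_coe w' with rfl | ⟨c', rfl⟩ <;> simp only [hcoe, hinf]
      · ring
      · linear_combination -hcross
      · linear_combination hcross
      · linear_combination (c - c') * hcross
    obtain ⟨lc₁, hl₁, h1⟩ := hprod q₁ (Or.inl rfl)
    obtain ⟨lc₂, hl₂, h2⟩ := hprod q₂ (Or.inr rfl)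
    have h3 := hcross' (c q₁) (c q₂)
    rw [h1, h1, h2, h2] at h3
    have hz : ∀ i j, zeroPt s i - polePt s j ≠ 0 := zeroPt_sub_ne_zero hst
    have hne : ∀ i q, ∏ j, (zeroPt s i - polePt s j) ^
        (if ρ.target (Sum.inl (Sum.inr (some j))) = q then
          ρ.mult (Sum.inl (Sum.inr (some j))) else 0) ≠ 0 := fun i q =>
      Finset.prod_ne_zero_iff.2 fun j _ => pow_ne_zero _ (hz i j)
    have hzpow : ∀ i, ∏ j, (zeroPt s i - polePt s j) ^
        ((if ρ.target (Sum.inl (Sum.inr (some j))) = q₁ then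
          (ρ.mult (Sum.inl (Sum.inr (some j))) : ℤ) else 0) -
        if ρ.target (Sum.inl (Sum.inr (some j))) = q₂ then
          (ρ.mult (Sum.inl (Sum.inr (some j))) : ℤ) else 0) =
        (∏ j, (zeroPt s i - polePt s j) ^ (if ρ.target (Sum.inl (Sum.inr (some j))) = q₁ then
          ρ.mult (Sum.inl (Sum.inr (some j))) else 0)) /
        ∏ j, (zeroPt s i - polePt s j) ^ (if ρ.target (Sum.inl (Sum.inr (some j))) = q₂ then
          ρ.mult (Sum.inl (Sum.inr (some j))) else 0) := by
      intro i
      rw [← Finset.prod_div_distrib]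
      refine Finset.prod_congr rfl fun j _ => ?_
      rw [zpow_sub₀ (hz i j), ← zpow_natCast, ← zpow_natCast]
      push_cast
      rfl
    simp only [CoveringData.fiberDiff]
    rw [hzpow, hzpow, div_eq_div_iff (hne _ _) (hne _ _)]
    refine mul_left_cancel₀ (mul_ne_zero hl₁ hl₂) ?_
    linear_combination h3

/-- A covering construction that contains a differential with generic residues is trivial, or consists
of pullbacks of differentials with exactly two poles and no zeros. -/
theorem CoveringData.IsNumerical.dichotomy (hρ : ρ.IsNumerical e) (hn : ∑ i, e i = n) (hn1 : 1 ≤ n)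
    {R : Fin (n + 1) → ℂ} (hgen : IsGenericRes R) {τ : Fin ρ.numBase → ℂ}
    (hτ : ∀ a, extendRes R a = ρ.mult (Sum.inl (Sum.inr a)) *
        τ (ρ.target (Sum.inl (Sum.inr a)))) :
    ρ.deg = 1 ∨ ∃ q₁ q₂, q₁ ≠ q₂ ∧ ρ.order q₁ = -1 ∧ ρ.order q₂ = -1 ∧
      ∀ q, q ≠ q₁ → q ≠ q₂ → ρ.order q = 0 := by
  classical
  have hmult : ∀ a, (1 : ℤ) ≤ ρ.mult a := fun a => by exact_mod_cast ρ.mult_pos a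
  have hge : ∀ q, -1 ≤ ρ.order q := by
    intro q
    obtain ⟨a, ha⟩ : ∃ a, ρ.target a = q := by
      by_contra hcon
      push Not at hcon
      have := hρ.sum_mult q
      rw [Finset.filter_false_of_mem fun a _ => hcon a, Finset.sum_empty] at this
      exact ρ.deg_pos.ne this
    have h1 := hρ.mult_mul a
    rw [ha] at h1
    have h2 : (0 : ℤ) ≤ Sum.elim (singOrd e) 0 a + 1 := by
      rcases a with a | x
      · have := neg_one_le_singOrd (e := e) a
        simp only [Sum.elim_inl]
        omega
      · simp
    by_contra hcon
    have h3 : (ρ.mult a : ℤ) * (ρ.order q + 1) < 0 :=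
      mul_neg_of_pos_of_neg (by have := hmult a; omega) (by omega)
    omega
  set T : Finset (Fin ρ.numBase) := Finset.univ.filter fun q => ρ.order q = -1 with hT
  have hnot : ∀ q ∉ T, 0 ≤ ρ.order q := fun q hq => by
    have h1 : ρ.order q ≠ -1 := fun h => hq (Finset.mem_filter.2 ⟨Finset.mem_univ _, h⟩)
    have := hge q
    omega
  have hpoles : ∀ a, ρ.target (Sum.inl (Sum.inr a)) ∈ T := by
    intro a
    have h1 := hρ.mult_mul (Sum.inl (Sum.inr a))
    have h2 : Sum.elim (singOrd e) 0 (Sum.inl (Sum.inr a) : SingIdx m n ⊕ Fin ρ.numExtra) + 1 =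
      (0 : ℤ) := rfl
    rw [h2, mul_eq_zero] at h1
    have h3 := hmult (Sum.inl (Sum.inr a))
    refine Finset.mem_filter.2 ⟨Finset.mem_univ _, ?_⟩
    rcases h1 with h1 | h1 <;> omega
  have hsum : ∑ q ∈ Tᶜ, ρ.order q = (T.card : ℤ) - 2 := by
    have h1 := Finset.sum_add_sum_compl T ρ.order
    rw [hρ.sum_order, Finset.sum_congr rfl fun q hq => (Finset.mem_filter.1 hq).2,
      Finset.sum_const, nsmul_eq_mul] at h1
    linarith
  have hnonneg : 0 ≤ ∑ q ∈ Tᶜ, ρ.order q :=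
    Finset.sum_nonneg fun q hq => hnot q (Finset.mem_compl.1 hq)
  by_cases h2 : T.card = 2
  · right
    obtain ⟨q₁, q₂, hq, hT2⟩ := Finset.card_eq_two.1 h2
    have hm : ∀ q ∈ T, ρ.order q = -1 := fun q hq => (Finset.mem_filter.1 hq).2
    refine ⟨q₁, q₂, hq, hm q₁ (by simp [hT2]), hm q₂ (by simp [hT2]), fun q h1 h1' => ?_⟩
    rw [h2] at hsum
    exact (Finset.sum_eq_zero_iff_of_nonneg fun q hq => hnot q (Finset.mem_compl.1 hq)).1
      (hsum.trans (by norm_num)) q (by simp [hT2, h1, h1'])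
  · left
    have hcard : 3 ≤ T.card := by
      have : 2 ≤ (T.card : ℤ) := by linarith
      have : 2 ≤ T.card := by exact_mod_cast this
      omega
    -- the Riemann-Hurwitz formula bounds the degree
    have hRH : (ρ.deg : ℤ) * ((T.card : ℤ) - 2) ≤ n := by
      have h1 : (ρ.deg : ℤ) * ((T.card : ℤ) - 2) =
          ∑ a with ρ.target a ∈ Tᶜ, (ρ.mult a : ℤ) * ρ.order (ρ.target a) := by
        rw [← hsum, Finset.mul_sum, ← Finset.sum_fiberwise_of_maps_to (s := Finset.univ.filter
          fun a => ρ.target a ∈ Tᶜ) (t := Tᶜ) (g := ρ.target)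
          (fun a ha => (Finset.mem_filter.1 ha).2)]
        refine Finset.sum_congr rfl fun q hq => ?_
        rw [← hρ.sum_mult q, Nat.cast_sum, Finset.sum_mul, Finset.filter_filter]
        have h3 : (Finset.univ.filter fun a => ρ.target a ∈ Tᶜ ∧ ρ.target a = q) =
            Finset.univ.filter fun a => ρ.target a = q := by
          refine Finset.filter_congr fun a _ => ⟨fun h => h.2, fun h => ⟨h ▸ hq, h⟩⟩
        rw [h3]
        exact Finset.sum_congr rfl fun a ha => by rw [(Finset.mem_filter.1 ha).2]
      have h3 : ∑ a with ρ.target a ∈ Tᶜ, (ρ.mult a : ℤ) * ρ.order (ρ.target a) ≤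
          ∑ a with ρ.target a ∈ Tᶜ, Sum.elim (fun b : SingIdx m n =>
            Sum.elim (fun i => (e i : ℤ)) (fun _ => 0) b) 0 a := by
        refine Finset.sum_le_sum fun a ha => ?_
        have h4 := hρ.mult_mul a
        have h5 := hmult a
        have h6 : (ρ.mult a : ℤ) * ρ.order (ρ.target a) =
            Sum.elim (singOrd e) 0 a + 1 - ρ.mult a := by linarith
        rw [h6]
        rcases a with (i | b) | x
        · simp only [Sum.elim_inl, singOrd]
          omega
        · exact absurd (hpoles b) (Finset.mem_compl.1 (Finset.mem_filter.1 ha).2)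
        · simp only [Sum.elim_inr, Pi.zero_apply]
          omega
      have h4 : ∑ a with ρ.target a ∈ Tᶜ, Sum.elim (fun b : SingIdx m n =>
            Sum.elim (fun i => (e i : ℤ)) (fun _ => 0) b) 0 a ≤
          ∑ a : SingIdx m n ⊕ Fin ρ.numExtra, Sum.elim (fun b : SingIdx m n =>
            Sum.elim (fun i => (e i : ℤ)) (fun _ => 0) b) 0 a := by
        refine Finset.sum_le_sum_of_subset_of_nonneg (Finset.filter_subset _ _) fun a _ _ => ?_
        rcases a with (i | b) | x <;> simp
      have h5 : ∑ a : SingIdx m n ⊕ Fin ρ.numExtra, Sum.elim (fun b : SingIdx m n =>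
            Sum.elim (fun i => (e i : ℤ)) (fun _ => 0) b) 0 a = n := by
        rw [Fintype.sum_sum_type, Fintype.sum_sum_type]
        simp only [Sum.elim_inl, Sum.elim_inr, Pi.zero_apply, Finset.sum_const_zero, add_zero]
        rw [← hn]
        push_cast
        rfl
      linarith
    have hcard' : (3 : ℤ) ≤ T.card := by exact_mod_cast hcard
    have hdegpos : (1 : ℤ) ≤ ρ.deg := by exact_mod_cast ρ.deg_pos
    have hdegn : (ρ.deg : ℤ) ≤ n := by nlinarith
    have hmultle : ∀ a, ρ.mult a ≤ n := fun a => (hρ.mult_le a).trans (by exact_mod_cast hdegn)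
    have hinj : Function.Injective fun a : Option (Fin (n + 1)) =>
        (⟨ρ.target (Sum.inl (Sum.inr a)), hpoles a⟩ : T) := by
      intro a b hab
      by_contra hne
      have h1 : ρ.target (Sum.inl (Sum.inr a)) = ρ.target (Sum.inl (Sum.inr b)) :=
        congrArg Subtype.val hab
      refine hgen a b hne _ _ (ρ.mult_pos (Sum.inl (Sum.inr a))) (hmultle _)
        (ρ.mult_pos (Sum.inl (Sum.inr b))) (hmultle _) ?_
      rw [hτ, hτ, h1]
      ring
    have h3 := Fintype.card_le_of_injective _ hinj
    rw [Fintype.card_option, Fintype.card_fin, Fintype.card_coe] at h3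
    have h4 : (n : ℤ) + 2 ≤ T.card := by exact_mod_cast h3
    have h5 : (1 : ℤ) ≤ n := by exact_mod_cast hn1
    have h6 : (ρ.deg : ℤ) ≤ 1 := by nlinarith
    have h7 : ρ.deg ≤ 1 := by exact_mod_cast h6
    have := ρ.deg_pos
    omega

end CoveringAnalysis

/-! ### Differentials that belong to a given covering construction -/

section CoveringConstruction

open Polynomial

variable {e : Fin (m + 1) → ℕ} {s : Coord m n} {ρ : CoveringData m n} {P Q : ℂ[X]}

/-- An injective choice of points extending a given one. -/
lemma exists_injective_extension {α β γ : Type*} [Countable β] [Finite α] [Infinite γ]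
    (t : α → β) (val : α → γ) (h : ∀ a b, val a = val b ↔ t a = t b) :
    ∃ c : β → γ, Function.Injective c ∧ ∀ a, c (t a) = val a := by
  classical
  have hinf : (Set.range val)ᶜ.Infinite := (Set.finite_range val).infinite_compl
  have := hinf.to_subtype
  obtain ⟨ι, hι⟩ := Countable.exists_injective_nat β
  set g : β → γ := fun q => (Infinite.natEmbedding ((Set.range val)ᶜ : Set γ) (ι q) : γ) with hg
  have hgi : Function.Injective g := Subtype.val_injective.comp
    ((Infinite.natEmbedding _).injective.comp hι)
  have hgv : ∀ q a, g q ≠ val a := fun q a hqa =>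
    (Infinite.natEmbedding ((Set.range val)ᶜ : Set γ) (ι q)).2 ⟨a, hqa.symm⟩
  refine ⟨fun q => if hq : ∃ a, t a = q then val hq.choose else g q, fun q q' hqq => ?_,
    fun a => ?_⟩
  · by_cases hq : ∃ a, t a = q <;> by_cases hq' : ∃ a, t a = q'
    · simp only [dif_pos hq, dif_pos hq'] at hqq
      rw [← hq.choose_spec, ← hq'.choose_spec]
      exact (h _ _).1 hqq
    · simp only [dif_pos hq, dif_neg hq'] at hqq
      exact absurd hqq.symm (hgv _ _)
    · simp only [dif_neg hq, dif_pos hq'] at hqq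
      exact absurd hqq (hgv _ _)
    · simp only [dif_neg hq, dif_neg hq'] at hqq
      exact hgi hqq
  · have hq : ∃ b, t b = t a := ⟨a, rfl⟩
    simp only [dif_pos hq]
    exact (h _ _).2 hq.choose_spec

lemma exists_bijOn_of_card_eq {α β : Type*} [Nonempty β] {S : Finset α} {T : Finset β}
    (h : S.card = T.card) : ∃ f : α → β, Set.BijOn f S T := by
  classical
  obtain ⟨b₀⟩ := ‹Nonempty β›
  let g := Finset.equivOfCardEq h
  refine ⟨fun a => if ha : a ∈ S then g ⟨a, ha⟩ else b₀, fun a ha => ?_, fun a ha a' ha' haa => ?_,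
    fun b hb => ?_⟩
  · have ha : a ∈ S := ha
    simp only [dif_pos ha]
    exact (g ⟨a, ha⟩).2
  · have ha : a ∈ S := ha
    have ha' : a' ∈ S := ha'
    simp only [dif_pos ha, dif_pos ha'] at haa
    have := g.injective (Subtype.ext haa)
    exact congrArg Subtype.val this
  · refine ⟨g.symm ⟨b, hb⟩, (g.symm ⟨b, hb⟩).2, ?_⟩
    simp

lemma finite_ramIndex_ne_zero (hPQ : IsCoprime P Q) (hd : 0 < max P.natDegree Q.natDegree)
    (w : OnePoint ℂ) : {z | ramIndex P Q w z ≠ 0}.Finite := by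
  classical
  have hH := fiberPoly_ne_zero hPQ hd w
  refine (Finset.finite_toSet (insert OnePoint.infty
    ((fiberPoly P Q w).roots.toFinset.map coeEmb))).subset fun z hz => ?_
  rcases eq_infty_or_coe z with rfl | ⟨z, rfl⟩
  · simp
  · refine Finset.mem_coe.2 (Finset.mem_insert_of_mem (Finset.mem_map.2 ⟨z, ?_, rfl⟩))
    rw [Multiset.mem_toFinset, ← Multiset.count_pos, count_roots]
    exact Nat.pos_of_ne_zero hz

/-- A differential that is a pullback under a map which is unramified outside of the zeros and poles,
and has the right behaviour there, belongs to the covering construction: the remaining marked points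
exist, since the ramification indices over every point add up to the degree. -/
theorem mem_coveringLocus_of_pullback (hρ : ρ.IsNumerical e) (hs : s ∈ stratum m n)
    (hPQ : IsCoprime P Q) (hdeg : max P.natDegree Q.natDegree = ρ.deg)
    {val : SingIdx m n → OnePoint ℂ}
    (hval : ∀ a b, val a = val b ↔ ρ.target (Sum.inl a) = ρ.target (Sum.inl b))
    (hram : ∀ a, ramIndex P Q (val a) (singPt s a) = ρ.mult (Sum.inl a))
    (hunram : ∀ w z, 2 ≤ ramIndex P Q w z → ∃ a, z = singPt s a)
    (hextra : ∀ x, ρ.mult (Sum.inr x) = 1) {N D : ℂ[X]} (hN : N ≠ 0) (hD : D ≠ 0)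
    (hord : ∀ a, ordAt N D (val a) = ρ.order (ρ.target (Sum.inl a)))
    (hord0 : ∀ w, ordAt N D w ≠ 0 → ∃ a, w = val a)
    (hω : ∀ᶠ z in Filter.cofinite, omega e s z =
      N.eval (P.eval z / Q.eval z) / D.eval (P.eval z / Q.eval z) *
          deriv (fun w => P.eval w / Q.eval w) z) : s ∈ coveringLocus e ρ := by
  classical
  have hd : 0 < max P.natDegree Q.natDegree := by rw [hdeg]; exact ρ.deg_pos
  have : Infinite (OnePoint ℂ) := Infinite.of_injective _ OnePoint.coe_injective
  obtain ⟨c, hc, hcval⟩ := exists_injective_extension (fun a => ρ.target (Sum.inl a)) val hval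
  have hsing : ∀ a q, 0 < ramIndex P Q (c q) (singPt s a) → ρ.target (Sum.inl a) = q := by
    intro a q h
    have h1 : 0 < ramIndex P Q (val a) (singPt s a) := by rw [hram]; exact ρ.mult_pos _
    rw [← hcval] at h1
    exact hc (eq_of_ramIndex_pos hPQ hd h1 h)
  -- the unmarked part of a fiber has as many points as there are additional labels
  have hfib : ∀ q, ∃ f : Fin ρ.numExtra → OnePoint ℂ,
      Set.BijOn f {x | ρ.target (Sum.inr x) = q}
        {z | 0 < ramIndex P Q (c q) z ∧ ∀ a, z ≠ singPt s a} := by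
    intro q
    set Z := (finite_ramIndex_ne_zero hPQ hd (c q)).toFinset with hZ
    have hmemZ : ∀ z, z ∈ Z ↔ ramIndex P Q (c q) z ≠ 0 := by simp [hZ]
    have h1 : ∑ z ∈ Z, ramIndex P Q (c q) z = ρ.deg := by
      rw [← hdeg]
      exact sum_ramIndex _ _ fun z hz => (hmemZ z).2 hz
    have h2 := hρ.sum_mult q
    rw [← h1, Finset.sum_filter, Fintype.sum_sum_type, ← Finset.sum_filter, ← Finset.sum_filter,
      ← Finset.sum_filter_add_sum_filter_not Z fun z => ∃ a, z = singPt s a] at h2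
    have h3 : ∑ z ∈ Z with ∃ a, z = singPt s a, ramIndex P Q (c q) z =
        ∑ a with ρ.target (Sum.inl a) = q, ρ.mult (Sum.inl a) := by
      have h4 : Z.filter (fun z => ∃ a, z = singPt s a) =
          (Finset.univ.filter fun a => ρ.target (Sum.inl a) = q).map
            ⟨singPt s, singPt_injective hs⟩ := by
        ext z
        rw [Finset.mem_filter, hmemZ, Finset.mem_map]
        constructor
        · rintro ⟨hz, a, rfl⟩
          exact ⟨a, Finset.mem_filter.2 ⟨Finset.mem_univ _, hsing a q (Nat.pos_of_ne_zero hz)⟩, rfl⟩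
        · rintro ⟨a, ha, rfl⟩
          have ha' := (Finset.mem_filter.1 ha).2
          refine ⟨?_, a, rfl⟩
          change ramIndex P Q (c q) (singPt s a) ≠ 0
          rw [← ha', hcval, hram]
          exact (ρ.mult_pos _).ne'
      rw [h4, Finset.sum_map]
      refine Finset.sum_congr rfl fun a ha => ?_
      change ramIndex P Q (c q) (singPt s a) = _
      rw [← (Finset.mem_filter.1 ha).2, hcval, hram]
    have h5 : ∑ z ∈ Z with ¬ ∃ a, z = singPt s a, ramIndex P Q (c q) z =
        (Z.filter fun z => ¬ ∃ a, z = singPt s a).card := by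
      rw [Finset.card_eq_sum_ones]
      refine Finset.sum_congr rfl fun z hz => ?_
      rw [Finset.mem_filter, hmemZ] at hz
      have := mt (hunram (c q) z) hz.2
      omega
    have h6 : ∑ x with ρ.target (Sum.inr x) = q, ρ.mult (Sum.inr x) =
        (Finset.univ.filter fun x => ρ.target (Sum.inr x) = q).card := by
      rw [Finset.card_eq_sum_ones]
      exact Finset.sum_congr rfl fun x _ => hextra x
    rw [h3, h5, h6] at h2
    obtain ⟨f, hf⟩ := exists_bijOn_of_card_eq (Nat.add_left_cancel h2)
    refine ⟨f, ?_⟩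
    convert hf using 1
    · ext x; simp
    · ext z
      rw [Finset.mem_coe, Finset.mem_filter, hmemZ]
      simp [Nat.pos_iff_ne_zero]
  choose f hf using hfib
  set p : Fin ρ.numExtra → OnePoint ℂ := fun x => f (ρ.target (Sum.inr x)) x with hp
  have hpmem : ∀ x, 0 < ramIndex P Q (c (ρ.target (Sum.inr x))) (p x) ∧ ∀ a, p x ≠ singPt s a :=
    fun x => (hf (ρ.target (Sum.inr x))).mapsTo rfl
  have hram' : ∀ a, ramIndex P Q (c (ρ.target a)) (Sum.elim (singPt s) p a) = ρ.mult a := by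
    rintro (a | x)
    · rw [hcval a]
      exact hram a
    · obtain ⟨h1, h2⟩ := hpmem x
      rw [hextra]
      have h3 : ¬ 2 ≤ ramIndex P Q (c (ρ.target (Sum.inr x))) (p x) := fun h =>
        (hunram _ _ h).elim fun a ha => h2 a ha
      change ramIndex P Q (c (ρ.target (Sum.inr x))) (p x) = 1
      omega
  have hlabel : ∀ q, ∃ a, ρ.target a = q := by
    intro q
    by_contra hcon
    push Not at hcon
    have := hρ.sum_mult q
    rw [Finset.filter_false_of_mem fun a _ => hcon a, Finset.sum_empty] at this
    exact ρ.deg_pos.ne this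
  refine ⟨hs, p, c, P, Q, N, D, ?_, hc, hPQ, hdeg, hram', fun q z hz => ?_, fun w z hwz => ?_, hN,
    hD, fun q => ?_, fun w hw => ?_, hω⟩
  · rintro (a | x) (b | y) h
    · rw [singPt_injective hs h]
    · exact absurd (Eq.symm h) ((hpmem y).2 a)
    · exact absurd h ((hpmem x).2 b)
    · change p x = p y at h
      have h1 := (hpmem x).1
      have h2 := (hpmem y).1
      rw [h] at h1
      have h3 : ρ.target (Sum.inr x) = ρ.target (Sum.inr y) := hc (eq_of_ramIndex_pos hPQ hd h1 h2)
      refine congrArg Sum.inr ((hf (ρ.target (Sum.inr y))).injOn h3 rfl ?_)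
      rw [← h3]
      simp only [hp] at h
      rw [h, h3]
  · by_cases h : ∃ a, z = singPt s a
    · obtain ⟨a, rfl⟩ := h
      exact ⟨Sum.inl a, rfl⟩
    · push Not at h
      obtain ⟨x, hx, hxz⟩ := (hf q).surjOn ⟨hz, h⟩
      refine ⟨Sum.inr x, ?_⟩
      have hx : ρ.target (Sum.inr x) = q := hx
      rw [← hxz, ← hx]
      rfl
  · obtain ⟨a, rfl⟩ := hunram w z hwz
    refine ⟨ρ.target (Sum.inl a), ?_⟩
    rw [hcval a]
    refine eq_of_ramIndex_pos hPQ hd (z := singPt s a) (by omega) ?_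
    rw [hram]
    exact ρ.mult_pos _
  · by_cases h : ∃ a, ρ.target (Sum.inl a) = q
    · obtain ⟨a, rfl⟩ := h
      rw [hcval a, hord]
    · have h1 : ordAt N D (c q) = 0 := by
        by_contra hcon
        obtain ⟨a, ha⟩ := hord0 _ hcon
        rw [← hcval a] at ha
        exact h ⟨a, (hc ha).symm⟩
      obtain ⟨b, hb⟩ := hlabel q
      rcases b with a | x
      · exact absurd ⟨a, hb⟩ h
      · have h2 := hρ.mult_mul (Sum.inr x)
        rw [hextra, hb] at h2
        simp only [Sum.elim_inr, Pi.zero_apply] at h2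
        rw [h1]
        omega
  · obtain ⟨a, rfl⟩ := hord0 w hw
    exact ⟨_, (hcval a).symm⟩

lemma ramIndex_le (hPQ : IsCoprime P Q) (hd : 0 < max P.natDegree Q.natDegree) (w z : OnePoint ℂ) :
    ramIndex P Q w z ≤ max P.natDegree Q.natDegree := by
  rw [← sum_ramIndex (P := P) (Q := Q) w (finite_ramIndex_ne_zero hPQ hd w).toFinset fun z hz => by
    simpa using hz]
  by_cases h : ramIndex P Q w z = 0
  · rw [h]; exact Nat.zero_le _
  · exact Finset.single_le_sum (f := ramIndex P Q w) (fun _ _ => Nat.zero_le _) (by simpa using h)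

/-- Covering constructions of degree one are the whole stratum. -/
theorem mem_coveringLocus_of_deg_eq_one (hn : ∑ i, e i = n) (hρ : ρ.IsNumerical e)
    (hdeg : ρ.deg = 1) (hs : s ∈ stratum m n) : s ∈ coveringLocus e ρ := by
  classical
  have hmult : ∀ a, ρ.mult a = 1 := by
    intro a
    have h1 := hρ.mult_le a
    have := ρ.mult_pos a
    omega
  have hinj : Function.Injective ρ.target := by
    intro a b hab
    have h1 := hρ.sum_mult (ρ.target b)
    rw [Finset.sum_congr rfl fun a _ => hmult a, ← Finset.card_eq_sum_ones, hdeg] at h1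
    exact Finset.card_le_one.1 h1.le a (by simp [hab]) b (by simp)
  have hPQ : IsCoprime (X : ℂ[X]) 1 := isCoprime_one_right
  have hd : max (X : ℂ[X]).natDegree (1 : ℂ[X]).natDegree = 1 := by simp
  refine mem_coveringLocus_of_pullback hρ hs hPQ (hd.trans hdeg.symm) (val := singPt s)
    (N := numPoly e s) (D := polePoly s) (fun a b => ?_)
    (fun a => ?_) (fun w z hwz => ?_) (fun x => hmult _) (numPoly_ne_zero hs) (polePoly_ne_zero s)
    (fun a => ?_) (fun w hw => ?_) ?_
  · rw [(singPt_injective hs).eq_iff, hinj.eq_iff, Sum.inl_injective.eq_iff]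
  · rw [hmult]
    rcases eq_infty_or_coe (singPt s a) with h | ⟨z, h⟩ <;> rw [h]
    · change max (X : ℂ[X]).natDegree (1 : ℂ[X]).natDegree - (1 : ℂ[X]).natDegree = 1
      simp
    · change (X - C z * 1 : ℂ[X]).rootMultiplicity z = 1
      rw [mul_one, rootMultiplicity_X_sub_C_self]
  · have := ramIndex_le hPQ (by rw [hd]; exact one_pos) w z
    omega
  · have h1 := hρ.mult_mul (Sum.inl a)
    rw [hmult, Sum.elim_inl] at h1
    rw [ordAt_singPt hn hs]
    push_cast at h1
    linarith
  · by_contra hcon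
    push Not at hcon
    exact hw (ordAt_eq_zero hs hcon)
  · refine Filter.Eventually.of_forall fun z => ?_
    simp [omega_eq_div]

end CoveringConstruction

/-! ### Pullbacks of differentials with two poles and no zeros -/

section TwoPoles

open Polynomial

variable {e : Fin (m + 1) → ℕ} {s : Coord m n} {ρ : CoveringData m n}

lemma natDegree_prod_X_sub_C_pow {ι : Type*} [Fintype ι] (x : ι → ℂ) (k : ι → ℕ) :
    (∏ l, (X - C (x l)) ^ k l).natDegree = ∑ l, k l := by
  rw [natDegree_prod_of_monic _ _ fun l _ => (monic_X_sub_C _).pow _]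
  simp

lemma isCoprime_prod_X_sub_C_pow {ι : Type*} [Fintype ι] {x : ι → ℂ} (hx : Function.Injective x)
    {k k' : ι → ℕ} (h : ∀ i, k i = 0 ∨ k' i = 0) :
    IsCoprime (∏ l, (X - C (x l)) ^ k l) (∏ l, (X - C (x l)) ^ k' l) := by
  refine IsCoprime.prod_left fun i _ => IsCoprime.prod_right fun l _ => ?_
  by_cases hil : i = l
  · subst hil
    rcases h i with h | h <;> rw [h, pow_zero]
    · exact isCoprime_one_left
    · exact isCoprime_one_right
  · exact (isCoprime_X_sub_C_of_isUnit_sub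
      (sub_ne_zero.2 fun h => hil (hx h)).isUnit).pow

lemma eval_derivative_div_eval_prod {ι : Type*} [Fintype ι] {x : ι → ℂ}
    (k : ι → ℕ) {z : ℂ} (hz : ∀ i, z ≠ x i) :
    (derivative (∏ l, (X - C (x l)) ^ k l)).eval z / (∏ l, (X - C (x l)) ^ k l).eval z =
      ∑ l, (k l : ℂ) / (z - x l) := by
  classical
  have h0 : ∀ i, z - x i ≠ 0 := fun i => sub_ne_zero.2 (hz i)
  rw [← Polynomial.deriv, ← logDeriv_apply]
  simp only [eval_prod, eval_pow, eval_sub, eval_X, eval_C]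
  rw [logDeriv_prod (f := fun i w => (w - x i) ^ k i) (fun i _ => pow_ne_zero _ (h0 i))
    (fun i _ => by fun_prop)]
  refine Finset.sum_congr rfl fun l _ => ?_
  rw [logDeriv_fun_pow (by fun_prop)]
  simp [logDeriv_apply, div_eq_mul_inv]

open Classical in
lemma ordAt_C_X {τ : ℂ} (w : OnePoint ℂ) :
    ordAt (C τ) X w = if w = ((0 : ℂ) : OnePoint ℂ) ∨ w = OnePoint.infty then -1 else 0 := by
  rcases eq_infty_or_coe w with rfl | ⟨c, rfl⟩
  · rw [if_pos (Or.inr rfl)]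
    change ((X : ℂ[X]).natDegree : ℤ) - (C τ).natDegree - 2 = -1
    simp
  · change ((C τ).rootMultiplicity c : ℤ) - (X : ℂ[X]).rootMultiplicity c = _
    rw [rootMultiplicity_C]
    by_cases hc : c = 0
    · subst hc
      have := rootMultiplicity_X_sub_C_self (R := ℂ) (x := 0)
      rw [C_0, sub_zero] at this
      simp [this]
    · have : (X : ℂ[X]).rootMultiplicity c = 0 := rootMultiplicity_eq_zero (by simpa using hc)
      simp [this, hc, OnePoint.coe_ne_infty]

/-- The criterion for a differential to belong to a covering construction of pullbacks of
`τ dw / w`: the residues have to be integral multiples of `τ`, and the map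
`∏ (z - y_j) ^ (R_j / τ)` has to separate the zeros. -/
theorem mem_coveringLocus_of_two_poles (hn : ∑ i, e i = n) (hρ : ρ.IsNumerical e)
    (hs : s ∈ stratum m n) {q₁ q₂ : Fin ρ.numBase} (hq : q₁ ≠ q₂) (h1 : ρ.order q₁ = -1)
    (h2 : ρ.order q₂ = -1) (h0 : ∀ q, q ≠ q₁ → q ≠ q₂ → ρ.order q = 0) {τ : ℂ} (hτ : τ ≠ 0)
    (hres : ∀ j, res e s j = τ * ρ.fiberDiff q₁ q₂ j)
    (hinj : ∀ i l, ρ.target (Sum.inl (Sum.inl i)) = ρ.target (Sum.inl (Sum.inl l)) → i = l)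
    (hdist : ∀ i l, ∏ j, (zeroPt s i - polePt s j) ^ ρ.fiberDiff q₁ q₂ j =
      ∏ j, (zeroPt s l - polePt s j) ^ ρ.fiberDiff q₁ q₂ j → i = l) : s ∈ coveringLocus e ρ := by
  classical
  -- the multiplicities of the poles in the fiber over `q`
  set A : Fin ρ.numBase → Option (Fin (n + 1)) → ℕ := fun q b =>
    if ρ.target (Sum.inl (Sum.inr b)) = q then ρ.mult (Sum.inl (Sum.inr b)) else 0 with hA
  have htq : ∀ b, ρ.target (Sum.inl (Sum.inr b)) = q₁ ∨ ρ.target (Sum.inl (Sum.inr b)) = q₂ := by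
    intro b
    have h3 : (ρ.mult (Sum.inl (Sum.inr b)) : ℤ) *
      (ρ.order (ρ.target (Sum.inl (Sum.inr b))) + 1) = -1 + 1 := hρ.mult_mul (Sum.inl (Sum.inr b))
    by_contra hcon
    push Not at hcon
    rw [h0 _ hcon.1 hcon.2] at h3
    have := ρ.mult_pos (Sum.inl (Sum.inr b))
    omega
  have hother : ∀ a, ρ.target a = q₁ ∨ ρ.target a = q₂ →
      Sum.elim (singOrd e) 0 a + 1 = (0 : ℤ) := by
    intro a ha
    rw [← hρ.mult_mul a]
    rcases ha with ha | ha <;> rw [ha]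
    · rw [h1]; ring
    · rw [h2]; ring
  have htz : ∀ i, ρ.target (Sum.inl (Sum.inl i)) ≠ q₁ ∧ ρ.target (Sum.inl (Sum.inl i)) ≠ q₂ := by
    intro i
    rw [← not_or]
    intro h
    have h3 : (e i : ℤ) + 1 = 0 := hother _ h
    omega
  have htx : ∀ x, ρ.target (Sum.inr x) ≠ q₁ ∧ ρ.target (Sum.inr x) ≠ q₂ := by
    intro x
    rw [← not_or]
    intro h
    have h3 : (0 : ℤ) + 1 = 0 := hother _ h
    omega
  have hsumA : ∀ q, q = q₁ ∨ q = q₂ → A q none + ∑ j, A q (some j) = ρ.deg := by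
    intro q hq
    rw [← Fintype.sum_option, ← hρ.sum_mult q, Finset.sum_filter, Fintype.sum_sum_type,
      Fintype.sum_sum_type, Finset.sum_eq_zero (f := fun i => if ρ.target (Sum.inl (Sum.inl i)) = q
        then ρ.mult (Sum.inl (Sum.inl i)) else 0), Finset.sum_eq_zero (f := fun x =>
        if ρ.target (Sum.inr x) = q then ρ.mult (Sum.inr x) else 0), zero_add, add_zero]
    · intro x _
      refine if_neg fun h => ?_
      rcases hq with rfl | rfl
      exacts [(htx x).1 h, (htx x).2 h]
    · intro x _
      refine if_neg fun h => ?_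
      rcases hq with rfl | rfl
      exacts [(htz x).1 h, (htz x).2 h]
  have hA0 : ∀ b, A q₁ b = 0 ∨ A q₂ b = 0 := by
    intro b
    by_cases h : ρ.target (Sum.inl (Sum.inr b)) = q₁
    · exact Or.inr (if_neg fun h' => hq (h.symm.trans h'))
    · exact Or.inl (if_neg h)
  have hdiff : ∀ j, ρ.fiberDiff q₁ q₂ j = (A q₁ (some j) : ℤ) - A q₂ (some j) := fun j => by
    simp [CoveringData.fiberDiff, hA]
  set P : ℂ[X] := ∏ j, (X - C (polePt s j)) ^ A q₁ (some j) with hP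
  set Q : ℂ[X] := ∏ j, (X - C (polePt s j)) ^ A q₂ (some j) with hQ
  have hPdeg : P.natDegree = ∑ j, A q₁ (some j) := natDegree_prod_X_sub_C_pow _ _
  have hQdeg : Q.natDegree = ∑ j, A q₂ (some j) := natDegree_prod_X_sub_C_pow _ _
  have hs1 := hsumA q₁ (Or.inl rfl)
  have hs2 := hsumA q₂ (Or.inr rfl)
  have hdeg : max P.natDegree Q.natDegree = ρ.deg := by
    rw [hPdeg, hQdeg]
    rcases hA0 none with h | h <;> omega
  have hPQ : IsCoprime P Q :=
    isCoprime_prod_X_sub_C_pow (polePt_injective hs) fun j => hA0 (some j)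
  have hd : 0 < max P.natDegree Q.natDegree := by rw [hdeg]; exact ρ.deg_pos
  have heval : ∀ q z, (∏ j, (X - C (polePt s j)) ^ A q (some j)).eval z =
      ∏ j, (z - polePt s j) ^ A q (some j) := fun q z => by simp [eval_prod]
  have hne : ∀ q z, (∀ j, z ≠ polePt s j) →
      (∏ j, (X - C (polePt s j)) ^ A q (some j)).eval z ≠ 0 := fun q z hz => by
    rw [heval]
    exact Finset.prod_ne_zero_iff.2 fun j _ => pow_ne_zero _ (sub_ne_zero.2 (hz j))
  have hω : ∀ᶠ z in Filter.cofinite, omega e s z =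
      (C τ).eval (P.eval z / Q.eval z) / X.eval (P.eval z / Q.eval z) *
          deriv (fun w => P.eval w / Q.eval w) z := by
    have hy : ∀ᶠ z in Filter.cofinite, ∀ j, z ≠ polePt s j := by
      rw [Filter.eventually_all]
      intro j
      exact Filter.eventually_cofinite.2 (by simp)
    filter_upwards [hy] with z hz
    have hP0 : P.eval z ≠ 0 := hne q₁ z hz
    have hQ0 : Q.eval z ≠ 0 := hne q₂ z hz
    have hP1 : (derivative P).eval z / P.eval z = ∑ l, (A q₁ (some l) : ℂ) / (z - polePt s l) :=
      eval_derivative_div_eval_prod _ hz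
    have hQ1 : (derivative Q).eval z / Q.eval z = ∑ l, (A q₂ (some l) : ℂ) / (z - polePt s l) :=
      eval_derivative_div_eval_prod _ hz
    have h3 : omega e s z = τ * ((derivative P).eval z / P.eval z -
        (derivative Q).eval z / Q.eval z) := by
      rw [omega_eq_sum hn hs hz, hP1, hQ1, ← Finset.sum_sub_distrib, Finset.mul_sum]
      refine Finset.sum_congr rfl fun j _ => ?_
      rw [hres, hdiff]
      push_cast
      ring
    rw [h3, deriv_div_eval hQ0, eval_C, eval_X]
    simp only [wronskianPoly, eval_sub, eval_mul]
    field_simp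
  have hC0 : C τ ≠ 0 := C_ne_zero.2 hτ
  have hpull : ∀ w z, 0 < ramIndex P Q w z → ordAt (numPoly e s) (polePoly s) z + 1 =
      ramIndex P Q w z * (ordAt (C τ) X w + 1) := by
    intro w z h
    rw [← multAt_sub_multAt hn hs]
    refine order_pullback hPQ hd hC0 X_ne_zero (numPoly_ne_zero hs) (polePoly_ne_zero s)
      ?_ ?_ ?_ h
    · rw [natDegree_numPoly e hs.1, hn]
    · rw [natDegree_polePoly]; omega
    · simpa only [omega_eq_div] using hω
  have hratio : ∀ i, P.eval (zeroPt s i) / Q.eval (zeroPt s i) =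
      ∏ j, (zeroPt s i - polePt s j) ^ ρ.fiberDiff q₁ q₂ j := by
    intro i
    rw [hP, hQ, heval, heval, ← Finset.prod_div_distrib]
    refine Finset.prod_congr rfl fun j _ => ?_
    rw [hdiff, zpow_sub₀ (zeroPt_sub_ne_zero hs i j), zpow_natCast, zpow_natCast]
  have hratio0 : ∀ i, P.eval (zeroPt s i) / Q.eval (zeroPt s i) ≠ 0 := fun i =>
    div_ne_zero (hne q₁ _ (zeroPt_ne_polePt hs i)) (hne q₂ _ (zeroPt_ne_polePt hs i))
  set val : SingIdx m n → OnePoint ℂ := Sum.elim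
    (fun i => ((P.eval (zeroPt s i) / Q.eval (zeroPt s i) : ℂ) : OnePoint ℂ))
    (fun b => if ρ.target (Sum.inl (Sum.inr b)) = q₁ then ((0 : ℂ) : OnePoint ℂ)
      else OnePoint.infty) with hval
  have hvz : ∀ i, val (Sum.inl i) =
      ((P.eval (zeroPt s i) / Q.eval (zeroPt s i) : ℂ) : OnePoint ℂ) := fun _ => rfl
  have hv1 : ∀ b, ρ.target (Sum.inl (Sum.inr b)) = q₁ → val (Sum.inr b) = ((0 : ℂ) : OnePoint ℂ) :=
    fun b hb => if_pos hb
  have hv2 : ∀ b, ρ.target (Sum.inl (Sum.inr b)) = q₂ → val (Sum.inr b) = OnePoint.infty :=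
    fun b hb => if_neg fun h => hq (h.symm.trans hb)
  have h0inf : ((0 : ℂ) : OnePoint ℂ) ≠ OnePoint.infty := OnePoint.coe_ne_infty _
  have hzp : ∀ i b, val (Sum.inl i) ≠ val (Sum.inr b) := by
    intro i b
    rw [hvz]
    rcases htq b with hb | hb
    · rw [hv1 b hb]
      exact fun h => hratio0 i (OnePoint.coe_injective h)
    · rw [hv2 b hb]
      exact OnePoint.coe_ne_infty _
  have htzp : ∀ i b, ρ.target (Sum.inl (Sum.inl i)) ≠ ρ.target (Sum.inl (Sum.inr b)) := by
    intro i b h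
    rcases htq b with hb | hb <;> rw [hb] at h
    exacts [(htz i).1 h, (htz i).2 h]
  refine mem_coveringLocus_of_pullback hρ hs hPQ hdeg (val := val)
    (N := C τ) (D := X) ?_ ?_ (fun w z hwz => ?_) (fun x => ?_) hC0 X_ne_zero
    ?_ (fun w hw => ?_) hω
  · rintro (i | b) (l | b')
    · rw [hvz, hvz]
      constructor
      · intro h
        have h3 := OnePoint.coe_injective h
        rw [hratio, hratio] at h3
        rw [hdist i l h3]
      · intro h
        rw [hinj i l h]
    · exact iff_of_false (hzp i b') (htzp i b')
    · exact iff_of_false (hzp l b).symm (htzp l b).symm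
    · rcases htq b with hb | hb <;> rcases htq b' with hb' | hb' <;> rw [hb, hb']
      · rw [hv1 b hb, hv1 b' hb']
        simp
      · rw [hv1 b hb, hv2 b' hb']
        exact iff_of_false h0inf hq
      · rw [hv2 b hb, hv1 b' hb']
        exact iff_of_false h0inf.symm hq.symm
      · rw [hv2 b hb, hv2 b' hb']
        simp
  · have hF0 : fiberPoly P Q ((0 : ℂ) : OnePoint ℂ) = P := by
      change P - C 0 * Q = P
      simp
    have hm : ∀ q b, ρ.target (Sum.inl (Sum.inr b)) = q → A q b = ρ.mult (Sum.inl (Sum.inr b)) :=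
      fun q b hb => if_pos hb
    rintro (i | _ | j)
    · have hpos : 0 < ramIndex P Q (val (Sum.inl i)) (singPt s (Sum.inl i)) := by
        rw [ramIndex_pos_iff hPQ hd, hvz, evalAt_fiberPoly_coe, sub_eq_zero]
        change P.eval (zeroPt s i) = P.eval (zeroPt s i) / Q.eval (zeroPt s i) *
          Q.eval (zeroPt s i)
        rw [div_mul_cancel₀ _ (hne q₂ _ (zeroPt_ne_polePt hs i))]
      have h3 := hpull _ _ hpos
      have h4 := hρ.mult_mul (Sum.inl (Sum.inl i))
      rw [ordAt_singPt hn hs, ordAt_C_X, if_neg] at h3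
      · rw [h0 _ (htz i).1 (htz i).2, Sum.elim_inl, h3] at h4
        have h5 : (ρ.mult (Sum.inl (Sum.inl i)) : ℤ) =
            ramIndex P Q (val (Sum.inl i)) (singPt s (Sum.inl i)) := by linarith
        exact_mod_cast h5.symm
      · rw [hvz]
        rintro (h | h)
        · exact hratio0 i (OnePoint.coe_injective h)
        · exact OnePoint.coe_ne_infty _ h
    · rcases htq none with hb | hb
      · rw [hv1 _ hb, ← hm _ _ hb]
        change max P.natDegree Q.natDegree -
          (fiberPoly P Q ((0 : ℂ) : OnePoint ℂ)).natDegree = _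
        rw [hF0, hPdeg, ← hPdeg, hdeg, hPdeg]
        omega
      · rw [hv2 _ hb, ← hm _ _ hb]
        change max P.natDegree Q.natDegree - Q.natDegree = _
        rw [hdeg, hQdeg]
        omega
    · rcases htq (some j) with hb | hb
      · rw [hv1 _ hb, ← hm _ _ hb]
        change (fiberPoly P Q ((0 : ℂ) : OnePoint ℂ)).rootMultiplicity (polePt s j) = _
        rw [hF0]
        exact rootMultiplicity_prod_X_sub_C_pow (polePt_injective hs) _ j
      · rw [hv2 _ hb, ← hm _ _ hb]
        exact rootMultiplicity_prod_X_sub_C_pow (polePt_injective hs)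
          (fun j => A q₂ (some j)) j
  · by_contra hcon
    push Not at hcon
    have h3 := hpull w z (by omega)
    rw [ordAt_eq_zero hs hcon, zero_add] at h3
    have h4 := Int.eq_one_or_neg_one_of_mul_eq_one h3.symm
    omega
  · have h3 : (ρ.mult (Sum.inr x) : ℤ) * (ρ.order (ρ.target (Sum.inr x)) + 1) = 0 + 1 :=
      hρ.mult_mul (Sum.inr x)
    rw [h0 _ (htx x).1 (htx x).2] at h3
    have : (ρ.mult (Sum.inr x) : ℤ) = 1 := by linarith
    exact_mod_cast this
  · rintro (i | b)
    · rw [h0 _ (htz i).1 (htz i).2, ordAt_C_X, hvz, if_neg]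
      rintro (h | h)
      · exact hratio0 i (OnePoint.coe_injective h)
      · exact OnePoint.coe_ne_infty _ h
    · rcases htq b with hb | hb
      · rw [hv1 b hb, hb, h1, ordAt_C_X, if_pos (Or.inl rfl)]
      · rw [hv2 b hb, hb, h2, ordAt_C_X, if_pos (Or.inr rfl)]
  · have hex : ∀ q, q = q₁ ∨ q = q₂ → ∃ b, ρ.target (Sum.inl (Sum.inr b)) = q := by
      intro q hq
      by_contra hcon
      push Not at hcon
      have h3 := hsumA q hq
      have h4 : ∀ b, A q b = 0 := fun b => if_neg (hcon b)
      simp only [h4, Finset.sum_const_zero, add_zero] at h3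
      exact ρ.deg_pos.ne h3
    rw [ordAt_C_X] at hw
    have hw' : w = ((0 : ℂ) : OnePoint ℂ) ∨ w = OnePoint.infty := by
      by_contra h
      exact hw (if_neg h)
    rcases hw' with rfl | rfl
    · obtain ⟨b, hb⟩ := hex q₁ (Or.inl rfl)
      exact ⟨Sum.inr b, (hv1 b hb).symm⟩
    · obtain ⟨b, hb⟩ := hex q₂ (Or.inr rfl)
      exact ⟨Sum.inr b, (hv2 b hb).symm⟩

end TwoPoles

/-! ### Components of `S_M` that are not obvious -/

section NotObvious

variable {e : Fin (m + 1) → ℕ} {s : Coord m n}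

/-- The value at the zero `x_i` of the rational function `∏ (z - y_j) ^ t_j`. -/
def zeroValue (t : Fin (n + 1) → ℤ) (s : Coord m n) (i : Fin (m + 1)) : ℂ :=
  ∏ j, (zeroPt s i - polePt s j) ^ t j

lemma zeroValue_ne_zero (hs : s ∈ stratum m n) (t : Fin (n + 1) → ℤ) (i : Fin (m + 1)) :
    zeroValue t s i ≠ 0 :=
  Finset.prod_ne_zero_iff.2 fun j _ => zpow_ne_zero _ (zeroPt_sub_ne_zero hs i j)

lemma isRegular_zeroValue (t : Fin (n + 1) → ℤ) (i : Fin (m + 1)) :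
    IsRegular fun s : Coord m n => zeroValue t s i :=
  .prod _ fun j _ => ((isRegular_zeroPt i).sub (isRegular_polePt j)).zpow
    (fun _ hs => zeroPt_sub_ne_zero hs i j) _

/-- If the residues are integral multiples `c t_j` of a number `c`, then the primitives of `ω` are
`c` times the logarithms of `∏ (z - y_j) ^ t_j`. -/
lemma exp_period_div (hn : ∑ i, e i = n) (hs : s ∈ stratum m n) {v : PeriodSpace m n}
    (hv : IsPeriodVector e s v) {t : Fin (n + 1) → ℤ} {c : ℂ} (hc : c ≠ 0)
    (hres : ∀ j, res e s j = c * t j) (i : Fin (m + 1)) :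
    Complex.exp ((Fin.cons 0 fun i => v (Sum.inl i) : Fin (m + 1) → ℂ) i / c) =
      zeroValue t s i / zeroValue t s 0 := by
  refine Fin.cases ?_ (fun i => ?_) i
  · rw [Fin.cons_zero, zero_div, Complex.exp_zero, div_self (zeroValue_ne_zero hs t 0)]
  · obtain ⟨κ, hκ, rfl⟩ := (isPeriodVector_iff hn hs v).1 hv
    have h1 : (∑ j, res e s j * κ i j) / c = ∑ j, (t j : ℂ) * κ i j := by
      rw [div_eq_iff hc, Finset.sum_mul]
      exact Finset.sum_congr rfl fun j _ => by rw [hres]; ring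
    rw [Fin.cons_succ, Sum.elim_inl, h1, hκ.exp_sum, crossRatio, zeroValue, zeroValue,
      ← Finset.prod_div_distrib]
    exact Finset.prod_congr rfl fun j _ => div_zpow _ _ _

/-- Finitely many subvarieties that do not contain the irreducible `C` are contained in one that does
not contain `C`. -/
lemma IsIrredSubvariety.exists_isSubvariety_not_subset {C : Set (Coord m n)}
    (hC : IsIrredSubvariety C) {ι : Type*} (F : Finset ι) {T : ι → Set (Coord m n)}
    (hT : ∀ i, IsSubvariety (T i)) (h : ∀ i, ¬ C ⊆ T i) :
    ∃ X, IsSubvariety X ∧ ¬ C ⊆ X ∧ ∀ i ∈ F, T i ⊆ X := by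
  classical
  induction F using Finset.induction_on with
  | empty =>
    refine ⟨∅, isSubvariety_empty, fun h => ?_, fun i hi => by simp at hi⟩
    obtain ⟨x, hx⟩ := hC.2.1
    exact h hx
  | insert a F ha ih =>
    obtain ⟨X, hX, hCX, hF⟩ := ih
    refine ⟨T a ∪ X, (hT a).union hX, fun hsub => ?_, fun i hi => ?_⟩
    · rcases hC.2.2 _ _ (hT a) hX hsub with h1 | h1
      exacts [h a h1, hCX h1]
    · rcases Finset.mem_insert.1 hi with rfl | hi
      · exact Set.subset_union_left
      · exact (hF i hi).trans Set.subset_union_right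

lemma eventually_add_smul_mem_ball (v d : PeriodSpace m n) {ε : ℝ} (hε : 0 < ε) :
    ∀ᶠ μ in 𝓝 (0 : ℂ), v + μ • d ∈ Metric.ball v ε := by
  have h : Continuous fun μ : ℂ => v + μ • d := by fun_prop
  refine h.continuousAt.eventually_mem (Metric.isOpen_ball.mem_nhds ?_)
  simpa using hε

variable {k : ℕ} {A : Matrix (Fin k) (Fin m) ℚ} {B : Matrix (Fin k) (Fin (n + 1)) ℂ} {q : Fin n → ℚ}
  {p : Fin k → Fin m}

/-- A point of a component of `S_M` can be moved inside of the component such that its period vector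
moves in the direction of a given vector in `ker M`. -/
lemma eventually_exists_mem_germClosure (he : ∀ i, 1 ≤ e i) (hn : ∑ i, e i = n)
    (hp : ∀ l l', A l (p l') = if l = l' then 1 else 0) (hs : s ∈ periodLocus e A B q) :
    ∃ v, IsPeriodVector e s v ∧ (periodMatrix A B q).mulVec v = 0 ∧
      ∀ d, (periodMatrix A B q).mulVec d = 0 → ∀ᶠ μ in 𝓝 (0 : ℂ),
        ∃ x ∈ germClosure (periodLocus e A B q) s, IsPeriodVector e x (v + μ • d) := by
  obtain ⟨v, κ, U, ψ, ε, hch, -, hv, hiff⟩ := exists_isLocalChart_germClosure he hn hp hs s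
    (mem_germClosure_self (fun u hu => hu.1) hs) Set.univ Filter.univ_mem
  refine ⟨v, ?_, hv, fun d hd => ?_⟩
  · have := hch.isPeriodChart.isPeriodVector s hch.mem
    rwa [hch.map_self] at this
  · filter_upwards [eventually_add_smul_mem_ball v d hch.pos] with μ hμ
    have hψ := hch.inv_mem _ hμ
    refine ⟨ψ (v + μ • d), (hiff _ hψ).2 ?_, ?_⟩
    · rw [hch.right_inv _ hμ, Matrix.mulVec_add, Matrix.mulVec_smul, hv, hd, smul_zero, add_zero]
    · have := hch.isPeriodChart.isPeriodVector _ hψ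
      rwa [hch.right_inv _ hμ] at this

/-- The rational function `∏ (z - y_j) ^ t_j` separates two given zeros on a component of `S_M`, if
the relative periods can be moved in pairwise different directions. -/
lemma exists_zeroValue_ne (he : ∀ i, 1 ≤ e i) (hn : ∑ i, e i = n)
    (hp : ∀ l l', A l (p l') = if l = l' then 1 else 0) (hs : s ∈ periodLocus e A B q)
    {u : Fin m → ℂ} (hu0 : ∀ i, u i ≠ 0) (hui : Function.Injective u)
    (hAu : ∀ l, ∑ i, (A l i : ℂ) * u i = 0) {t : Fin (n + 1) → ℤ} {c : ℂ}
    (hres : ∀ j, res e s j = c * t j) {i l : Fin (m + 1)} (hil : i ≠ l) :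
    ∃ x ∈ germClosure (periodLocus e A B q) s, zeroValue t x i ≠ zeroValue t x l := by
  by_contra hcon
  push Not at hcon
  have hc : c ≠ 0 := by
    rintro rfl
    exact res_ne_zero e hs.1 0 (by rw [hres, zero_mul])
  obtain ⟨v, hv, -, hev⟩ := eventually_exists_mem_germClosure he hn hp hs
  set d : PeriodSpace m n := Sum.elim u 0 with hd
  have hMd : (periodMatrix A B q).mulVec d = 0 :=
    (mulVec_periodMatrix_eq_zero_iff d).2 ⟨fun l => by simp [hd, hAu], fun j => by simp [hd]⟩
  set u' : Fin (m + 1) → ℂ := Fin.cons 0 u with hu'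
  set v' : Fin (m + 1) → ℂ := Fin.cons 0 fun i => v (Sum.inl i) with hv'
  have hne : u' i - u' l ≠ 0 := by
    rw [sub_ne_zero]
    have hinj : Function.Injective u' :=
      Fin.cons_injective_iff.2 ⟨by rintro ⟨i, hi⟩; exact hu0 i hi, hui⟩
    exact fun h => hil (hinj h)
  have hcons : ∀ μ : ℂ, ∀ i, (Fin.cons 0 fun i => (v + μ • d) (Sum.inl i) : Fin (m + 1) → ℂ) i =
      v' i + μ * u' i := by
    intro μ i
    refine Fin.cases ?_ (fun i => ?_) i
    · simp [hv', hu']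
    · simp [hv', hu', hd]
  -- the difference of the primitives at the two zeros would be locally constant
  have hconst : (fun μ : ℂ => Complex.exp ((v' i - v' l) / c + μ * ((u' i - u' l) / c))) =ᶠ[𝓝 0]
      fun _ => 1 := by
    filter_upwards [hev d hMd] with μ hμ
    obtain ⟨x, hx, hper⟩ := hμ
    have hxs : x ∈ stratum m n := (germClosure_subset_periodLocus hn hp s hx).1
    have hresx : ∀ j, res e x j = c * t j := by
      intro j
      have h1 := hper.2 j
      have h2 := hv.2 j
      simp only [hd, Pi.add_apply, Pi.smul_apply, Sum.elim_inr, Pi.zero_apply, smul_zero,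
        add_zero] at h1
      rw [← hres]
      exact mul_left_cancel₀ Complex.two_pi_I_ne_zero (h1.symm.trans h2)
    have h1 := exp_period_div hn hxs hper hc hresx i
    have h2 := exp_period_div hn hxs hper hc hresx l
    rw [hcons] at h1 h2
    have h3 : (v' i - v' l) / c + μ * ((u' i - u' l) / c) =
        (v' i + μ * u' i) / c - (v' l + μ * u' l) / c := by ring
    rw [h3, Complex.exp_sub, h1, h2, hcon x hx]
    exact div_self (div_ne_zero (zeroValue_ne_zero hxs t l) (zeroValue_ne_zero hxs t 0))
  have h1 : HasDerivAt (fun μ : ℂ => Complex.exp ((v' i - v' l) / c + μ * ((u' i - u' l) / c)))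
      (Complex.exp ((v' i - v' l) / c + 0 * ((u' i - u' l) / c)) * (1 * ((u' i - u' l) / c))) 0 :=
    (((hasDerivAt_id (0 : ℂ)).mul_const _).const_add _).cexp
  have h2 := h1.unique ((hasDerivAt_const (0 : ℂ) (1 : ℂ)).congr_of_eventuallyEq hconst)
  rw [one_mul, mul_eq_zero] at h2
  rcases h2 with h2 | h2
  · exact Complex.exp_ne_zero _ h2
  · exact div_ne_zero hne hc h2

open MvPolynomial in
lemma isRegular_eval_res (e : Fin (m + 1) → ℕ) (f : MvPolynomial (Fin (n + 1)) ℂ) :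
    IsRegular fun s : Coord m n => eval (res e s) f := by
  induction f using MvPolynomial.induction_on with
  | C a => simpa using isRegular_const a
  | add f g hf hg => simpa using hf.add hg
  | mul_X f j hf => simpa using hf.mul (isRegular_res e j)

lemma isSubvariety_residueVariety (e : Fin (m + 1) → ℕ) (J : Ideal (MvPolynomial (Fin (n + 1)) ℂ)) :
    IsSubvariety (residueVariety (m := m) e J) := by
  convert isSubvariety_of_isRegular (m := m) (n := n) (ι := J)
    (fun f => isRegular_eval_res e f.1) using 1
  ext s
  simp only [residueVariety, Set.mem_ofPred_eq, MvPolynomial.mem_zeroLocus_iff,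
    MvPolynomial.aeval_eq_eval, Subtype.forall]

/-- The residues on a component of `S_M` are unique up to scaling and can be scaled, so that
algebraic equations for the residues that hold on the component hold for all multiples. -/
lemma smul_res_mem_zeroLocus (he : ∀ i, 1 ≤ e i) (hn : ∑ i, e i = n)
    (hp : ∀ l l', A l (p l') = if l = l' then 1 else 0) (hs : s ∈ periodLocus e A B q)
    {J : Ideal (MvPolynomial (Fin (n + 1)) ℂ)}
    (hJ : germClosure (periodLocus e A B q) s ⊆ residueVariety e J) (c : ℂ) :
    c • res e s ∈ MvPolynomial.zeroLocus ℂ J := by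
  obtain ⟨v, hv, hM, hev⟩ := eventually_exists_mem_germClosure he hn hp hs
  rw [mem_zeroLocus_iff_eval]
  intro f hf
  set g : Polynomial ℂ :=
    MvPolynomial.aeval (fun j => Polynomial.C (res e s j) * Polynomial.X) f with hg
  have hgeval : ∀ μ : ℂ, g.eval μ = MvPolynomial.eval (μ • res e s) f := by
    intro μ
    rw [hg, ← Polynomial.coe_evalRingHom, MvPolynomial.aeval_def, MvPolynomial.hom_eval₂]
    change _ = MvPolynomial.eval₂ (RingHom.id ℂ) _ f
    congr 1
    · ext; simp
    · ext j
      change (Polynomial.C (res e s j) * Polynomial.X).eval μ = μ * res e s j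
      rw [Polynomial.eval_mul, Polynomial.eval_C, Polynomial.eval_X, mul_comm]
  have hroot : ∀ᶠ μ in 𝓝 (0 : ℂ), g.eval (1 + μ) = 0 := by
    filter_upwards [hev v hM] with μ hμ
    obtain ⟨x, hx, hper⟩ := hμ
    have h1 : res e x = (1 + μ) • res e s := by
      ext j
      have h1 := hper.2 j
      simp only [Pi.add_apply, Pi.smul_apply, smul_eq_mul, hv.2 j] at h1 ⊢
      refine mul_left_cancel₀ Complex.two_pi_I_ne_zero (h1.symm.trans ?_)
      ring
    rw [hgeval, ← h1]
    exact mem_zeroLocus_iff_eval.1 (hJ hx).2 f hf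
  have hg0 : g.comp (1 + Polynomial.X) = 0 := by
    refine Polynomial.eq_zero_of_infinite_isRoot _ ((infinite_of_mem_nhds 0 hroot).mono ?_)
    intro μ hμ
    change (g.comp (1 + Polynomial.X)).eval μ = 0
    have hμ : g.eval (1 + μ) = 0 := hμ
    simpa using hμ
  have := congrArg (Polynomial.eval (c - 1)) hg0
  rw [← hgeval]
  simpa using this

end NotObvious

section Comparison

variable {e : Fin (m + 1) → ℕ} {s : Coord m n} {ρ : CoveringData m n}

lemma CoveringData.IsNumerical.abs_fiberDiff_le (hρ : ρ.IsNumerical e) (q₁ q₂ : Fin ρ.numBase)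
    (j : Fin (n + 1)) : |ρ.fiberDiff q₁ q₂ j| ≤ ρ.deg := by
  have h := hρ.mult_le (Sum.inl (Sum.inr (some j)))
  rw [CoveringData.fiberDiff, abs_le]
  split_ifs <;> constructor <;> omega

lemma CoveringData.IsNumerical.eq_pole_of_order_eq_neg_one (hρ : ρ.IsNumerical e)
    {a : SingIdx m n ⊕ Fin ρ.numExtra} (ha : ρ.order (ρ.target a) = -1) :
    ∃ b, a = Sum.inl (Sum.inr b) := by
  have h := hρ.mult_mul a
  rw [ha] at h
  rcases a with (i | b) | x
  · have h : (ρ.mult (Sum.inl (Sum.inl i)) : ℤ) * (-1 + 1) = e i + 1 := h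
    omega
  · exact ⟨b, rfl⟩
  · have h : (ρ.mult (Sum.inr x) : ℤ) * (-1 + 1) = 0 + 1 := h
    omega

/-- A covering construction that contains a differential with generic residues, whose zeros are
separated by the functions `∏ (z - y_j) ^ t_j` whose exponents are proportional to the residues, contains
all nearby differentials with proportional residues. The relative periods of these are arbitrary. -/
theorem eventually_mem_coveringLocus (hn : ∑ i, e i = n) (hn1 : 1 ≤ n)
    (hs : s ∈ coveringLocus e ρ) (hgen : IsGenericRes (res e s))
    (hsep : ∀ t : Fin (n + 1) → ℤ, (∀ j, |t j| ≤ ρ.deg) → ∀ c : ℂ, (∀ j, res e s j = c * t j) →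
      ∀ i l, i ≠ l → zeroValue t s i ≠ zeroValue t s l) :
    ∀ᶠ u in 𝓝 s, u ∈ stratum m n → (∃ c : ℂ, ∀ j, res e u j = c * res e s j) →
      u ∈ coveringLocus e ρ := by
  obtain ⟨hρ, ⟨τ, hτ, hτ0, hτres⟩, hfib⟩ := analysis_of_mem_coveringLocus hn hs
  have hst : s ∈ stratum m n := hs.1
  rcases hρ.dichotomy hn hn1 hgen hτres with hdeg | ⟨q₁, q₂, hq, h1, h2, h0⟩
  · exact Filter.Eventually.of_forall fun u hu _ => mem_coveringLocus_of_deg_eq_one hn hρ hdeg hu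
  have hτ2 : τ q₂ = -τ q₁ := by
    rw [eq_neg_iff_add_eq_zero, add_comm, ← Finset.sum_pair hq, ← hτ0]
    refine Finset.sum_subset (Finset.subset_univ _) fun q _ hq' => ?_
    simp only [Finset.mem_insert, Finset.mem_singleton, not_or] at hq'
    by_contra hne
    have := hτ q hne
    rw [h0 q hq'.1 hq'.2] at this
    norm_num at this
  have hres : ∀ j, res e s j = τ q₁ * ρ.fiberDiff q₁ q₂ j := by
    intro j
    have h3 : res e s j = _ := hτres (some j)
    have h4 : ρ.target (Sum.inl (Sum.inr (some j))) = q₁ ∨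
        ρ.target (Sum.inl (Sum.inr (some j))) = q₂ := by
      by_contra hcon
      push Not at hcon
      refine res_ne_zero e hst j ?_
      rw [h3]
      by_contra hne
      have := hτ _ (right_ne_zero_of_mul hne)
      rw [h0 _ hcon.1 hcon.2] at this
      norm_num at this
    rw [h3, CoveringData.fiberDiff]
    rcases h4 with h4 | h4 <;> rw [h4]
    · rw [if_pos rfl, if_neg hq]
      push_cast
      ring
    · rw [if_pos rfl, if_neg hq.symm, hτ2]
      push_cast
      ring
  have hsep' := hsep _ (hρ.abs_fiberDiff_le q₁ q₂) _ hres
  have hev : ∀ᶠ u in 𝓝 s, ∀ i l, i ≠ l →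
      zeroValue (ρ.fiberDiff q₁ q₂) u i ≠ zeroValue (ρ.fiberDiff q₁ q₂) u l := by
    rw [Filter.eventually_all]
    intro i
    rw [Filter.eventually_all]
    intro l
    by_cases hil : i = l
    · exact Filter.Eventually.of_forall fun u h => absurd hil h
    · filter_upwards [(((isRegular_zeroValue (ρ.fiberDiff q₁ q₂) i).sub
        (isRegular_zeroValue (ρ.fiberDiff q₁ q₂) l)).analyticAt hst).continuousAt.eventually_ne
          (sub_ne_zero.2 (hsep' i l hil))] with u hu _
      exact sub_ne_zero.1 hu
  filter_upwards [hev] with u hu hust hur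
  obtain ⟨c, hc⟩ := hur
  have hc' : ∀ j, res e u j = c * τ q₁ * ρ.fiberDiff q₁ q₂ j := fun j => by
    rw [hc, hres]
    ring
  refine mem_coveringLocus_of_two_poles hn hρ hust hq h1 h2 h0 (τ := c * τ q₁) ?_ hc' ?_ ?_
  · intro h
    refine res_ne_zero e hust 0 ?_
    rw [hc', h, zero_mul]
  · intro i l hil
    by_contra hne
    refine hsep' i l hne (hfib q₁ q₂ hq (fun a ha => ?_) i l hil)
    refine hρ.eq_pole_of_order_eq_neg_one ?_
    rcases ha with ha | ha <;> rw [ha]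
    exacts [h1, h2]
  · intro i l hil
    by_contra hne
    exact hu i l hne hil

variable {k : ℕ} {A : Matrix (Fin k) (Fin m) ℚ} {B : Matrix (Fin k) (Fin (n + 1)) ℂ} {q : Fin n → ℚ}
  {p : Fin k → Fin m}

lemma IsGenericRes.smul {𝕜 : Type*} [Field 𝕜] {R : Fin (n + 1) → 𝕜} (h : IsGenericRes R) {c : 𝕜}
    (hc : c ≠ 0) : IsGenericRes (c • R) := by
  intro a b hab r r' hr hrn hr' hrn' heq
  have hext : ∀ a, extendRes (c • R) a = c * extendRes R a := by
    rintro (_ | j)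
    · simp [extendRes, Finset.mul_sum]
    · rfl
  refine h a b hab r r' hr hrn hr' hrn' (mul_left_cancel₀ hc ?_)
  rw [hext, hext] at heq
  linear_combination heq

lemma res_eq_smul_of_mem_periodLocus {k' : ℕ} {A' : Matrix (Fin k') (Fin m) ℚ}
    {B' : Matrix (Fin k') (Fin (n + 1)) ℂ} {x : Coord m n} (hx : x ∈ periodLocus e A' B' q)
    (hs : s ∈ periodLocus e A B q) :
    res e x = (res e x (Fin.last n) / res e s (Fin.last n)) • res e s := by
  have h0 := res_ne_zero e hs.1 (Fin.last n)
  ext j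
  rw [Pi.smul_apply, smul_eq_mul]
  refine Fin.lastCases ?_ (fun j => ?_) j
  · rw [div_mul_cancel₀ _ h0]
  · have h1 := res_add_eq_zero_of_mem_periodLocus hx j
    have h2 := res_add_eq_zero_of_mem_periodLocus hs j
    rw [div_mul_eq_mul_div, eq_div_iff h0]
    linear_combination res e s (Fin.last n) * h1 - res e x (Fin.last n) * h2

lemma periodLocus_subset_periodLocus_zero (A' : Matrix (Fin 0) (Fin m) ℚ)
    (B' : Matrix (Fin 0) (Fin (n + 1)) ℂ) : periodLocus e A B q ⊆ periodLocus e A' B' q := by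
  rintro s ⟨hs, v, hv, hM⟩
  refine ⟨hs, v, hv, (mulVec_periodMatrix_eq_zero_iff v).2 ⟨fun l => l.elim0, ?_⟩⟩
  exact ((mulVec_periodMatrix_eq_zero_iff v).1 hM).2

/-- A locus `S_M` with at least one condition on the relative periods is smaller, near each of its
points, than the locus given by its conditions on the residues only. -/
lemma not_eventually_mem_periodLocus (he : ∀ i, 1 ≤ e i) (hn : ∑ i, e i = n)
    (hp : ∀ l l', A l (p l') = if l = l' then 1 else 0) (hk : 0 < k) (hs : s ∈ periodLocus e A B q)
    (A' : Matrix (Fin 0) (Fin m) ℚ) (B' : Matrix (Fin 0) (Fin (n + 1)) ℂ) :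
    ¬ ∀ᶠ u in 𝓝 s, u ∈ periodLocus e A' B' q → u ∈ periodLocus e A B q := by
  intro hev
  obtain ⟨v, κ, U, ψ, ε, hch, hUV, hv, hiff⟩ := exists_isLocalChart_periodLocus he hn hs hev
  set l₀ : Fin k := ⟨0, hk⟩
  set d : PeriodSpace m n := Sum.elim (Pi.single (p l₀) 1) 0 with hd
  obtain ⟨μ, hμ, hμ0⟩ := ((eventually_add_smul_mem_ball v d hch.pos).filter_mono
    nhdsWithin_le_nhds).and (self_mem_nhdsWithin (a := (0 : ℂ)) (s := {0}ᶜ)) |>.exists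
  have hψ := hch.inv_mem _ hμ
  have hper := hch.isPeriodChart.isPeriodVector _ hψ
  rw [hch.right_inv _ hμ] at hper
  have hmem : ψ (v + μ • d) ∈ periodLocus e A' B' q := by
    refine ⟨hch.isPeriodChart.subset_stratum hψ, _, hper,
      (mulVec_periodMatrix_eq_zero_iff _).2 ⟨fun l => l.elim0, fun j => ?_⟩⟩
    have := ((mulVec_periodMatrix_eq_zero_iff v).1 hv).2 j
    simpa [hd] using this
  have h1 := (hiff _ hψ).1 (hUV hψ hmem)
  rw [hch.right_inv _ hμ, Matrix.mulVec_add, hv, zero_add, Matrix.mulVec_smul] at h1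
  have h2 := ((mulVec_periodMatrix_eq_zero_iff d).1 ((smul_eq_zero.1 h1).resolve_left hμ0)).1 l₀
  simp [hd, Pi.single_apply, hp] at h2

/-- A component of `S_M` is not obvious if its residues are generic, there is at least one condition
on the relative periods, and these can be moved in pairwise different directions. -/
theorem not_isObvious_germClosure (he : ∀ i, 1 ≤ e i) (hn : ∑ i, e i = n)
    (hp : ∀ l l', A l (p l') = if l = l' then 1 else 0) (hk : 0 < k) (hs : s ∈ periodLocus e A B q)
    {u : Fin m → ℂ} (hu0 : ∀ i, u i ≠ 0) (hui : Function.Injective u)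
    (hAu : ∀ l, ∑ i, (A l i : ℂ) * u i = 0) (hgen : IsGenericRes (res e s)) :
    ¬ IsObvious e (germClosure (periodLocus e A B q) s) := by
  classical
  rintro ⟨ρ, J, hC⟩
  have hn1 := one_le_of_sum_eq he hn
  set C := germClosure (periodLocus e A B q) s with hCdef
  set Z := coveringLocus e ρ ∩ residueVariety e J with hZ
  have hZst : Z ⊆ stratum m n := fun x hx => hx.1.1
  have hCS : C ⊆ periodLocus e A B q := germClosure_subset_periodLocus hn hp s
  have hCJ : C ⊆ residueVariety e J := hC.2.1.trans
    (zariskiClosure_subset (isSubvariety_residueVariety e J) Set.inter_subset_right)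
  -- the exceptional subvarieties where a function `∏ (z - y_j) ^ t_j` does not separate the zeros
  set T : ((Fin (n + 1) → ℤ) × Fin (m + 1) × Fin (m + 1)) → Set (Coord m n) := fun c =>
    if (∃ b : ℂ, ∀ j, res e s j = b * c.1 j) ∧ c.2.1 ≠ c.2.2 then
      {x | x ∈ stratum m n ∧ ∀ _ : Unit, zeroValue c.1 x c.2.1 - zeroValue c.1 x c.2.2 = 0}
    else ∅ with hT
  obtain ⟨X, hX, hCX, hTX⟩ := hC.1.exists_isSubvariety_not_subset (T := T)
    (Fintype.piFinset (fun _ : Fin (n + 1) => Finset.Icc (-(ρ.deg : ℤ)) ρ.deg) ×ˢ Finset.univ)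
    (fun c => by
      simp only [hT]
      split_ifs
      · exact isSubvariety_of_isRegular fun _ =>
          (isRegular_zeroValue _ _).sub (isRegular_zeroValue _ _)
      · exact isSubvariety_empty)
    (fun c hcon => by
      simp only [hT] at hcon
      split_ifs at hcon with h
      · obtain ⟨⟨b, hb⟩, hne⟩ := h
        obtain ⟨x, hx, hxne⟩ := exists_zeroValue_ne he hn hp hs hu0 hui hAu hb hne
        exact hxne (sub_eq_zero.1 ((hcon hx).2 ()))
      · obtain ⟨x, hx⟩ := hC.1.2.1
        exact hcon hx)
  obtain ⟨x, hxC, hxZ, hxX⟩ := hC.exists_mem_of_zariskiClosure hZst hX hCX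
  have hxst := hZst hxZ
  have hxs := res_eq_smul_of_mem_periodLocus (hCS hxC) hs
  set b := res e x (Fin.last n) / res e s (Fin.last n) with hb
  have hb0 : b ≠ 0 := div_ne_zero (res_ne_zero e hxst _) (res_ne_zero e hs.1 _)
  set A' : Matrix (Fin 0) (Fin m) ℚ := 0
  set B' : Matrix (Fin 0) (Fin (n + 1)) ℂ := 0
  have hp' : ∀ l l' : Fin 0, A' l ((Fin.elim0 : Fin 0 → Fin m) l') = if l = l' then 1 else 0 :=
    fun l => l.elim0
  have hCS' : C ⊆ periodLocus e A' B' q := hCS.trans (periodLocus_subset_periodLocus_zero A' B')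
  have hcov := eventually_mem_coveringLocus hn hn1 hxZ.1 (by rw [hxs]; exact hgen.smul hb0)
    fun t ht c htc i l hil heq => hxX (hTX (t, i, l) (by
      simp only [Finset.mem_product, Fintype.mem_piFinset, Finset.mem_Icc, Finset.mem_univ,
        and_true]
      exact fun j => abs_le.1 (ht j)) (by
      simp only [hT]
      rw [if_pos]
      · exact ⟨hxst, fun _ => sub_eq_zero.2 heq⟩
      · refine ⟨⟨b⁻¹ * c, fun j => ?_⟩, hil⟩
        rw [mul_assoc, ← htc, hxs, Pi.smul_apply, smul_eq_mul, inv_mul_cancel_left₀ hb0]))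
  -- near `x`, the conditions on the residues alone imply membership in the closure of `Z`
  have hZnear : ∀ᶠ y in 𝓝 x, y ∈ periodLocus e A' B' q → y ∈ zariskiClosure Z := by
    filter_upwards [hcov] with y hy hyq
    have h1 := res_eq_smul_of_mem_periodLocus hyq hs
    have h2 := res_eq_smul_of_mem_periodLocus hyq (hCS hxC)
    refine subset_zariskiClosure hZst ⟨hy hyq.1 ⟨_, fun j => congrFun h2 j⟩, hyq.1, ?_⟩
    rw [h1]
    exact smul_res_mem_zeroLocus he hn hp hs hCJ _
  have hsub := germClosure_subset (isSubvariety_zariskiClosure Z) hZnear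
  have heq := hC.2.2 _ (isIrredSubvariety_germClosure he hn (hCS' hxC))
    (hC.1.subset_germClosure he hn hp' hCS' hxC) hsub
  refine not_eventually_mem_periodLocus he hn hp hk (hCS hxC) A' B' ?_
  filter_upwards [eventually_mem_germClosure (fun u hu => hu.1 :
    periodLocus e A' B' q ⊆ stratum m n) x] with y hy hyq
  have h1 := hy hyq
  rw [heq] at h1
  exact hCS h1

end Comparison

/-! ### Infinitely many Teichmüller curves -/

section TeichmullerCurves

variable {e : Fin (m + 1) → ℕ} {s : Coord m n}
  {k : ℕ} {A : Matrix (Fin k) (Fin m) ℚ} {B : Matrix (Fin k) (Fin (n + 1)) ℂ} {q : Fin n → ℚ}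
  {p : Fin k → Fin m}

lemma isTeichmullerCurve_germClosure (he : ∀ i, 1 ≤ e i) (hn : ∑ i, e i = n)
    (hp : ∀ l l', A l (p l') = if l = l' then 1 else 0) (hB : ∀ i j, B i j ∈ realSubfield)
    (hk : k + 1 = m) (hs : s ∈ periodLocus e A B q) :
    IsTeichmullerCurve e (germClosure (periodLocus e A B q) s) := by
  have hirr := isIrredSubvariety_germClosure he hn hs
  have hcharts : ∀ t ∈ germClosure (periodLocus e A B q) s, ∃ U φ, IsPeriodChart e U φ ∧ t ∈ U ∧
      ∀ u ∈ U, u ∈ germClosure (periodLocus e A B q) s ↔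
        (periodMatrix A B q).mulVec (φ u) = 0 := by
    intro t ht
    obtain ⟨v, κ, U, ψ, ε, h, -, -, hiff⟩ :=
      exists_isLocalChart_germClosure he hn hp hs t ht Set.univ Filter.univ_mem
    exact ⟨U, _, h.isPeriodChart, h.mem, hiff⟩
  refine ⟨hirr, isBiAlgebraic_of_charts hirr.1 hcharts,
    isLinearVariety_of_charts hirr.1 hcharts (periodMatrix_mem hB) ?_⟩
  have := finrank_ker_periodMatrix (B := B) (q := q) hp
  omega

/-- The Teichmüller curves are given by `k = m - 1` conditions on the relative periods. The rows of `A`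
are the vectors `(0, …, 1, …, 0, -u_i / u_m)`, where `u` are the real parts of the relative periods of
a differential with generic rational residues. -/
theorem infinite_teichmullerCurves (he : ∀ i, 1 ≤ e i) (hn : ∑ i, e i = n) (hm : 2 ≤ m) :
    {C : Set (Coord m n) | IsTeichmullerCurve e C ∧ ¬ IsObvious e C ∧
      ∃ (k : ℕ) (A : Matrix (Fin k) (Fin m) ℚ) (B : Matrix (Fin k) (Fin (n + 1)) ℂ)
        (q : Fin n → ℚ), IsAdmissible A B q ∧
          IsIrredComponent C (periodLocus e A B q)}.Infinite := by
  have hn1 := one_le_of_sum_eq he hn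
  obtain ⟨k, rfl⟩ : ∃ k, m = k + 1 := ⟨m - 1, by omega⟩
  refine infinite_of_forall_exists (e := e) fun F => ?_
  obtain ⟨s, v, r, u, hs, hv, hr, hu, hu0, hui, hgen, hF⟩ := exists_generic_point he hn F
  have hr0 : ∀ j, r j ≠ 0 := fun j => by
    have := res_ne_zero e hs j
    rw [hr] at this
    exact_mod_cast this
  set A : Matrix (Fin k) (Fin (k + 1)) ℚ :=
    residueBlock fun l => -(u l.castSucc / u (Fin.last k)) with hA
  have hA0 : ∀ l, A l ≠ 0 := fun l h => by
    have := congrFun h l.castSucc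
    rw [hA, residueBlock_castSucc, if_pos rfl] at this
    exact one_ne_zero this
  have hAu : ∀ l, ∑ i, A l i * u i = 0 := by
    intro l
    rw [Fin.sum_univ_castSucc]
    simp only [hA, residueBlock_last, residueBlock_castSucc, ite_mul, one_mul, zero_mul,
      Finset.sum_ite_eq', Finset.mem_univ, if_true]
    have := hu0 (Fin.last k)
    field_simp
    ring
  set q : Fin n → ℚ := fun j => -(r j.castSucc / r (Fin.last n)) with hq
  set b : Fin k → ℂ := fun l =>
    -(∑ i, (A l i : ℂ) * v (Sum.inl i)) / (2 * Real.pi * Complex.I * r (Fin.last n)) with hb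
  -- the combination of the relative periods is purely imaginary, just as `2πi R_n`
  have hbreal : ∀ l, b l ∈ realSubfield := by
    intro l
    set w := ∑ i, (A l i : ℂ) * v (Sum.inl i) with hw
    have hwre : w.re = 0 := by
      have h1 : ∀ i, ((A l i : ℂ) * v (Sum.inl i)).re = ((A l i * u i : ℚ) : ℝ) := by
        intro i
        have : ((A l i : ℚ) : ℂ) = (((A l i : ℚ) : ℝ) : ℂ) := by norm_cast
        rw [this, Complex.re_ofReal_mul, hu]
        push_cast
        ring
      rw [hw, Complex.re_sum, Finset.sum_congr rfl fun i _ => h1 i, ← Rat.cast_sum, hAu,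
        Rat.cast_zero]
    refine ⟨-w.im / (2 * Real.pi * r (Fin.last n)), ?_⟩
    have h2 : w = w.im * Complex.I := by
      conv_lhs => rw [← Complex.re_add_im w, hwre]
      simp
    change ((-w.im / (2 * Real.pi * r (Fin.last n)) : ℝ) : ℂ) =
      -w / (2 * Real.pi * Complex.I * r (Fin.last n))
    rw [h2]
    have h3 : (r (Fin.last n) : ℂ) ≠ 0 := by exact_mod_cast hr0 _
    have h4 : (Real.pi : ℂ) ≠ 0 := by exact_mod_cast Real.pi_ne_zero
    have h5 := Complex.I_ne_zero
    push_cast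
    field_simp
    simp
  have hadm : IsAdmissible A (fun l j => if j = Fin.last n then b l else 0) q :=
    isAdmissible_of_isReducedRowEchelon (isReducedRowEchelon_residueBlock _) hA0
      (fun j => neg_ne_zero.2 (div_ne_zero (hr0 _) (hr0 _))) b
  obtain ⟨p, hp⟩ := hadm.exists_pivots hn1
  have hmem := mem_periodLocus_of_rat (A := A) hs hv hr
  have hcomp := isIrredComponent_germClosure he hn hp hmem
  refine ⟨_, ⟨isTeichmullerCurve_germClosure he hn hp (fun l j => ?_) rfl hmem, ?_,
    k, A, _, q, hadm, hcomp⟩, hcomp.1.2.1, _, ?_,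
    fun t ht => res_div_eq_of_mem_periodLocus (hcomp.2.1 ht) hn1⟩
  · split_ifs
    · exact hbreal l
    · exact zero_mem _
  · refine not_isObvious_germClosure he hn hp (by omega) hmem (u := fun i => (u i : ℂ))
      (fun i => by exact_mod_cast hu0 i) (fun i i' h => hui (Rat.cast_injective h))
      (fun l => by exact_mod_cast congrArg (fun x : ℚ => (x : ℂ)) (hAu l)) ?_
    intro a c hac i i' hi hin hi' hin' heq
    have hext : ∀ a, extendRes (res e s) a = ((extendRes r a : ℚ) : ℂ) := by
      rintro (_ | j)
      · simp [extendRes, hr]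
      · exact hr j
    refine hgen a c hac i i' hi hin hi' hin' ?_
    rw [hext, hext] at heq
    exact_mod_cast heq
  · intro hc
    rw [neg_neg] at hc
    exact hF _ hc (div_mul_cancel₀ _ (hr0 _)).symm

end TeichmullerCurves

end SimplePoleStratum

end

open SimplePoleStratum

theorem theorem1p7 {m n : ℕ} (e : Fin (m + 1) → ℕ) (he : ∀ i, 1 ≤ e i) (hn : ∑ i, e i = n) :
    (∀ (k : ℕ) (A : Matrix (Fin k) (Fin m) ℚ) (B : Matrix (Fin k) (Fin (n + 1)) ℂ) (q : Fin n → ℚ),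
      IsAdmissible A B q →
        (∀ U φ, IsPeriodChart e U φ → ∀ s ∈ U, (periodMatrix A B q).mulVec (φ s) = 0 →
          ∀ᶠ u in nhds s, u ∈ periodLocus e A B q ↔ (periodMatrix A B q).mulVec (φ u) = 0) ∧
        (∀ s ∈ periodLocus e A B q, ∃ U φ, IsPeriodChart e U φ ∧ s ∈ U ∧
          ∀ u ∈ U, u ∈ periodLocus e A B q ↔ (periodMatrix A B q).mulVec (φ u) = 0) ∧
        IsSubvariety (periodLocus e A B q) ∧
        IsBiAlgebraic e (periodLocus e A B q) ∧
        ∃ d, d + (k + n) = m + n + 1 ∧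
          IsLinearVariety e ⊤ d (periodLocus e A B q) ∧
          ∀ K : Subfield ℂ, (∀ i j, B i j ∈ K) → IsLinearVariety e K d (periodLocus e A B q)) ∧
    (∀ (k : ℕ) (A : Matrix (Fin k) (Fin m) ℚ), A.IsReducedRowEchelon → (∀ i, A i ≠ 0) →
      {S : Set (Coord m n) | ∃ B q, IsAdmissible A B q ∧ S = periodLocus e A B q ∧
        S.Nonempty}.Infinite) ∧
    (2 ≤ m →
      {C : Set (Coord m n) | IsTeichmullerCurve e C ∧ ¬ IsObvious e C ∧
        ∃ (k : ℕ) (A : Matrix (Fin k) (Fin m) ℚ) (B : Matrix (Fin k) (Fin (n + 1)) ℂ)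
          (q : Fin n → ℚ), IsAdmissible A B q ∧
            IsIrredComponent C (periodLocus e A B q)}.Infinite) := by
  refine ⟨fun k A B q hM => ?_, fun k A hA hA0 => infinite_periodLocus he hn hA hA0,
    infinite_teichmullerCurves he hn⟩
  obtain ⟨p, hp⟩ := hM.exists_pivots (one_le_of_sum_eq he hn)
  have hS : IsSubvariety (periodLocus e A B q) := isSubvariety_periodLocus hn hp
  have hcharts := exists_isPeriodChart_periodLocus (A := A) (B := B) (q := q) he hn
  exact ⟨fun U φ hU s hs h0 => eventually_mem_periodLocus_iff hn hU hs h0, hcharts, hS,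
    isBiAlgebraic_of_charts hS hcharts, _, finrank_ker_periodMatrix hp,
    isLinearVariety_of_charts hS hcharts (fun _ _ => Subfield.mem_top _) rfl,
    fun K hB => isLinearVariety_of_charts hS hcharts (periodMatrix_mem hB) rfl⟩
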